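/- **Setting.** Let $p$ be a prime, $k$ a finite field of characteristic $p$, $N_0=[k:\mathbb F_p]$, $\alpha_0\in k$ with $\operatorname{Tr}_{k/\mathbb F_p}\alpha_0=1$, $\mathcal K=k((t))$. For a finite Lie $\mathbb F_p$-algebra $L$ put $L_k=L\otimes k$, $L_{\mathcal K}=L\otimes\mathcal K$ (likewise for subspaces and linear maps), and let $\sigma$ be the $p$-th power map on the factor $\mathcal K$ of $L_{\mathcal K}$. All sets of the form "generated by $t^{-b}l$" are taken as closed $k$-submodules. If $L$ has nilpotent class $<p$, then $\circ$ is its Campbell–Hausdorff group law: $\widetilde{\exp}(x)\,\widetilde{\exp}(y)\equiv\widetilde{\exp}(x\circ y)$ modulo the $p$-th power of the augmentation ideal of the enveloping algebra, $\widetilde{\exp}(x)=\sum_{0\le i<p}x^i/i!$. $C_2$ denotes the ideal spanned by all commutators. $\mathbb Z^+(p)$ is the set of positive integers prime to $p$. **Parameters.** Fix $v_0>0$ real, $u^*=(p-1)(p-2)+1$, $w^*=(p-1)v_0$. For $u\ge1$, $M\ge0$ let $A[u,M]$ be the set of all $\sum_{i=1}^u a_ip^{-n_i}$ with integers $a_i\in[0,w^*)$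 and $0=n_1\le\dots\le n_u\le M$; $A[u]=\bigcup_MA[u,M]$. Let $\delta_0$ be the minimum of the positive values of $v_0-\alpha/s$, where $1\le s<p$, $\alpha\in A[u]$, $1\le u\le u^*$. Choose $r^*=b_0^*/(q_0^*-1)\in(v_0-\delta_0,v_0)$, where $q_0^*=p^{N_0^*}$, $N_0^*\ge2$, $b_0^*\ge1$, $\gcd(b_0^*,p(q_0^*-1))=1$. Let $B[u,M]$ be the set of all $r^*\sum_{i=1}^ub_ip^{-m_i}$ with integers $b_i\ge0$, $b_1\ne0$, $\sum b_i<p$, $0=m_1\le\dots\le m_u\le M$; $B[u]=\bigcup_MB[u,M]$. Choose $N^*\ge1$ divisible by $N_0$ and $N_0^*$ such that, with $q=p^{N^*}$ and $\rho$ the distance between $A[u^*]$ and $B[u^*]$, one has $q\rho\ge2r^*(p-1)$ and $r^*(1-1/q)\in(v_0-\delta_0,v_0)$. Put $b^*=b_0^*(q-1)/(q_0^*-1)$. Let $\mathfrak A^0$ be the set of all $\iota=p^m(q\alpha-(q-1)\beta)$ with $m\ge0$, $\alpha\in A[u^*,m]$, $\beta\in B[u^*,m]\cup\{0\}$, $|\iota|\le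 b^*(p-1)$. These are integers, and $p^m\alpha$, $p^m\beta/r^*$ and $\operatorname{ch}(\iota):=\sum b_i$ (for $\beta=r^*\sum b_ip^{-m_i}$; $\operatorname{ch}(\iota)=0$ if $\beta=0$) depend only on $\iota$. Let $\kappa(\iota)$ be the least $u\geq 1$ such that $\iota$ has such a presentation with $\alpha\in A[u,m]$, and $w^0(\iota)$ the least integer $w\ge1$ with $\iota<wb^*$. Let $\mathfrak A^+(p)$ be the set of $\iota\in\mathfrak A^0$ with $\iota>0$, $\gcd(p^m\alpha,p^m\beta/r^*,p)=1$, $w^0(\iota)+\operatorname{ch}(\iota)\le p-1$ and $\kappa(\iota)\le(p-2)\operatorname{ch}(\iota)+w^0(\iota)$; $\mathfrak A^0(p)=\mathfrak A^+(p)\cup\{0\}$. **Lie algebras.** For a set $X$ of labels consider the free Lie $k$-algebra on $D_0$ and $D_{xn}$ ($x\in X$, $n\in\mathbb Z/N_0$) with the $\sigma$-linear automorphism $D_0\mapsto D_0$, $D_{xn}\mapsto D_{x,n+1}$; its $\sigma$-invariants form a Lie $\mathbb F_p$-algebra. Given integer weights $\ge1$ of the generators (independent of $n$, with $D_0$ of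 weight $1$), filter it by the ideals $(s)$ spanned by commutators of total weight $\ge s$. For $X=\mathbb Z^+(p)$ and $\operatorname{wt}(D_{an})=s\iff(s-1)v_0\le a<sv_0$, the quotient by the ideal $(p)$ is $\bar{\mathcal L}$, with induced filtration $\bar{\mathcal L}(s)$. For $X=\mathfrak A^+(p)$, generators $D^\dagger_{\iota n},D^\dagger_0$ and $\operatorname{wt}^\dagger(D^\dagger_{\iota n})=w^0(\iota)+\operatorname{ch}(\iota)$, the quotient by $(p)$ is $\bar{\mathcal L}^\dagger$, with filtration $\bar{\mathcal L}^\dagger(s)$; it is graded by $\bar{\mathcal L}^\dagger[m]$, spanned over $k$ by the commutators of generators $D^\dagger_{\iota_jn_j}$ with $\sum\operatorname{ch}(\iota_j)=m$ ($\operatorname{ch}=0$ for $D_0^\dagger$). Put $D_{0n}=\sigma^n(\alpha_0)D_0$, $D^\dagger_{0n}=\sigma^n(\alpha_0)D^\dagger_0$. Let $\mathcal V:\bar{\mathcal L}^\dagger\to\bar{\mathcal L}$ be the Lie epimorphism with $D^\dagger_0\mapsto D_0$, $D^\dagger_{\iota n}\mapsto D_{an}$ if $\iota=qa$, $a\in\mathbb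 Z^+(p)$ (equivalently $\operatorname{ch}(\iota)=0$), and $D^\dagger_{\iota n}\mapsto0$ otherwise. **The elements $\bar e$ and $\bar e^{sp}$.** Let $\bar{\mathcal N}\subset\bar{\mathcal L}_{\mathcal K}$ be generated by all $t^{-b}l$ with $l\in\bar{\mathcal L}(s)_k$, $b<sv_0$, and $\bar{\mathcal N}^\dagger\subset\bar{\mathcal L}^\dagger_{\mathcal K}$ by all $t^{-b}l$ with $l\in\bar{\mathcal L}^\dagger(s)_k$, $b<sb^*$ ($s\ge1$). Put $\widetilde{\mathcal N}^\dagger=\bar{\mathcal N}^\dagger/t^{(p-1)b^*}\bar{\mathcal N}^\dagger$. For $j\ge0$ let $\widetilde{\mathcal N}^{sp}\langle j\rangle\subset\widetilde{\mathcal N}^\dagger$ be generated by the $t^{-\iota}l$ with $\iota\in\mathfrak A^0$ and $l\in(\bar{\mathcal L}^\dagger(s)\cap\bar{\mathcal L}^\dagger[m])_k$ for some $s\ge1$, $m\ge0$ such that $\iota+\operatorname{ch}(\iota)b^*<sb^*$, $\operatorname{ch}(\iota)\ge m+j$, $\kappa(\iota)\le(p-3)m+s$. Put $\widetilde{\mathcal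 N}^{sp}=\widetilde{\mathcal N}^{sp}\langle0\rangle$. Let $\bar e\in\bar{\mathcal N}$ with $\bar e\equiv\sum_{a\in\mathbb Z^+(p)\cup\{0\}}t^{-a}D_{a0}\bmod C_2(\bar{\mathcal L}_{\mathcal K})$. Let $\bar e^{sp}\in\bar{\mathcal N}^\dagger$ have class $\widetilde e^{sp}\in\widetilde{\mathcal N}^{sp}$ and satisfy $\bar e^{sp}\equiv\sum_{\iota\in\mathfrak A^0(p)}t^{-\iota}D^\dagger_{\iota0}\bmod C_2(\bar{\mathcal L}^\dagger_{\mathcal K})$ and $\mathcal V_{\mathcal K}(\bar e^{sp})=\sigma^{N^*}\bar e$ (that is, $\bar e(t^q)$). **The actions.** For $\gamma\in\mathbb Z/p$ define $\Omega_\gamma$ on $\widetilde{\mathcal N}^{sp}$ by $\Omega_\gamma\bigl(\sum_{\iota\in\mathfrak A^0}t^{-\iota}l_\iota\bigr)=\sum_\iota t^{-\iota}\,\widetilde{\exp}\bigl(\gamma(p^m\alpha)_\iota t^{b^*}\bigr)l_\iota$, where $(p^m\alpha)_\iota$ is the integer $p^m\alpha$ attached to $\iota$. Let $A^\dagger_\gamma$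 ($\gamma\in\mathbb Z/p$) be Lie algebra automorphisms of $\bar{\mathcal L}^\dagger$ such that for every $\gamma$: * for some $\widetilde c_\gamma\in\widetilde{\mathcal N}^{sp}\langle1\rangle$ with $\sigma\widetilde c_\gamma\in\widetilde{\mathcal N}^{sp}\langle1\rangle$ one has $\Omega_\gamma(\widetilde e^{sp})=(\sigma\widetilde c_\gamma)\circ(A^\dagger_\gamma\otimes\mathrm{id}_{\mathcal K})\widetilde e^{sp}\circ(-\widetilde c_\gamma)$; * $A^\dagger_\gamma(D^\dagger_{\iota0})-D^\dagger_{\iota0}\in\bigoplus_{m<\operatorname{ch}(\iota)}\bar{\mathcal L}^\dagger[m]_k$ for all $\iota\in\mathfrak A^0(p)$. Let $\bar{\mathcal L}^\dagger[v_0]$ be the minimal ideal of $\bar{\mathcal L}^\dagger$ containing $A^\dagger_\gamma(\operatorname{Ker}\mathcal V)$ for all $\gamma\in\mathbb Z/p$, and $\bar{\mathcal L}[v_0]=\mathcal V(\bar{\mathcal L}^\dagger[v_0])$. **Statement.** There is a unique derivation $B^\dagger$ of the Lie algebra $\bar{\mathcal L}^\dagger$ such that $B^\dagger(\bar{\mathcal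 L}^\dagger[m])\subset\bigoplus_{m'<m}\bar{\mathcal L}^\dagger[m']$ for all $m\ge0$ and $A^\dagger_\gamma=\widetilde{\exp}(\gamma B^\dagger)$ for all $\gamma\in\mathbb Z/p$. Moreover: 1. $\bar{\mathcal L}[v_0]$ is the minimal ideal $\mathcal I$ of $\bar{\mathcal L}$ such that $\mathcal V_kB^\dagger_k(D^\dagger_{\iota0})\in\mathcal I_k$ for all $\iota\in\mathfrak A^0_1(p):=\{\iota\in\mathfrak A^0(p)\mid\operatorname{ch}(\iota)=1\}$. 2. If $\iota\in\mathfrak A^0(p)$ and $\operatorname{ch}(\iota)\ge2$, then $\mathcal V_kB^\dagger_k(D^\dagger_{\iota0})\in[\bar{\mathcal L}[v_0],\bar{\mathcal L}]_k$. -/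

import Mathlib

open scoped TensorProduct

noncomputable section

namespace Ramification

/-! ### The numerical parameters -/

/-- The numerical data: the real number `v₀`, and natural numbers `N₀^*`, `b₀^*`, `N^*`
(written `N₀s`, `b₀s`, `Ns`). -/
structure Param (p : ℕ) where
  v₀ : ℝ
  N₀s : ℕ
  b₀s : ℕ
  Ns : ℕ

/-- `Σ_i a_i p^{-n_i}`. -/
def pSum (p : ℕ) {u : ℕ} (a n : Fin u → ℕ) : ℚ := ∑ i, (a i : ℚ) / (p : ℚ) ^ n i

/-- `0 = n_1 ≤ n_2 ≤ … ≤ n_u ≤ M`. -/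
def IsExpSeq {u : ℕ} (M : ℕ) (n : Fin u → ℕ) : Prop :=
  Monotone n ∧ (∀ i : Fin u, i.val = 0 → n i = 0) ∧ ∀ i, n i ≤ M

/-- `b_1 ≠ 0` and `b_1 + … + b_u < p`. -/
def IsDigitSeq (p : ℕ) {u : ℕ} (b : Fin u → ℕ) : Prop :=
  (∀ i : Fin u, i.val = 0 → b i ≠ 0) ∧ ∑ i, b i < p

namespace Param

variable {p : ℕ} (P : Param p)

/-- `q₀^* = p^{N₀^*}`. -/
def q₀ : ℕ := p ^ P.N₀s

/-- `q = p^{N^*}`. -/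
def q : ℕ := p ^ P.Ns

/-- `r^* = b₀^* / (q₀^* - 1)`. -/
def rs : ℚ := (P.b₀s : ℚ) / ((P.q₀ : ℚ) - 1)

/-- `b^* = b₀^* (q - 1) / (q₀^* - 1)`; the division is exact as soon as `N₀^* ∣ N^*`. -/
def bs : ℕ := P.b₀s * ((P.q - 1) / (P.q₀ - 1))

/-- `u^* = (p - 1)(p - 2) + 1`. -/
def us (_P : Param p) : ℕ := (p - 1) * (p - 2) + 1

/-- `w^* = (p - 1) v₀`. -/
def ws : ℝ := ((p : ℝ) - 1) * P.v₀

/-- `A[u, M]`. -/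
def setA (u M : ℕ) : Set ℚ :=
  {α | ∃ a n : Fin u → ℕ, (∀ i, (a i : ℝ) < P.ws) ∧ IsExpSeq M n ∧ α = pSum p a n}

/-- `B[u, M]`. -/
def setB (u M : ℕ) : Set ℚ :=
  {β | ∃ b m : Fin u → ℕ, IsDigitSeq p b ∧ IsExpSeq M m ∧ β = P.rs * pSum p b m}

/-- The distance `ρ(A[u^*], B[u^*])`, where `A[u] = ⋃_M A[u, M]` and `B[u] = ⋃_M B[u, M]`. -/
def rho : ℝ :=
  sInf {d : ℝ | ∃ M, ∃ α ∈ P.setA P.us M, ∃ β ∈ P.setB P.us M, d = |((α - β : ℚ) : ℝ)|}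

/-- The set of positive values of `v₀ - α / s`, where `1 ≤ s < p` and `α ∈ A[u]`, `1 ≤ u ≤ u^*`. -/
def gaps : Set ℝ :=
  {d : ℝ | 0 < d ∧ ∃ s : ℕ, 1 ≤ s ∧ s < p ∧ ∃ u : ℕ, 1 ≤ u ∧ u ≤ P.us ∧
    ∃ M, ∃ α ∈ P.setA u M, d = P.v₀ - (α : ℝ) / s}

/-- `δ₀`, the minimum of the positive values of `v₀ - α / s`. -/
def δ₀ : ℝ := sInf P.gaps

/-- The requirements on the parameters; `N₀` is the degree of the residue field over `𝔽_p`. -/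
structure Admissible (N₀ : ℕ) : Prop where
  v₀_pos : 0 < P.v₀
  two_le_N₀s : 2 ≤ P.N₀s
  b₀s_pos : 0 < P.b₀s
  coprime : Nat.Coprime P.b₀s (p * (P.q₀ - 1))
  rs_mem : (P.rs : ℝ) ∈ Set.Ioo (P.v₀ - P.δ₀) P.v₀
  Ns_pos : 0 < P.Ns
  residue : N₀ ∣ P.Ns
  C1 : P.N₀s ∣ P.Ns
  C2 : 2 * (P.rs : ℝ) * ((p : ℝ) - 1) ≤ (P.q : ℝ) * P.rho
  C3 : (P.rs : ℝ) * (1 - 1 / (P.q : ℝ)) ∈ Set.Ioo (P.v₀ - P.δ₀) P.v₀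

/-! ### The set `𝔄⁰` and the functions on it -/

/-- `ι = p^m (q α - (q - 1) β)` with `α ∈ A[u, m]` and `β ∈ B[u^*, m] ∪ {0}`, where
`β = r^* Σ_i b_i p^{-m_i}` (all `b_i` vanish if `β = 0`). -/
structure IsPres (u : ℕ) (ι : ℤ) (m : ℕ) (α : ℚ) (b e : Fin P.us → ℕ) : Prop where
  α_mem : α ∈ P.setA u m
  exps : IsExpSeq m e
  digits : (∀ i, b i = 0) ∨ IsDigitSeq p b
  eq : (ι : ℚ) = (p : ℚ) ^ m *
    ((P.q : ℚ) * α - ((P.q : ℚ) - 1) * (P.rs * pSum p b e))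

open Classical in
/-- The set `𝔄⁰` of all `ι = p^m (q α - (q - 1) β)` with `α ∈ A[u^*, m]`,
`β ∈ B[u^*, m] ∪ {0}`, `|ι| ≤ b^* (p - 1)`. All these rational numbers are integers. -/
def A0 : Finset ℤ :=
  (Finset.Icc (-((P.bs : ℤ) * ((p : ℤ) - 1))) ((P.bs : ℤ) * ((p : ℤ) - 1))).filter
    fun ι => ∃ m α b e, P.IsPres P.us ι m α b e

/-- The integer `p^m α`; it is the same for all presentations of `ι`. -/
def aNum (ι : ℤ) : ℕ := sInf {x : ℕ | ∃ m α b e, P.IsPres P.us ι m α b e ∧ (x : ℚ) = p ^ m * α}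

/-- The integer `p^m β / r^*`; it is the same for all presentations of `ι`. -/
def bNum (ι : ℤ) : ℕ :=
  sInf {x : ℕ | ∃ m α b e, P.IsPres P.us ι m α b e ∧ (x : ℚ) = p ^ m * pSum p b e}

/-- `ch(ι) = b_1 + … + b_u`; it is the same for all presentations of `ι`. -/
def ch (ι : ℤ) : ℕ := sInf {x : ℕ | ∃ m α b e, P.IsPres P.us ι m α b e ∧ x = ∑ i, b i}

/-- `κ(ι)`, the smallest number of summands in a presentation
`p^m α = a_1 p^m + a_2 p^{n_2} + … + a_u p^{n_u}`. -/
def kappa (ι : ℤ) : ℕ :=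
  sInf {u : ℕ | 1 ≤ u ∧ u ≤ P.us ∧ ∃ m α b e, P.IsPres u ι m α b e}

/-- `w⁰(ι)`, the least natural number `w ≥ 1` with `ι < w b^*`. -/
def w0 (ι : ℤ) : ℕ := sInf {w : ℕ | 1 ≤ w ∧ ι < w * P.bs}

open Classical in
/-- The set `𝔄⁺(p)`. -/
def Aplus : Finset ℤ :=
  P.A0.filter fun ι => 0 < ι ∧ Nat.gcd (Nat.gcd (P.aNum ι) (P.bNum ι)) p = 1 ∧
    P.w0 ι + P.ch ι ≤ p - 1 ∧ P.kappa ι ≤ (p - 2) * P.ch ι + P.w0 ι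

/-- `w†(ι) = w⁰(ι) + ch(ι)`. -/
def wdag (ι : ℤ) : ℕ := P.w0 ι + P.ch ι

end Param

/-! ### Weighted truncated free Lie algebras over `𝔽_p` -/

/-- The left-normed commutator `[…[[x₁, x₂], x₃], …, x_r]` of a list (`0` for the empty list). -/
def lnBracket {L : Type*} [LieRing L] : List L → L
  | [] => 0
  | x :: l => l.foldl (fun y z => ⁅y, z⁆) x

/-- The ideal of the free Lie algebra spanned by the commutators of weight `≥ p`. -/
def topIdeal (p : ℕ) {G : Type*} (w : G → ℕ) : LieIdeal (ZMod p) (FreeLieAlgebra (ZMod p) G) :=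
  LieSubmodule.lieSpan (ZMod p) (FreeLieAlgebra (ZMod p) G)
    {x | ∃ l : List G, p ≤ (l.map w).sum ∧ x = lnBracket (l.map (FreeLieAlgebra.of (ZMod p)))}

/-- The free Lie `𝔽_p`-algebra on generators `G` with weights `w`, modulo all commutators of
weight `≥ p`. If all weights are `≥ 1`, commutators of degree `≥ p` vanish in it. -/
abbrev TruncLie (p : ℕ) {G : Type*} (w : G → ℕ) : Type _ :=
  FreeLieAlgebra (ZMod p) G ⧸ topIdeal p w

section TruncLie

variable (p : ℕ) {G : Type*} (w : G → ℕ)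

/-- The class of a generator. -/
def gen (g : G) : TruncLie p w :=
  LieSubmodule.Quotient.mk (N := topIdeal p w) (FreeLieAlgebra.of (ZMod p) g)

/-- The weight filtration: the ideal generated by the commutators of weight `≥ s`. -/
def filt (s : ℕ) : LieIdeal (ZMod p) (TruncLie p w) :=
  LieSubmodule.lieSpan (ZMod p) (TruncLie p w)
    {x | ∃ l : List G, s ≤ (l.map w).sum ∧ x = lnBracket (l.map (gen p w))}

/-- The `m`-th graded piece for the degree function `c`. -/
def grade (c : G → ℕ) (m : ℕ) : Submodule (ZMod p) (TruncLie p w) :=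
  Submodule.span (ZMod p)
    {x | ∃ l : List G, (l.map c).sum = m ∧ x = lnBracket (l.map (gen p w))}

variable {p w} in
/-- A Lie algebra homomorphism out of `TruncLie` given on generators. -/
def truncLift {L' : Type*} [LieRing L'] [LieAlgebra (ZMod p) L'] (f : G → L')
    (hf : ∀ l : List G, p ≤ (l.map w).sum → lnBracket (l.map f) = 0) :
    TruncLie p w →ₗ⁅ZMod p⁆ L' :=
  have hL : ∀ (l : List G), FreeLieAlgebra.lift (ZMod p) f
      (lnBracket (l.map (FreeLieAlgebra.of (ZMod p)))) = lnBracket (l.map f) := by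
    intro l
    cases l with
    | nil => simp [lnBracket]
    | cons a l =>
      simp only [lnBracket, List.map_cons]
      suffices ∀ (l : List G) (y : FreeLieAlgebra (ZMod p) G),
          FreeLieAlgebra.lift (ZMod p) f
            ((l.map (FreeLieAlgebra.of (ZMod p))).foldl (fun y z => ⁅y, z⁆) y) =
          (l.map f).foldl (fun y z => ⁅y, z⁆) (FreeLieAlgebra.lift (ZMod p) f y) by
        rw [this, FreeLieAlgebra.lift_of_apply]
      intro l
      induction l with
      | nil => intro y; rfl
      | cons b l ih =>
        intro y
        simp only [List.map_cons, List.foldl_cons]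
        rw [ih, LieHom.map_lie, FreeLieAlgebra.lift_of_apply]
  have hker : topIdeal p w ≤ (FreeLieAlgebra.lift (ZMod p) f).ker := by
    refine LieSubmodule.lieSpan_le.2 ?_
    rintro x ⟨l, hl, rfl⟩
    simp only [SetLike.mem_coe, LieHom.mem_ker]
    rw [hL, hf l hl]
  { (topIdeal p w).toSubmodule.liftQ
      (FreeLieAlgebra.lift (ZMod p) f : FreeLieAlgebra (ZMod p) G →ₗ[ZMod p] L')
      (fun x hx => by simpa using hker hx) with
    map_lie' := by
      intro x y
      induction x using Submodule.Quotient.induction_on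
      induction y using Submodule.Quotient.induction_on
      exact LieHom.map_lie (FreeLieAlgebra.lift (ZMod p) f) _ _ }

end TruncLie

/-! ### Extension of scalars

`L_k = k ⊗ L` and `L_𝒦 = 𝒦 ⊗ L` with `𝒦 = k((t))`, for a finite Lie `𝔽_p`-algebra `L`. -/

/-- `𝒦 = k((t))`. -/
def Kt (k : Type*) [Field k] : Type _ := LaurentSeries k

instance (k : Type*) [Field k] : Field (Kt k) := inferInstanceAs (Field (LaurentSeries k))

instance (R k : Type*) [CommRing R] [Field k] [Algebra R k] : Algebra R (Kt k) :=
  inferInstanceAs (Algebra R (LaurentSeries k))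

section Scalars

variable (p : ℕ) [Fact p.Prime] (k : Type*) [Field k] [Algebra (ZMod p) k]

/-- `c ↦ c t^n`. -/
def singleT (n : ℤ) : k →ₗ[ZMod p] Kt k :=
  AddMonoidHom.toZModLinearMap p
    (HahnSeries.single.addMonoidHom n : k →+ LaurentSeries k)

/-- The coefficient of `t^n`. -/
def coeffT (n : ℤ) : Kt k →ₗ[ZMod p] k :=
  AddMonoidHom.toZModLinearMap p
    (HahnSeries.coeff.addMonoidHom n : LaurentSeries k →+ k)

variable (L : Type*) [LieRing L] [LieAlgebra (ZMod p) L]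

/-- `L_k`. -/
abbrev Lk : Type _ := k ⊗[ZMod p] L

/-- `L_𝒦`. -/
abbrev LK : Type _ := Kt k ⊗[ZMod p] L

variable {L}

/-- `l ↦ t^n l`, from `L_k` to `L_𝒦`. -/
def tmon (n : ℤ) : Lk p k L →ₗ[ZMod p] LK p k L :=
  (singleT p k n).rTensor L

/-- The coefficient of `t^n`, from `L_𝒦` to `L_k`. -/
def tcoeff (n : ℤ) : LK p k L →ₗ[ZMod p] Lk p k L :=
  (coeffT p k n).rTensor L

/-- `σ`, the `p`-th power map on the factor `𝒦` of `L_𝒦`. -/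
def sigma : LK p k L →ₗ[ZMod p] LK p k L :=
  (FiniteField.frobeniusAlgHom (ZMod p) (Kt k)).toLinearMap.rTensor L

variable {p} in
/-- `M_k ⊆ L_k` for a subspace `M ⊆ L`. -/
def subK (M : Submodule (ZMod p) L) : Submodule k (Lk p k L) := M.baseChange k

variable {p} in
/-- `f_k : L_k → L'_k` for a linear map `f : L → L'`. -/
def mapk {L' : Type*} [LieRing L'] [LieAlgebra (ZMod p) L'] (f : L →ₗ[ZMod p] L') :
    Lk p k L →ₗ[k] Lk p k L' := f.baseChange k

variable {p} in
/-- `f_𝒦 : L_𝒦 → L'_𝒦` for a linear map `f : L → L'`. -/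
def mapK {L' : Type*} [LieRing L'] [LieAlgebra (ZMod p) L'] (f : L →ₗ[ZMod p] L') :
    LK p k L →ₗ[Kt k] LK p k L' := f.baseChange (Kt k)

/-- The ideal `C₂(L_𝒦)` spanned by all commutators. -/
def commK (L : Type*) [LieRing L] [LieAlgebra (ZMod p) L] :
    LieIdeal (Kt k) (LK p k L) :=
  ⁅(⊤ : LieIdeal (Kt k) (LK p k L)), (⊤ : LieIdeal (Kt k) (LK p k L))⁆

/-- For a filtration `F` of `L`, real `c` and `J`: the elements of `t^J N`, where `N ⊆ L_𝒦` is the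
(closed) `k`-submodule generated by all `t^{-b} l` with `l ∈ F(s)_k`, `s ≥ 1`, `b < s c`. In terms
of coefficients: the coefficient of `t^{J - b}` lies in `F(s)_k` whenever `(s - 1) c ≤ b`. -/
def lattice (F : ℕ → LieIdeal (ZMod p) L) (c J : ℝ) : Submodule (ZMod p) (LK p k L) where
  carrier := {x | ∀ (n : ℤ) (s : ℕ), 1 ≤ s → ((s : ℝ) - 1) * c ≤ J - n →
    tcoeff p k n x ∈ subK k (F s).toSubmodule}
  add_mem' := by
    intro x y hx hy n s hs h
    rw [map_add]
    exact add_mem (hx n s hs h) (hy n s hs h)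
  zero_mem' := by
    intro n s _ _
    rw [map_zero]
    exact zero_mem _
  smul_mem' := by
    intro r x hx n s hs h
    rw [map_smul, ← algebraMap_smul k r]
    exact Submodule.smul_mem _ _ (hx n s hs h)

end Scalars

/-! ### The Campbell–Hausdorff composition law -/

section CH

attribute [local instance 100] LieRing.ofAssociativeRing

variable (p : ℕ) (R : Type*) [Field R] {L : Type*} [LieRing L] [LieAlgebra R L]

/-- The truncated exponential `Σ_{i < p} x^i / i!`. -/
def texp {A : Type*} [Ring A] [Algebra R A] (x : A) : A :=
  ∑ i ∈ Finset.range p, ((i.factorial : R)⁻¹) • x ^ i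

/-- The augmentation ideal of the enveloping algebra of `L`. -/
def augIdeal (L : Type*) [LieRing L] [LieAlgebra R L] :
    Submodule R (UniversalEnvelopingAlgebra R L) :=
  LinearMap.ker (UniversalEnvelopingAlgebra.lift R (0 : L →ₗ⁅R⁆ R)).toLinearMap

/-- `w = x₁ ∘ x₂ ∘ … ∘ x_r` for the Campbell–Hausdorff composition law on a Lie algebra of nilpotent
class `< p`, that is `exp(x₁) exp(x₂) ⋯ exp(x_r) ≡ exp(w)` modulo the `p`-th power of the
augmentation ideal of the enveloping algebra, where `exp` is truncated. -/
def IsCHProd (l : List L) (w : L) : Prop :=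
  (l.map fun x => texp p R (UniversalEnvelopingAlgebra.ι R x)).prod -
    texp p R (UniversalEnvelopingAlgebra.ι R w) ∈ (augIdeal R L) ^ p

end CH

/-! ### Generators -/

/-- Generators over `𝔽_p`: `none` for `D₀`, and `some (x, i)` for `E_{x,i}`, where `i` runs over the
indices of a basis `ω` of `k` over `𝔽_p`. The relation with the generators `D_{xn}` over `k` is
`D_{xn} = Σ_i σ^n(ω_i) E_{x,i}`: thus `Σ_i 𝔽_p E_{x,i}` is the set of `σ`-invariants
(for `σ D_{xn} = D_{x,n+1}`) in the `k`-space with basis `D_{xn}`, `n ∈ ℤ/N₀`. -/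
abbrev Gen (X : Type*) (N₀ : ℕ) := Option (X × Fin N₀)

/-- Extend a function on labels to generators, with value `c` on `D₀`. -/
def onGen {X : Type*} {N₀ : ℕ} (f : X → ℕ) (c : ℕ) : Gen X N₀ → ℕ
  | none => c
  | some (x, _) => f x

section Generators

variable (p : ℕ) [Fact p.Prime] {k : Type*} [Field k] [Finite k] [Algebra (ZMod p) k] (α₀ : k)

/-- The element `D_{xn}` of `L_k` (with `D_{0n} = σ^n(α₀) D₀` for the label `none`). -/
def Delt {X : Type*} (w : Gen X (Module.finrank (ZMod p) k) → ℕ) (n : ℕ) :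
    Option X → Lk p k (TruncLie p w)
  | none => (α₀ ^ p ^ n) ⊗ₜ gen p w none
  | some x => ∑ i, ((Module.finBasis (ZMod p) k i) ^ p ^ n) ⊗ₜ[ZMod p] gen p w (some (x, i))

end Generators

/-! ### The Lie algebras `ℒ̄` and `ℒ̄†` -/

section Main

variable {p : ℕ} [Fact p.Prime] (P : Param p) (k : Type*) [Field k] [Finite k]
  [Algebra (ZMod p) k]

/-- The labels `a ∈ ℤ⁺(p)` of the generators `D_{an}` of `ℒ`. -/
abbrev LabelBar (p : ℕ) := {a : ℕ // 0 < a ∧ Nat.Coprime a p}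

/-- The labels `ι ∈ 𝔄⁺(p)` of the generators `D†_{ιn}`. -/
abbrev LabelDag := {ι : ℤ // ι ∈ P.Aplus}

/-- `wt(D_{an}) = s` iff `(s - 1) v₀ ≤ a < s v₀`. -/
def wtBar : Gen (LabelBar p) (Module.finrank (ZMod p) k) → ℕ :=
  onGen (fun a => ⌊(a.1 : ℝ) / P.v₀⌋₊ + 1) 1

/-- `wt†(D†_{ιn}) = w†(ι)`. -/
def wtDag : Gen (LabelDag P) (Module.finrank (ZMod p) k) → ℕ :=
  onGen (fun ι => P.wdag ι.1) 1

/-- `ch` on generators. -/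
def chDag : Gen (LabelDag P) (Module.finrank (ZMod p) k) → ℕ :=
  onGen (fun ι => P.ch ι.1) 0

/-- `ℒ̄ = ℒ / ℒ(p)`. It is finite, since `D_{an} = 0` in it for `a ≥ (p - 1) v₀`; so the free Lie
algebra can be used here instead of its profinite completion. -/
abbrev Lbar : Type := TruncLie p (wtBar P k)

/-- `ℒ̄† = ℒ† / ℒ†(p)`. -/
abbrev Ldag : Type := TruncLie p (wtDag P k)

/-- `ℒ̄†[m]`. -/
def LdagGr (m : ℕ) : Submodule (ZMod p) (Ldag P k) := grade p (wtDag P k) (chDag P k) m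

/-- `⊕_{m' < m} ℒ̄†[m']`. -/
def LdagGrLT (m : ℕ) : Submodule (ZMod p) (Ldag P k) := ⨆ m' : Fin m, LdagGr P k m'

variable {k} in
/-- `D_{an}` in `ℒ̄_k`, for `a ∈ ℤ⁰(p)` (`none` stands for `a = 0`). -/
def Dbar (α₀ : k) (n : ℕ) : Option (LabelBar p) → Lk p k (Lbar P k) := Delt p α₀ (wtBar P k) n

variable {k} in
/-- `D†_{ιn}` in `ℒ̄†_k`, for `ι ∈ 𝔄⁰(p) = 𝔄⁺(p) ∪ {0}` (`none` stands for `ι = 0`). -/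
def Ddag (α₀ : k) (n : ℕ) : Option (LabelDag P) → Lk p k (Ldag P k) := Delt p α₀ (wtDag P k) n

/-! ### The projection `𝒱 : ℒ̄† → ℒ̄` -/

open Classical in
/-- Values of `𝒱` on generators: if `ι = q a` with `a ∈ ℤ⁺(p)` (that is, if `ch(ι) = 0`) then
`D†_{ιn} ↦ D_{an}`, otherwise `D†_{ιn} ↦ 0`; and `D†₀ ↦ D₀`. -/
def VGen : Gen (LabelDag P) (Module.finrank (ZMod p) k) → Lbar P k
  | none => gen p (wtBar P k) none
  | some (ι, i) =>
      if h : ∃ a : LabelBar p, ι.1 = (P.q : ℤ) * a.1 then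
        gen p (wtBar P k) (some (h.choose, i))
      else 0


/-! ### Helper facts for the construction of `𝒱` -/

set_option linter.unusedSectionVars false in
theorem lnBracket_gen_eq_zero {G : Type*} (w : G → ℕ) (l : List G) (h : p ≤ (l.map w).sum) :
    lnBracket (l.map (gen p w)) = 0 := by
  have key : lnBracket (l.map (gen p w)) = LieSubmodule.Quotient.mk (N := topIdeal p w)
      (lnBracket (l.map (FreeLieAlgebra.of (ZMod p)))) := by
    cases l with
    | nil => rfl
    | cons a l =>
      simp only [lnBracket, List.map_cons]
      suffices ∀ (l : List G) (y : FreeLieAlgebra (ZMod p) G),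
          (l.map (gen p w)).foldl (fun y z => ⁅y, z⁆)
            (LieSubmodule.Quotient.mk (N := topIdeal p w) y : TruncLie p w) =
          LieSubmodule.Quotient.mk (N := topIdeal p w)
            ((l.map (FreeLieAlgebra.of (ZMod p))).foldl (fun y z => ⁅y, z⁆) y) from this l _
      intro l
      induction l with
      | nil => intro y; rfl
      | cons b l ih =>
        intro y
        simp only [List.map_cons, List.foldl_cons]
        rw [← ih]
        rfl
  rw [key]
  exact LieSubmodule.Quotient.mk_eq_zero'.2 (LieSubmodule.subset_lieSpan ⟨l, h, rfl⟩)

theorem foldl_lie_zero {L : Type*} [LieRing L] (l : List L) :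
    l.foldl (fun y z => ⁅y, z⁆) 0 = 0 := by
  induction l with
  | nil => rfl
  | cons a l ih => simpa using ih

theorem lnBracket_eq_zero_of_weight {G H : Type*} (w : G → ℕ) (v : H → ℕ)
    (f : H → TruncLie p w) (hf : ∀ h, f h = 0 ∨ ∃ g, v h ≤ w g ∧ f h = gen p w g)
    (l : List H) (hl : p ≤ (l.map v).sum) : lnBracket (l.map f) = 0 := by
  have aux : ∀ (l : List H) (y : TruncLie p w),
      (l.map f).foldl (fun y z => ⁅y, z⁆) y = 0 ∨ ∃ l' : List G, (l.map v).sum ≤ (l'.map w).sum ∧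
        (l.map f).foldl (fun y z => ⁅y, z⁆) y =
          (l'.map (gen p w)).foldl (fun y z => ⁅y, z⁆) y := by
    intro l
    induction l with
    | nil => intro y; exact Or.inr ⟨[], le_rfl, rfl⟩
    | cons b l ih =>
      intro y
      simp only [List.map_cons, List.foldl_cons, List.sum_cons]
      rcases hf b with hb | ⟨g, hg, hb⟩
      · left
        rw [hb, lie_zero, foldl_lie_zero]
      · rcases ih ⁅y, f b⁆ with h | ⟨l', h1, h2⟩
        · exact Or.inl h
        · refine Or.inr ⟨g :: l', ?_, ?_⟩
          · simp only [List.map_cons, List.sum_cons]; omega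
          · rw [h2, hb]; rfl
  cases l with
  | nil => rfl
  | cons a l =>
    simp only [List.map_cons, lnBracket]
    rcases hf a with ha | ⟨g, hg, ha⟩
    · rw [ha, foldl_lie_zero]
    · rcases aux l (f a) with h | ⟨l', h1, h2⟩
      · exact h
      · rw [h2, ha]
        refine lnBracket_gen_eq_zero w (g :: l') ?_
        simp only [List.map_cons, List.sum_cons] at hl ⊢
        omega

theorem Param.Admissible.bs_eq {P : Param p} {N₀ : ℕ} (hP : P.Admissible N₀) :
    (P.bs : ℝ) = (P.rs : ℝ) * (1 - 1 / (P.q : ℝ)) * P.q := by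
  have hp : 1 < p := (Fact.out : p.Prime).one_lt
  have hq0 : 1 < P.q₀ := Nat.one_lt_pow (by have := hP.two_le_N₀s; omega) hp
  have hq : 1 < P.q := Nat.one_lt_pow (by have := hP.Ns_pos; omega) hp
  have hdvd : P.q₀ - 1 ∣ P.q - 1 := by
    obtain ⟨c, hc⟩ := hP.C1
    have := Nat.sub_dvd_pow_sub_pow P.q₀ 1 c
    rwa [one_pow, show P.q₀ ^ c = P.q by rw [Param.q, hc, pow_mul]; rfl] at this
  have h1 : ((P.q₀ : ℝ) - 1) ≠ 0 := by
    have : (1 : ℝ) < P.q₀ := by exact_mod_cast hq0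
    linarith
  have h2 : (P.q : ℝ) ≠ 0 := by
    have : (1 : ℝ) < P.q := by exact_mod_cast hq
    linarith
  have h3 : (((P.q₀ - 1 : ℕ) : ℝ)) ≠ 0 := by
    rw [Nat.cast_sub hq0.le]; simpa using h1
  rw [Param.bs, Nat.cast_mul, Nat.cast_div hdvd h3, Nat.cast_sub hq0.le, Nat.cast_sub hq.le,
    Param.rs]
  push_cast
  field_simp

theorem Param.Admissible.wdag_le {P : Param p} {N₀ : ℕ} (hP : P.Admissible N₀) {ι : ℤ}
    (hι : ι ∈ P.Aplus) {a : ℕ} (ha : ι = (P.q : ℤ) * a) :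
    P.wdag ι ≤ ⌊(a : ℝ) / P.v₀⌋₊ + 1 := by
  have hp : 1 < p := (Fact.out : p.Prime).one_lt
  have hpr : (1 : ℝ) < p := by exact_mod_cast hp
  have hq : 1 < P.q := Nat.one_lt_pow (by have := hP.Ns_pos; omega) hp
  have hqr : (0 : ℝ) < P.q := by exact_mod_cast (by omega : 0 < P.q)
  have hv := hP.v₀_pos
  have hws : 0 < P.ws := mul_pos (by linarith) hv
  have hbs := hP.bs_eq
  obtain ⟨hC1, hC2⟩ := hP.C3
  set ρ : ℝ := (P.rs : ℝ) * (1 - 1 / (P.q : ℝ)) with hρ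
  simp only [Param.Aplus, Finset.mem_filter, Param.A0, Finset.mem_Icc] at hι
  obtain ⟨⟨⟨-, hle⟩, -⟩, -, -, hw, -⟩ := hι
  have haw : (a : ℝ) < P.ws := by
    rw [ha] at hle
    have h1 : (P.q : ℝ) * a ≤ (P.bs : ℝ) * ((p : ℝ) - 1) := by exact_mod_cast hle
    rw [hbs] at h1
    have h2 : (a : ℝ) ≤ ρ * ((p : ℝ) - 1) := by
      by_contra h
      push Not at h
      nlinarith
    unfold Param.ws
    nlinarith
  let a' : Fin P.us → ℕ := fun i => if i.val = 0 then a else 0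
  have husum : pSum p a' (fun _ => 0) = a := by
    have h0 : 0 < P.us := Nat.succ_pos _
    unfold pSum
    rw [Finset.sum_eq_single (⟨0, h0⟩ : Fin P.us)]
    · simp [a']
    · intro i _ hi
      have : i.val ≠ 0 := fun h => hi (Fin.ext h)
      simp [a', this]
    · simp
  have hexp : IsExpSeq (u := P.us) 0 (fun _ => 0) :=
    ⟨fun _ _ _ => le_rfl, fun _ _ => rfl, fun _ => le_rfl⟩
  have hA : (a : ℚ) ∈ P.setA P.us 0 := by
    refine ⟨a', fun _ => 0, fun i => ?_, hexp, husum.symm⟩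
    by_cases h : i.val = 0
    · simpa [a', h] using haw
    · simpa [a', h] using hws
  have hpres : P.IsPres P.us ι 0 a (fun _ => 0) (fun _ => 0) := by
    refine ⟨hA, hexp, Or.inl fun _ => rfl, ?_⟩
    simp [pSum, ha]
  have hch : P.ch ι = 0 := by
    apply Nat.eq_zero_of_le_zero
    exact Nat.sInf_le ⟨0, a, fun _ => 0, fun _ => 0, hpres, by simp⟩
  rw [Param.wdag, hch, add_zero]
  set s : ℕ := ⌊(a : ℝ) / P.v₀⌋₊ + 1 with hs
  by_cases hsp : p ≤ s
  · omega
  push Not at hsp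
  refine Nat.sInf_le ⟨by omega, ?_⟩
  have hs0 : (0 : ℝ) < s := by exact_mod_cast (by omega : 0 < s)
  have hlt : (a : ℝ) / P.v₀ < s := by
    rw [hs]; push_cast; exact Nat.lt_floor_add_one _
  have hgap : (0 : ℝ) < P.v₀ - (a : ℝ) / s := by
    rw [div_lt_iff₀ hv] at hlt
    rw [sub_pos, div_lt_iff₀ hs0]
    linarith
  have hδ : P.δ₀ ≤ P.v₀ - (a : ℝ) / s := by
    refine csInf_le ⟨0, fun d hd => hd.1.le⟩ ⟨hgap, s, by omega, hsp, P.us, Nat.succ_pos _, le_rfl,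
      0, a, hA, by simp⟩
  have hlt2 : (a : ℝ) / s < ρ := by linarith
  rw [div_lt_iff₀ hs0] at hlt2
  have : (P.q : ℝ) * a < s * P.bs := by
    rw [hbs]
    nlinarith
  rw [ha]
  exact_mod_cast this

/-- `𝒱 : ℒ̄† → ℒ̄`. -/
def V (hP : P.Admissible (Module.finrank (ZMod p) k)) : Ldag P k →ₗ⁅ZMod p⁆ Lbar P k :=
  truncLift (VGen P k) fun l hl => by
    refine lnBracket_eq_zero_of_weight (wtBar P k) (wtDag P k) (VGen P k) ?_ l hl
    rintro (_ | ⟨ι, i⟩)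
    · exact Or.inr ⟨none, le_rfl, rfl⟩
    · by_cases h : ∃ a : LabelBar p, ι.1 = (P.q : ℤ) * a.1
      · refine Or.inr ⟨some (h.choose, i), ?_, by simp only [VGen, dif_pos h]⟩
        exact hP.wdag_le ι.2 h.choose_spec
      · exact Or.inl (by simp only [VGen, dif_neg h])

/-! ### The algebras `𝒩̄`, `𝒩̄†`, `𝒩̃^{sp}` and the element `ē^{sp}`

Elements of `𝒩̃† = 𝒩̄† / t^{(p-1)b^*} 𝒩̄†` are represented by elements of `𝒩̄† ⊆ ℒ̄†_𝒦`. -/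

/-- `𝒩̄ ⊆ ℒ̄_𝒦`, generated by all `t^{-b} l` with `l ∈ ℒ̄(s)_k` and `b < s v₀`. -/
def Nbar : Submodule (ZMod p) (LK p k (Lbar P k)) :=
  lattice p k (filt p (wtBar P k)) P.v₀ 0

/-- `𝒩̄† ⊆ ℒ̄†_𝒦`, generated by all `t^{-b} l` with `l ∈ ℒ̄†(s)_k` and `b < s b^*`. -/
def Ndag : Submodule (ZMod p) (LK p k (Ldag P k)) :=
  lattice p k (filt p (wtDag P k)) P.bs 0

/-- `t^{(p-1)b^*} 𝒩̄†`. -/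
def NdagTop : Submodule (ZMod p) (LK p k (Ldag P k)) :=
  lattice p k (filt p (wtDag P k)) P.bs (((p : ℝ) - 1) * P.bs)

/-- The preimage in `𝒩̄†` of `𝒩̃^{sp}⟨j⟩`; for `j = 0` this is the preimage of `𝒩̃^{sp}`. -/
def Nsp (j : ℕ) : Submodule (ZMod p) (LK p k (Ldag P k)) :=
  Submodule.span (ZMod p)
    {x | ∃ ι ∈ P.A0, ∃ s m : ℕ, 1 ≤ s ∧
      ∃ l ∈ subK k ((filt p (wtDag P k) s).toSubmodule ⊓ LdagGr P k m),
        ι + P.ch ι * P.bs < s * P.bs ∧ m + j ≤ P.ch ι ∧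
        (P.kappa ι : ℤ) ≤ ((p : ℤ) - 3) * m + s ∧ x = tmon p k (-ι) l} ⊔ NdagTop P k

variable {k}

/-- `e ≡ Σ_{a ∈ ℤ⁰(p)} t^{-a} D_{a0}` modulo `C₂(ℒ̄_𝒦)`, and `e ∈ 𝒩̄`. (The sum is over
`a < (p - 1) v₀` because `D_{a0} = 0` in `ℒ̄_k` for the other `a`.) -/
def IsBarElement (α₀ : k) (e : LK p k (Lbar P k)) : Prop :=
  e ∈ Nbar P k ∧
  e - (tmon p k 0 (Dbar P α₀ 0 none) +
    ∑ᶠ a ∈ {a : LabelBar p | (a.1 : ℝ) < P.ws}, tmon p k (-(a.1 : ℤ)) (Dbar P α₀ 0 (some a))) ∈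
      commK p k (Lbar P k)

/-- `ē^{sp} ∈ 𝒩̄†`, `ē^{sp} ≡ Σ_{ι ∈ 𝔄⁰(p)} t^{-ι} D†_{ι0}` modulo `C₂(ℒ̄†_𝒦)`, and the class of
`ē^{sp}` lies in `𝒩̃^{sp}`. -/
def IsSpElement (α₀ : k) (e : LK p k (Ldag P k)) : Prop :=
  e ∈ Ndag P k ∧
  e - (tmon p k 0 (Ddag P α₀ 0 none) +
    ∑ ι : LabelDag P, tmon p k (-ι.1) (Ddag P α₀ 0 (some ι))) ∈ commK p k (Ldag P k) ∧
  e ∈ Nsp P k 0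

/-! ### The actions `Ω_γ`, `A†_γ` and the differentiation `B†` -/

/-- `Ω_γ(Σ_ι t^{-ι} l_ι) = Σ_ι t^{-ι} exp(γ (p^m α)_ι t^{b^*}) l_ι`, the sum over `ι ∈ 𝔄⁰`
(truncated exponential); it is defined on classes modulo `t^{(p-1)b^*} 𝒩̄†`. -/
def Omega (γ : ZMod p) (e : LK p k (Ldag P k)) : LK p k (Ldag P k) :=
  ∑ ι ∈ P.A0, ∑ j ∈ Finset.range p,
    (((j.factorial : ZMod p)⁻¹) * (γ * (P.aNum ι : ZMod p)) ^ j) •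
      tmon p k (-ι + j * P.bs) (tcoeff p k (-ι) e)

/-- The family `A_γ ∈ Aut(ℒ̄†)`, `γ ∈ ℤ/p`, is the family of automorphisms `A†_γ` associated with
`e = ē^{sp}`: for each `γ` there is `c = c̃_γ ∈ 𝒩̃^{sp}⟨1⟩` such that

* `σ c ∈ 𝒩̃^{sp}⟨1⟩` and `Ω_γ(e) = σ(c) ∘ (A_γ ⊗ id) e ∘ (-c)` in `𝒩̃†`;
* `A_γ(D†_{ι0}) - D†_{ι0} ∈ ⊕_{m < ch(ι)} ℒ̄†[m]_k` for all `ι ∈ 𝔄⁰(p)`. -/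
def IsConjugatedAction (α₀ : k) (e : LK p k (Ldag P k))
    (A : ZMod p → (Ldag P k ≃ₗ⁅ZMod p⁆ Ldag P k)) : Prop :=
  ∀ γ : ZMod p,
    (∃ c ∈ Nsp P k 1, sigma p k c ∈ Nsp P k 1 ∧ ∃ w : LK p k (Ldag P k),
      IsCHProd p (Kt k) [sigma p k c, mapK k (A γ : Ldag P k →ₗ[ZMod p] Ldag P k) e, -c] w ∧
      w - Omega P γ e ∈ NdagTop P k) ∧
    mapk k (A γ : Ldag P k →ₗ[ZMod p] Ldag P k) (Ddag P α₀ 0 none) = Ddag P α₀ 0 none ∧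
    ∀ ι : LabelDag P,
      mapk k (A γ : Ldag P k →ₗ[ZMod p] Ldag P k) (Ddag P α₀ 0 (some ι)) -
        Ddag P α₀ 0 (some ι) ∈ subK k (LdagGrLT P k (P.ch ι.1))

/-- `B` is the differentiation `B†`: `B(ℒ̄†[m]) ⊆ ⊕_{m' < m} ℒ̄†[m']` for all `m`, and
`A_γ = Σ_{i < p} (γ B)^i / i!` for all `γ ∈ ℤ/p`. -/
def IsDifferential (A : ZMod p → (Ldag P k ≃ₗ⁅ZMod p⁆ Ldag P k))
    (B : LieDerivation (ZMod p) (Ldag P k) (Ldag P k)) : Prop :=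
  (∀ m, ∀ x ∈ LdagGr P k m, B x ∈ LdagGrLT P k m) ∧
  ∀ (γ : ZMod p) (x : Ldag P k), A γ x =
    ∑ i ∈ Finset.range p, (((i.factorial : ZMod p)⁻¹) * γ ^ i) •
      ((B : Ldag P k →ₗ[ZMod p] Ldag P k) ^ i) x

/-! ### The ideals `ℒ̄†[v₀]` and `ℒ̄[v₀]` -/

variable (hP : P.Admissible (Module.finrank (ZMod p) k))

/-- `ℒ̄†[v₀]`, the minimal ideal of `ℒ̄†` containing all `A_γ(Ker 𝒱)`. -/
def LdagIdeal (A : ZMod p → (Ldag P k ≃ₗ⁅ZMod p⁆ Ldag P k)) : LieIdeal (ZMod p) (Ldag P k) :=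
  LieSubmodule.lieSpan (ZMod p) (Ldag P k) {y | ∃ γ, ∃ x ∈ (V P k hP).ker, y = A γ x}

/-- `ℒ̄[v₀] = 𝒱(ℒ̄†[v₀])`. (`LieIdeal.map` is the ideal generated by the image, which is the image
itself, as `𝒱` is surjective.) -/
def LbarIdeal (A : ZMod p → (Ldag P k ≃ₗ⁅ZMod p⁆ Ldag P k)) : LieIdeal (ZMod p) (Lbar P k) :=
  LieIdeal.map (V P k hP) (LdagIdeal P hP A)

/-- The element `𝒱_k B_k(D†_{ι0})` of `ℒ̄_k`. -/
def VB (α₀ : k) (B : LieDerivation (ZMod p) (Ldag P k) (Ldag P k)) (ι : LabelDag P) :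
    Lk p k (Lbar P k) :=
  mapk k (V P k hP : Ldag P k →ₗ[ZMod p] Lbar P k)
    (mapk k (B : Ldag P k →ₗ[ZMod p] Ldag P k) (Ddag P α₀ 0 (some ι)))

end Main

end Ramification
end

/-!
All congruences below are modulo `t^{(p-1)b^*} 𝒩̄†` (or its image in `ℒ̄_𝒦`). Truncated free Lie
algebras carry a derivation that multiplies commutators by their length; it gives them a faithful
nilpotent representation, which embeds the composition `∘` into a group of truncated exponentials.
So `∘` is the value of a universal element `bch` of the free Lie algebra (`isCHProd_eq_bch`,
`bch_assoc`). Being universal, `∘` is compatible with Lie homomorphisms, even with linear maps that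
are homomorphisms only modulo some subspace (`map_bch_sub_mem`), and summands that are central
modulo a subspace can be taken out of it (`bch_add_sub_mem`).

*The operators.* Let `Φ_{γ,μ}` take `t^{-ι} l` to `μ^{ch(ι)} t^{-ι} exp(γ (p^m α)_ι t^{b^*}) l`.
Thus `Φ_{γ,1} = Ω_γ`. The integers `(p^m α)_ι` and `ch(ι)` are additive in `ι`, and multiplication
by `t^{b^*}` leaves the first unchanged and raises the second by one. Hence the `Φ_{γ,μ}` are Lie
homomorphisms on `𝒩^{sp}` (`Phi_lie_sub_mem`), they commute with `σ` (`Phi_sigma_sub_mem`), and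
they compose like affine maps `x ↦ γ + μ x` (`Phi_Phi_sub_mem`).

*Uniqueness of conjugations.* In `σ d ∘ ε ∘ (-d)` the pair `(d, ε)` is determined by the result, if
`d` has no terms with exponent `≤ 0` other than `t^{-ι}`, `0 ≠ ι ∈ 𝔄⁰`, and `ε` is determined by
its coefficients at the `t^{-ι}`, `ι ∈ 𝔄⁺(p) ∪ {0}`. Along the lower central series the difference
of two solutions is central, so that this comes down to the equation `σ z - z + η = 0`. Here `z`
vanishes, because no element of `𝔄⁺(p)` is of the form `p^j ι` with `j ≥ 1` and `ι ∈ 𝔄⁰`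
(`conj_unique_step`, `conjSigma_unique`).

*The derivation.* As `Ω_{γ+γ'} ≡ Ω_{γ'} Ω_γ`, uniqueness gives `A_{γ+γ'} = A_γ A_{γ'}`
(`IsConjugation.comp_eq`). Every function of `γ ∈ 𝔽_p` is a polynomial of degree `< p`. By the
homomorphism property, the coefficient of `γ^i` in `A_γ` is `B^i / i!`, where `B` is the
coefficient of `γ`; so `A_γ = exp(γ B)`, and this property determines `B`. That `B` is a derivation
needs an argument, because `γ^p = γ`: besides `[B x, y] + [x, B y]`, the coefficient of `γ` in
`[A_γ x, A_γ y]` contains the terms `[B^i x, B^j y] / (i! j!)` with `i + j = p`. If such a term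
does not vanish, then `x` and `y` have degrees at least `i` and `j`, since `B` lowers the degree.
On commutators of generators the weight exceeds the degree, and the `A_γ` respect the weight
(`IsConjugation.map_mem_filt`); hence the term has weight `> p` and vanishes after all
(`polyCoeff_one_lie`).

*The ideal.* Let `ℐ` be the ideal of `ℒ̄` generated by the values of `𝒱 B`. The operator `Φ_{0,μ}`
fixes `𝒱 ē^{sp} = σ^{N^*} ē`, where only exponents divisible by `q` occur, and it satisfies
`Φ_{0,μ} Ω_1 ≡ Ω_μ Φ_{0,μ}`. So both `𝒱 A_μ ē^{sp}` and `Φ_{0,μ} 𝒱 A_1 ē^{sp}` are conjugate to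
`Ω_μ 𝒱 ē^{sp}`. On `C_2` the map `𝒱 (A_μ - 1)` has values in `[ℐ, ℒ̄]`, and uniqueness modulo `[ℐ,
ℒ̄]` yields `𝒱 (A_μ - 1) D_ι ≡ μ^{ch(ι)} 𝒱 (A_1 - 1) D_ι` (`V_action_sub_mem`). For `ch(ι) ≥ 2` the
coefficient of `μ` is zero on the right and `𝒱 B D_ι` on the left (`V_der_gen_mem`). As `B D_ι = 0`
for `ch(ι) = 0`, the ideal `ℐ` is generated modulo `[ℐ, ℒ̄]` by the values with `ch(ι) = 1`, hence
by them alone, as `ℒ̄` is nilpotent (`derIdeal_le`). Finally `ℐ = ℒ̄[v₀]`, since `𝒱 A_γ x`, for `x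
∈ Ker 𝒱`, is a polynomial in `γ` with coefficients in `ℐ`, one of which is `𝒱 B x`
(`LbarIdeal_eq_derIdeal`).
-/

open scoped TensorProduct

noncomputable section

namespace Ramification

/-! ### The truncated exponential -/

section TruncatedExp

attribute [local instance 100] LieRing.ofAssociativeRing

variable {p : ℕ} [Fact p.Prime] {A : Type*} [Ring A] [Algebra (ZMod p) A]

theorem factorial_cast_ne_zero {n : ℕ} (h : n < p) : (n.factorial : ZMod p) ≠ 0 := by
  rw [Ne, ZMod.natCast_eq_zero_iff, (Fact.out : p.Prime).dvd_factorial]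
  omega

theorem natCast_ne_zero_of_lt {n : ℕ} (h0 : 0 < n) (h : n < p) : (n : ZMod p) ≠ 0 := by
  rw [Ne, ZMod.natCast_eq_zero_iff]
  exact fun hd => absurd (Nat.le_of_dvd h0 hd) (by omega)

theorem pow_mul_eq_sum_ad (a b : A) (n : ℕ) :
    a ^ n * b = ∑ m ∈ Finset.HasAntidiagonal.antidiagonal n,
      n.choose m.1 • (((LieAlgebra.ad (ZMod p) A a) ^ m.1) b * a ^ m.2) := by
  have h1 : LinearMap.mulLeft (ZMod p) a =
      LieAlgebra.ad (ZMod p) A a + LinearMap.mulRight (ZMod p) a := by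
    ext x; simp [Ring.lie_def]
  have hc : Commute (LieAlgebra.ad (ZMod p) A a) (LinearMap.mulRight (ZMod p) a) := by
    ext x; simp [Ring.lie_def, mul_assoc, sub_mul]
  have h2 := hc.add_pow' n
  rw [← h1] at h2
  have h3 := LinearMap.congr_fun h2 b
  rw [LinearMap.pow_mulLeft] at h3
  simp only [LinearMap.mulLeft_apply] at h3
  rw [h3, LinearMap.sum_apply]
  refine Finset.sum_congr rfl fun m _ => ?_
  rw [hc.pow_pow m.1 m.2]
  simp [LinearMap.pow_mulRight]

theorem choose_mul_inv_factorial {n : ℕ} (hn : n < p) {m : ℕ × ℕ}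
    (hm : m ∈ Finset.HasAntidiagonal.antidiagonal n) :
    ((n.factorial : ZMod p)⁻¹) * (n.choose m.1 : ZMod p) =
      ((m.1.factorial : ZMod p)⁻¹) * ((m.2.factorial : ZMod p)⁻¹) := by
  rw [Finset.HasAntidiagonal.mem_antidiagonal] at hm
  have h1 := factorial_cast_ne_zero (p := p) hn
  have h2 := factorial_cast_ne_zero (p := p) (n := m.1) (by omega)
  have h3 := factorial_cast_ne_zero (p := p) (n := m.2) (by omega)
  have h4 : (n.choose m.1 : ZMod p) * m.1.factorial * m.2.factorial = n.factorial := by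
    have := Nat.choose_mul_factorial_mul_factorial (n := n) (k := m.1) (by omega)
    rw [show n - m.1 = m.2 by omega] at this
    rw [← Nat.cast_mul, ← Nat.cast_mul, this]
  field_simp
  rw [← h4]

theorem sum_range_sub_sum_antidiagonal_mem {M : Type*} [AddCommGroup M] {S : Type*}
    [SetLike S M] [AddSubgroupClass S M] (T : S) (f : ℕ → ℕ → M) (n : ℕ)
    (h : ∀ i j, n ≤ i + j → f i j ∈ T) :
    ∑ i ∈ Finset.range n, ∑ j ∈ Finset.range n, f i j -
      ∑ k ∈ Finset.range n, ∑ m ∈ Finset.HasAntidiagonal.antidiagonal k, f m.1 m.2 ∈ T := by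
  have h1 : ∑ k ∈ Finset.range n, ∑ m ∈ Finset.HasAntidiagonal.antidiagonal k, f m.1 m.2 =
      ∑ x ∈ (Finset.range n ×ˢ Finset.range n).filter (fun x => x.1 + x.2 < n), f x.1 x.2 := by
    rw [Finset.sum_sigma']
    refine Finset.sum_bij' (fun x _ => x.2) (fun x _ => ⟨x.1 + x.2, x⟩) ?_ ?_ ?_ ?_ ?_
    · rintro ⟨k, m⟩ hm
      simp only [Finset.mem_sigma, Finset.mem_range, Finset.HasAntidiagonal.mem_antidiagonal] at hm
      obtain ⟨h1, h2⟩ := hm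
      simp only [Finset.mem_filter, Finset.mem_product, Finset.mem_range]
      omega
    · rintro m hm
      simp only [Finset.mem_filter, Finset.mem_product, Finset.mem_range] at hm
      simp only [Finset.mem_sigma, Finset.mem_range, Finset.HasAntidiagonal.mem_antidiagonal]
      exact ⟨hm.2, trivial⟩
    · rintro ⟨k, m⟩ hm
      simp only [Finset.mem_sigma, Finset.mem_range, Finset.HasAntidiagonal.mem_antidiagonal] at hm
      obtain ⟨_, rfl⟩ := hm
      rfl
    · intros; rfl
    · intros; rfl
  rw [← Finset.sum_product', h1, ← Finset.sum_filter_add_sum_filter_not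
    (Finset.range n ×ˢ Finset.range n) (fun x => x.1 + x.2 < n), add_sub_cancel_left]
  refine sum_mem fun x hx => h _ _ ?_
  simp only [Finset.mem_filter] at hx
  omega

section Ideal

variable {I : Submodule (ZMod p) A} (hI : I * I ≤ I)
include hI

theorem pow_le_pow_of_mul_le {m n : ℕ} (hm : 1 ≤ m) (h : m ≤ n) : I ^ n ≤ I ^ m := by
  obtain ⟨d, rfl⟩ := Nat.exists_eq_add_of_le h
  clear h
  induction d with
  | zero => simp
  | succ d ih =>
    refine le_trans ?_ ih
    obtain ⟨e, rfl⟩ : ∃ e, m = e + 1 := ⟨m - 1, by omega⟩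
    rw [show e + 1 + (d + 1) = (e + d) + 1 + 1 by omega, pow_succ, pow_succ, mul_assoc,
      show e + 1 + d = e + d + 1 by omega, pow_succ]
    exact mul_le_mul' le_rfl hI

theorem mul_mem_pow_of_le {m n k : ℕ} {x y : A} (hx : x ∈ I ^ m) (hy : y ∈ I ^ n) (hk : 1 ≤ k)
    (h : k ≤ m + n) : x * y ∈ I ^ k :=
  pow_le_pow_of_mul_le hI hk h (pow_add I m n ▸ Submodule.mul_mem_mul hx hy)

theorem lie_mem_pow_of_le {m n k : ℕ} {x y : A} (hx : x ∈ I ^ m) (hy : y ∈ I ^ n) (hk : 1 ≤ k)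
    (h : k ≤ m + n) : ⁅x, y⁆ ∈ I ^ k := by
  rw [Ring.lie_def]
  exact sub_mem (mul_mem_pow_of_le hI hx hy hk h)
    (mul_mem_pow_of_le hI hy hx hk (by omega))

theorem ad_pow_mem_pow {n : ℕ} {x y : A} (hx : x ∈ I) (hy : y ∈ I ^ n) (hn : 1 ≤ n) (i : ℕ) :
    ((LieAlgebra.ad (ZMod p) A x) ^ i) y ∈ I ^ (n + i) := by
  induction i with
  | zero => simpa
  | succ i ih =>
    rw [pow_succ', Module.End.mul_apply, LieAlgebra.ad_apply]
    exact lie_mem_pow_of_le hI (m := 1) (by simpa using hx) ih (by omega) (by omega)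

theorem texp_mul_sub_mem {a b : A} (ha : a ∈ I) (hb : b ∈ I) :
    texp p (ZMod p) a * b - (∑ i ∈ Finset.range p, ((i.factorial : ZMod p)⁻¹) •
      ((LieAlgebra.ad (ZMod p) A a) ^ i) b) * texp p (ZMod p) a ∈ I ^ p := by
  have hp := (Fact.out : p.Prime).one_lt
  rw [← neg_mem_iff, neg_sub]
  have h1 : texp p (ZMod p) a * b = ∑ n ∈ Finset.range p, ∑ m ∈ Finset.HasAntidiagonal.antidiagonal n,
      (((m.1.factorial : ZMod p)⁻¹) • ((LieAlgebra.ad (ZMod p) A a) ^ m.1) b) *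
        (((m.2.factorial : ZMod p)⁻¹) • a ^ m.2) := by
    rw [texp, Finset.sum_mul]
    refine Finset.sum_congr rfl fun n hn => ?_
    rw [smul_mul_assoc, pow_mul_eq_sum_ad (p := p), Finset.smul_sum]
    refine Finset.sum_congr rfl fun m hm => ?_
    rw [smul_mul_smul_comm, ← choose_mul_inv_factorial (Finset.mem_range.1 hn) hm, mul_smul,
      Nat.cast_smul_eq_nsmul]
  rw [h1, texp, Finset.sum_mul_sum]
  refine sum_range_sub_sum_antidiagonal_mem (I ^ p) (fun i j =>
    (((i.factorial : ZMod p)⁻¹) • ((LieAlgebra.ad (ZMod p) A a) ^ i) b) *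
        (((j.factorial : ZMod p)⁻¹) • a ^ j)) p fun i j hij => ?_
  refine mul_mem_pow_of_le hI (m := 1 + i) (n := j)
    (Submodule.smul_mem _ _ (ad_pow_mem_pow hI ha (by simpa using hb) le_rfl i))
    (Submodule.smul_mem _ _ (Submodule.pow_mem_pow _ ha j)) (by omega) (by omega)

/-- The truncated logarithmic derivative: `δ (exp z) = dlog δ z * exp z` up to terms of
degree `≥ p`. -/
def dlog (δ : A →ₗ[ZMod p] A) (z : A) : A :=
  ∑ i ∈ Finset.range (p - 1), (((i + 1).factorial : ZMod p)⁻¹) •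
    ((LieAlgebra.ad (ZMod p) A z) ^ i) (δ z)

variable {δ : A →ₗ[ZMod p] A} (hδ : ∀ a b, δ (a * b) = δ a * b + a * δ b)
include hδ

omit hI in
theorem derivation_one : δ 1 = 0 := by
  have := hδ 1 1
  simp only [mul_one, one_mul] at this
  simpa using this

omit hI in
theorem derivation_pow (z : A) (n : ℕ) :
    δ (z ^ n) = ∑ m ∈ Finset.HasAntidiagonal.antidiagonal n, n.choose m.1 •
      ((if m.1 = 0 then 0 else ((LieAlgebra.ad (ZMod p) A z) ^ (m.1 - 1)) (δ z)) * z ^ m.2) := by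
  set Lz : Module.End (ZMod p) A := LinearMap.mulLeft (ZMod p) z with hLz
  have h1 : ∀ i : ℕ, ((LieAlgebra.ad (ZMod p) (Module.End (ZMod p) A) Lz) ^ (i + 1)) δ =
      - LinearMap.mulLeft (ZMod p) (((LieAlgebra.ad (ZMod p) A z) ^ i) (δ z)) := by
    intro i
    induction i with
    | zero => ext x; simp [Ring.lie_def, hLz, hδ]
    | succ i ih =>
      rw [pow_succ', Module.End.mul_apply, ih, pow_succ', Module.End.mul_apply]
      ext x
      simp [Ring.lie_def, hLz, mul_assoc, sub_mul]
      abel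
  have h2 := LinearMap.congr_fun (pow_mul_eq_sum_ad (p := p) Lz δ n) (1 : A)
  rw [Module.End.mul_apply, derivation_one hδ, map_zero, LinearMap.sum_apply,
    Finset.Nat.sum_antidiagonal_eq_sum_range_succ_mk, Finset.sum_range_succ'] at h2
  rw [Finset.Nat.sum_antidiagonal_eq_sum_range_succ_mk, Finset.sum_range_succ']
  have h3 : ∀ i : ℕ, (Lz ^ i) 1 = z ^ i := fun i => by simp [hLz, LinearMap.pow_mulLeft]
  simp only [h1, LinearMap.smul_apply, Module.End.mul_apply, h3, LinearMap.neg_apply,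
    LinearMap.mulLeft_apply, pow_zero, Module.End.one_apply, Nat.choose_zero_right, one_smul,
    Nat.sub_zero, smul_neg, Finset.sum_neg_distrib] at h2
  simp only [Nat.succ_ne_zero, if_false, if_true, zero_mul, smul_zero, add_zero,
    Nat.add_sub_cancel]
  rw [eq_comm, neg_add_eq_zero] at h2
  exact h2.symm

/-- The defining property of the truncated logarithmic derivative. -/
theorem derivation_texp_sub_mem (hδI : ∀ a ∈ I, δ a ∈ I) {z : A} (hz : z ∈ I) :
    δ (texp p (ZMod p) z) - dlog δ z * texp p (ZMod p) z ∈ I ^ p := by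
  have hp := (Fact.out : p.Prime).one_lt
  rw [← neg_mem_iff, neg_sub]
  set g : ℕ → A := fun i => ((i.factorial : ZMod p)⁻¹) •
    (if i = 0 then 0 else ((LieAlgebra.ad (ZMod p) A z) ^ (i - 1)) (δ z)) with hg
  have h0 : dlog δ z = ∑ i ∈ Finset.range p, g i := by
    obtain ⟨e, he⟩ : ∃ e, p = e + 1 := ⟨p - 1, by omega⟩
    rw [dlog, show Finset.range p = Finset.range (p - 1 + 1) by congr 1; omega,
      Finset.sum_range_succ']
    simp [hg]
  have h1 : δ (texp p (ZMod p) z) = ∑ n ∈ Finset.range p, ∑ m ∈ Finset.HasAntidiagonal.antidiagonal n,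
      g m.1 * (((m.2.factorial : ZMod p)⁻¹) • z ^ m.2) := by
    rw [texp, map_sum]
    refine Finset.sum_congr rfl fun n hn => ?_
    rw [map_smul, derivation_pow hδ, Finset.smul_sum]
    refine Finset.sum_congr rfl fun m hm => ?_
    rw [smul_mul_smul_comm, ← choose_mul_inv_factorial (Finset.mem_range.1 hn) hm, mul_smul,
      Nat.cast_smul_eq_nsmul]
  rw [h0, h1, texp, Finset.sum_mul_sum]
  refine sum_range_sub_sum_antidiagonal_mem (I ^ p) (fun i j =>
    g i * (((j.factorial : ZMod p)⁻¹) • z ^ j)) p fun i j hij => ?_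
  rcases Nat.eq_zero_or_pos i with rfl | hi
  · simp [hg]
  · refine mul_mem_pow_of_le hI (m := i) (n := j) ?_
      (Submodule.smul_mem _ _ (Submodule.pow_mem_pow _ hz j)) (by omega) (by omega)
    simp only [hg, if_neg hi.ne']
    have := ad_pow_mem_pow hI hz (n := 1) (by simpa using hδI z hz) le_rfl (i - 1)
    rw [show 1 + (i - 1) = i by omega] at this
    exact Submodule.smul_mem _ _ this

end Ideal

end TruncatedExp

/-! ### The Campbell–Hausdorff theorem in low degrees -/

section CampbellHausdorff

attribute [local instance 100] LieRing.ofAssociativeRing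

section Solve

variable {p : ℕ} [Fact p.Prime] {A : Type*} [Ring A] [Algebra (ZMod p) A]
  {I : Submodule (ZMod p) A} (hI : I * I ≤ I) {δ : A →ₗ[ZMod p] A}
  (hδ : ∀ a b, δ (a * b) = δ a * b + a * δ b) (hδI : ∀ a ∈ I, δ a - a ∈ I ^ 2)
include hI

include hδ hδI in
/-- A derivation that is the identity on `I / I ^ 2` is multiplication by `n` on
`I ^ n / I ^ (n + 1)`. -/
theorem derivation_sub_smul_mem (n : ℕ) (hn : 1 ≤ n) {a : A} (ha : a ∈ I ^ n) :
    δ a - (n : ZMod p) • a ∈ I ^ (n + 1) := by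
  induction n, hn using Nat.le_induction generalizing a with
  | base => simpa using hδI a (by simpa using ha)
  | succ n hn ih =>
    rw [pow_succ] at ha
    refine Submodule.mul_induction_on ha (fun x hx y hy => ?_) fun x y hx hy => ?_
    · have : δ (x * y) - ((n + 1 : ℕ) : ZMod p) • (x * y) =
          (δ x - (n : ZMod p) • x) * y + x * (δ y - y) := by
        rw [hδ, sub_mul, mul_sub, Nat.cast_succ, add_smul, one_smul, smul_mul_assoc]
        abel
      rw [this]
      exact add_mem (mul_mem_pow_of_le hI (ih hx) (n := 1) (by simpa using hy) (by omega) le_rfl)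
        (mul_mem_pow_of_le hI hx (hδI y hy) (by omega) le_rfl)
    · rw [map_add, smul_add, add_sub_add_comm]
      exact add_mem hx hy

include hδI in
theorem derivation_mem {a : A} (ha : a ∈ I) : δ a ∈ I := by
  have h1 := pow_le_pow_of_mul_le hI le_rfl (by norm_num : 1 ≤ 2) (hδI a ha)
  rw [pow_one] at h1
  simpa using add_mem h1 ha

theorem ad_pow_add_sub_mem {n : ℕ} (hn : 1 ≤ n) {z h w v : A} (hz : z ∈ I) (hh : h ∈ I ^ n)
    (hw : w ∈ I) (hv : v ∈ I ^ n) (i : ℕ) :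
    ((LieAlgebra.ad (ZMod p) A (z + h)) ^ (i + 1)) (w + v) -
      ((LieAlgebra.ad (ZMod p) A z) ^ (i + 1)) w ∈ I ^ (n + 1) := by
  have hzh : z + h ∈ I := add_mem hz (by simpa using pow_le_pow_of_mul_le hI le_rfl hn hh)
  have key : ∀ i, ((LieAlgebra.ad (ZMod p) A (z + h)) ^ i) (w + v) -
      ((LieAlgebra.ad (ZMod p) A z) ^ i) w ∈ I ^ n →
      ((LieAlgebra.ad (ZMod p) A (z + h)) ^ (i + 1)) (w + v) -
      ((LieAlgebra.ad (ZMod p) A z) ^ (i + 1)) w ∈ I ^ (n + 1) := by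
    intro i hi
    set a := ((LieAlgebra.ad (ZMod p) A z) ^ i) w with ha
    set b := ((LieAlgebra.ad (ZMod p) A (z + h)) ^ i) (w + v) with hb
    have ha' : a ∈ I := by
      simpa using pow_le_pow_of_mul_le hI le_rfl (by omega)
        (ad_pow_mem_pow hI hz (n := 1) (by simpa using hw) le_rfl i)
    rw [pow_succ' (LieAlgebra.ad (ZMod p) A (z + h)), pow_succ' (LieAlgebra.ad (ZMod p) A z),
      Module.End.mul_apply, Module.End.mul_apply, ← ha, ← hb,
      LieAlgebra.ad_apply, LieAlgebra.ad_apply]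
    have : ⁅z + h, b⁆ - ⁅z, a⁆ = ⁅z + h, b - a⁆ + ⁅h, a⁆ := by
      rw [lie_sub, add_lie z h a]; abel
    rw [this]
    exact add_mem (lie_mem_pow_of_le hI (m := 1) (by simpa using hzh) hi (by omega) (by omega))
      (lie_mem_pow_of_le hI hh (n := 1) (by simpa using ha') (by omega) le_rfl)
  induction i with
  | zero => exact key 0 (by simpa using hv)
  | succ i ih => exact key _ (pow_le_pow_of_mul_le hI hn (by omega) ih)

include hδ hδI in
/-- The equation `dlog δ z = u` can be solved for `z` in a Lie subalgebra, up to terms of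
degree `≥ p`, by successive approximations. -/
theorem exists_dlog_sub_mem (S : LieSubalgebra (ZMod p) A) (hS : ∀ a ∈ S, δ a ∈ S) {u : A}
    (hu : u ∈ S) (huI : u ∈ I) : ∃ z ∈ S, z ∈ I ∧ dlog δ z - u ∈ I ^ p := by
  have hp := (Fact.out : p.Prime).one_lt
  have hlog : ∀ z ∈ S, dlog δ z ∈ S := fun z hz => by
    refine sum_mem fun i hi => S.smul_mem _ ?_
    clear hi
    induction i with
    | zero => exact hS z hz
    | succ i ih =>
      rw [pow_succ', Module.End.mul_apply, LieAlgebra.ad_apply]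
      exact S.lie_mem hz ih
  suffices ∀ n, 1 ≤ n → n ≤ p → ∃ z ∈ S, z ∈ I ∧ dlog δ z - u ∈ I ^ n from this p hp.le le_rfl
  intro n hn
  induction n, hn using Nat.le_induction with
  | base =>
    intro _
    refine ⟨0, S.zero_mem, I.zero_mem, ?_⟩
    have : dlog δ (0 : A) = 0 := by
      unfold dlog
      exact Finset.sum_eq_zero fun i _ => by simp
    rw [this, zero_sub, pow_one]
    exact neg_mem huI
  | succ n hn ih =>
    intro hnp
    obtain ⟨z, hzS, hzI, hz⟩ := ih (by omega)
    have hn0 : (n : ZMod p) ≠ 0 := natCast_ne_zero_of_lt hn (by omega)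
    set h : A := (n : ZMod p)⁻¹ • (u - dlog δ z) with hh
    have hhn : h ∈ I ^ n := Submodule.smul_mem _ _ (by rw [← neg_mem_iff, neg_sub]; exact hz)
    have hhI : h ∈ I := by simpa using pow_le_pow_of_mul_le hI le_rfl hn hhn
    have hδh := derivation_sub_smul_mem hI hδ hδI n hn hhn
    refine ⟨z + h, S.add_mem hzS (S.smul_mem _ (S.sub_mem hu (hlog z hzS))),
      add_mem hzI hhI, ?_⟩
    have h1 : dlog δ (z + h) - dlog δ z - δ h ∈ I ^ (n + 1) := by
      obtain ⟨e, he⟩ : ∃ e, p - 1 = e + 1 := ⟨p - 2, by omega⟩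
      have : dlog δ (z + h) - dlog δ z - δ h = ∑ i ∈ Finset.range e,
          (((i + 1 + 1).factorial : ZMod p)⁻¹) •
          (((LieAlgebra.ad (ZMod p) A (z + h)) ^ (i + 1)) (δ z + δ h) -
            ((LieAlgebra.ad (ZMod p) A z) ^ (i + 1)) (δ z)) := by
        simp only [dlog, he, Finset.sum_range_succ', map_add, smul_sub, Finset.sum_sub_distrib]
        simp
        abel
      rw [this]
      refine sum_mem fun i _ => Submodule.smul_mem _ _ ?_
      have hδn : δ h ∈ I ^ n := by
        have := pow_le_pow_of_mul_le hI hn (Nat.le_succ n) hδh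
        simpa using add_mem this (Submodule.smul_mem _ (n : ZMod p) hhn)
      exact ad_pow_add_sub_mem hI hn hzI hhn (derivation_mem hI hδI hzI) hδn i
    have h2 : dlog δ (z + h) - u = (dlog δ (z + h) - dlog δ z - δ h) +
        (δ h - (n : ZMod p) • h) := by
      rw [hh, smul_smul, mul_inv_cancel₀ hn0, one_smul]; abel
    rw [h2]
    exact add_mem h1 hδh

include hδ hδI in
/-- A solution of the linear equation `δ a = u * a` without constant term vanishes up to terms of
degree `≥ p`. -/
theorem mem_pow_of_derivation_sub_mul_mem {u a : A} (hu : u ∈ I) (ha : a ∈ I)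
    (h : δ a - u * a ∈ I ^ p) : a ∈ I ^ p := by
  have hp := (Fact.out : p.Prime).one_lt
  suffices ∀ n, 1 ≤ n → n ≤ p → a ∈ I ^ n from this p hp.le le_rfl
  intro n hn
  induction n, hn using Nat.le_induction with
  | base => intro _; simpa using ha
  | succ n hn ih =>
    intro hnp
    have han := ih (by omega)
    have hn0 : (n : ZMod p) ≠ 0 := natCast_ne_zero_of_lt hn (by omega)
    have h1 := derivation_sub_smul_mem hI hδ hδI n hn han
    have h2 := pow_le_pow_of_mul_le hI (by omega) hnp h
    have h3 : u * a ∈ I ^ (n + 1) :=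
      mul_mem_pow_of_le hI (m := 1) (by simpa using hu) han (by omega) (by omega)
    have h4 : (n : ZMod p) • a ∈ I ^ (n + 1) := by
      have := add_mem (sub_mem h2 h1) h3
      simpa using this
    have := Submodule.smul_mem _ ((n : ZMod p)⁻¹) h4
    rwa [smul_smul, inv_mul_cancel₀ hn0, one_smul] at this

theorem texp_sub_one_mem {a : A} (ha : a ∈ I) : texp p (ZMod p) a - 1 ∈ I := by
  have hp := (Fact.out : p.Prime).one_lt
  rw [texp, show Finset.range p = Finset.range (p - 1 + 1) by congr 1; omega,
    Finset.sum_range_succ']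
  simp only [Nat.factorial_zero, Nat.cast_one, inv_one, pow_zero, one_smul, add_sub_cancel_right]
  refine sum_mem fun i _ => I.smul_mem _ ?_
  have := pow_le_pow_of_mul_le hI le_rfl (by omega : 1 ≤ i + 1) (Submodule.pow_mem_pow _ ha (i + 1))
  simpa using this

include hδ hδI in
/-- The Campbell–Hausdorff theorem up to terms of degree `≥ p`. -/
theorem exists_texp_mul_texp_sub_mem (hIl : ∀ a, ∀ x ∈ I ^ p, a * x ∈ I ^ p)
    (hIr : ∀ a, ∀ x ∈ I ^ p, x * a ∈ I ^ p)
    (S : LieSubalgebra (ZMod p) A) (hS : ∀ a ∈ S, δ a ∈ S)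
    {x y : A} (hxS : x ∈ S) (hyS : y ∈ S) (hx : x ∈ I) (hy : y ∈ I) :
    ∃ z ∈ S, z ∈ I ∧
      texp p (ZMod p) x * texp p (ZMod p) y - texp p (ZMod p) z ∈ I ^ p := by
  have hp := (Fact.out : p.Prime).one_lt
  have adS : ∀ a ∈ S, ∀ b ∈ S, ∀ i : ℕ, ((LieAlgebra.ad (ZMod p) A a) ^ i) b ∈ S := by
    intro a ha b hb i
    induction i with
    | zero => exact hb
    | succ i ih =>
      rw [pow_succ', Module.End.mul_apply, LieAlgebra.ad_apply]
      exact S.lie_mem ha ih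
  have adI : ∀ a ∈ I, ∀ b ∈ I, ∀ i : ℕ, ((LieAlgebra.ad (ZMod p) A a) ^ i) b ∈ I := by
    intro a ha b hb i
    simpa using pow_le_pow_of_mul_le hI le_rfl (by omega)
        (ad_pow_mem_pow hI ha (n := 1) (by simpa using hb) le_rfl i)
  have dS : ∀ a ∈ S, dlog δ a ∈ S := fun a ha =>
    sum_mem fun i _ => S.smul_mem _ (adS a ha _ (hS a ha) i)
  have dI : ∀ a ∈ I, dlog δ a ∈ I := fun a ha =>
    sum_mem fun i _ => I.smul_mem _ (adI a ha _ (derivation_mem hI hδI ha) i)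
  set c := ∑ i ∈ Finset.range p, ((i.factorial : ZMod p)⁻¹) •
      ((LieAlgebra.ad (ZMod p) A x) ^ i) (dlog δ y) with hc
  set u := dlog δ x + c with hu
  have huS : u ∈ S := S.add_mem (dS x hxS)
    (sum_mem fun i _ => S.smul_mem _ (adS x hxS _ (dS y hyS) i))
  have huI : u ∈ I := I.add_mem (dI x hx)
    (sum_mem fun i _ => I.smul_mem _ (adI x hx _ (dI y hy) i))
  obtain ⟨z, hzS, hzI, hz⟩ := exists_dlog_sub_mem hI hδ hδI S hS huS huI
  refine ⟨z, hzS, hzI, ?_⟩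
  have hδI' : ∀ a ∈ I, δ a ∈ I := fun a ha => derivation_mem hI hδI ha
  have ex := derivation_texp_sub_mem hI hδ hδI' hx
  have ey := derivation_texp_sub_mem hI hδ hδI' hy
  have ez := derivation_texp_sub_mem hI hδ hδI' hzI
  have ec := texp_mul_sub_mem hI hx (dI y hy)
  rw [← hc] at ec
  refine mem_pow_of_derivation_sub_mul_mem hI hδ hδI huI ?_ ?_
  · have h1 := texp_sub_one_mem hI hx
    have h2 := texp_sub_one_mem hI hy
    have h3 := texp_sub_one_mem hI hzI
    have : texp p (ZMod p) x * texp p (ZMod p) y - texp p (ZMod p) z =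
      (texp p (ZMod p) x - 1) * (texp p (ZMod p) y - 1) + (texp p (ZMod p) x - 1) +
        (texp p (ZMod p) y - 1) - (texp p (ZMod p) z - 1) := by noncomm_ring
    rw [this]
    exact sub_mem (add_mem (add_mem (hI (Submodule.mul_mem_mul h1 h2)) h1) h2) h3
  · set X := texp p (ZMod p) x
    set Y := texp p (ZMod p) y
    set Z := texp p (ZMod p) z
    have : δ (X * Y - Z) - u * (X * Y - Z) =
        (δ X - dlog δ x * X) * Y + X * (δ Y - dlog δ y * Y) + (X * dlog δ y - c * X) * Y
          - (δ Z - dlog δ z * Z) - (dlog δ z - u) * Z := by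
      rw [map_sub, hδ, hu]; noncomm_ring
    rw [this]
    exact sub_mem (sub_mem (add_mem (add_mem (hIr _ _ ex) (hIl _ _ ey)) (hIr _ _ ec)) ez)
      (hIr _ _ hz)

end Solve

section Universal

variable (p : ℕ) [Fact p.Prime]

/-- The augmentation ideal of the free associative algebra on two generators. -/
def freeAug : Submodule (ZMod p) (FreeAlgebra (ZMod p) Bool) :=
  LinearMap.ker (FreeAlgebra.algebraMapInv (R := ZMod p) (X := Bool)).toLinearMap

/-- The homomorphism `a ↦ a + ε δ(a)` to the dual numbers over the free algebra that defines the
degree derivation `δ`. -/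
def degreeHom : FreeAlgebra (ZMod p) Bool →ₐ[ZMod p]
    TrivSqZeroExt (FreeAlgebra (ZMod p) Bool) (FreeAlgebra (ZMod p) Bool) :=
  FreeAlgebra.lift (ZMod p) fun i =>
    TrivSqZeroExt.inl (FreeAlgebra.ι (ZMod p) i) + TrivSqZeroExt.inr (FreeAlgebra.ι (ZMod p) i)

/-- The derivation of the free algebra that multiplies words by their length. -/
def degreeDer : FreeAlgebra (ZMod p) Bool →ₗ[ZMod p] FreeAlgebra (ZMod p) Bool :=
  (TrivSqZeroExt.sndHom (FreeAlgebra (ZMod p) Bool) (FreeAlgebra (ZMod p) Bool)).restrictScalars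
    (ZMod p) ∘ₗ (degreeHom p).toLinearMap

theorem fst_degreeHom (a : FreeAlgebra (ZMod p) Bool) : (degreeHom p a).fst = a := by
  have : (TrivSqZeroExt.fstHom (ZMod p) (FreeAlgebra (ZMod p) Bool)
      (FreeAlgebra (ZMod p) Bool)).comp (degreeHom p) = AlgHom.id _ _ := by
    ext i
    simp [degreeHom]
  exact DFunLike.congr_fun this a

theorem degreeDer_mul (a b : FreeAlgebra (ZMod p) Bool) :
    degreeDer p (a * b) = degreeDer p a * b + a * degreeDer p b := by
  change (degreeHom p (a * b)).snd = (degreeHom p a).snd * b + a * (degreeHom p b).snd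
  rw [map_mul, TrivSqZeroExt.snd_mul, fst_degreeHom, fst_degreeHom]
  simp [add_comm]

theorem degreeDer_ι (i : Bool) :
    degreeDer p (FreeAlgebra.ι (ZMod p) i) = FreeAlgebra.ι (ZMod p) i := by
  change (degreeHom p (FreeAlgebra.ι (ZMod p) i)).snd = _
  simp [degreeHom]

theorem ι_mem_freeAug (i : Bool) : FreeAlgebra.ι (ZMod p) i ∈ freeAug p := by
  simp [freeAug, FreeAlgebra.algebraMapInv]

theorem mul_mem_freeAug_left (a : FreeAlgebra (ZMod p) Bool) {x : FreeAlgebra (ZMod p) Bool}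
    (hx : x ∈ freeAug p) : a * x ∈ freeAug p := by
  simp only [freeAug, LinearMap.mem_ker, AlgHom.toLinearMap_apply, map_mul] at hx ⊢
  rw [hx, mul_zero]

theorem mul_mem_freeAug_right (a : FreeAlgebra (ZMod p) Bool) {x : FreeAlgebra (ZMod p) Bool}
    (hx : x ∈ freeAug p) : x * a ∈ freeAug p := by
  simp only [freeAug, LinearMap.mem_ker, AlgHom.toLinearMap_apply, map_mul] at hx ⊢
  rw [hx, zero_mul]

theorem mul_mem_freeAug_pow {n : ℕ} (hn : 1 ≤ n) (a : FreeAlgebra (ZMod p) Bool)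
    {x : FreeAlgebra (ZMod p) Bool} (hx : x ∈ freeAug p ^ n) :
    a * x ∈ freeAug p ^ n ∧ x * a ∈ freeAug p ^ n := by
  obtain ⟨n, rfl⟩ : ∃ m, n = m + 1 := ⟨n - 1, by omega⟩
  constructor
  · rw [pow_succ'] at hx ⊢
    refine Submodule.mul_induction_on hx (fun u hu v hv => ?_) fun u v hu hv => ?_
    · rw [← mul_assoc]
      exact Submodule.mul_mem_mul (mul_mem_freeAug_left p a hu) hv
    · rw [mul_add]
      exact add_mem hu hv
  · rw [pow_succ] at hx ⊢
    refine Submodule.mul_induction_on hx (fun u hu v hv => ?_) fun u v hu hv => ?_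
    · rw [mul_assoc]
      exact Submodule.mul_mem_mul hu (mul_mem_freeAug_right p a hv)
    · rw [add_mul]
      exact add_mem hu hv

theorem freeAug_mul_le : freeAug p * freeAug p ≤ freeAug p :=
  Submodule.mul_le.2 fun a _ _ hb => mul_mem_freeAug_left p a hb

theorem degreeDer_sub_mem {a : FreeAlgebra (ZMod p) Bool} (ha : a ∈ freeAug p) :
    degreeDer p a - a ∈ freeAug p ^ 2 := by
  have h0 : degreeDer p 1 = 0 := derivation_one (degreeDer_mul p)
  have key : ∀ a : FreeAlgebra (ZMod p) Bool, degreeDer p a -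
      (a - algebraMap (ZMod p) _ (FreeAlgebra.algebraMapInv a)) ∈ freeAug p ^ 2 := by
    intro a
    induction a using FreeAlgebra.induction with
    | grade0 r =>
      rw [Algebra.algebraMap_eq_smul_one, map_smul, h0]
      simp [Algebra.algebraMap_eq_smul_one]
    | grade1 i => simp [degreeDer_ι, FreeAlgebra.algebraMapInv]
    | mul a b ha hb =>
      set c := FreeAlgebra.algebraMapInv a
      set d := FreeAlgebra.algebraMapInv b
      have hac : a - algebraMap (ZMod p) _ c ∈ freeAug p := by simp [freeAug, c]
      have hbd : b - algebraMap (ZMod p) _ d ∈ freeAug p := by simp [freeAug, d]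
      have : degreeDer p (a * b) - (a * b -
          algebraMap (ZMod p) _ (FreeAlgebra.algebraMapInv (a * b))) =
          (degreeDer p a - (a - algebraMap (ZMod p) _ c)) * b +
          a * (degreeDer p b - (b - algebraMap (ZMod p) _ d)) +
          (a - algebraMap (ZMod p) _ c) * (b - algebraMap (ZMod p) _ d) := by
        rw [degreeDer_mul, map_mul, map_mul]
        noncomm_ring
      rw [this, pow_two]
      rw [pow_two] at ha hb
      refine add_mem (add_mem ?_ ?_) (Submodule.mul_mem_mul hac hbd)
      · rw [← pow_two] at ha ⊢
        exact (mul_mem_freeAug_pow p (by norm_num) b ha).2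
      · rw [← pow_two] at hb ⊢
        exact (mul_mem_freeAug_pow p (by norm_num) a hb).1
    | add a b ha hb =>
      have : degreeDer p (a + b) - (a + b -
          algebraMap (ZMod p) _ (FreeAlgebra.algebraMapInv (a + b))) =
          (degreeDer p a - (a - algebraMap (ZMod p) _ (FreeAlgebra.algebraMapInv a))) +
          (degreeDer p b - (b - algebraMap (ZMod p) _ (FreeAlgebra.algebraMapInv b))) := by
        rw [map_add, map_add, map_add]; abel
      rw [this]
      exact add_mem ha hb
  have := key a
  rwa [show FreeAlgebra.algebraMapInv a = 0 from ha, map_zero, sub_zero] at this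

/-- The embedding of the free Lie algebra into the free associative algebra. -/
def freeLieEmb : FreeLieAlgebra (ZMod p) Bool →ₗ⁅ZMod p⁆ FreeAlgebra (ZMod p) Bool :=
  FreeLieAlgebra.lift (ZMod p) (FreeAlgebra.ι (ZMod p))

/-- The Campbell–Hausdorff theorem for the free Lie algebra on two generators. -/
theorem exists_free_campbellHausdorff : ∃ z : FreeLieAlgebra (ZMod p) Bool,
    freeLieEmb p z ∈ freeAug p ∧
    texp p (ZMod p) (FreeAlgebra.ι (ZMod p) false) * texp p (ZMod p) (FreeAlgebra.ι (ZMod p) true) -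
      texp p (ZMod p) (freeLieEmb p z) ∈ freeAug p ^ p := by
  have hp := (Fact.out : p.Prime).one_lt
  set S := LieSubalgebra.lieSpan (ZMod p) (FreeAlgebra (ZMod p) Bool)
    (Set.range (FreeAlgebra.ι (ZMod p))) with hSdef
  have hSι : ∀ i, FreeAlgebra.ι (ZMod p) i ∈ S := fun i => LieSubalgebra.subset_lieSpan ⟨i, rfl⟩
  have hS : ∀ a ∈ S, degreeDer p a ∈ S := by
    intro a ha
    induction ha using LieSubalgebra.lieSpan_induction with
    | mem x hx =>
      obtain ⟨i, rfl⟩ := hx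
      rw [degreeDer_ι]
      exact hSι i
    | zero => rw [map_zero]; exact S.zero_mem
    | add x y hx hy hx' hy' => rw [map_add]; exact S.add_mem hx' hy'
    | smul r x hx hx' => rw [map_smul]; exact S.smul_mem r hx'
    | lie x y hx hy hx' hy' =>
      have : degreeDer p ⁅x, y⁆ = ⁅degreeDer p x, y⁆ + ⁅x, degreeDer p y⁆ := by
        simp only [Ring.lie_def, map_sub, degreeDer_mul]
        abel
      rw [this]
      exact S.add_mem (S.lie_mem hx' hy) (S.lie_mem hx hy')
  obtain ⟨z, hzS, hzI, hz⟩ := exists_texp_mul_texp_sub_mem (freeAug_mul_le p) (degreeDer_mul p)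
    (fun a ha => degreeDer_sub_mem p ha)
    (fun a x hx => (mul_mem_freeAug_pow p hp.le a hx).1)
    (fun a x hx => (mul_mem_freeAug_pow p hp.le a hx).2)
    S hS (hSι false) (hSι true) (ι_mem_freeAug p _) (ι_mem_freeAug p _)
  have hle : S ≤ (freeLieEmb p).range := by
    refine LieSubalgebra.lieSpan_le.2 ?_
    rintro _ ⟨i, rfl⟩
    exact ⟨FreeLieAlgebra.of (ZMod p) i, by
      simp [freeLieEmb, FreeLieAlgebra.lift_of_apply]⟩
  obtain ⟨z', rfl⟩ := hle hzS
  exact ⟨z', hzI, hz⟩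

/-- The truncated Campbell–Hausdorff element of the free Lie algebra on two generators. -/
def freeBch : FreeLieAlgebra (ZMod p) Bool := (exists_free_campbellHausdorff p).choose

theorem freeLieEmb_freeBch_mem : freeLieEmb p (freeBch p) ∈ freeAug p :=
  (exists_free_campbellHausdorff p).choose_spec.1

theorem texp_freeBch :
    texp p (ZMod p) (FreeAlgebra.ι (ZMod p) false) * texp p (ZMod p) (FreeAlgebra.ι (ZMod p) true) -
      texp p (ZMod p) (freeLieEmb p (freeBch p)) ∈ freeAug p ^ p :=
  (exists_free_campbellHausdorff p).choose_spec.2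

end Universal

end CampbellHausdorff

/-! ### The Campbell–Hausdorff group law -/

section Bch

variable (p : ℕ) [Fact p.Prime] {L L' : Type*} [LieRing L] [LieAlgebra (ZMod p) L]
  [LieRing L'] [LieAlgebra (ZMod p) L']

/-- The homomorphism from the free Lie algebra on two generators with given values. -/
def lift₂ (x y : L) : FreeLieAlgebra (ZMod p) Bool →ₗ⁅ZMod p⁆ L :=
  FreeLieAlgebra.lift (ZMod p) fun i => if i then y else x

/-- The Campbell–Hausdorff series of `x`, `y`, truncated in degrees `≥ p` (up to an irrelevant
choice in those degrees). -/
def bch (x y : L) : L := lift₂ p x y (freeBch p)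

omit [Fact p.Prime] in
theorem lift₂_unique {x y : L} (f : FreeLieAlgebra (ZMod p) Bool →ₗ⁅ZMod p⁆ L)
    (hx : f (FreeLieAlgebra.of (ZMod p) false) = x)
    (hy : f (FreeLieAlgebra.of (ZMod p) true) = y) : f = lift₂ p x y := by
  refine FreeLieAlgebra.hom_ext fun i => ?_
  rw [lift₂, FreeLieAlgebra.lift_of_apply]
  cases i <;> simp [hx, hy]

theorem map_bch (f : L →ₗ⁅ZMod p⁆ L') (x y : L) : f (bch p x y) = bch p (f x) (f y) := by
  have : f.comp (lift₂ p x y) = lift₂ p (f x) (f y) :=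
    lift₂_unique p _ (by simp [lift₂, FreeLieAlgebra.lift_of_apply])
      (by simp [lift₂, FreeLieAlgebra.lift_of_apply])
  exact LieHom.congr_fun this (freeBch p)

end Bch

section BchAssoc

attribute [local instance 100] LieRing.ofAssociativeRing

variable {p : ℕ} [Fact p.Prime] {L : Type*} [LieRing L] [LieAlgebra (ZMod p) L]
  {A : Type*} [Ring A] [Algebra (ZMod p) A]

theorem map_texp {B : Type*} [Ring B] [Algebra (ZMod p) B] (g : A →ₐ[ZMod p] B) (a : A) :
    g (texp p (ZMod p) a) = texp p (ZMod p) (g a) := by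
  simp [texp]

/-- The Campbell–Hausdorff law in a representation by nilpotent elements: the relation in the free
associative algebra holds up to `I^p`, where `I` is the augmentation ideal, and `I^p` is mapped to
`M^p = 0`. -/
theorem texp_mul_texp_eq (f : L →ₗ⁅ZMod p⁆ A) {M : Submodule (ZMod p) A} (hM : M * M ≤ M)
    (hMp : M ^ p = ⊥) {x y : L} (hx : f x ∈ M) (hy : f y ∈ M) :
    texp p (ZMod p) (f x) * texp p (ZMod p) (f y) = texp p (ZMod p) (f (bch p x y)) := by
  set g : FreeAlgebra (ZMod p) Bool →ₐ[ZMod p] A :=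
    FreeAlgebra.lift (ZMod p) fun i => if i then f y else f x with hg
  have h1 : ∀ a, g a - algebraMap (ZMod p) A (FreeAlgebra.algebraMapInv a) ∈ M := by
    intro a
    induction a using FreeAlgebra.induction with
    | grade0 r => simp
    | grade1 i => cases i <;> simp [hg, FreeAlgebra.algebraMapInv, hx, hy]
    | mul a b ha hb =>
      set c := FreeAlgebra.algebraMapInv a
      set d := FreeAlgebra.algebraMapInv b
      have : g (a * b) - algebraMap (ZMod p) A (FreeAlgebra.algebraMapInv (a * b)) =
          (g a - algebraMap (ZMod p) A c) * (g b - algebraMap (ZMod p) A d) +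
          c • (g b - algebraMap (ZMod p) A d) + d • (g a - algebraMap (ZMod p) A c) := by
        rw [Algebra.smul_def, Algebra.smul_def, Algebra.commutes d, map_mul, map_mul, map_mul]
        noncomm_ring
      rw [this]
      exact add_mem (add_mem (hM (Submodule.mul_mem_mul ha hb)) (M.smul_mem _ hb))
        (M.smul_mem _ ha)
    | add a b ha hb =>
      rw [map_add, map_add, map_add, add_sub_add_comm]
      exact add_mem ha hb
  have h2 : (freeAug p).map g.toLinearMap ≤ M := by
    rintro _ ⟨a, ha, rfl⟩
    have := h1 a
    rwa [show FreeAlgebra.algebraMapInv a = 0 from ha, map_zero, sub_zero] at this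
  have h3 : (freeAug p ^ p).map g.toLinearMap ≤ ⊥ := by
    rw [Submodule.map_pow, ← hMp]
    exact pow_le_pow_left' h2 p
  have h4 : ∀ z, g (freeLieEmb p z) = f (lift₂ p x y z) := by
    intro z
    have : (g : FreeAlgebra (ZMod p) Bool →ₗ⁅ZMod p⁆ A).comp (freeLieEmb p) =
        f.comp (lift₂ p x y) := by
      refine FreeLieAlgebra.hom_ext fun i => ?_
      cases i <;> simp [freeLieEmb, lift₂, FreeLieAlgebra.lift_of_apply, hg]
    exact LieHom.congr_fun this z
  have h5 := h3 (Submodule.mem_map_of_mem (texp_freeBch p))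
  rw [Submodule.mem_bot, AlgHom.toLinearMap_apply, map_sub, map_mul, map_texp, map_texp, map_texp,
    h4, sub_eq_zero] at h5
  simpa [hg, bch] using h5

theorem pow_eq_bot_of_mul_eq_bot {M : Submodule (ZMod p) A} (hM : M * M = ⊥) {n : ℕ}
    (hn : 2 ≤ n) : M ^ n = ⊥ := by
  obtain ⟨j, rfl⟩ := Nat.exists_eq_add_of_le hn
  rw [pow_add, pow_two, hM, Submodule.bot_mul]

/-- The linear part of the Campbell–Hausdorff element is `X + Y`, as is seen in the dual numbers,
where `exp x = 1 + x`. -/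
theorem freeBch_linear (c d : ZMod p) : FreeLieAlgebra.lift (ZMod p)
    (fun i : Bool => if i then d else c) (freeBch p) = c + d := by
  have hp := (Fact.out : p.Prime).two_le
  set g : FreeAlgebra (ZMod p) Bool →ₐ[ZMod p] DualNumber (ZMod p) :=
    FreeAlgebra.lift (ZMod p) fun i => TrivSqZeroExt.inr (if i then d else c) with hg
  set M : Submodule (ZMod p) (DualNumber (ZMod p)) :=
    LinearMap.range (TrivSqZeroExt.inrHom (ZMod p) (ZMod p)) with hMdef
  have hM0 : M * M = ⊥ := by
    rw [eq_bot_iff, Submodule.mul_le]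
    rintro _ ⟨a, rfl⟩ _ ⟨b, rfl⟩
    simp
  have hM : ∀ x ∈ M, texp p (ZMod p) x = 1 + x := by
    rintro _ ⟨a, rfl⟩
    rw [texp, ← Finset.sum_subset (Finset.range_subset_range.2 hp)]
    · simp [Finset.sum_range_succ]
    · intro i _ hi
      rw [Finset.mem_range, not_lt] at hi
      obtain ⟨j, rfl⟩ := Nat.exists_eq_add_of_le hi
      rw [pow_add, pow_two]
      simp
  have h2 : (freeAug p).map g.toLinearMap ≤ M := by
    rintro _ ⟨a, ha, rfl⟩
    have : ∀ a, (g a).fst = FreeAlgebra.algebraMapInv a := by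
      intro a
      have : (TrivSqZeroExt.fstHom (ZMod p) (ZMod p) (ZMod p)).comp g =
          FreeAlgebra.algebraMapInv := by
        ext i; cases i <;> simp [hg, FreeAlgebra.algebraMapInv]
      exact DFunLike.congr_fun this a
    refine ⟨(g a).snd, TrivSqZeroExt.ext ?_ (by simp)⟩
    simp only [TrivSqZeroExt.inrHom_apply, TrivSqZeroExt.fst_inr, AlgHom.toLinearMap_apply]
    rw [this]
    exact (show FreeAlgebra.algebraMapInv a = 0 from ha).symm
  have h3 : (freeAug p ^ p).map g.toLinearMap ≤ ⊥ := by
    rw [Submodule.map_pow]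
    refine (pow_le_pow_left' h2 p).trans ?_
    exact (pow_eq_bot_of_mul_eq_bot hM0 hp).le
  have h5 := h3 (Submodule.mem_map_of_mem (texp_freeBch p))
  have h7 : ∀ a ∈ freeAug p, texp p (ZMod p) (g a) = 1 + g a := fun a ha =>
    hM _ (h2 (Submodule.mem_map_of_mem ha))
  rw [Submodule.mem_bot, AlgHom.toLinearMap_apply, map_sub, map_mul, map_texp, map_texp, map_texp,
    h7 _ (ι_mem_freeAug p _), h7 _ (ι_mem_freeAug p _), h7 _ (freeLieEmb_freeBch_mem p)] at h5
  set inrLie : ZMod p →ₗ⁅ZMod p⁆ DualNumber (ZMod p) :=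
    { TrivSqZeroExt.inrHom (ZMod p) (ZMod p) with
      map_lie' := by intro x y; simp [Ring.lie_def, mul_comm] } with hinr
  have h4 : (g : FreeAlgebra (ZMod p) Bool →ₗ⁅ZMod p⁆ DualNumber (ZMod p)).comp (freeLieEmb p) =
      inrLie.comp (FreeLieAlgebra.lift (ZMod p) (fun i : Bool => if i then d else c)) := by
    refine FreeLieAlgebra.hom_ext fun i => ?_
    change g (freeLieEmb p (FreeLieAlgebra.of (ZMod p) i)) =
      inrLie (FreeLieAlgebra.lift (ZMod p) _ (FreeLieAlgebra.of (ZMod p) i))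
    rw [freeLieEmb, FreeLieAlgebra.lift_of_apply, FreeLieAlgebra.lift_of_apply]
    exact FreeAlgebra.lift_ι_apply _ _
  have h8 : g (freeLieEmb p (freeBch p)) = TrivSqZeroExt.inr
      (FreeLieAlgebra.lift (ZMod p) (fun i : Bool => if i then d else c) (freeBch p)) :=
    LieHom.congr_fun h4 (freeBch p)
  rw [h8, sub_eq_zero] at h5
  have h6 := congrArg TrivSqZeroExt.snd h5
  have e1 : g (FreeAlgebra.ι (ZMod p) false) = TrivSqZeroExt.inr c := by simp [hg]
  have e2 : g (FreeAlgebra.ι (ZMod p) true) = TrivSqZeroExt.inr d := by simp [hg]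
  rw [e1, e2] at h6
  simp only [TrivSqZeroExt.snd_mul, TrivSqZeroExt.snd_add, TrivSqZeroExt.snd_one,
    TrivSqZeroExt.fst_add, TrivSqZeroExt.fst_one, TrivSqZeroExt.snd_inr, TrivSqZeroExt.fst_inr] at h6
  simp at h6
  rw [← h6, add_comm]

/-- Central summands can be taken out of the Campbell–Hausdorff element: `z ↦ z(x, y)` plus the
linear part of `z` at `(h, h')` is a homomorphism from the free Lie algebra. -/
theorem bch_add_central {h h' : L} (hh : ∀ x : L, ⁅h, x⁆ = 0) (hh' : ∀ x : L, ⁅h', x⁆ = 0)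
    (x y : L) : bch p (x + h) (y + h') = bch p x y + h + h' := by
  have hr : ∀ x : L, ⁅x, h⁆ = 0 := fun x => by rw [← lie_skew, hh, neg_zero]
  have hr' : ∀ x : L, ⁅x, h'⁆ = 0 := fun x => by rw [← lie_skew, hh', neg_zero]
  set E : ZMod p → ZMod p → FreeLieAlgebra (ZMod p) Bool →ₗ⁅ZMod p⁆ ZMod p := fun c d =>
    FreeLieAlgebra.lift (ZMod p) (fun i : Bool => if i then d else c) with hE
  have hcomm : ∀ a b : ZMod p, ⁅a, b⁆ = 0 := fun a b => by rw [Ring.lie_def, mul_comm, sub_self]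
  set f : FreeLieAlgebra (ZMod p) Bool →ₗ⁅ZMod p⁆ L :=
    { toFun := fun a => lift₂ p x y a + (E 1 0 a • h + E 0 1 a • h')
      map_add' := fun a b => by simp only [map_add, add_smul]; abel
      map_smul' := fun r a => by
        simp only [map_smul, smul_eq_mul, mul_smul, RingHom.id_apply, smul_add]
      map_lie' := fun {a b} => by
        simp only [LieHom.map_lie, hcomm, zero_smul, add_zero]
        simp [hh, hh', hr, hr'] } with hf
  have h1 : f = lift₂ p (x + h) (y + h') := by
    refine lift₂_unique p _ ?_ ?_
    · change lift₂ p x y _ + (E 1 0 _ • h + E 0 1 _ • h') = _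
      simp [hE, lift₂, FreeLieAlgebra.lift_of_apply]
    · change lift₂ p x y _ + (E 1 0 _ • h + E 0 1 _ • h') = _
      simp [hE, lift₂, FreeLieAlgebra.lift_of_apply]
  have h2 := LieHom.congr_fun h1 (freeBch p)
  rw [bch, ← h2]
  change lift₂ p x y _ + (E 1 0 _ • h + E 0 1 _ • h') = _
  have h3 : E 1 0 (freeBch p) = 1 := by rw [hE]; simp only; rw [freeBch_linear]; ring
  have h4 : E 0 1 (freeBch p) = 1 := by rw [hE]; simp only; rw [freeBch_linear]; ring
  rw [h3, h4, one_smul, one_smul, ← add_assoc]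
  rfl

end BchAssoc

section BchCongr

variable {p : ℕ} [Fact p.Prime] {L : Type*} [LieRing L] [LieAlgebra (ZMod p) L]
  (N : LieSubalgebra (ZMod p) L) {T : Submodule (ZMod p) L}

theorem bch_mem {x y : L} (hx : x ∈ N) (hy : y ∈ N) : bch p x y ∈ N := by
  have := map_bch p N.incl ⟨x, hx⟩ ⟨y, hy⟩
  simp only [LieSubalgebra.coe_incl] at this
  rw [← this]
  exact Subtype.property _

/-- A subspace normalised by a subalgebra, as an ideal of the subalgebra. -/
def idealOf (hT : ∀ x ∈ N, ∀ t ∈ T, ⁅x, t⁆ ∈ T) : LieIdeal (ZMod p) N :=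
  { T.comap (N.toSubmodule.subtype) with
    lie_mem := fun {x m} hm => hT x x.2 m hm }

variable {N}

/-- Summands that are central modulo `T` can be taken out of the Campbell–Hausdorff element
modulo `T`. -/
theorem bch_add_sub_mem (hT : ∀ x ∈ N, ∀ t ∈ T, ⁅x, t⁆ ∈ T) {x y h h' : L}
    (hx : x ∈ N) (hy : y ∈ N) (hh : h ∈ N) (hh' : h' ∈ N)
    (hc : ∀ x ∈ N, ⁅x, h⁆ ∈ T) (hc' : ∀ x ∈ N, ⁅x, h'⁆ ∈ T) :
    bch p (x + h) (y + h') - (bch p x y + h + h') ∈ T := by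
  set J := idealOf N hT with hJ
  have hmem : ∀ z : N, z ∈ J ↔ (z : L) ∈ T := fun z => Iff.rfl
  set π := LieSubmodule.Quotient.mk' J with hπ
  let φ : N →ₗ⁅ZMod p⁆ N ⧸ J :=
    { toFun := fun z => π z
      map_add' := fun _ _ => rfl
      map_smul' := fun _ _ => rfl
      map_lie' := rfl }
  have hker : ∀ z : N, φ z = 0 ↔ (z : L) ∈ T := fun z =>
    (LieSubmodule.Quotient.mk_eq_zero' (N := J)).trans (hmem z)
  have cen : ∀ {g : L} (hg : g ∈ N), (∀ x ∈ N, ⁅x, g⁆ ∈ T) → ∀ z : N ⧸ J, ⁅φ ⟨g, hg⟩, z⁆ = 0 := by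
    intro g hg hcg z
    obtain ⟨z, rfl⟩ := LieSubmodule.Quotient.surjective_mk' J z
    rw [← lie_skew, neg_eq_zero]
    exact (LieHom.map_lie φ z ⟨g, hg⟩).symm.trans ((hker _).2 (hcg z z.2))
  have key := bch_add_central (p := p) (cen hh hc) (cen hh' hc') (φ ⟨x, hx⟩) (φ ⟨y, hy⟩)
  rw [← map_add, ← map_add, ← map_bch, ← map_bch, ← map_add, ← map_add, ← sub_eq_zero, ← map_sub,
    hker] at key
  have e : ∀ a b : N, ((bch p a b : N) : L) = bch p (a : L) (b : L) := fun a b =>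
    map_bch p N.incl a b
  simpa [e] using key

theorem bch_sub_bch_mem (hT : ∀ x ∈ N, ∀ t ∈ T, ⁅x, t⁆ ∈ T) (hTN : T ≤ N.toSubmodule)
    {x y x' y' : L} (hx : x ∈ N) (hy : y ∈ N) (hxx : x' - x ∈ T) (hyy : y' - y ∈ T) :
    bch p x' y' - bch p x y ∈ T := by
  have := bch_add_sub_mem hT hx hy (hTN hxx) (hTN hyy) (fun z hz => hT z hz _ hxx)
    (fun z hz => hT z hz _ hyy)
  have h2 := add_mem (add_mem this hxx) hyy
  convert h2 using 1
  simp only [add_sub_cancel]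
  abel

/-- A linear map that is a homomorphism modulo `T` commutes with the Campbell–Hausdorff law
modulo `T`. -/
theorem map_bch_sub_mem (hT : ∀ x ∈ N, ∀ t ∈ T, ⁅x, t⁆ ∈ T) (f : L →ₗ[ZMod p] L)
    (hf : ∀ x ∈ N, f x ∈ N) (hlie : ∀ x ∈ N, ∀ y ∈ N, f ⁅x, y⁆ - ⁅f x, f y⁆ ∈ T) {x y : L}
    (hx : x ∈ N) (hy : y ∈ N) : f (bch p x y) - bch p (f x) (f y) ∈ T := by
  set J := idealOf N hT with hJ
  have hmem : ∀ z : N, z ∈ J ↔ (z : L) ∈ T := fun z => Iff.rfl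
  set π := LieSubmodule.Quotient.mk' J with hπ
  let φ : N →ₗ⁅ZMod p⁆ N ⧸ J :=
    { toFun := fun z => π z
      map_add' := fun _ _ => rfl
      map_smul' := fun _ _ => rfl
      map_lie' := rfl }
  have hker : ∀ z : N, φ z = 0 ↔ (z : L) ∈ T := fun z =>
    (LieSubmodule.Quotient.mk_eq_zero' (N := J)).trans (hmem z)
  let fN : N →ₗ[ZMod p] N := f.restrict hf
  let ψ : N →ₗ⁅ZMod p⁆ N ⧸ J :=
    { toFun := fun z => φ (fN z)
      map_add' := fun a b => by rw [map_add, map_add]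
      map_smul' := fun r a => by rw [map_smul, map_smul, RingHom.id_apply]
      map_lie' := fun {a b} => by
        rw [← LieHom.map_lie, ← sub_eq_zero, ← map_sub, hker]
        exact hlie a a.2 b b.2 }
  have e : ∀ a b : N, ((bch p a b : N) : L) = bch p (a : L) (b : L) := fun a b =>
    map_bch p N.incl a b
  have key : φ (fN (bch p ⟨x, hx⟩ ⟨y, hy⟩)) = φ (bch p (fN ⟨x, hx⟩) (fN ⟨y, hy⟩)) := by
    have h1 := map_bch p ψ ⟨x, hx⟩ ⟨y, hy⟩
    have h2 := map_bch p φ (fN ⟨x, hx⟩) (fN ⟨y, hy⟩)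
    exact h1.trans h2.symm
  rw [← sub_eq_zero, ← map_sub, hker] at key
  change f ((bch p (⟨x, hx⟩ : N) ⟨y, hy⟩ : N) : L) -
    ((bch p (fN ⟨x, hx⟩) (fN ⟨y, hy⟩) : N) : L) ∈ T at key
  rw [e, e] at key
  exact key

end BchCongr

/-! ### Commutators in truncated free Lie algebras -/

section LnBracket

variable {p : ℕ} {L : Type*} [LieRing L] [LieAlgebra (ZMod p) L] {G : Type*}

omit [LieAlgebra (ZMod p) L] in
theorem lnBracket_append_singleton {l : List L} (hl : l ≠ []) (x : L) :
    lnBracket (l ++ [x]) = ⁅lnBracket l, x⁆ := by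
  cases l with
  | nil => exact absurd rfl hl
  | cons a l => simp [lnBracket]

/-- The span of the left-normed commutators of those lists of generators that satisfy `Q`. -/
def lnSpan (p : ℕ) {L : Type*} [LieRing L] [LieAlgebra (ZMod p) L] (f : G → L)
    (Q : List G → Prop) : Submodule (ZMod p) L :=
  Submodule.span (ZMod p) {x | ∃ l : List G, Q l ∧ x = lnBracket (l.map f)}

theorem lnBracket_mem_lnSpan (f : G → L) {Q : List G → Prop} {l : List G} (h : Q l) :
    lnBracket (l.map f) ∈ lnSpan p f Q := Submodule.subset_span ⟨l, h, rfl⟩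

theorem lnSpan_mono (f : G → L) {Q Q' : List G → Prop} (h : ∀ l, Q l → Q' l) :
    lnSpan p f Q ≤ lnSpan p f Q' := by
  refine Submodule.span_mono ?_
  rintro x ⟨l, hl, rfl⟩
  exact ⟨l, h l hl, rfl⟩

theorem lie_lnBracket_mem (f : G → L) (l' l : List G) :
    ⁅lnBracket (l.map f), lnBracket (l'.map f)⁆ ∈
      lnSpan p f fun m => l ≠ [] ∧ l' ≠ [] ∧ m.Perm (l ++ l') := by
  induction l' using List.reverseRecOn generalizing l with
  | nil => simp [lnBracket]
  | append_singleton l' g ih =>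
    rcases eq_or_ne l [] with rfl | hl
    · simp [lnBracket]
    rcases eq_or_ne l' [] with rfl | hl'
    · have := lnBracket_append_singleton (l := l.map f) (by simpa using hl) (f g)
      rw [List.nil_append, show lnBracket ([g].map f) = f g from rfl, ← this]
      exact Submodule.subset_span ⟨l ++ [g], by simp [hl], by simp⟩
    · rw [List.map_append, List.map_singleton,
        lnBracket_append_singleton (by simpa using hl'), leibniz_lie]
      refine add_mem ?_ ?_
      · refine Submodule.span_induction (p := fun x _ => ⁅x, f g⁆ ∈ _) ?_ (by simp) ?_ ?_ (ih l)
        · rintro _ ⟨m, ⟨h1, h2, hm⟩, rfl⟩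
          have hm0 : m ≠ [] := by
            rintro rfl
            simp [hl] at hm
          rw [← lnBracket_append_singleton (by simpa using hm0)]
          refine Submodule.subset_span ⟨m ++ [g], ⟨hl, by simp, ?_⟩, by simp⟩
          rw [← List.append_assoc]
          exact hm.append_right [g]
        · intro x y _ _ hx hy
          rw [add_lie]; exact add_mem hx hy
        · intro r x _ hx
          rw [smul_lie]; exact Submodule.smul_mem _ r hx
      · rw [← lie_skew, neg_mem_iff, ← lnBracket_append_singleton (by simpa using hl),
          ← List.map_singleton, ← List.map_append]
        refine lnSpan_mono f ?_ (ih (l ++ [g]))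
        rintro m ⟨-, -, hm⟩
        refine ⟨hl, by simp, hm.trans ?_⟩
        rw [List.append_assoc]
        exact (List.perm_append_comm).append_left l

theorem lie_mem_lnSpan (f : G → L) {Q Q' Q'' : List G → Prop}
    (h : ∀ l l' m, Q l → Q' l' → l ≠ [] → l' ≠ [] → m.Perm (l ++ l') → Q'' m) {x y : L}
    (hx : x ∈ lnSpan p f Q) (hy : y ∈ lnSpan p f Q') : ⁅x, y⁆ ∈ lnSpan p f Q'' := by
  induction hx using Submodule.span_induction with
  | mem x hx =>
    obtain ⟨l, hl, rfl⟩ := hx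
    induction hy using Submodule.span_induction with
    | mem y hy =>
      obtain ⟨l', hl', rfl⟩ := hy
      exact lnSpan_mono f (fun m hm => h l l' m hl hl' hm.1 hm.2.1 hm.2.2)
        (lie_lnBracket_mem f l' l)
    | zero => simp
    | add y z _ _ hy hz => rw [lie_add]; exact add_mem hy hz
    | smul r y _ hy => rw [lie_smul]; exact Submodule.smul_mem _ r hy
  | zero => simp
  | add x z _ _ hx hz => rw [add_lie]; exact add_mem hx hz
  | smul r x _ hx => rw [smul_lie]; exact Submodule.smul_mem _ r hx

theorem sum_map_of_perm_append {l l' m : List G} (h : m.Perm (l ++ l')) (c : G → ℕ) :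
    (m.map c).sum = (l.map c).sum + (l'.map c).sum := by
  rw [(h.map c).sum_eq, List.map_append, List.sum_append]

theorem length_of_perm_append {l l' m : List G} (h : m.Perm (l ++ l')) :
    m.length = l.length + l'.length := by
  rw [h.length_eq, List.length_append]

end LnBracket

section TruncLieStructure

variable {p : ℕ} {G : Type*} (w : G → ℕ)

theorem lnSpan_gen_eq_top : lnSpan p (gen p w) (fun _ => True) = ⊤ := by
  let S : LieSubalgebra (ZMod p) (TruncLie p w) :=
    { lnSpan p (gen p w) (fun _ => True) with
      lie_mem' := fun {x y} hx hy => lie_mem_lnSpan _ (fun _ _ _ _ _ _ _ _ => trivial) hx hy }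
  have hgen : ∀ g, gen p w g ∈ S := fun g => lnBracket_mem_lnSpan (l := [g]) (gen p w) trivial
  let mk : FreeLieAlgebra (ZMod p) G →ₗ⁅ZMod p⁆ TruncLie p w :=
    { toFun := fun z => LieSubmodule.Quotient.mk' (topIdeal p w) z
      map_add' := fun _ _ => rfl
      map_smul' := fun _ _ => rfl
      map_lie' := rfl }
  have h1 : S.incl.comp (FreeLieAlgebra.lift (ZMod p) fun g => (⟨gen p w g, hgen g⟩ : S)) = mk := by
    refine FreeLieAlgebra.hom_ext fun g => ?_
    rw [LieHom.comp_apply, FreeLieAlgebra.lift_of_apply]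
    rfl
  rw [eq_top_iff]
  intro x _
  obtain ⟨z, rfl⟩ := LieSubmodule.Quotient.surjective_mk' (topIdeal p w) x
  change mk z ∈ S
  rw [← h1]
  exact Subtype.property _

theorem mem_lnSpan_true (x : TruncLie p w) : x ∈ lnSpan p (gen p w) (fun _ => True) := by
  rw [lnSpan_gen_eq_top]; trivial

theorem filt_toSubmodule (s : ℕ) :
    (filt p w s).toSubmodule = lnSpan p (gen p w) fun l => s ≤ (l.map w).sum := by
  let I : LieIdeal (ZMod p) (TruncLie p w) :=
    { lnSpan p (gen p w) fun l => s ≤ (l.map w).sum with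
      lie_mem := fun {x y} hy => lie_mem_lnSpan _ (fun l l' m _ h2 _ _ hm => by
        rw [sum_map_of_perm_append hm]; omega) (mem_lnSpan_true w x) hy }
  refine le_antisymm ?_ ?_
  · have : filt p w s ≤ I := LieSubmodule.lieSpan_le.2 fun x hx => Submodule.subset_span hx
    exact this
  · exact Submodule.span_le.2 fun x hx => LieSubmodule.subset_lieSpan hx

theorem mem_filt_iff {s : ℕ} {x : TruncLie p w} :
    x ∈ filt p w s ↔ x ∈ lnSpan p (gen p w) fun l => s ≤ (l.map w).sum := by
  rw [← filt_toSubmodule]; rfl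

theorem lie_mem_filt {s s' : ℕ} {x y : TruncLie p w} (hx : x ∈ filt p w s)
    (hy : y ∈ filt p w s') : ⁅x, y⁆ ∈ filt p w (s + s') := by
  rw [mem_filt_iff] at *
  exact lie_mem_lnSpan _ (fun l l' m h1 h2 _ _ hm => by
    rw [sum_map_of_perm_append hm]; omega) hx hy

theorem filt_antitone {s s' : ℕ} (h : s ≤ s') : filt p w s' ≤ filt p w s := by
  intro x hx
  rw [mem_filt_iff] at *
  exact lnSpan_mono _ (fun l hl => h.trans hl) hx

theorem filt_eq_bot {s : ℕ} (h : p ≤ s) [Fact p.Prime] : filt p w s = ⊥ := by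
  rw [eq_bot_iff]
  refine LieSubmodule.lieSpan_le.2 ?_
  rintro x ⟨l, hl, rfl⟩
  exact lnBracket_gen_eq_zero w l (h.trans hl)

theorem gen_mem_filt (g : G) : gen p w g ∈ filt p w (w g) :=
  LieSubmodule.subset_lieSpan ⟨[g], by simp, rfl⟩

theorem lie_mem_grade (c : G → ℕ) {m m' : ℕ} {x y : TruncLie p w} (hx : x ∈ grade p w c m)
    (hy : y ∈ grade p w c m') : ⁅x, y⁆ ∈ grade p w c (m + m') :=
  lie_mem_lnSpan _ (fun l l' k h1 h2 _ _ hk => by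
    rw [sum_map_of_perm_append hk, h1, h2]) hx hy

variable {w}

theorem filt_one_eq_top (hw : ∀ g, 1 ≤ w g) : filt p w 1 = ⊤ := by
  rw [eq_top_iff]
  intro x _
  rw [mem_filt_iff]
  have h0 := mem_lnSpan_true w x
  induction h0 using Submodule.span_induction with
  | mem x hx =>
    obtain ⟨l, -, rfl⟩ := hx
    cases l with
    | nil => simp [lnBracket]
    | cons a l =>
      refine lnBracket_mem_lnSpan _ ?_
      have := hw a
      simp only [List.map_cons, List.sum_cons]; omega
  | zero => exact zero_mem _
  | add x y _ _ hx hy => exact add_mem (hx trivial) (hy trivial)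
  | smul r x _ hx => exact Submodule.smul_mem _ r (hx trivial)

/-- The ideal `C_{r+1}` spanned by the commutators of length `≥ r + 1`; thus `lcs p L 0 = C_1 = L`.
-/
abbrev lcs (p : ℕ) (L : Type*) [LieRing L] [LieAlgebra (ZMod p) L] (r : ℕ) : LieIdeal (ZMod p) L :=
  LieModule.lowerCentralSeries (ZMod p) L L r

theorem lie_mem_lcs {L : Type*} [LieRing L] [LieAlgebra (ZMod p) L] {r : ℕ} {x y : L}
    (hy : y ∈ lcs p L r) : ⁅x, y⁆ ∈ lcs p L (r + 1) := by
  rw [lcs, LieModule.lowerCentralSeries_succ]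
  exact LieSubmodule.lie_mem_lie (LieSubmodule.mem_top x) hy

theorem lie_mem_lcs' {L : Type*} [LieRing L] [LieAlgebra (ZMod p) L] {r : ℕ} {x y : L}
    (hy : y ∈ lcs p L r) : ⁅y, x⁆ ∈ lcs p L (r + 1) := by
  rw [← lie_skew, neg_mem_iff]
  exact lie_mem_lcs hy

theorem lcs_le_lnSpan (r : ℕ) :
    (lcs p (TruncLie p w) r).toSubmodule ≤ lnSpan p (gen p w) fun l => r + 1 ≤ l.length := by
  induction r with
  | zero =>
    intro x _
    have h0 := mem_lnSpan_true w x
    induction h0 using Submodule.span_induction with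
    | mem x hx =>
      obtain ⟨l, -, rfl⟩ := hx
      cases l with
      | nil => simp [lnBracket]
      | cons a l => exact lnBracket_mem_lnSpan _ (by simp)
    | zero => exact zero_mem _
    | add x y _ _ hx hy => exact add_mem (hx trivial) (hy trivial)
    | smul r x _ hx => exact Submodule.smul_mem _ r (hx trivial)
  | succ r ih =>
    rw [lcs, LieModule.lowerCentralSeries_succ, LieSubmodule.lieIdeal_oper_eq_linear_span']
    refine Submodule.span_le.2 ?_
    rintro _ ⟨x, -, y, hy, rfl⟩
    refine lie_mem_lnSpan _ (fun l l' m _ h2 hl _ hm => ?_) (mem_lnSpan_true w x) (ih hy)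
    rw [length_of_perm_append hm]
    have := List.length_pos_iff.2 hl
    omega

theorem lcs_eq_bot [Fact p.Prime] (hw : ∀ g, 1 ≤ w g) {r : ℕ} (h : p ≤ r + 1) :
    lcs p (TruncLie p w) r = ⊥ := by
  rw [eq_bot_iff]
  intro x hx
  have h1 := lcs_le_lnSpan r hx
  have h2 : lnSpan p (gen p w) (fun l => r + 1 ≤ l.length) ≤ ⊥ := by
    refine Submodule.span_le.2 ?_
    rintro _ ⟨l, hl, rfl⟩
    refine lnBracket_gen_eq_zero w l ?_
    have : ∀ l : List G, l.length ≤ (l.map w).sum := by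
      intro l
      induction l with
      | nil => simp
      | cons a l ih =>
        have := hw a
        simp only [List.length_cons, List.map_cons, List.sum_cons]; omega
    have := this l
    omega
  exact h2 h1

theorem truncLift_gen {L' : Type*} [LieRing L'] [LieAlgebra (ZMod p) L'] (f : G → L')
    (hf : ∀ l : List G, p ≤ (l.map w).sum → lnBracket (l.map f) = 0) (g : G) :
    truncLift f hf (gen p w g) = f g :=
  FreeLieAlgebra.lift_of_apply f g

theorem map_lnBracket {L L' : Type*} [LieRing L] [LieAlgebra (ZMod p) L] [LieRing L']
    [LieAlgebra (ZMod p) L'] (f : L →ₗ⁅ZMod p⁆ L') (l : List L) :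
    f (lnBracket l) = lnBracket (l.map f) := by
  induction l using List.reverseRecOn with
  | nil => simp [lnBracket]
  | append_singleton l x ih =>
    rcases eq_or_ne l [] with rfl | hl
    · simp [lnBracket]
    · rw [lnBracket_append_singleton hl, LieHom.map_lie, ih, List.map_append, List.map_singleton,
        lnBracket_append_singleton (by simpa using hl)]

/-! ### The length derivation -/

variable [Fact p.Prime]

theorem lnBracket_tmul {R : Type*} [CommRing R] [Algebra (ZMod p) R] {L : Type*} [LieRing L]
    [LieAlgebra (ZMod p) L] (r : R) (l : List L) :
    lnBracket (l.map fun x => (r ⊗ₜ[ZMod p] x : R ⊗[ZMod p] L)) = (r ^ l.length) ⊗ₜ lnBracket l := by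
  induction l using List.reverseRecOn with
  | nil => simp [lnBracket]
  | append_singleton l x ih =>
    rcases eq_or_ne l [] with rfl | hl
    · simp [lnBracket]
    · rw [List.map_append, List.map_singleton, lnBracket_append_singleton (by simpa using hl), ih,
        lnBracket_append_singleton hl, LieAlgebra.ExtendScalars.bracket_tmul, List.length_append,
        List.length_singleton, pow_succ]

variable (p w) in
/-- The homomorphism `D_g ↦ X ⊗ D_g` that records the length of commutators. -/
def lengthHom : TruncLie p w →ₗ⁅ZMod p⁆ (Polynomial (ZMod p)) ⊗[ZMod p] (TruncLie p w) :=
  truncLift (fun g => Polynomial.X ⊗ₜ gen p w g) fun l hl => by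
    have := lnBracket_tmul (p := p) (Polynomial.X : Polynomial (ZMod p)) (l.map (gen p w))
    rw [List.map_map] at this
    refine Eq.trans this ?_
    rw [lnBracket_gen_eq_zero w l hl, TensorProduct.tmul_zero]

variable (p w) in
/-- The derivation of `TruncLie` that multiplies commutators by their length. -/
def lengthDer : TruncLie p w →ₗ[ZMod p] TruncLie p w :=
  (TensorProduct.lid (ZMod p) (TruncLie p w)).toLinearMap ∘ₗ
    ((Polynomial.leval (1 : ZMod p) ∘ₗ Polynomial.derivative).rTensor (TruncLie p w)) ∘ₗ
    (lengthHom p w : TruncLie p w →ₗ[ZMod p] _)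

theorem lengthDer_lnBracket (l : List G) : lengthDer p w (lnBracket (l.map (gen p w))) =
    (l.length : ZMod p) • lnBracket (l.map (gen p w)) := by
  have h : lengthHom p w (lnBracket (l.map (gen p w))) =
      (Polynomial.X ^ l.length) ⊗ₜ lnBracket (l.map (gen p w)) := by
    rw [map_lnBracket, List.map_map]
    have := lnBracket_tmul (p := p) (Polynomial.X : Polynomial (ZMod p)) (l.map (gen p w))
    rw [List.map_map, List.length_map] at this
    rw [← this]
    congr 1
    refine List.map_congr_left fun g _ => ?_
    exact truncLift_gen _ _ g
  change TensorProduct.lid (ZMod p) (TruncLie p w) ((LinearMap.rTensor _ _)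
    (lengthHom p w (lnBracket (l.map (gen p w))))) = _
  rw [h, LinearMap.rTensor_tmul, TensorProduct.lid_tmul]
  simp [Polynomial.leval, Polynomial.derivative_X_pow]

theorem lengthDer_lie (x y : TruncLie p w) :
    lengthDer p w ⁅x, y⁆ = ⁅lengthDer p w x, y⁆ + ⁅x, lengthDer p w y⁆ := by
  have hx := mem_lnSpan_true w x
  have hy := mem_lnSpan_true w y
  induction hx using Submodule.span_induction with
  | mem x hx =>
    obtain ⟨l, hl, rfl⟩ := hx
    induction hy using Submodule.span_induction with
    | mem y hy =>
      obtain ⟨l', hl', rfl⟩ := hy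
      rw [lengthDer_lnBracket, lengthDer_lnBracket, smul_lie, lie_smul, ← add_smul]
      have h1 := lie_lnBracket_mem (p := p) (gen p w) l' l
      have h2 : ∀ z ∈ lnSpan p (gen p w) fun m => l ≠ [] ∧ l' ≠ [] ∧ m.Perm (l ++ l'),
          lengthDer p w z = ((l.length : ZMod p) + l'.length) • z := by
        intro z hz
        induction hz using Submodule.span_induction with
        | mem z hz =>
          obtain ⟨m, ⟨-, -, hm⟩, rfl⟩ := hz
          rw [lengthDer_lnBracket, length_of_perm_append hm, Nat.cast_add]
        | zero => simp
        | add y z _ _ hy hz => rw [map_add, hy, hz, smul_add]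
        | smul r y _ hy => rw [map_smul, hy, smul_comm]
      exact h2 _ h1
    | zero => simp
    | add y z _ _ hy hz =>
      rw [lie_add, map_add, map_add, hy, hz, lie_add, lie_add]; abel
    | smul r y _ hy =>
      rw [lie_smul, map_smul, map_smul, hy, lie_smul, lie_smul, smul_add]
  | zero => simp
  | add x z _ _ hx hz => rw [add_lie, map_add, map_add, hx, hz, add_lie, add_lie]; abel
  | smul r x _ hx => rw [smul_lie, map_smul, map_smul, hx, smul_lie, smul_lie, smul_add]

theorem lengthDer_sub_mem (x : TruncLie p w) : lengthDer p w x - x ∈ lcs p (TruncLie p w) 1 := by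
  have hx := mem_lnSpan_true w x
  induction hx using Submodule.span_induction with
  | mem x hx =>
    obtain ⟨l, hl, rfl⟩ := hx
    rw [lengthDer_lnBracket]
    induction l using List.reverseRecOn with
    | nil => simp [lnBracket]
    | append_singleton l g ih =>
      rcases eq_or_ne l [] with rfl | hl
      · simp [lnBracket]
      · rw [List.map_append, List.map_singleton, lnBracket_append_singleton (by simpa using hl)]
        have : ⁅lnBracket (l.map (gen p w)), gen p w g⁆ ∈ lcs p (TruncLie p w) 1 :=
          lie_mem_lcs (r := 0) (by simp [lcs])
        exact sub_mem (SMulMemClass.smul_mem _ this) this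
  | zero => simp
  | add x y _ _ hx hy => rw [map_add, add_sub_add_comm]; exact add_mem hx hy
  | smul r x _ hx => rw [map_smul, ← smul_sub]; exact SMulMemClass.smul_mem _ hx

end TruncLieStructure

/-! ### A faithful nilpotent representation -/

section Raising

variable (R : Type*) {K V : Type*} [CommRing R] [CommRing K] [AddCommGroup V] [Module K V]
  [Module R V] [SMulCommClass K R V] [Algebra R K] [IsScalarTower R K V]

/-- The endomorphisms that raise the index of a filtration by subspaces. -/
def raising (F : ℕ → Submodule K V) : Submodule R (Module.End K V) where
  carrier := {φ | ∀ i, ∀ v ∈ F i, φ v ∈ F (i + 1)}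
  add_mem' := fun {a b} ha hb i v hv => add_mem (ha i v hv) (hb i v hv)
  zero_mem' := fun i v _ => zero_mem _
  smul_mem' := fun r a ha i v hv => by
    rw [LinearMap.smul_apply, ← algebraMap_smul K r]
    exact Submodule.smul_mem _ _ (ha i v hv)

variable {R}

theorem raising_mul_le {F : ℕ → Submodule K V} (hF : Antitone F) :
    raising R F * raising R F ≤ raising R F :=
  Submodule.mul_le.2 fun _ ha _ hb i v hv => hF (Nat.le_succ _) (ha _ _ (hb i v hv))

theorem raising_pow_apply_mem {F : ℕ → Submodule K V} (n : ℕ) {φ : Module.End K V}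
    (hφ : φ ∈ raising R F ^ n) (i : ℕ) (v : V) (hv : v ∈ F i) : φ v ∈ F (i + n) := by
  induction n generalizing φ i v with
  | zero =>
    rw [pow_zero] at hφ
    obtain ⟨r, rfl⟩ := Submodule.mem_one.1 hφ
    rw [Module.algebraMap_end_apply, ← algebraMap_smul K r]
    exact Submodule.smul_mem _ _ hv
  | succ n ih =>
    rw [pow_succ] at hφ
    refine Submodule.mul_induction_on hφ (fun a ha b hb => ?_) fun a b ha hb => add_mem ha hb
    have := ih ha (i + 1) _ (hb i v hv)
    rwa [show i + (n + 1) = i + 1 + n by omega]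

theorem raising_pow_eq_bot {F : ℕ → Submodule K V} (h0 : F 0 = ⊤) {n : ℕ} (hn : F n = ⊥) :
    raising R F ^ n = ⊥ := by
  rw [eq_bot_iff]
  intro φ hφ
  rw [Submodule.mem_bot]
  ext v
  have := raising_pow_apply_mem n hφ 0 v (by rw [h0]; trivial)
  rw [zero_add, hn] at this
  simpa using this

end Raising

section TexpInjective

variable {p : ℕ} [Fact p.Prime] {A : Type*} [Ring A] [Algebra (ZMod p) A]

/-- The truncated exponential is injective on nilpotent elements, since `exp a - exp b ≡ a - b`
modulo `M ^ (n + 1)` if `a - b ∈ M ^ n`. -/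
theorem texp_injOn {M : Submodule (ZMod p) A} (hM : M * M ≤ M) (hMp : M ^ p = ⊥) {a b : A}
    (ha : a ∈ M) (hb : b ∈ M) (h : texp p (ZMod p) a = texp p (ZMod p) b) : a = b := by
  have hp := (Fact.out : p.Prime).two_le
  have key : ∀ n, 1 ≤ n → a - b ∈ M ^ n := by
    intro n hn
    induction n, hn using Nat.le_induction with
    | base => simpa using sub_mem ha hb
    | succ n hn ih =>
      have hpow : ∀ i : ℕ, a ^ (i + 1) - b ^ (i + 1) ∈ M ^ (n + i) := by
        intro i
        induction i with
        | zero => simpa using ih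
        | succ i ihi =>
          have : a ^ (i + 1 + 1) - b ^ (i + 1 + 1) =
              a * (a ^ (i + 1) - b ^ (i + 1)) + (a - b) * b ^ (i + 1) := by
            rw [pow_succ' a (i + 1), pow_succ' b (i + 1)]; noncomm_ring
          rw [this]
          refine add_mem (mul_mem_pow_of_le hM (m := 1) (by simpa using ha) ihi (by omega)
            (by omega)) (mul_mem_pow_of_le hM ih (Submodule.pow_mem_pow _ hb (i + 1)) (by omega)
            (by omega))
      have h2 : a - b = -∑ i ∈ Finset.range (p - 2), ((i + 1 + 1).factorial : ZMod p)⁻¹ •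
          (a ^ (i + 1 + 1) - b ^ (i + 1 + 1)) := by
        have h3 : ∀ c : A, texp p (ZMod p) c = 1 + c + ∑ i ∈ Finset.range (p - 2),
            ((i + 1 + 1).factorial : ZMod p)⁻¹ • c ^ (i + 1 + 1) := by
          intro c
          rw [texp, show Finset.range p = Finset.range (p - 2 + 1 + 1) by congr 1; omega,
            Finset.sum_range_succ', Finset.sum_range_succ']
          simp
          abel
        rw [h3, h3] at h
        simp only [smul_sub, Finset.sum_sub_distrib]
        rw [eq_neg_iff_add_eq_zero]
        rw [← sub_eq_zero] at h
        rw [← h]; abel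
      rw [h2]
      refine neg_mem (sum_mem fun i _ => Submodule.smul_mem _ _ ?_)
      exact pow_le_pow_of_mul_le hM (by omega) (by omega) (hpow (i + 1))
  have := key p (by omega)
  rw [hMp, Submodule.mem_bot] at this
  exact sub_eq_zero.1 this

end TexpInjective

section Affine

attribute [local instance 100] LieRing.ofAssociativeRing

variable {p : ℕ} [Fact p.Prime] {K : Type*} [Field K] [Algebra (ZMod p) K] {L : Type*} [LieRing L]
  [LieAlgebra K L] [LieAlgebra (ZMod p) L] [IsScalarTower (ZMod p) K L]
  (δ : L →ₗ[K] L) (hδ : ∀ x y, δ ⁅x, y⁆ = ⁅δ x, y⁆ + ⁅x, δ y⁆)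

/-- The affine representation of a Lie algebra `L` with a derivation `δ` on `L × K`: `x` acts by
`(y, r) ↦ ([x, y] + r δ(x), 0)`, which is the adjoint action of `L` on the semidirect sum of `L` and
`K δ`, up to the sign of `δ`. -/
def affineRep (hδ : ∀ x y, δ ⁅x, y⁆ = ⁅δ x, y⁆ + ⁅x, δ y⁆) : L →ₗ⁅K⁆ Module.End K (L × K) where
  toFun x := LinearMap.inl K L K ∘ₗ
    ((LieAlgebra.ad K L x) ∘ₗ LinearMap.fst K L K + (LinearMap.snd K L K).smulRight (δ x))
  map_add' x y := by
    ext v <;> simp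
  map_smul' r x := by
    ext v <;> simp
  map_lie' {x y} := by
    ext v <;> simp [Ring.lie_def, hδ]
    rw [← lie_skew (δ x) y]; abel

theorem affineRep_apply (x v : L) (r : K) : affineRep δ hδ x (v, r) = (⁅x, v⁆ + r • δ x, 0) := rfl

variable (K L) in
/-- The filtration of `L × K` by `C_i × 0`, preceded by the whole space. -/
def affineFil : ℕ → Submodule K (L × K)
  | 0 => ⊤
  | i + 1 => (LieModule.lowerCentralSeries K L L i).toSubmodule.map (LinearMap.inl K L K)

theorem affineFil_antitone : Antitone (affineFil K L) := by
  refine antitone_nat_of_succ_le fun n => ?_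
  cases n with
  | zero => exact le_top
  | succ n => exact Submodule.map_mono (LieModule.antitone_lowerCentralSeries K L L (Nat.le_succ n))

theorem affineRep_mem (x : L) {R : Type*} [CommRing R] [Algebra R K] [Module R L]
    [IsScalarTower R K L] : affineRep δ hδ x ∈ raising R (affineFil K L) := by
  intro i v hv
  cases i with
  | zero =>
    obtain ⟨v, r⟩ := v
    rw [affineRep_apply]
    exact ⟨⁅x, v⁆ + r • δ x, by simp, rfl⟩
  | succ i =>
    obtain ⟨v, hv, rfl⟩ := hv
    refine ⟨⁅x, v⁆, ?_, by simp [affineRep_apply]⟩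
    change ⁅x, v⁆ ∈ LieModule.lowerCentralSeries K L L (i + 1)
    rw [LieModule.lowerCentralSeries_succ]
    exact LieSubmodule.lie_mem_lie (LieSubmodule.mem_top x) hv

variable (hδ1 : ∀ x, δ x - x ∈ LieModule.lowerCentralSeries K L L 1)
  (hnil : LieModule.lowerCentralSeries K L L (p - 1) = ⊥)

omit [Algebra (ZMod p) K] [LieAlgebra (ZMod p) L] [IsScalarTower (ZMod p) K L] in
theorem affineFil_eq_bot (hnil : LieModule.lowerCentralSeries K L L (p - 1) = ⊥) :
    affineFil K L p = ⊥ := by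
  obtain ⟨e, he⟩ : ∃ e, p = e + 1 := ⟨p - 1, by have := (Fact.out : p.Prime).one_lt; omega⟩
  rw [show affineFil K L p = affineFil K L (e + 1) from congrArg _ he]
  rw [affineFil, show e = p - 1 by omega, hnil]
  simp

include hδ hδ1 in
/-- A derivation that is the identity modulo `C_2` acts on `C_{n+1} / C_{n+2}` as multiplication by
`n + 1`. -/
theorem lengthLike_sub_smul_mem (n : ℕ) {x : L} (hx : x ∈ LieModule.lowerCentralSeries K L L n) :
    δ x - ((n + 1 : ℕ) : K) • x ∈ LieModule.lowerCentralSeries K L L (n + 1) := by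
  induction n generalizing x with
  | zero => simpa using hδ1 x
  | succ n ih =>
    rw [LieModule.lowerCentralSeries_succ, ← LieSubmodule.mem_toSubmodule,
      LieSubmodule.lieIdeal_oper_eq_linear_span'] at hx
    induction hx using Submodule.span_induction with
    | mem x hx =>
      obtain ⟨y, -, z, hz, rfl⟩ := hx
      have : δ ⁅y, z⁆ - ((n + 1 + 1 : ℕ) : K) • ⁅y, z⁆ =
          ⁅δ y - y, z⁆ + ⁅y, δ z - ((n + 1 : ℕ) : K) • z⁆ := by
        rw [hδ, sub_lie, lie_sub, lie_smul, Nat.cast_succ (n + 1), add_smul, one_smul]; abel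
      rw [this]
      refine add_mem ?_ ?_
      · have h1 := hδ1 y
        have : ∀ u ∈ LieModule.lowerCentralSeries K L L 1,
            ⁅u, z⁆ ∈ LieModule.lowerCentralSeries K L L (n + 1 + 1) := by
          intro u hu
          rw [LieModule.lowerCentralSeries_succ, LieModule.lowerCentralSeries_zero,
            ← LieSubmodule.mem_toSubmodule, LieSubmodule.lieIdeal_oper_eq_linear_span'] at hu
          induction hu using Submodule.span_induction with
          | mem u hu =>
            obtain ⟨a, -, b, -, rfl⟩ := hu
            rw [lie_lie]
            simp only [LieModule.lowerCentralSeries_succ]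
            exact sub_mem
              (LieSubmodule.lie_mem_lie (LieSubmodule.mem_top a)
                (LieSubmodule.lie_mem_lie (LieSubmodule.mem_top b) hz))
              (LieSubmodule.lie_mem_lie (LieSubmodule.mem_top b)
                (LieSubmodule.lie_mem_lie (LieSubmodule.mem_top a) hz))
          | zero => simp
          | add u v _ _ hu hv => rw [add_lie]; exact add_mem hu hv
          | smul r u _ hu => rw [smul_lie]; exact SMulMemClass.smul_mem r hu
        exact this _ h1
      · rw [LieModule.lowerCentralSeries_succ]
        exact LieSubmodule.lie_mem_lie (LieSubmodule.mem_top y) (ih hz)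
    | zero => simp
    | add x y _ _ hx hy => rw [map_add, smul_add, add_sub_add_comm]; exact add_mem hx hy
    | smul r x _ hx =>
      rw [map_smul, smul_comm, ← smul_sub]; exact SMulMemClass.smul_mem r hx

omit [LieAlgebra (ZMod p) L] [IsScalarTower (ZMod p) K L] in
include hδ hδ1 hnil in
theorem lengthLike_injective : Function.Injective δ := by
  rw [← LinearMap.ker_eq_bot, eq_bot_iff]
  intro x hx
  rw [LinearMap.mem_ker] at hx
  have key : ∀ n, n ≤ p - 1 → x ∈ LieModule.lowerCentralSeries K L L n := by
    intro n
    induction n with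
    | zero => intro _; simp
    | succ n ih =>
      intro hn
      have h1 := lengthLike_sub_smul_mem δ hδ hδ1 n (ih (by omega))
      rw [hx, zero_sub, neg_mem_iff] at h1
      have h2 : ((n + 1 : ℕ) : K) ≠ 0 := by
        have := natCast_ne_zero_of_lt (p := p) (n := n + 1) (by omega) (by omega)
        intro h
        apply this
        apply (algebraMap (ZMod p) K).injective
        rw [map_natCast, h, map_zero]
      have := SMulMemClass.smul_mem (((n + 1 : ℕ) : K)⁻¹) h1
      rwa [smul_smul, inv_mul_cancel₀ h2, one_smul] at this
  have := key (p - 1) le_rfl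
  rw [hnil] at this
  simpa using this

omit [LieAlgebra (ZMod p) L] [IsScalarTower (ZMod p) K L] in
include hδ1 hnil in
theorem affineRep_injective : Function.Injective (affineRep δ hδ) := by
  intro x y hxy
  have := LinearMap.congr_fun hxy (0, 1)
  rw [affineRep_apply, affineRep_apply] at this
  simp at this
  exact lengthLike_injective δ hδ hδ1 hnil this

/-- The affine representation, over the prime field. -/
def affineRepRestrict : L →ₗ⁅ZMod p⁆ Module.End K (L × K) :=
  { (affineRep δ hδ : L →ₗ[K] Module.End K (L × K)).restrictScalars (ZMod p) with
    map_lie' := fun {x y} => LieHom.map_lie (affineRep δ hδ) x y }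

include hδ1 hnil in
theorem texp_affineRep_injective {x y : L}
    (h : texp p (ZMod p) (affineRep δ hδ x) = texp p (ZMod p) (affineRep δ hδ y)) : x = y :=
  affineRep_injective δ hδ hδ1 hnil (texp_injOn (M := raising (ZMod p) (affineFil K L))
    (raising_mul_le affineFil_antitone)
    (raising_pow_eq_bot rfl (affineFil_eq_bot hnil)) (affineRep_mem δ hδ x) (affineRep_mem δ hδ y) h)

include hnil in
theorem texp_affineRep_bch (x y : L) :
    texp p (ZMod p) (affineRep δ hδ x) * texp p (ZMod p) (affineRep δ hδ y) =
      texp p (ZMod p) (affineRep δ hδ (bch p x y)) :=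
  texp_mul_texp_eq (affineRepRestrict δ hδ) (M := raising (ZMod p) (affineFil K L))
    (raising_mul_le affineFil_antitone)
    (raising_pow_eq_bot rfl (affineFil_eq_bot hnil)) (affineRep_mem δ hδ x) (affineRep_mem δ hδ y)

include hδ hδ1 hnil in
/-- The Campbell–Hausdorff law is associative, because the truncated exponentials in the affine
representation, which is faithful, multiply according to it. -/
theorem bch_assoc_of_lengthLike (x y z : L) : bch p (bch p x y) z = bch p x (bch p y z) := by
  refine texp_affineRep_injective δ hδ hδ1 hnil ?_
  rw [← texp_affineRep_bch δ hδ hnil, ← texp_affineRep_bch δ hδ hnil,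
    ← texp_affineRep_bch δ hδ hnil, ← texp_affineRep_bch δ hδ hnil, mul_assoc]

theorem texp_zmod {A : Type*} [Ring A] [Algebra K A] [Algebra (ZMod p) A]
    [IsScalarTower (ZMod p) K A] (a : A) : texp p K a = texp p (ZMod p) a := by
  unfold texp
  refine Finset.sum_congr rfl fun i _ => ?_
  rw [← algebraMap_smul K ((i.factorial : ZMod p)⁻¹), map_inv₀, map_natCast]

omit [LieAlgebra (ZMod p) L] [IsScalarTower (ZMod p) K L] in
/-- The enveloping algebra consists of scalars and elements that raise the filtration. -/
theorem lift_affineRep_sub_mem (u : UniversalEnvelopingAlgebra K L) :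
    UniversalEnvelopingAlgebra.lift K (affineRep δ hδ) u - algebraMap K _
      (UniversalEnvelopingAlgebra.lift K (0 : L →ₗ⁅K⁆ K) u) ∈ raising K (affineFil K L) := by
  set g := UniversalEnvelopingAlgebra.lift K (affineRep δ hδ) with hg
  set e := UniversalEnvelopingAlgebra.lift K (0 : L →ₗ⁅K⁆ K) with he
  set M := raising K (affineFil K L) with hM
  let S : Subalgebra K (UniversalEnvelopingAlgebra K L) :=
    { carrier := {u | g u - algebraMap K _ (e u) ∈ M}
      mul_mem' := fun {a b} ha hb => by
        have : g (a * b) - algebraMap K _ (e (a * b)) =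
            (g a - algebraMap K _ (e a)) * (g b - algebraMap K _ (e b)) +
            e a • (g b - algebraMap K _ (e b)) + e b • (g a - algebraMap K _ (e a)) := by
          rw [Algebra.smul_def, Algebra.smul_def, map_mul, map_mul]
          rw [map_mul (algebraMap K (Module.End K (L × K)))]
          simp only [mul_sub, sub_mul]
          rw [Algebra.commutes (e b) (g a), Algebra.commutes (e b)]
          abel
        change g (a * b) - algebraMap K _ (e (a * b)) ∈ M
        rw [this]
        exact add_mem (add_mem (raising_mul_le affineFil_antitone (Submodule.mul_mem_mul ha hb))
          (M.smul_mem _ hb)) (M.smul_mem _ ha)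
      add_mem' := fun {a b} ha hb => by
        change g (a + b) - algebraMap K _ (e (a + b)) ∈ M
        rw [map_add, map_add, map_add, add_sub_add_comm]
        exact add_mem ha hb
      algebraMap_mem' := fun r => by
        change g _ - algebraMap K _ (e _) ∈ M
        simp }
  have hι : ∀ x : L, UniversalEnvelopingAlgebra.ι K x ∈ S := fun x => by
    change g _ - algebraMap K _ (e _) ∈ M
    rw [hg, he, UniversalEnvelopingAlgebra.lift_ι_apply, UniversalEnvelopingAlgebra.lift_ι_apply]
    simpa using affineRep_mem δ hδ x
  let f : L →ₗ⁅K⁆ S :=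
    { toFun := fun x => ⟨UniversalEnvelopingAlgebra.ι K x, hι x⟩
      map_add' := fun x y => by ext; simp
      map_smul' := fun r x => by ext; simp
      map_lie' := fun {x y} => by ext; simp [Ring.lie_def] }
  have h1 : S.val.comp (UniversalEnvelopingAlgebra.lift K f) = AlgHom.id K _ := by
    refine UniversalEnvelopingAlgebra.hom_ext K ?_
    ext x
    change S.val (UniversalEnvelopingAlgebra.lift K f (UniversalEnvelopingAlgebra.ι K x)) = _
    rw [UniversalEnvelopingAlgebra.lift_ι_apply]
    rfl
  have h2 := DFunLike.congr_fun h1 u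
  have h3 : u ∈ S := by
    rw [AlgHom.id_apply] at h2
    rw [← h2]
    exact Subtype.property _
  exact h3

include hδ hδ1 hnil in
/-- In a Lie algebra with a length derivation, the product in the sense of enveloping algebras is
given by the Campbell–Hausdorff element. -/
theorem IsCHProd.eq_bch {x y z v : L} (h : IsCHProd p K [x, y, z] v) :
    v = bch p (bch p x y) z := by
  set g := UniversalEnvelopingAlgebra.lift K (affineRep δ hδ) with hg
  have h1 : (augIdeal K L).map g.toLinearMap ≤ raising K (affineFil K L) := by
    rintro _ ⟨u, hu, rfl⟩
    have h1 := lift_affineRep_sub_mem δ hδ u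
    have h2 : UniversalEnvelopingAlgebra.lift K (0 : L →ₗ⁅K⁆ K) u = 0 := hu
    rw [h2, map_zero, sub_zero] at h1
    exact h1
  have h2 : (augIdeal K L ^ p).map g.toLinearMap ≤ ⊥ := by
    rw [Submodule.map_pow, ← raising_pow_eq_bot (R := K) rfl (affineFil_eq_bot hnil)]
    exact pow_le_pow_left' h1 p
  have h3 := h2 (Submodule.mem_map_of_mem h)
  have h4 : ∀ x : L, g (texp p K (UniversalEnvelopingAlgebra.ι K x)) =
      texp p (ZMod p) (affineRep δ hδ x) := by
    intro x
    rw [← texp_zmod (K := K)]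
    simp only [texp, map_sum, map_smul, map_pow, hg, UniversalEnvelopingAlgebra.lift_ι_apply]
  rw [Submodule.mem_bot] at h3
  simp only [List.map_cons, List.map_nil, List.prod_cons, List.prod_nil, mul_one,
    AlgHom.toLinearMap_apply, map_sub, map_mul, h4] at h3
  refine (texp_affineRep_injective δ hδ hδ1 hnil ?_).symm
  rw [← texp_affineRep_bch δ hδ hnil, ← texp_affineRep_bch δ hδ hnil, mul_assoc]
  exact sub_eq_zero.1 h3

end Affine

section BchOneParam

variable {p : ℕ} [Fact p.Prime] {L : Type*} [LieRing L] [LieAlgebra (ZMod p) L]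

attribute [local instance 100] LieRing.ofAssociativeRing

theorem bch_smul_smul (c d : ZMod p) (x : L) : bch p (c • x) (d • x) = (c + d) • x := by
  let f : ZMod p →ₗ⁅ZMod p⁆ L :=
    { (LinearMap.toSpanSingleton (ZMod p) L x) with
      map_lie' := fun {a b} => by simp [Ring.lie_def, mul_comm] }
  have h1 : f (bch p c d) = bch p (f c) (f d) := map_bch p f c d
  have h2 : bch p c d = c + d := freeBch_linear c d
  rw [h2] at h1
  exact h1.symm

end BchOneParam

section BchInverse

variable {p : ℕ} [Fact p.Prime] {L : Type*} [LieRing L] [LieAlgebra (ZMod p) L]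

@[simp]
theorem bch_zero (x : L) : bch p x 0 = x := by
  have h := bch_smul_smul (p := p) 1 0 x
  rwa [one_smul, zero_smul, add_zero, one_smul] at h

@[simp]
theorem zero_bch (x : L) : bch p 0 x = x := by
  have h := bch_smul_smul (p := p) 0 1 x
  rwa [one_smul, zero_smul, zero_add, one_smul] at h

@[simp]
theorem bch_neg_self (x : L) : bch p x (-x) = 0 := by
  have h := bch_smul_smul (p := p) 1 (-1) x
  rwa [neg_smul, one_smul, add_neg_cancel, zero_smul] at h

@[simp]
theorem neg_bch_self (x : L) : bch p (-x) x = 0 := by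
  have h := bch_smul_smul (p := p) (-1) 1 x
  rwa [neg_smul, one_smul, neg_add_cancel, zero_smul] at h

end BchInverse

section DerivationExt

variable {p : ℕ} [Fact p.Prime] {L : Type*} [LieRing L] [LieAlgebra (ZMod p) L]

theorem baseChange_lie {K : Type*} [CommRing K] [Algebra (ZMod p) K] (d : L →ₗ[ZMod p] L)
    (hd : ∀ x y, d ⁅x, y⁆ = ⁅d x, y⁆ + ⁅x, d y⁆) (x y : K ⊗[ZMod p] L) :
    d.baseChange K ⁅x, y⁆ = ⁅d.baseChange K x, y⁆ + ⁅x, d.baseChange K y⁆ := by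
  induction x using TensorProduct.induction_on with
  | zero => rw [map_zero, zero_lie, map_zero, zero_lie, add_zero]
  | tmul a x =>
    induction y using TensorProduct.induction_on with
    | zero => rw [map_zero, lie_zero, map_zero, lie_zero, add_zero]
    | tmul b y =>
      simp only [LieAlgebra.ExtendScalars.bracket_tmul, LinearMap.baseChange_tmul, hd,
        TensorProduct.tmul_add]
    | add y z hy hz => rw [lie_add, map_add, map_add, hy, hz, lie_add, lie_add]; abel
  | add x z hx hz => rw [add_lie, map_add, map_add, hx, hz, add_lie, add_lie]; abel

end DerivationExt

section ScalarExtension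

variable {p : ℕ} [Fact p.Prime] {G : Type*} {w : G → ℕ} {K : Type*} [Field K]
  [Algebra (ZMod p) K]

variable (K) in
/-- The length derivation after extension of scalars. -/
def lengthDerExt (w : G → ℕ) : K ⊗[ZMod p] TruncLie p w →ₗ[K] K ⊗[ZMod p] TruncLie p w :=
  (lengthDer p w).baseChange K

theorem lengthDerExt_lie (x y : K ⊗[ZMod p] TruncLie p w) :
    lengthDerExt K w ⁅x, y⁆ = ⁅lengthDerExt K w x, y⁆ + ⁅x, lengthDerExt K w y⁆ :=
  baseChange_lie (lengthDer p w) lengthDer_lie x y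

theorem lowerCentralSeries_ext (L : Type*) [LieRing L] [LieAlgebra (ZMod p) L] (r : ℕ) :
    LieModule.lowerCentralSeries K (K ⊗[ZMod p] L) (K ⊗[ZMod p] L) r =
      (lcs p L r).baseChange K := by
  induction r with
  | zero => simp [lcs]
  | succ r ih =>
    change _ = (LieModule.lowerCentralSeries (ZMod p) L L (r + 1)).baseChange K
    rw [LieModule.lowerCentralSeries_succ, LieModule.lowerCentralSeries_succ, ih,
      LieSubmodule.lie_baseChange, LieSubmodule.baseChange_top]

theorem lengthDerExt_sub_mem (x : K ⊗[ZMod p] TruncLie p w) :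
    lengthDerExt K w x - x ∈ LieModule.lowerCentralSeries K (K ⊗[ZMod p] TruncLie p w)
      (K ⊗[ZMod p] TruncLie p w) 1 := by
  rw [lowerCentralSeries_ext]
  induction x using TensorProduct.induction_on with
  | zero => simp
  | tmul a x =>
    rw [lengthDerExt, LinearMap.baseChange_tmul, ← TensorProduct.tmul_sub]
    exact LieSubmodule.tmul_mem_baseChange_of_mem a (lengthDer_sub_mem x)
  | add x y hx hy => rw [map_add, add_sub_add_comm]; exact add_mem hx hy

theorem lowerCentralSeries_ext_eq_bot (hw : ∀ g, 1 ≤ w g) :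
    LieModule.lowerCentralSeries K (K ⊗[ZMod p] TruncLie p w)
      (K ⊗[ZMod p] TruncLie p w) (p - 1) = ⊥ := by
  rw [lowerCentralSeries_ext, lcs_eq_bot hw (by omega), LieSubmodule.baseChange_bot]

theorem bch_assoc (hw : ∀ g, 1 ≤ w g) (x y z : K ⊗[ZMod p] TruncLie p w) :
    bch p (bch p x y) z = bch p x (bch p y z) :=
  bch_assoc_of_lengthLike (K := K) (lengthDerExt K w) lengthDerExt_lie lengthDerExt_sub_mem
    (lowerCentralSeries_ext_eq_bot hw) x y z

theorem isCHProd_eq_bch (hw : ∀ g, 1 ≤ w g) {x y z v : K ⊗[ZMod p] TruncLie p w}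
    (h : IsCHProd p K [x, y, z] v) : v = bch p (bch p x y) z :=
  IsCHProd.eq_bch (lengthDerExt K w) lengthDerExt_lie lengthDerExt_sub_mem
    (lowerCentralSeries_ext_eq_bot hw) h

end ScalarExtension

/-! ### Coefficients of Laurent series with values in a Lie algebra -/

section LaurentCoefficients

variable {p : ℕ} [Fact p.Prime] {k : Type*} [Field k] [Algebra (ZMod p) k]

theorem coeffT_singleT (n m : ℤ) (c : k) :
    coeffT p k n (singleT p k m c) = if n = m then c else 0 := by
  have : coeffT p k n (singleT p k m c) = _ := HahnSeries.coeff_single (a := m) (b := n) (r := c)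
  rw [this]
  split_ifs <;> rfl

theorem exists_coeffT_eq_zero (a : Kt k) : ∃ M : ℤ, ∀ n < M, coeffT p k n a = 0 :=
  ⟨HahnSeries.order (show LaurentSeries k from a), fun _ hn =>
    HahnSeries.coeff_eq_zero_of_lt_order hn⟩

theorem coeffT_mul {a b : Kt k} {M : ℤ} (ha : ∀ n < M, coeffT p k n a = 0)
    (hb : ∀ n < M, coeffT p k n b = 0) (n : ℤ) :
    coeffT p k n (a * b) = ∑ i ∈ Finset.Icc M (n - M), coeffT p k i a * coeffT p k (n - i) b := by
  have h1 : coeffT p k n (a * b) = _ := HahnSeries.coeff_mul (x := (show LaurentSeries k from a))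
    (y := (show LaurentSeries k from b)) (a := n)
  rw [h1]
  refine Finset.sum_of_injOn Prod.fst ?_ ?_ ?_ ?_
  · rintro ⟨i, j⟩ hij ⟨i', j'⟩ hij' h
    simp only [Finset.mem_coe, Finset.mem_antidiagonal] at hij hij' h
    ext <;> simp <;> omega
  · rintro ⟨i, j⟩ hij
    simp only [Finset.mem_coe, Finset.mem_antidiagonal] at hij
    simp only [Finset.coe_Icc, Set.mem_Icc]
    constructor
    · by_contra h
      exact hij.1 (ha i (by omega))
    · by_contra h
      exact hij.2.1 (hb j (by omega))
  · intro i _ hi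
    by_contra h
    apply hi
    refine ⟨(i, n - i), ?_, rfl⟩
    simp only [Finset.mem_coe, Finset.mem_antidiagonal]
    exact ⟨left_ne_zero_of_mul h, right_ne_zero_of_mul h, by omega⟩
  · rintro ⟨i, j⟩ hij
    simp only [Finset.mem_antidiagonal] at hij
    have : j = n - i := by omega
    subst this
    rfl

variable (p k) in
theorem charP_Kt : CharP (Kt k) p :=
  charP_of_injective_algebraMap (algebraMap (ZMod p) (Kt k)).injective p

theorem singleT_pow (m : ℤ) (c : k) : singleT p k m c ^ p = singleT p k (p * m) (c ^ p) := by
  have := HahnSeries.single_pow (Γ := ℤ) m p c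
  rw [nsmul_eq_mul] at this
  exact this

theorem coeffT_pow_eq_zero_of_lt {a : Kt k} {M : ℤ} (ha : ∀ n < M, coeffT p k n a = 0) {n : ℤ}
    (hn : n < p * M) : coeffT p k n (a ^ p) = 0 := by
  by_cases h0 : a = 0
  · rw [h0, zero_pow (Fact.out : p.Prime).ne_zero, map_zero]
  · refine HahnSeries.coeff_eq_zero_of_lt_order (lt_of_lt_of_le hn ?_)
    have h1 : HahnSeries.order (show LaurentSeries k from a ^ p) =
        p • HahnSeries.order (show LaurentSeries k from a) :=
      HahnSeries.order_pow (show LaurentSeries k from a) p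
    rw [h1, nsmul_eq_mul]
    have h2 : M ≤ HahnSeries.order (show LaurentSeries k from a) := by
      by_contra h
      exact HahnSeries.coeff_order_eq_zero.not.2 h0 (ha _ (not_le.1 h))
    exact mul_le_mul_of_nonneg_left h2 (by positivity)

/-- The coefficients of a `p`-th power in characteristic `p`. -/
theorem coeffT_pow (a : Kt k) (n : ℤ) :
    coeffT p k n (a ^ p) = if (p : ℤ) ∣ n then coeffT p k (n / p) a ^ p else 0 := by
  have hp : (0 : ℤ) < p := by exact_mod_cast (Fact.out : p.Prime).pos
  have : CharP (Kt k) p := charP_Kt p k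
  obtain ⟨M, hM⟩ := exists_coeffT_eq_zero (p := p) a
  -- Split off the part of `a` of degree `≤ |n|`; the rest contributes nothing in degree `n`.
  set b : Kt k := ∑ i ∈ Finset.Icc M |n|, singleT p k i (coeffT p k i a) with hb
  have hcb : ∀ m, coeffT p k m b = if m ∈ Finset.Icc M |n| then coeffT p k m a else 0 := by
    intro m
    rw [hb, map_sum]
    simp only [coeffT_singleT]
    rw [Finset.sum_ite_eq]
  have hr : ∀ m < |n| + 1, coeffT p k m (a - b) = 0 := by
    intro m hm
    rw [map_sub, hcb]
    split_ifs with h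
    · rw [sub_self]
    · rw [Finset.mem_Icc] at h
      rw [hM m (by omega), sub_zero]
  have hn : n < p * (|n| + 1) := by
    have := le_abs_self n
    nlinarith [abs_nonneg n]
  have h1 : a ^ p = b ^ p + (a - b) ^ p := by
    rw [← add_pow_char, add_sub_cancel]
  rw [h1, map_add, coeffT_pow_eq_zero_of_lt hr hn, add_zero, hb, sum_pow_char, map_sum]
  simp only [singleT_pow, coeffT_singleT]
  split_ifs with hd
  · obtain ⟨m, rfl⟩ := hd
    rw [Int.mul_ediv_cancel_left _ hp.ne']
    have : ∀ i : ℤ, (p * m = p * i) ↔ (m = i) := fun i => mul_right_inj' hp.ne'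
    simp only [this]
    rw [Finset.sum_ite_eq]
    split_ifs with h
    · rfl
    · rw [Finset.mem_Icc] at h
      have : m ≤ |(p : ℤ) * m| := by
        rw [abs_mul, abs_of_pos hp]
        nlinarith [abs_nonneg m, le_abs_self m]
      rw [hM m (by omega), zero_pow (Fact.out : p.Prime).ne_zero]
  · refine Finset.sum_eq_zero fun i _ => if_neg ?_
    rintro rfl
    exact hd (dvd_mul_right _ _)

end LaurentCoefficients

section TensorCoefficients

variable {p : ℕ} [Fact p.Prime] {k : Type*} [Field k] [Algebra (ZMod p) k]
  {L L' : Type*} [LieRing L] [LieAlgebra (ZMod p) L] [LieRing L'] [LieAlgebra (ZMod p) L']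

theorem tcoeff_tmul (n : ℤ) (a : Kt k) (x : L) :
    tcoeff p k n (a ⊗ₜ x) = coeffT p k n a ⊗ₜ x := rfl

theorem tmon_tmul (n : ℤ) (c : k) (x : L) : tmon p k n (c ⊗ₜ x) = singleT p k n c ⊗ₜ x := rfl

theorem tcoeff_tmon (n m : ℤ) (l : Lk p k L) :
    tcoeff p k n (tmon p k m l) = if n = m then l else 0 := by
  induction l using TensorProduct.induction_on with
  | zero => simp
  | tmul c x =>
    rw [tmon_tmul, tcoeff_tmul, coeffT_singleT]
    split_ifs <;> simp
  | add x y hx hy => rw [map_add, map_add, hx, hy]; split_ifs <;> simp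

theorem tcoeff_tmon_self (n : ℤ) (l : Lk p k L) : tcoeff p k n (tmon p k n l) = l := by
  rw [tcoeff_tmon, if_pos rfl]

theorem tcoeff_tmon_of_ne {n m : ℤ} (h : n ≠ m) (l : Lk p k L) :
    tcoeff p k n (tmon p k m l) = 0 := by
  rw [tcoeff_tmon, if_neg h]

theorem tcoeff_mapK (f : L →ₗ[ZMod p] L') (n : ℤ) (x : LK p k L) :
    tcoeff p k n (mapK k f x) = mapk k f (tcoeff p k n x) := by
  induction x using TensorProduct.induction_on with
  | zero => simp
  | tmul a x => rfl
  | add x y hx hy => simp only [map_add, hx, hy]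

theorem mapK_tmon (f : L →ₗ[ZMod p] L') (n : ℤ) (l : Lk p k L) :
    mapK k f (tmon p k n l) = tmon p k n (mapk k f l) := by
  induction l using TensorProduct.induction_on with
  | zero => simp
  | tmul a x => rfl
  | add x y hx hy => simp only [map_add, hx, hy]

theorem mapK_sigma (f : L →ₗ[ZMod p] L') (x : LK p k L) :
    mapK k f (sigma p k x) = sigma p k (mapK k f x) := by
  induction x using TensorProduct.induction_on with
  | zero => simp
  | tmul a x => rfl
  | add x y hx hy => simp only [map_add, hx, hy]

theorem mapK_zmod_smul (f : L →ₗ[ZMod p] L') (c : ZMod p) (x : LK p k L) :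
    mapK k f (c • x) = c • mapK k f x := by
  rw [← algebraMap_smul (Kt k) c, map_smul, algebraMap_smul]

variable (k) in
/-- The extension of a Lie algebra homomorphism to `𝒦`. -/
def mapKLie (f : L →ₗ⁅ZMod p⁆ L') : LK p k L →ₗ⁅ZMod p⁆ LK p k L' :=
  LieAlgebra.ExtendScalars.map (AlgHom.id (ZMod p) (Kt k)) f

theorem mapKLie_apply (f : L →ₗ⁅ZMod p⁆ L') (x : LK p k L) :
    mapKLie k f x = mapK k (f : L →ₗ[ZMod p] L') x := by
  induction x using TensorProduct.induction_on with
  | zero => simp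
  | tmul a x => rfl
  | add x y hx hy => simp only [map_add, hx, hy]

theorem mapK_bch (f : L →ₗ⁅ZMod p⁆ L') (x y : LK p k L) :
    mapK k (f : L →ₗ[ZMod p] L') (bch p x y) =
      bch p (mapK k (f : L →ₗ[ZMod p] L') x) (mapK k (f : L →ₗ[ZMod p] L') y) := by
  simp only [← mapKLie_apply, map_bch]

theorem exists_tcoeff_eq_zero (x : LK p k L) : ∃ M : ℤ, ∀ n < M, tcoeff p k n x = 0 := by
  induction x using TensorProduct.induction_on with
  | zero => exact ⟨0, fun n _ => map_zero _⟩
  | tmul a x =>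
    obtain ⟨M, hM⟩ := exists_coeffT_eq_zero (p := p) a
    exact ⟨M, fun n hn => by rw [tcoeff_tmul, hM n hn, TensorProduct.zero_tmul]⟩
  | add x y hx hy =>
    obtain ⟨M, hM⟩ := hx
    obtain ⟨M', hM'⟩ := hy
    exact ⟨min M M', fun n hn => by rw [map_add, hM n (by omega), hM' n (by omega), add_zero]⟩

/-- The coefficients of a commutator are given by the Cauchy product; the sum over exponents may be
extended to any sufficiently large interval. -/
theorem exists_tcoeff_lie (x y : LK p k L) : ∃ M₀ : ℤ, ∀ M ≤ M₀, ∀ n, tcoeff p k n ⁅x, y⁆ =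
    ∑ i ∈ Finset.Icc M (n - M), ⁅tcoeff p k i x, tcoeff p k (n - i) y⁆ := by
  induction x using TensorProduct.induction_on with
  | zero => exact ⟨0, fun M _ n => by simp only [zero_lie, map_zero, Finset.sum_const_zero]⟩
  | tmul a x =>
    induction y using TensorProduct.induction_on with
    | zero => exact ⟨0, fun M _ n => by simp only [lie_zero, map_zero, Finset.sum_const_zero]⟩
    | tmul b y =>
      obtain ⟨M₁, h₁⟩ := exists_coeffT_eq_zero (p := p) a
      obtain ⟨M₂, h₂⟩ := exists_coeffT_eq_zero (p := p) b
      refine ⟨min M₁ M₂, fun M hM n => ?_⟩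
      rw [LieAlgebra.ExtendScalars.bracket_tmul, tcoeff_tmul,
        coeffT_mul (M := M) (fun n hn => h₁ n (by omega)) (fun n hn => h₂ n (by omega)),
        TensorProduct.sum_tmul]
      rfl
    | add y z hy hz =>
      obtain ⟨M₁, h₁⟩ := hy
      obtain ⟨M₂, h₂⟩ := hz
      refine ⟨min M₁ M₂, fun M hM n => ?_⟩
      simp only [lie_add, map_add, Finset.sum_add_distrib]
      rw [h₁ M (by omega), h₂ M (by omega)]
  | add x z hx hz =>
    obtain ⟨M₁, h₁⟩ := hx
    obtain ⟨M₂, h₂⟩ := hz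
    refine ⟨min M₁ M₂, fun M hM n => ?_⟩
    simp only [add_lie, map_add, Finset.sum_add_distrib]
    rw [h₁ M (by omega), h₂ M (by omega)]

theorem tcoeff_lie_mem {x y : LK p k L} {n : ℤ} {W : Submodule k (Lk p k L)}
    (h : ∀ i j, i + j = n → ⁅tcoeff p k i x, tcoeff p k j y⁆ ∈ W) : tcoeff p k n ⁅x, y⁆ ∈ W := by
  obtain ⟨M, hM⟩ := exists_tcoeff_lie x y
  rw [hM M le_rfl]
  exact sum_mem fun i _ => h _ _ (by omega)

theorem lie_tmon_tmon (n m : ℤ) (a b : Lk p k L) :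
    ⁅tmon p k n a, tmon p k m b⁆ = tmon p k (n + m) ⁅a, b⁆ := by
  induction a using TensorProduct.induction_on with
  | zero => simp only [zero_lie, map_zero]
  | tmul c x =>
    induction b using TensorProduct.induction_on with
    | zero => simp only [lie_zero, map_zero]
    | tmul d y =>
      rw [LieAlgebra.ExtendScalars.bracket_tmul, tmon_tmul, tmon_tmul, tmon_tmul,
        LieAlgebra.ExtendScalars.bracket_tmul]
      congr 1
      exact HahnSeries.single_mul_single
    | add b c hb hc => simp only [lie_add, map_add, hb, hc]
  | add a c ha hc => simp only [add_lie, map_add, ha, hc]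

variable (p k L) in
/-- The `p`-th power map on the factor `k` of `L_k`. -/
def frobk : Lk p k L →ₗ[ZMod p] Lk p k L :=
  (FiniteField.frobeniusAlgHom (ZMod p) k).toLinearMap.rTensor L

theorem frobk_tmul (c : k) (x : L) : frobk p k L (c ⊗ₜ x) = (c ^ p) ⊗ₜ x := by
  have : (FiniteField.frobeniusAlgHom (ZMod p) k) c = c ^ p := by
    rw [FiniteField.coe_frobeniusAlgHom, ZMod.card]
  rw [← this]; rfl

theorem sigma_tmul (a : Kt k) (x : L) : sigma p k (a ⊗ₜ x) = (a ^ p) ⊗ₜ x := by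
  have : (FiniteField.frobeniusAlgHom (ZMod p) (Kt k)) a = a ^ p := by
    rw [FiniteField.coe_frobeniusAlgHom, ZMod.card]
  rw [← this]; rfl

theorem tcoeff_sigma (n : ℤ) (x : LK p k L) :
    tcoeff p k n (sigma p k x) = if (p : ℤ) ∣ n then frobk p k L (tcoeff p k (n / p) x) else 0 := by
  induction x using TensorProduct.induction_on with
  | zero => simp
  | tmul a x =>
    rw [sigma_tmul, tcoeff_tmul, coeffT_pow]
    split_ifs with h
    · rw [tcoeff_tmul, frobk_tmul]
    · rw [TensorProduct.zero_tmul]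
  | add x y hx hy => simp only [map_add, hx, hy]; split_ifs <;> simp

theorem tcoeff_sigma_mul (n : ℤ) (x : LK p k L) :
    tcoeff p k (p * n) (sigma p k x) = frobk p k L (tcoeff p k n x) := by
  have hp : (p : ℤ) ≠ 0 := by exact_mod_cast (Fact.out : p.Prime).ne_zero
  rw [tcoeff_sigma, if_pos (dvd_mul_right _ _), Int.mul_ediv_cancel_left _ hp]

theorem tcoeff_sigma_of_not_dvd {n : ℤ} (h : ¬ (p : ℤ) ∣ n) (x : LK p k L) :
    tcoeff p k n (sigma p k x) = 0 := by
  rw [tcoeff_sigma, if_neg h]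

theorem sigma_tmon (n : ℤ) (l : Lk p k L) :
    sigma p k (tmon p k n l) = tmon p k (p * n) (frobk p k L l) := by
  induction l using TensorProduct.induction_on with
  | zero => simp
  | tmul c x => rw [tmon_tmul, sigma_tmul, frobk_tmul, tmon_tmul, singleT_pow]
  | add x y hx hy => simp only [map_add, hx, hy]

theorem sigma_bch (x y : LK p k L) :
    sigma p k (bch p x y) = bch p (sigma p k x) (sigma p k y) :=
  map_bch p (LieAlgebra.ExtendScalars.map (FiniteField.frobeniusAlgHom (ZMod p) (Kt k))
    (LieHom.id : L →ₗ⁅ZMod p⁆ L)) x y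

end TensorCoefficients

section Subspaces

variable {p : ℕ} [Fact p.Prime] {k : Type*} [Field k] [Algebra (ZMod p) k]
  {L L' : Type*} [LieRing L] [LieAlgebra (ZMod p) L] [LieRing L'] [LieAlgebra (ZMod p) L']

theorem tmul_mem_subK {M : Submodule (ZMod p) L} (c : k) {x : L} (hx : x ∈ M) :
    c ⊗ₜ x ∈ subK k M :=
  Submodule.tmul_mem_baseChange_of_mem c hx

@[elab_as_elim]
theorem baseChange_induction {K : Type*} [CommRing K] [Algebra (ZMod p) K]
    {M : Submodule (ZMod p) L} {motive : K ⊗[ZMod p] L → Prop} {y : K ⊗[ZMod p] L}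
    (hy : y ∈ M.baseChange K) (zero : motive 0)
    (tmul : ∀ (c : K) (x : L), x ∈ M → motive (c ⊗ₜ x))
    (add : ∀ x y, motive x → motive y → motive (x + y)) : motive y := by
  rw [Submodule.baseChange_eq_span] at hy
  have key : ∀ c : K, motive (c • y) := by
    induction hy using Submodule.span_induction with
    | mem y hy =>
      obtain ⟨x, hx, rfl⟩ := hy
      intro c
      rw [TensorProduct.mk_apply, TensorProduct.smul_tmul', smul_eq_mul, mul_one]
      exact tmul c x hx
    | zero => intro c; rwa [smul_zero]
    | add y z _ _ hy hz => intro c; rw [smul_add]; exact add _ _ (hy c) (hz c)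
    | smul r y _ hy => intro c; rw [smul_smul]; exact hy _
  simpa using key 1

@[elab_as_elim]
theorem subK_induction {M : Submodule (ZMod p) L} {motive : Lk p k L → Prop} {y : Lk p k L}
    (hy : y ∈ subK k M) (zero : motive 0) (tmul : ∀ (c : k) (x : L), x ∈ M → motive (c ⊗ₜ x))
    (add : ∀ x y, motive x → motive y → motive (x + y)) : motive y :=
  baseChange_induction hy zero tmul add

theorem subK_mono {M M' : Submodule (ZMod p) L} (h : M ≤ M') : subK k M ≤ subK k M' :=
  Submodule.baseChange_mono _ h

theorem subK_bot : subK k (⊥ : Submodule (ZMod p) L) = ⊥ := Submodule.baseChange_bot _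

theorem subK_top : subK k (⊤ : Submodule (ZMod p) L) = ⊤ := Submodule.baseChange_top _

theorem lie_mem_subK {M M' M'' : Submodule (ZMod p) L}
    (h : ∀ x ∈ M, ∀ y ∈ M', ⁅x, y⁆ ∈ M'') {x y : Lk p k L} (hx : x ∈ subK k M)
    (hy : y ∈ subK k M') : ⁅x, y⁆ ∈ subK k M'' := by
  refine subK_induction hx ?_ ?_ ?_
  · rw [zero_lie]; exact zero_mem _
  · intro c x hx
    refine subK_induction hy ?_ ?_ ?_
    · rw [lie_zero]; exact zero_mem _
    · intro d y hy
      rw [LieAlgebra.ExtendScalars.bracket_tmul]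
      exact tmul_mem_subK _ (h x hx y hy)
    · intro y z hy hz
      rw [lie_add]; exact add_mem hy hz
  · intro x z hx hz
    rw [add_lie]; exact add_mem hx hz

theorem mapk_mem_subK {M : Submodule (ZMod p) L} {M' : Submodule (ZMod p) L'}
    {f : L →ₗ[ZMod p] L'} (h : ∀ x ∈ M, f x ∈ M') {y : Lk p k L} (hy : y ∈ subK k M) :
    mapk k f y ∈ subK k M' := by
  refine subK_induction hy ?_ ?_ ?_
  · rw [map_zero]; exact zero_mem _
  · intro c x hx
    exact tmul_mem_subK c (h x hx)
  · intro x y hx hy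
    rw [map_add]; exact add_mem hx hy

theorem zmod_smul_mem_subK {M : Submodule (ZMod p) L} (c : ZMod p) {y : Lk p k L}
    (hy : y ∈ subK k M) : c • y ∈ subK k M := by
  rw [← algebraMap_smul k c]
  exact Submodule.smul_mem _ _ hy

theorem rTensor_mem_subK {M : Submodule (ZMod p) L} (g : k →ₗ[ZMod p] k) {y : Lk p k L}
    (hy : y ∈ subK k M) : g.rTensor L y ∈ subK k M := by
  refine subK_induction hy ?_ ?_ ?_
  · rw [map_zero]; exact zero_mem _
  · intro c x hx
    exact tmul_mem_subK _ hx
  · intro x y hx hy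
    rw [map_add]; exact add_mem hx hy

theorem frobk_mem_subK {M : Submodule (ZMod p) L} {y : Lk p k L} (hy : y ∈ subK k M) :
    frobk p k L y ∈ subK k M :=
  rTensor_mem_subK _ hy

theorem mem_subK_of_frobk_mem [Finite k] {M : Submodule (ZMod p) L} {y : Lk p k L}
    (hy : frobk p k L y ∈ subK k M) : y ∈ subK k M := by
  have hb : Function.Bijective (FiniteField.frobeniusAlgHom (ZMod p) k) :=
    Finite.injective_iff_bijective.1 (FiniteField.frobeniusAlgHom (ZMod p) k).injective
  let e := AlgEquiv.ofBijective (FiniteField.frobeniusAlgHom (ZMod p) k) hb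
  have h1 : e.symm.toLinearMap.rTensor L (frobk p k L y) = y := by
    rw [frobk, ← LinearMap.comp_apply, ← LinearMap.rTensor_comp]
    have : e.symm.toLinearMap ∘ₗ (FiniteField.frobeniusAlgHom (ZMod p) k).toLinearMap =
        LinearMap.id := by
      ext x
      exact e.symm_apply_apply x
    rw [this, LinearMap.rTensor_id, LinearMap.id_apply]
  rw [← h1]
  exact rTensor_mem_subK _ hy

variable (k L) in
/-- The coordinates of an element of `L_k` with respect to a basis of `k` over `𝔽_p`. -/
def coordk [FiniteDimensional (ZMod p) k] (i : Fin (Module.finrank (ZMod p) k)) :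
    Lk p k L →ₗ[ZMod p] L :=
  (TensorProduct.lid (ZMod p) L).toLinearMap ∘ₗ
    ((Module.finBasis (ZMod p) k).coord i).rTensor L

theorem coordk_tmul [FiniteDimensional (ZMod p) k] (i : Fin (Module.finrank (ZMod p) k)) (c : k)
    (x : L) : coordk k L i (c ⊗ₜ x) = (Module.finBasis (ZMod p) k).coord i c • x := by
  simp [coordk]

theorem sum_tmul_coordk [FiniteDimensional (ZMod p) k] (y : Lk p k L) :
    ∑ i, Module.finBasis (ZMod p) k i ⊗ₜ coordk k L i y = y := by
  induction y using TensorProduct.induction_on with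
  | zero => simp
  | tmul c x =>
    simp only [coordk_tmul]
    conv_rhs => rw [← (Module.finBasis (ZMod p) k).sum_repr c, TensorProduct.sum_tmul]
    simp only [TensorProduct.tmul_smul, TensorProduct.smul_tmul']
    rfl
  | add x y hx hy =>
    simp only [map_add, TensorProduct.tmul_add, Finset.sum_add_distrib, hx, hy]

theorem mem_subK_iff [FiniteDimensional (ZMod p) k] {M : Submodule (ZMod p) L} {y : Lk p k L} :
    y ∈ subK k M ↔ ∀ i, coordk k L i y ∈ M := by
  constructor
  · intro hy i
    refine subK_induction hy ?_ ?_ ?_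
    · rw [map_zero]; exact zero_mem _
    · intro c x hx
      rw [coordk_tmul]
      exact M.smul_mem _ hx
    · intro x y hx hy
      rw [map_add]; exact add_mem hx hy
  · intro h
    rw [← sum_tmul_coordk y]
    exact sum_mem fun i _ => tmul_mem_subK _ (h i)

theorem coordk_mapk [FiniteDimensional (ZMod p) k] (f : L →ₗ[ZMod p] L') (i) (y : Lk p k L) :
    coordk k L' i (mapk k f y) = f (coordk k L i y) := by
  induction y using TensorProduct.induction_on with
  | zero => simp
  | tmul c x =>
    rw [coordk_tmul, map_smul]
    exact coordk_tmul i c (f x)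
  | add x y hx hy => simp only [map_add, hx, hy]

theorem coordk_sum_tmul [FiniteDimensional (ZMod p) k] (g : Fin (Module.finrank (ZMod p) k) → L)
    (i) : coordk k L i (∑ j, Module.finBasis (ZMod p) k j ⊗ₜ g j) = g i := by
  rw [map_sum]
  simp only [coordk_tmul, Module.Basis.coord_apply, Module.Basis.repr_self]
  rw [Finset.sum_eq_single i]
  · simp
  · intro j _ hj
    rw [Finsupp.single_eq_of_ne hj.symm, zero_smul]
  · simp

/-- Coefficients of elements of `C₂(L_𝒦)` lie in `C₂(L)_k`. -/
theorem tcoeff_mem_of_mem_commK {x : LK p k L} (hx : x ∈ commK p k L) (n : ℤ) :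
    tcoeff p k n x ∈ subK k (lcs p L 1).toSubmodule := by
  have h1 : commK p k L = (lcs p L 1).baseChange (Kt k) := by
    change _ = (LieModule.lowerCentralSeries (ZMod p) L L 1).baseChange (Kt k)
    rw [commK, LieModule.lowerCentralSeries_succ, LieModule.lowerCentralSeries_zero,
      LieSubmodule.lie_baseChange, LieSubmodule.baseChange_top]
  rw [h1] at hx
  refine baseChange_induction (M := (lcs p L 1).toSubmodule) hx ?_ ?_ ?_
  · rw [map_zero]; exact zero_mem _
  · intro c x hx
    exact tmul_mem_subK _ hx
  · intro x y hx hy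
    rw [map_add]; exact add_mem hx hy

end Subspaces

/-! ### The lattices attached to a filtration -/

section Lattice

variable {p : ℕ} [Fact p.Prime] {k : Type*} [Field k] [Algebra (ZMod p) k]
  {L L' : Type*} [LieRing L] [LieAlgebra (ZMod p) L] [LieRing L'] [LieAlgebra (ZMod p) L']
  {F F' F'' : ℕ → LieIdeal (ZMod p) L} {c J J' : ℝ}

/-- A multiplicative descending filtration `L = F(1) ⊇ F(2) ⊇ …` by ideals with `F(p) = 0`. -/
structure IsLieFiltration (F : ℕ → LieIdeal (ZMod p) L) : Prop where
  one : F 1 = ⊤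
  antitone : Antitone F
  lie_mem : ∀ {s s' : ℕ} {x y : L}, x ∈ F s → y ∈ F s' → ⁅x, y⁆ ∈ F (s + s')
  eq_bot : F p = ⊥

theorem lattice_mono (h : ∀ s, F s ≤ F' s) : lattice p k F c J ≤ lattice p k F' c J :=
  fun _ hx n s hs hn => subK_mono (h s) (hx n s hs hn)

theorem lattice_anti (h : J ≤ J') : lattice p k F c J' ≤ lattice p k F c J :=
  fun _ hx n s hs hn => hx n s hs (by linarith)

/-- Multiplicativity of the lattices: if `x_i` has weight `> (J - i) / c` and `y_j` has weight
`> (J' - j) / c` then `[x_i, y_j]` has weight `> (J + J' - i - j) / c`. -/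
theorem lie_mem_lattice (hc : 0 < c) (h1 : F 1 = ⊤) (h1' : F' 1 = ⊤) (hanti : Antitone F'')
    (hlie : ∀ s s' : ℕ, 1 ≤ s → 1 ≤ s' → ∀ x ∈ F s, ∀ y ∈ F' s', ⁅x, y⁆ ∈ F'' (s + s'))
    {x y : LK p k L} (hx : x ∈ lattice p k F c J) (hy : y ∈ lattice p k F' c J') :
    ⁅x, y⁆ ∈ lattice p k F'' c (J + J') := by
  have key : ∀ (F : ℕ → LieIdeal (ZMod p) L) (J : ℝ) (x : LK p k L), F 1 = ⊤ →
      x ∈ lattice p k F c J → ∀ i : ℤ, ∃ s : ℕ, 1 ≤ s ∧ (J - i) / c < s ∧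
        tcoeff p k i x ∈ subK k (F s).toSubmodule := by
    intro F J x h1 hx i
    refine ⟨⌊(J - i) / c⌋₊ + 1, by omega, by push_cast; exact Nat.lt_floor_add_one _, ?_⟩
    rcases le_or_gt 0 ((J - i) / c) with h | h
    · refine hx i _ (by omega) ?_
      rw [← le_div_iff₀ hc]
      push_cast
      rw [add_sub_cancel_right]
      exact Nat.floor_le h
    · rw [Nat.floor_of_nonpos h.le, zero_add, h1, LieSubmodule.top_toSubmodule, subK_top]
      trivial
  intro n s _ hn
  refine tcoeff_lie_mem fun i j hij => ?_
  obtain ⟨a, ha1, ha, hxa⟩ := key F J x h1 hx i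
  obtain ⟨b, hb1, hb, hyb⟩ := key F' J' y h1' hy j
  have hle : s ≤ a + b := by
    have h2 : ((s : ℝ) - 1) ≤ (J - i) / c + (J' - j) / c := by
      rw [← add_div, le_div_iff₀ hc]
      have : (n : ℝ) = i + j := by rw [← hij]; push_cast; ring
      rw [this] at hn
      linarith
    have h3 : (s : ℝ) < ((a + b + 1 : ℕ) : ℝ) := by push_cast; linarith
    have := Nat.cast_lt.1 h3
    omega
  exact subK_mono (hanti hle) (lie_mem_subK (hlie a b ha1 hb1) hxa hyb)

theorem tmon_mem_lattice (hc : 0 < c) (hanti : Antitone F) {n : ℤ} {s : ℕ} {l : Lk p k L}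
    (hl : l ∈ subK k (F s).toSubmodule) (h : J < n + s * c) : tmon p k n l ∈ lattice p k F c J := by
  intro m s' _ hm
  rw [tcoeff_tmon]
  split_ifs with hmn
  · subst hmn
    refine subK_mono (hanti ?_) hl
    have h2 : ((s' : ℝ) - 1) * c < s * c := by linarith
    have h3 := lt_of_mul_lt_mul_right h2 hc.le
    have : (s' : ℝ) < ((s + 1 : ℕ) : ℝ) := by push_cast; linarith
    have := Nat.cast_lt.1 this
    omega
  · exact zero_mem _

theorem tmon_tcoeff_mem_lattice {x : LK p k L} (hx : x ∈ lattice p k F c J) (n : ℤ) {i : ℤ}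
    (hi : 0 ≤ i) : tmon p k (n + i) (tcoeff p k n x) ∈ lattice p k F c J := by
  intro m s hs hm
  rw [tcoeff_tmon]
  split_ifs with hmn
  · subst hmn
    refine hx n s hs (hm.trans ?_)
    have : (0 : ℝ) ≤ i := by exact_mod_cast hi
    push_cast
    linarith
  · exact zero_mem _

theorem mapK_mem_lattice {F' : ℕ → LieIdeal (ZMod p) L'} (f : L →ₗ[ZMod p] L')
    (hf : ∀ s, ∀ x ∈ F s, f x ∈ F' s) {x : LK p k L} (hx : x ∈ lattice p k F c J) :
    mapK k f x ∈ lattice p k F' c J := by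
  intro n s hs hn
  rw [tcoeff_mapK]
  exact mapk_mem_subK (hf s) (hx n s hs hn)

theorem tcoeff_mem_of_nonpos (hp : ∀ s, F p ≤ F s) {x : LK p k L}
    (hx : x ∈ lattice p k F c (((p : ℝ) - 1) * c)) {n : ℤ} (hn : n ≤ 0) (s : ℕ) :
    tcoeff p k n x ∈ subK k (F s).toSubmodule := by
  have h0 : (n : ℝ) ≤ 0 := by exact_mod_cast hn
  exact subK_mono (hp s) (hx n p (Fact.out : p.Prime).one_le (by linarith))

theorem sigma_mem_lattice (hp : ∀ s, F p ≤ F s) {x : LK p k L}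
    (hx : x ∈ lattice p k F c (((p : ℝ) - 1) * c)) :
    sigma p k x ∈ lattice p k F c (((p : ℝ) - 1) * c) := by
  intro n s hs hn
  by_cases hd : (p : ℤ) ∣ n
  · obtain ⟨m, rfl⟩ := hd
    rw [tcoeff_sigma_mul]
    refine frobk_mem_subK ?_
    rcases le_or_gt m 0 with h0 | h0
    · exact tcoeff_mem_of_nonpos hp hx h0 s
    · refine hx m s hs (hn.trans ?_)
      have h1 : (0 : ℝ) < m := by exact_mod_cast h0
      have h2 : (1 : ℝ) ≤ p := by exact_mod_cast (Fact.out : p.Prime).one_le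
      push_cast
      nlinarith
  · rw [tcoeff_sigma_of_not_dvd hd]
    exact zero_mem _

variable (k) in
/-- The lattice `N` of a filtration is a Lie algebra. -/
def latticeSubalgebra (hF : IsLieFiltration F) (hc : 0 < c) : LieSubalgebra (ZMod p) (LK p k L) :=
  { lattice p k F c 0 with
    lie_mem' := fun {x y} hx hy => by
      have := lie_mem_lattice (J := 0) (J' := 0) hc hF.one hF.one hF.antitone
        (fun _ _ _ _ _ hx _ hy => hF.lie_mem hx hy) hx hy
      rwa [add_zero] at this }

end Lattice

/-! ### Uniqueness of the conjugation, one central step at a time -/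

section ConjugationStep

variable {p : ℕ} [Fact p.Prime] {k : Type*} [Field k] [Algebra (ZMod p) k]
  {L : Type*} [LieRing L] [LieAlgebra (ZMod p) L]
  {F : ℕ → LieIdeal (ZMod p) L} {c : ℝ}

/-- Suppose that `σ z - z + η` is small, that `z` has, among the exponents `≤ 0`, coefficients only
at `-ι`, `ι ∈ S`, and that `η` is small outside the exponent `0` and the exponents `-ι`, `ι ∈ S'`.
Then both are small. No element of `S'` is a multiple `p^j ι` with `j ≥ 1` of an element `ι` of
`S`; so the coefficients of `z` at `-p^j ι`, for `ι ∈ S`, are the images under `σ^j` of the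
coefficient at `-ι`, and vanish for large `j`. -/
theorem mem_lattice_of_sigma_sub_add_mem [Finite k] (hF : ∀ s, F p ≤ F s) (hc : 0 < c)
    {S S' : Finset ℤ}
    (hpos : ∀ ι ∈ S', 0 < ι) (hp : ∀ ι ∈ S, ∀ j : ℕ, (p : ℤ) ^ (j + 1) * ι ∉ S')
    {z η : LK p k L} (hrel : sigma p k z - z + η ∈ lattice p k F c (((p : ℝ) - 1) * c))
    (hz : ∀ n ≤ 0, (n = 0 ∨ -n ∉ S) → ∀ s, tcoeff p k n z ∈ subK k (F s).toSubmodule)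
    (hη : ∀ n, n ≠ 0 → -n ∉ S' → ∀ s : ℕ, 1 ≤ s → ((s : ℝ) - 1) * c ≤ ((p : ℝ) - 1) * c - n →
      tcoeff p k n η ∈ subK k (F s).toSubmodule) :
    z ∈ lattice p k F c (((p : ℝ) - 1) * c) ∧ η ∈ lattice p k F c (((p : ℝ) - 1) * c) := by
  have hp0 : 0 < p := (Fact.out : p.Prime).pos
  have hp2 : 2 ≤ p := (Fact.out : p.Prime).two_le
  have hpz : (2 : ℤ) ≤ p := by exact_mod_cast hp2
  have hp1 : ((p : ℝ) - 1) * c ≥ 0 := by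
    have : (1 : ℝ) ≤ p := by exact_mod_cast (Fact.out : p.Prime).one_le
    exact mul_nonneg (by linarith) hc.le
  -- At a positive exponent `n`, the coefficient of `σ z` comes from the smaller exponent `n / p`.
  have hposn : ∀ N : ℕ, ∀ n : ℤ, 0 < n → n.toNat ≤ N → ∀ s : ℕ, 1 ≤ s →
      ((s : ℝ) - 1) * c ≤ ((p : ℝ) - 1) * c - n → tcoeff p k n z ∈ subK k (F s).toSubmodule := by
    intro N
    induction N with
    | zero => intro n hn h; omega
    | succ N ih =>
      intro n hn hN s hs hsn
      have h1 := hrel n s hs hsn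
      have h2 := hη n hn.ne' (fun h => by have := hpos _ h; omega) s hs hsn
      rw [map_add, map_sub] at h1
      have h3 : tcoeff p k n (sigma p k z) ∈ subK k (F s).toSubmodule := by
        rw [tcoeff_sigma]
        split_ifs with hd
        · obtain ⟨m, rfl⟩ := hd
          rw [Int.mul_ediv_cancel_left _ (by omega)]
          have hm : 0 < m := pos_of_mul_pos_right hn (by omega)
          refine frobk_mem_subK (ih m hm (by
            have : m + 1 ≤ p * m := by nlinarith
            omega) s hs (hsn.trans ?_))
          have h1 : (0 : ℝ) < m := by exact_mod_cast hm
          have h2 : (1 : ℝ) ≤ p := by exact_mod_cast (Fact.out : p.Prime).one_le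
          push_cast
          nlinarith
        · exact zero_mem _
      have h4 := sub_mem (add_mem h3 h2) h1
      convert h4 using 1
      abel
  have hreln : ∀ n ≤ 0, tcoeff p k n (sigma p k z) - tcoeff p k n z + tcoeff p k n η ∈
      subK k (F p).toSubmodule := by
    intro n hn
    have := tcoeff_mem_of_nonpos hF hrel hn p
    rwa [map_add, map_sub] at this
  have hnonpos : ∀ n : ℤ, n ≤ 0 → ((p : ℝ) - 1) * c ≤ ((p : ℝ) - 1) * c - n := by
    intro n hn
    have h0 : (n : ℝ) ≤ 0 := by exact_mod_cast hn
    linarith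
  have hηp : ∀ n : ℤ, n < 0 → -n ∉ S' → tcoeff p k n η ∈ subK k (F p).toSubmodule :=
    fun n hn h => hη n hn.ne h p (by omega) (hnonpos n hn.le)
  have hchain : ∀ n : ℤ, n < 0 → -n ∈ S → tcoeff p k n z ∈ subK k (F p).toSubmodule := by
    intro n hn hS
    -- At `p^(j+1) n` the part `η` does not contribute, and `σ` is injective on coefficients.
    have hdesc : ∀ j : ℕ, tcoeff p k ((p : ℤ) ^ j * n) z ∈ subK k (F p).toSubmodule →
        tcoeff p k n z ∈ subK k (F p).toSubmodule := by
      intro j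
      induction j with
      | zero => intro h; rwa [pow_zero, one_mul] at h
      | succ j ih =>
        intro h
        refine ih (mem_subK_of_frobk_mem ?_)
        rw [← tcoeff_sigma_mul, ← mul_assoc, ← pow_succ']
        have hneg : (p : ℤ) ^ (j + 1) * n < 0 := mul_neg_of_pos_of_neg (by positivity) hn
        have h1 := hreln _ hneg.le
        have h2 := hηp _ hneg (by
          rw [← mul_neg]
          exact hp _ hS j)
        have h3 := sub_mem (add_mem h1 h) h2
        convert h3 using 1
        abel
    -- `z` is a Laurent series, so its coefficients vanish at sufficiently negative exponents.
    obtain ⟨M, hM⟩ := exists_tcoeff_eq_zero z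
    refine hdesc M.natAbs ?_
    rw [hM]
    · exact zero_mem _
    · have h1 : (M.natAbs : ℤ) < (p : ℤ) ^ M.natAbs := by
        exact_mod_cast Nat.lt_pow_self (by omega : 1 < p)
      nlinarith [neg_abs_le M, Int.natCast_natAbs M]
  have hneg : ∀ n : ℤ, n ≤ 0 → tcoeff p k n z ∈ subK k (F p).toSubmodule := by
    intro n hn
    by_cases h0 : n = 0 ∨ -n ∉ S
    · exact hz n hn h0 p
    · push Not at h0
      exact hchain n (by omega) h0.2
  have hηneg : ∀ n : ℤ, n ≤ 0 → tcoeff p k n η ∈ subK k (F p).toSubmodule := by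
    intro n hn
    have h1 := hreln n hn
    have h2 : tcoeff p k n (sigma p k z) ∈ subK k (F p).toSubmodule := by
      rw [tcoeff_sigma]
      split_ifs with hd
      · exact frobk_mem_subK (hneg _ (Int.ediv_nonpos_of_nonpos_of_neg hn (by omega)))
      · exact zero_mem _
    have h3 := add_mem (sub_mem h1 h2) (hneg n hn)
    convert h3 using 1
    abel
  constructor
  · intro n s hs hn
    rcases le_or_gt n 0 with h0 | h0
    · exact subK_mono (hF s) (hneg n h0)
    · exact hposn _ n h0 le_rfl s hs hn
  · intro n s hs hn
    rcases le_or_gt n 0 with h0 | h0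
    · exact subK_mono (hF s) (hηneg n h0)
    · exact hη n h0.ne' (fun h => by have := hpos _ h; omega) s hs hn

/-- The filtration `F` enlarged by a term of the lower central series and by an ideal. -/
def stepFil (F : ℕ → LieIdeal (ZMod p) L) (E : LieIdeal (ZMod p) L) (r s : ℕ) :
    LieIdeal (ZMod p) L := F s ⊔ (lcs p L r ⊔ E)

variable (hF : IsLieFiltration F) {E : LieIdeal (ZMod p) L}

omit [Fact p.Prime] in
include hF in
theorem stepFil_antitone (r : ℕ) : Antitone (stepFil F E r) :=
  fun _ _ h => sup_le_sup_right (hF.antitone h) _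

omit [Fact p.Prime] in
include hF in
theorem stepFil_one (r : ℕ) : stepFil F E r 1 = ⊤ := by
  rw [stepFil, hF.one, top_sup_eq]

omit [Fact p.Prime] in
include hF in
theorem stepFil_le (r s : ℕ) : stepFil F E r p ≤ stepFil F E r s := by
  rw [stepFil, hF.eq_bot, bot_sup_eq]
  exact le_sup_right

omit [Fact p.Prime] in
theorem stepFil_succ_le (r s : ℕ) : stepFil F E (r + 1) s ≤ stepFil F E r s :=
  sup_le_sup_left (sup_le_sup_right (LieModule.antitone_lowerCentralSeries _ _ _ (Nat.le_succ r)) _)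
    _

omit [Fact p.Prime] in
include hF in
theorem lie_mem_stepFil {r s s' : ℕ} {x y : L} (hx : x ∈ F s) (hy : y ∈ stepFil F E r s') :
    ⁅x, y⁆ ∈ stepFil F E (r + 1) (s + s') := by
  obtain ⟨a, ha, b, hb, rfl⟩ := (LieSubmodule.mem_sup _ _ _).1 hy
  obtain ⟨d, hd, e, he, rfl⟩ := (LieSubmodule.mem_sup _ _ _).1 hb
  rw [lie_add, lie_add]
  refine (LieSubmodule.mem_sup _ _ _).2 ⟨_, hF.lie_mem hx ha, _, ?_, rfl⟩
  exact (LieSubmodule.mem_sup _ _ _).2 ⟨_, lie_mem_lcs hd, _, lie_mem_right _ _ _ _ _ he, rfl⟩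

include hF in
theorem lie_mem_lattice_stepFil (hc : 0 < c) (r : ℕ) {J : ℝ} {x y : LK p k L}
    (hx : x ∈ lattice p k F c 0) (hy : y ∈ lattice p k (stepFil F E r) c J) :
    ⁅x, y⁆ ∈ lattice p k (stepFil F E (r + 1)) c J := by
  have := lie_mem_lattice (J := 0) (J' := J) hc hF.one (stepFil_one hF r)
    (stepFil_antitone hF (r + 1)) (fun _ _ _ _ _ hx _ hy => lie_mem_stepFil hF hx hy) hx hy
  rwa [zero_add] at this

include hF in
/-- Suppose that `σ d₁ ∘ ε₁ ∘ (-d₁)` and `σ d₂ ∘ ε₂ ∘ (-d₂)` agree and that `d₁`, `d₂` and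
`ε₁`, `ε₂` agree modulo `C_{r+1}`. Modulo `C_{r+2}` the differences are central, so that they
satisfy a linear equation, which forces them to vanish. -/
theorem conj_unique_step [Finite k] (hc : 0 < c) {S S' : Finset ℤ}
    (hpos : ∀ ι ∈ S', 0 < ι) (hp : ∀ ι ∈ S, ∀ j : ℕ, (p : ℤ) ^ (j + 1) * ι ∉ S')
    {d₁ d₂ ε₁ ε₂ : LK p k L} (hd₁ : d₁ ∈ lattice p k F c 0) (hd₂ : d₂ ∈ lattice p k F c 0)
    (hσ₁ : sigma p k d₁ ∈ lattice p k F c 0) (hσ₂ : sigma p k d₂ ∈ lattice p k F c 0)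
    (hε₁ : ε₁ ∈ lattice p k F c 0) (hε₂ : ε₂ ∈ lattice p k F c 0) {r : ℕ}
    (heq : bch p (bch p (sigma p k d₁) ε₁) (-d₁) - bch p (bch p (sigma p k d₂) ε₂) (-d₂) ∈
      lattice p k (stepFil F E (r + 1)) c (((p : ℝ) - 1) * c))
    (hd : d₁ - d₂ ∈ lattice p k (stepFil F E r) c (((p : ℝ) - 1) * c))
    (hε : ε₁ - ε₂ ∈ lattice p k (stepFil F E r) c (((p : ℝ) - 1) * c))
    (hz : ∀ n ≤ 0, (n = 0 ∨ -n ∉ S) → tcoeff p k n (d₁ - d₂) = 0)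
    (hη : ∀ n, n ≠ 0 → -n ∉ S' → ∀ s : ℕ, 1 ≤ s → ((s : ℝ) - 1) * c ≤ ((p : ℝ) - 1) * c - n →
      tcoeff p k n (ε₁ - ε₂) ∈ subK k (stepFil F E (r + 1) s).toSubmodule) :
    d₁ - d₂ ∈ lattice p k (stepFil F E (r + 1)) c (((p : ℝ) - 1) * c) ∧
      ε₁ - ε₂ ∈ lattice p k (stepFil F E (r + 1)) c (((p : ℝ) - 1) * c) := by
  set T := lattice p k (stepFil F E (r + 1)) c (((p : ℝ) - 1) * c) with hTdef
  set N := latticeSubalgebra k hF hc with hN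
  have hT' : ∀ x ∈ N, ∀ t ∈ lattice p k (stepFil F E r) c (((p : ℝ) - 1) * c), ⁅x, t⁆ ∈ T :=
    fun x hx t ht => lie_mem_lattice_stepFil hF hc r hx ht
  have hT : ∀ x ∈ N, ∀ t ∈ T, ⁅x, t⁆ ∈ T :=
    fun x hx t ht => hT' x hx t (lattice_mono (stepFil_succ_le r) ht)
  have hσd : sigma p k (d₁ - d₂) ∈ lattice p k (stepFil F E r) c (((p : ℝ) - 1) * c) :=
    sigma_mem_lattice (stepFil_le hF r) hd
  rw [map_sub] at hσd
  -- modulo `C_{r+2}`, replacing `σ d₂`, `ε₂` by `σ d₁`, `ε₁` only adds the differences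
  have h1 := bch_add_sub_mem hT (x := sigma p k d₂) (y := ε₂) (h := sigma p k d₁ - sigma p k d₂)
    (h' := ε₁ - ε₂) hσ₂ hε₂ (sub_mem hσ₁ hσ₂) (sub_mem hε₁ hε₂) (fun x hx => hT' x hx _ hσd)
    (fun x hx => hT' x hx _ hε)
  rw [add_sub_cancel, add_sub_cancel] at h1
  set X₁ := bch p (sigma p k d₁) ε₁ with hX₁
  set X₂ := bch p (sigma p k d₂) ε₂ with hX₂
  have hX₁N : X₁ ∈ N := bch_mem N hσ₁ hε₁
  have hX₂N : X₂ ∈ N := bch_mem N hσ₂ hε₂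
  have hX : X₁ - X₂ ∈ lattice p k (stepFil F E r) c (((p : ℝ) - 1) * c) := by
    have := add_mem (add_mem (lattice_mono (stepFil_succ_le r) h1) hσd) hε
    convert this using 1
    abel
  have h2 := bch_add_sub_mem hT (x := X₂) (y := -d₂) (h := X₁ - X₂) (h' := -(d₁ - d₂))
    hX₂N (neg_mem hd₂) (sub_mem hX₁N hX₂N) (neg_mem (sub_mem hd₁ hd₂)) (fun x hx => hT' x hx _ hX)
    (fun x hx => by rw [lie_neg]; exact neg_mem (hT' x hx _ hd))
  rw [add_sub_cancel, show -d₂ + -(d₁ - d₂) = -d₁ by abel] at h2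
  have hrel : sigma p k (d₁ - d₂) - (d₁ - d₂) + (ε₁ - ε₂) ∈ T := by
    have := sub_mem (sub_mem heq h1) h2
    rw [map_sub]
    convert this using 1
    abel
  exact mem_lattice_of_sigma_sub_add_mem (stepFil_le hF (r + 1)) hc hpos hp hrel
    (fun n hn h s => by rw [hz n hn h]; exact zero_mem _) hη

end ConjugationStep

/-! ### The index set `𝔄⁰` -/

section Digits

theorem exists_equiv_monotone {ι : Type*} [Fintype ι] {u : ℕ} (h : Fintype.card ι = u)
    (key : ι → ℕ) : ∃ e : Fin u ≃ ι, Monotone (key ∘ e) := by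
  let e₀ : Fin u ≃ ι := (Fintype.equivFinOfCardEq h).symm
  exact ⟨(Tuple.sort (key ∘ e₀)).trans e₀, Tuple.monotone_sort (key ∘ e₀)⟩

namespace Param

variable {p : ℕ} (P : Param p)

/-- `a = p^m α` for some `α ∈ A[u, m]`: a sum of `u` terms `d p^f` with `d < w^*` and `f ≤ m`, one
of the exponents being `m`. The terms are not ordered. -/
def ADig (u m a : ℕ) : Prop :=
  ∃ d f : Fin u → ℕ, (∀ i, (d i : ℝ) < P.ws) ∧ (∀ i, f i ≤ m) ∧ (∃ i, f i = m) ∧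
    a = ∑ i, d i * p ^ f i

/-- `b = p^m β / r^*` for some `β ∈ B[u^*, m] ∪ {0}` whose digit sum is `c`: a sum of `c < p` powers
`p^f` with `f ≤ m`, one of the exponents being `m` unless `c = 0`. -/
def BDig (p m b c : ℕ) : Prop :=
  c < p ∧ ∃ f : Fin c → ℕ, (∀ i, f i ≤ m) ∧ (0 < c → ∃ i, f i = m) ∧ b = ∑ i, p ^ f i

/-- A presentation of `ι` in terms of the integers `a = p^m α` and `b = p^m β / r^*`. -/
def Rep (u m a b c : ℕ) (ι : ℤ) : Prop :=
  P.ADig u m a ∧ BDig p m b c ∧ ι = P.q * a - P.bs * b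

variable {P}

theorem ADig.of_fintype {ι : Type*} [Fintype ι] (hws : 0 < P.ws) {u m : ℕ} (d f : ι → ℕ)
    (hd : ∀ i, (d i : ℝ) < P.ws) (hf : ∀ i, f i ≤ m) (hm : ∃ i, f i = m)
    (hu : Fintype.card ι ≤ u) : P.ADig u m (∑ i, d i * p ^ f i) := by
  let κ := ι ⊕ Fin (u - Fintype.card ι)
  have hκ : Fintype.card κ = u := by
    rw [Fintype.card_sum, Fintype.card_fin]; omega
  let e : Fin u ≃ κ := (Fintype.equivFinOfCardEq hκ).symm
  let d' : κ → ℕ := Sum.elim d fun _ => 0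
  let f' : κ → ℕ := Sum.elim f fun _ => 0
  refine ⟨d' ∘ e, f' ∘ e, fun i => ?_, fun i => ?_, ?_, ?_⟩
  · have : ∀ j, (d' j : ℝ) < P.ws := by
      rintro (j | j)
      · exact hd j
      · simpa [d'] using hws
    exact this _
  · have : ∀ j, f' j ≤ m := by
      rintro (j | j)
      · exact hf j
      · exact Nat.zero_le _
    exact this _
  · obtain ⟨i, hi⟩ := hm
    exact ⟨e.symm (Sum.inl i), by simp [f', hi]⟩
  · have : ∑ i, (d' ∘ e) i * p ^ (f' ∘ e) i = ∑ j : κ, d' j * p ^ f' j :=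
      e.sum_comp fun j => d' j * p ^ f' j
    rw [this, Fintype.sum_sum_type]
    simp [d', f']

theorem ADig.mono (hws : 0 < P.ws) {u u' m a : ℕ} (h : P.ADig u m a) (hu : u ≤ u') :
    P.ADig u' m a := by
  obtain ⟨d, f, hd, hf, hm, rfl⟩ := h
  exact ADig.of_fintype hws d f hd hf hm (by simpa using hu)

theorem BDig.of_fintype {ι : Type*} [Fintype ι] {m c : ℕ} (f : ι → ℕ) (hc : Fintype.card ι = c)
    (hcp : c < p) (hf : ∀ i, f i ≤ m) (hm : 0 < c → ∃ i, f i = m) :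
    BDig p m (∑ i, p ^ f i) c := by
  let e : Fin c ≃ ι := (Fintype.equivFinOfCardEq hc).symm
  refine ⟨hcp, f ∘ e, fun i => hf _, fun h => ?_, (e.sum_comp fun j => p ^ f j).symm⟩
  obtain ⟨i, hi⟩ := hm h
  exact ⟨e.symm i, by simp [hi]⟩

theorem ADig.mem_setA (hp : 0 < p) {u m a : ℕ} (h : P.ADig u m a) :
    (a : ℚ) / p ^ m ∈ P.setA u m := by
  obtain ⟨d, f, hd, hf, ⟨i₀, hi₀⟩, rfl⟩ := h
  obtain ⟨e, he⟩ := exists_equiv_monotone (Fintype.card_fin u) fun i => m - f i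
  refine ⟨d ∘ e, fun i => m - f (e i), fun i => hd _, ⟨he, fun i hi => ?_, fun i => Nat.sub_le _ _⟩,
    ?_⟩
  · have : i ≤ e.symm i₀ := by rw [Fin.le_def, hi]; exact Nat.zero_le _
    have := he this
    simpa [hi₀] using this
  · have h1 : pSum p (d ∘ e) (fun i => m - f (e i)) = ∑ i, (d i : ℚ) / p ^ (m - f i) :=
      e.sum_comp fun i => (d i : ℚ) / p ^ (m - f i)
    rw [h1]
    push_cast
    rw [Finset.sum_div]
    refine Finset.sum_congr rfl fun i _ => ?_
    have hp' : (p : ℚ) ≠ 0 := by exact_mod_cast hp.ne'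
    have : (p : ℚ) ^ m = p ^ f i * p ^ (m - f i) := by
      rw [← pow_add, Nat.add_sub_of_le (hf i)]
    rw [this]
    field_simp

theorem ADig.of_mem_setA (hp : 0 < p) {u m : ℕ} (hu : 1 ≤ u) {α : ℚ} (h : α ∈ P.setA u m) :
    ∃ a, P.ADig u m a ∧ (p : ℚ) ^ m * α = a := by
  obtain ⟨d, n, hd, ⟨-, hn0, hnm⟩, rfl⟩ := h
  refine ⟨∑ i, d i * p ^ (m - n i), ⟨d, fun i => m - n i, hd, fun i => Nat.sub_le _ _,
    ⟨⟨0, hu⟩, by simp [hn0 ⟨0, hu⟩ rfl]⟩, rfl⟩, ?_⟩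
  rw [pSum, Finset.mul_sum]
  push_cast
  refine Finset.sum_congr rfl fun i _ => ?_
  have hp' : (p : ℚ) ≠ 0 := by exact_mod_cast hp.ne'
  have : (p : ℚ) ^ m = p ^ (m - n i) * p ^ n i := by
    rw [← pow_add, Nat.sub_add_cancel (hnm i)]
  rw [this]
  field_simp

theorem sub_one_le_us (hp : 2 ≤ p) : p - 1 ≤ P.us := by
  obtain ⟨n, rfl⟩ : ∃ n, p = n + 2 := ⟨p - 2, by omega⟩
  simp only [us, Nat.add_sub_cancel, show n + 2 - 1 = n + 1 by omega]
  nlinarith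

/-- Sorting by exponent, with the zero digits after the nonzero digits of the same exponent. -/
theorem BDig.exists_digits (hp : 2 ≤ p) {m b c : ℕ} (h : BDig p m b c) :
    ∃ d e : Fin P.us → ℕ, IsExpSeq m e ∧ ((∀ i, d i = 0) ∨ IsDigitSeq p d) ∧
      (0 < c → IsDigitSeq p d) ∧ ∑ i, d i = c ∧ pSum p d e = b / p ^ m := by
  obtain ⟨hcp, f, hf, hm, rfl⟩ := h
  have hcu : c ≤ P.us := by have := sub_one_le_us (P := P) hp; omega
  rcases Nat.eq_zero_or_pos c with rfl | hc
  · refine ⟨fun _ => 0, fun _ => 0, ⟨fun _ _ _ => le_rfl, fun _ _ => rfl, fun _ => Nat.zero_le _⟩,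
      Or.inl fun _ => rfl, fun h => absurd h (lt_irrefl 0), by simp, by simp [pSum]⟩
  let κ := Fin c ⊕ Fin (P.us - c)
  have hκ : Fintype.card κ = P.us := by simp [κ]; omega
  let d : κ → ℕ := Sum.elim (fun _ => 1) fun _ => 0
  let n : κ → ℕ := Sum.elim (fun i => m - f i) fun _ => m
  obtain ⟨e, he⟩ := exists_equiv_monotone hκ fun i => 2 * n i + (1 - d i)
  have hsum : ∑ i, (d ∘ e) i = c := by
    have : ∑ i, (d ∘ e) i = ∑ j : κ, d j := e.sum_comp d
    rw [this, Fintype.sum_sum_type]; simp [d]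
  have hd1 : ∀ j, d j ≤ 1 := by rintro (j | j) <;> simp [d]
  have hfirst : ∀ i : Fin P.us, i.val = 0 → n (e i) = 0 ∧ d (e i) ≠ 0 := by
    intro i hi
    obtain ⟨i₀, hi₀⟩ := hm hc
    have h1 : i ≤ e.symm (Sum.inl i₀) := by rw [Fin.le_def, hi]; exact Nat.zero_le _
    have h2 := he h1
    simp only [Function.comp_apply, Equiv.apply_symm_apply] at h2
    have h3 : n (Sum.inl i₀) = 0 := by simp [n, hi₀]
    have h4 : d (Sum.inl i₀) = 1 := rfl
    rw [h3, h4] at h2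
    have := hd1 (e i)
    omega
  have hdig : IsDigitSeq p (d ∘ e) := ⟨fun i hi => (hfirst i hi).2, by rw [hsum]; exact hcp⟩
  refine ⟨d ∘ e, n ∘ e, ⟨fun i j hij => ?_, fun i hi => (hfirst i hi).1, fun i => ?_⟩, Or.inr hdig,
    fun _ => hdig, hsum, ?_⟩
  · have h1 := he hij
    simp only [Function.comp_apply] at h1 ⊢
    omega
  · have : ∀ j, n j ≤ m := by rintro (j | j) <;> simp [n]
    exact this _
  · have h1 : pSum p (d ∘ e) (n ∘ e) = ∑ j : κ, (d j : ℚ) / p ^ n j :=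
      e.sum_comp fun j => (d j : ℚ) / p ^ n j
    rw [h1, Fintype.sum_sum_type]
    simp only [d, n, Sum.elim_inl, Sum.elim_inr, Nat.cast_zero, zero_div, Finset.sum_const_zero,
      add_zero]
    push_cast
    rw [Finset.sum_div]
    refine Finset.sum_congr rfl fun i _ => ?_
    have hp' : (p : ℚ) ≠ 0 := by exact_mod_cast (by omega : p ≠ 0)
    have : (p : ℚ) ^ m = p ^ f i * p ^ (m - f i) := by
      rw [← pow_add, Nat.add_sub_of_le (hf i)]
    rw [this]
    field_simp

theorem BDig.of_digits (hp : 2 ≤ p) {m : ℕ} {d e : Fin P.us → ℕ} (he : IsExpSeq m e)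
    (hd : (∀ i, d i = 0) ∨ IsDigitSeq p d) :
    ∃ b, BDig p m b (∑ i, d i) ∧ (p : ℚ) ^ m * pSum p d e = b := by
  have hus : 0 < P.us := Nat.succ_pos _
  refine ⟨∑ x : (Σ i, Fin (d i)), p ^ (m - e x.1), BDig.of_fintype _ (by simp) ?_
    (fun i => Nat.sub_le _ _) ?_, ?_⟩
  · rcases hd with hd | hd
    · simp [hd]; omega
    · exact hd.2
  · intro hpos
    rcases hd with hd | hd
    · simp [hd] at hpos
    · have h0 := hd.1 ⟨0, hus⟩ rfl
      exact ⟨⟨⟨0, hus⟩, ⟨0, Nat.pos_of_ne_zero h0⟩⟩, by simp [he.2.1 ⟨0, hus⟩ rfl]⟩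
  · rw [Fintype.sum_sigma, pSum, Finset.mul_sum]
    push_cast
    refine Finset.sum_congr rfl fun i _ => ?_
    have hp' : (p : ℚ) ≠ 0 := by exact_mod_cast (by omega : p ≠ 0)
    have : (p : ℚ) ^ m = p ^ (m - e i) * p ^ e i := by
      rw [← pow_add, Nat.sub_add_cancel (he.2.2 i)]
    rw [this]
    simp
    field_simp

theorem BDig.eq_zero_iff {m b c : ℕ} (h : BDig p m b c) : b = 0 ↔ c = 0 := by
  obtain ⟨hcp, f, hf, hm, rfl⟩ := h
  constructor
  · intro h
    by_contra hc
    obtain ⟨i, hi⟩ := hm (Nat.pos_of_ne_zero hc)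
    have h1 := (Finset.sum_eq_zero_iff.1 h) i (Finset.mem_univ _)
    have : 0 < p ^ f i := Nat.pow_pos (by omega)
    omega
  · rintro rfl
    simp

theorem BDig.modEq {m b c : ℕ} (h : BDig p m b c) : b ≡ c [MOD p - 1] := by
  obtain ⟨hcp, f, hf, hm, rfl⟩ := h
  have h1 : ∀ i, p ^ f i ≡ 1 [MOD p - 1] := by
    intro i
    have : p ≡ 1 [MOD p - 1] := by
      have h2 : p = 1 + (p - 1) := by omega
      exact (Nat.modEq_iff_dvd' (by omega)).2 dvd_rfl |>.symm
    simpa using this.pow (f i)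
  have : ∑ i, p ^ f i ≡ ∑ _i : Fin c, 1 [MOD p - 1] := Nat.ModEq.sum fun i _ => h1 i
  simpa using this

/-- The digit sum `c ∈ [0, p-1]` is congruent to `b` modulo `p - 1`, and vanishes only if `b` does.
-/
theorem BDig.unique {m m' b c c' : ℕ} (h : BDig p m b c) (h' : BDig p m' b c') : c = c' := by
  have h0 := h.eq_zero_iff
  have h0' := h'.eq_zero_iff
  by_cases hb : b = 0
  · rw [h0.1 hb, h0'.1 hb]
  · have hc : c ≠ 0 := fun h => hb (h0.2 h)
    have hc' : c' ≠ 0 := fun h => hb (h0'.2 h)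
    have h1 := (h.modEq.symm.trans h'.modEq)
    have hcp := h.1
    have hcp' := h'.1
    have key : ∀ x y : ℕ, x ≤ y → 0 < x → y < p → x ≡ y [MOD p - 1] → x = y := by
      intro x y hxy hx hy hmod
      have h2 := (Nat.modEq_iff_dvd' hxy).1 hmod
      have h3 := Nat.eq_zero_of_dvd_of_lt h2 (by omega)
      omega
    rcases le_total c c' with hle | hle
    · exact key c c' hle (Nat.pos_of_ne_zero hc) hcp' h1
    · exact (key c' c hle (Nat.pos_of_ne_zero hc') hcp h1.symm).symm

theorem BDig.le {m b c : ℕ} (h : BDig p m b c) : b ≤ c * p ^ m := by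
  obtain ⟨hcp, f, hf, hm, rfl⟩ := h
  refine (Finset.sum_le_sum fun i _ => Nat.pow_le_pow_right (by omega) (hf i)).trans ?_
  simp

end Param

end Digits

section IndexSet

namespace Param

variable {p : ℕ} [Fact p.Prime] {P : Param p} {N₀ : ℕ}

theorem Admissible.ws_pos (hP : P.Admissible N₀) : 0 < P.ws := by
  have hp : (1 : ℝ) < p := by exact_mod_cast (Fact.out : p.Prime).one_lt
  exact mul_pos (by linarith) hP.v₀_pos

theorem Admissible.one_lt_q (hP : P.Admissible N₀) : 1 < P.q :=
  Nat.one_lt_pow (by have := hP.Ns_pos; omega) (Fact.out : p.Prime).one_lt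

theorem Admissible.one_lt_q₀ (hP : P.Admissible N₀) : 1 < P.q₀ :=
  Nat.one_lt_pow (by have := hP.two_le_N₀s; omega) (Fact.out : p.Prime).one_lt

omit [Fact p.Prime] in
theorem Admissible.q₀_sub_one_dvd (hP : P.Admissible N₀) : P.q₀ - 1 ∣ P.q - 1 := by
  obtain ⟨c, hc⟩ := hP.C1
  have := Nat.sub_dvd_pow_sub_pow P.q₀ 1 c
  rwa [one_pow, show P.q₀ ^ c = P.q by rw [Param.q, hc, pow_mul]; rfl] at this

theorem Admissible.bs_pos (hP : P.Admissible N₀) : 0 < P.bs := by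
  refine Nat.mul_pos hP.b₀s_pos (Nat.div_pos (Nat.le_of_dvd ?_ hP.q₀_sub_one_dvd) ?_)
  · have := hP.one_lt_q; omega
  · have := hP.one_lt_q₀; omega

theorem Admissible.bs_eq_rat (hP : P.Admissible N₀) : (P.bs : ℚ) = ((P.q : ℚ) - 1) * P.rs := by
  have h0 := hP.one_lt_q₀
  have h1 := hP.one_lt_q
  have h2 : ((P.q₀ : ℚ) - 1) ≠ 0 := by
    have : (1 : ℚ) < P.q₀ := by exact_mod_cast h0
    linarith
  have h3 : ((P.q₀ - 1 : ℕ) : ℚ) ≠ 0 := by rw [Nat.cast_sub h0.le]; simpa using h2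
  rw [Param.bs, Nat.cast_mul, Nat.cast_div hP.q₀_sub_one_dvd h3, Nat.cast_sub h0.le,
    Nat.cast_sub h1.le, Param.rs]
  push_cast
  field_simp

theorem Admissible.rs_pos (hP : P.Admissible N₀) : 0 < P.rs := by
  have h0 : (1 : ℚ) < P.q₀ := by exact_mod_cast hP.one_lt_q₀
  have h1 : (0 : ℚ) < P.b₀s := by exact_mod_cast hP.b₀s_pos
  exact div_pos h1 (by linarith)

theorem Admissible.coprime_q_bs (hP : P.Admissible N₀) : Nat.Coprime P.q P.bs := by
  have h1 := hP.one_lt_q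
  refine Nat.Coprime.mul_right ?_ ?_
  · have h2 : Nat.Coprime P.b₀s p := Nat.Coprime.coprime_mul_right_right hP.coprime
    exact Nat.Coprime.pow_left _ h2.symm
  · refine Nat.Coprime.coprime_dvd_right (Nat.div_dvd_of_dvd hP.q₀_sub_one_dvd) ?_
    rw [Nat.coprime_self_sub_right h1.le]
    exact Nat.coprime_one_right _

theorem Rep.of_isPres (hP : P.Admissible N₀) {u : ℕ} (hu : 1 ≤ u) {ι : ℤ} {m : ℕ} {α : ℚ}
    {d e : Fin P.us → ℕ} (h : P.IsPres u ι m α d e) :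
    ∃ a b, P.Rep u m a b (∑ i, d i) ι ∧ (p : ℚ) ^ m * α = a ∧ (p : ℚ) ^ m * pSum p d e = b := by
  have hp := (Fact.out : p.Prime).two_le
  obtain ⟨a, ha, haα⟩ := ADig.of_mem_setA (by omega) hu h.α_mem
  obtain ⟨b, hb, hbβ⟩ := BDig.of_digits (P := P) hp h.exps h.digits
  refine ⟨a, b, ⟨ha, hb, ?_⟩, haα, hbβ⟩
  have h1 := h.eq
  have h2 : (ι : ℚ) = P.q * a - P.bs * b := by
    rw [h1, hP.bs_eq_rat, ← haα, ← hbβ]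
    ring
  exact_mod_cast h2

theorem Rep.exists_isPres (hP : P.Admissible N₀) {u : ℕ} {ι : ℤ} {m a b c : ℕ}
    (h : P.Rep u m a b c ι) : ∃ α d e, P.IsPres u ι m α d e ∧ (p : ℚ) ^ m * α = a ∧
      (p : ℚ) ^ m * pSum p d e = b ∧ ∑ i, d i = c := by
  have hp := (Fact.out : p.Prime).two_le
  have hp' : (p : ℚ) ≠ 0 := by exact_mod_cast (by omega : p ≠ 0)
  obtain ⟨ha, hb, heq⟩ := h
  obtain ⟨d, e, he, hd, -, hc, hsum⟩ := hb.exists_digits (P := P) hp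
  have h1 : (p : ℚ) ^ m * (a / p ^ m) = a := by field_simp
  have h2 : (p : ℚ) ^ m * pSum p d e = b := by rw [hsum]; field_simp
  refine ⟨a / p ^ m, d, e, ⟨ha.mem_setA (by omega), he, hd, ?_⟩, h1, h2, hc⟩
  have h3 : (ι : ℚ) = P.q * a - P.bs * b := by rw [heq]; push_cast; rfl
  rw [h3, hP.bs_eq_rat, ← h2]
  linear_combination (-(P.q : ℚ)) * h1

/-- Here the choice of `N^*` is used: `α` and `β` are so far from each other that `q(α - β)`
dominates `β`, and the bound on `|ι|` becomes a bound on `p^m`. -/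
theorem Rep.pow_lt_q (hP : P.Admissible N₀) {ι : ℤ} {m a b c : ℕ} (h : P.Rep P.us m a b c ι)
    (hι : |ι| ≤ P.bs * ((p : ℤ) - 1)) (hc : 0 < c) : p ^ m < P.q := by
  have hp := (Fact.out : p.Prime).two_le
  have hpr : (2 : ℝ) ≤ p := by exact_mod_cast hp
  obtain ⟨ha, hb, heq⟩ := h
  have hrs : (0 : ℝ) < P.rs := by exact_mod_cast hP.rs_pos
  have hq : (1 : ℝ) < P.q := by exact_mod_cast hP.one_lt_q
  obtain ⟨d, e, he, -, hd, hdc, hsum⟩ := hb.exists_digits (P := P) hp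
  have hble : (b : ℝ) ≤ ((p : ℝ) - 1) * p ^ m := by
    have h1 := hb.le
    have h2 := hb.1
    have h3 : (c : ℝ) ≤ (p : ℝ) - 1 := by
      have : ((c + 1 : ℕ) : ℝ) ≤ p := by exact_mod_cast h2
      push_cast at this
      linarith
    calc (b : ℝ) ≤ c * p ^ m := by exact_mod_cast h1
      _ ≤ _ := by gcongr
  have hα := ha.mem_setA (by omega)
  have hβ : P.rs * (b / p ^ m) ∈ P.setB P.us m := ⟨d, e, hd hc, he, by rw [hsum]⟩
  have hρ : P.rho ≤ |(((a : ℚ) / p ^ m - P.rs * (b / p ^ m) : ℚ) : ℝ)| := by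
    refine csInf_le ⟨0, ?_⟩ ⟨m, _, hα, _, hβ, rfl⟩
    rintro x ⟨M, α, -, β, -, rfl⟩
    exact abs_nonneg _
  have hX : (0 : ℝ) < (p : ℝ) ^ m := by positivity
  have hC2 := hP.C2
  set X : ℝ := (p : ℝ) ^ m with hXdef
  set r : ℝ := (P.rs : ℝ) with hr
  set q : ℝ := (P.q : ℝ) with hqdef
  have hρ' : P.rho * X ≤ |(a : ℝ) - r * b| := by
    have h1 : (((a : ℚ) / p ^ m - P.rs * (b / p ^ m) : ℚ) : ℝ) = ((a : ℝ) - r * b) / X := by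
      push_cast; rw [hr, hXdef]; ring
    rw [h1, abs_div, abs_of_pos hX, le_div_iff₀ hX] at hρ
    exact hρ
  have hbs : (P.bs : ℝ) = (q - 1) * r := by
    have := hP.bs_eq_rat
    have h2 : ((P.bs : ℚ) : ℝ) = (((P.q : ℚ) - 1) * P.rs : ℚ) := by rw [this]
    push_cast at h2
    exact h2
  have hιr : |q * (a - r * b) + r * b| ≤ (q - 1) * r * ((p : ℝ) - 1) := by
    have h1 : |(ι : ℝ)| ≤ P.bs * ((p : ℝ) - 1) := by exact_mod_cast hι
    have h2 : (ι : ℝ) = q * (a - r * b) + r * b := by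
      rw [heq]; push_cast; rw [hbs]; ring
    rwa [h2, hbs] at h1
  have hb0 : (0 : ℝ) ≤ b := Nat.cast_nonneg _
  have key : q * (P.rho * X) ≤ (q - 1) * r * ((p : ℝ) - 1) + r * b := by
    have h1 : q * |(a : ℝ) - r * b| ≤ |q * (a - r * b) + r * b| + r * b := by
      have h2 : q * (a - r * b) = (q * (a - r * b) + r * b) - r * b := by ring
      have h3 : |q * (a - r * b)| = q * |(a : ℝ) - r * b| := by
        rw [abs_mul, abs_of_pos (by linarith : (0 : ℝ) < q)]
      have h4 : |q * (a - r * b)| ≤ |q * (a - r * b) + r * b| + |r * b| := by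
        conv_lhs => rw [h2]
        exact abs_sub _ _
      rw [abs_of_nonneg (mul_nonneg hrs.le hb0)] at h4
      linarith
    have h5 := mul_le_mul_of_nonneg_left hρ' (by linarith : (0 : ℝ) ≤ q)
    linarith
  have h6 : 2 * r * ((p : ℝ) - 1) * X ≤ q * (P.rho * X) := by
    have := mul_le_mul_of_nonneg_right hC2 hX.le
    linarith
  have h7 : r * b ≤ r * (((p : ℝ) - 1) * X) := mul_le_mul_of_nonneg_left hble hrs.le
  have h8 : r * ((p : ℝ) - 1) * X ≤ r * ((p : ℝ) - 1) * (q - 1) := by linarith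
  have h9 : X ≤ q - 1 := le_of_mul_le_mul_left h8 (mul_pos hrs (by linarith))
  have h10 : X < q := by linarith
  rw [hXdef, hqdef] at h10
  exact_mod_cast h10

/-- In a presentation with `c = ch(ι)` summands of `b` one has `p^m < q` (if `c ≠ 0`), and
`b ≤ c p^m ≤ (p - 1) p^m`. -/
theorem Rep.b_lt_q (hP : P.Admissible N₀) {ι : ℤ} {m a b c : ℕ} (h : P.Rep P.us m a b c ι)
    (hι : |ι| ≤ P.bs * ((p : ℤ) - 1)) : b < P.q := by
  have hp := (Fact.out : p.Prime).two_le
  rcases Nat.eq_zero_or_pos c with hc | hc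
  · rw [h.2.1.eq_zero_iff.2 hc]
    have := hP.one_lt_q; omega
  · have h1 := h.pow_lt_q hP hι hc
    have h2 : m < P.Ns := (Nat.pow_lt_pow_iff_right (by omega)).1 h1
    have h3 := h.2.1.le
    have h4 := h.2.1.1
    calc b ≤ c * p ^ m := h3
      _ < p * p ^ m := Nat.mul_lt_mul_of_pos_right h4 (Nat.pow_pos (by omega))
      _ = p ^ (m + 1) := by ring
      _ ≤ p ^ P.Ns := Nat.pow_le_pow_right (by omega) h2

/-- Since `b^*` is prime to `p`, the number `ι` determines `b` modulo `q`. -/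
theorem Rep.unique (hP : P.Admissible N₀) {ι : ℤ} {m a b c m' a' b' c' : ℕ}
    (h : P.Rep P.us m a b c ι) (h' : P.Rep P.us m' a' b' c' ι)
    (hι : |ι| ≤ P.bs * ((p : ℤ) - 1)) : a = a' ∧ b = b' ∧ c = c' := by
  have hb := h.b_lt_q hP hι
  have hb' := h'.b_lt_q hP hι
  have h1 : (P.q : ℤ) * a - P.bs * b = P.q * a' - P.bs * b' := by rw [← h.2.2, ← h'.2.2]
  have h2 : (P.q : ℤ) ∣ P.bs * ((b : ℤ) - b') := ⟨(a : ℤ) - a', by linarith⟩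
  have h3 : (P.q : ℤ) ∣ (b : ℤ) - b' := by
    refine IsCoprime.dvd_of_dvd_mul_left ?_ h2
    exact Nat.isCoprime_iff_coprime.2 hP.coprime_q_bs
  have h4 : (b : ℤ) - b' = 0 := by
    refine Int.eq_zero_of_abs_lt_dvd h3 ?_
    rw [abs_lt]
    constructor <;> omega
  have hbb : b = b' := by omega
  subst hbb
  refine ⟨?_, rfl, h.2.1.unique h'.2.1⟩
  have h5 : (P.q : ℤ) * a = P.q * a' := by linarith
  have h6 := mul_left_cancel₀ (by have := hP.one_lt_q; omega) h5
  exact_mod_cast h6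

theorem Rep.mono (hP : P.Admissible N₀) {u u' m a b c : ℕ} {ι : ℤ} (h : P.Rep u m a b c ι)
    (hu : u ≤ u') : P.Rep u' m a b c ι :=
  ⟨h.1.mono hP.ws_pos hu, h.2⟩

omit [Fact p.Prime] in
theorem one_le_us : 1 ≤ P.us := Nat.succ_pos _

theorem mem_A0_iff (hP : P.Admissible N₀) {ι : ℤ} :
    ι ∈ P.A0 ↔ |ι| ≤ P.bs * ((p : ℤ) - 1) ∧ ∃ m a b c, P.Rep P.us m a b c ι := by
  simp only [A0, Finset.mem_filter, Finset.mem_Icc, ← abs_le]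
  refine and_congr_right fun _ => ⟨?_, ?_⟩
  · rintro ⟨m, α, d, e, h⟩
    obtain ⟨a, b, h, -⟩ := Rep.of_isPres hP one_le_us h
    exact ⟨m, a, b, _, h⟩
  · rintro ⟨m, a, b, c, h⟩
    obtain ⟨α, d, e, h, -⟩ := h.exists_isPres hP
    exact ⟨m, α, d, e, h⟩

theorem abs_le_of_mem_A0 (hP : P.Admissible N₀) {ι : ℤ} (h : ι ∈ P.A0) :
    |ι| ≤ P.bs * ((p : ℤ) - 1) := ((mem_A0_iff hP).1 h).1

theorem Rep.nums_eq (hP : P.Admissible N₀) {ι : ℤ} {m a b c : ℕ} (h : P.Rep P.us m a b c ι)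
    (hι : |ι| ≤ P.bs * ((p : ℤ) - 1)) : P.aNum ι = a ∧ P.bNum ι = b ∧ P.ch ι = c := by
  obtain ⟨α, d, e, hpres, hα, hβ, hc⟩ := h.exists_isPres hP
  refine ⟨?_, ?_, ?_⟩
  · have : {x : ℕ | ∃ m α b e, P.IsPres P.us ι m α b e ∧ (x : ℚ) = p ^ m * α} = {a} := by
      ext x
      constructor
      · rintro ⟨m', α', d', e', h', hx⟩
        obtain ⟨a', b', h'', ha', -⟩ := Rep.of_isPres hP one_le_us h'
        rw [ha'] at hx
        have := (h.unique hP h'' hι).1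
        rw [Set.mem_singleton_iff, this]
        exact_mod_cast hx
      · rintro rfl
        exact ⟨m, α, d, e, hpres, hα.symm⟩
    rw [aNum, this, csInf_singleton]
  · have : {x : ℕ | ∃ m α b e, P.IsPres P.us ι m α b e ∧ (x : ℚ) = p ^ m * pSum p b e} = {b} := by
      ext x
      constructor
      · rintro ⟨m', α', d', e', h', hx⟩
        obtain ⟨a', b', h'', -, hb'⟩ := Rep.of_isPres hP one_le_us h'
        rw [hb'] at hx
        have := (h.unique hP h'' hι).2.1
        rw [Set.mem_singleton_iff, this]
        exact_mod_cast hx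
      · rintro rfl
        exact ⟨m, α, d, e, hpres, hβ.symm⟩
    rw [bNum, this, csInf_singleton]
  · have : {x : ℕ | ∃ m α b e, P.IsPres P.us ι m α b e ∧ x = ∑ i, b i} = {c} := by
      ext x
      constructor
      · rintro ⟨m', α', d', e', h', rfl⟩
        obtain ⟨a', b', h'', -⟩ := Rep.of_isPres hP one_le_us h'
        exact (h.unique hP h'' hι).2.2.symm
      · rintro rfl
        exact ⟨m, α, d, e, hpres, hc.symm⟩
    rw [ch, this, csInf_singleton]

theorem Rep.kappa_le (hP : P.Admissible N₀) {u : ℕ} {ι : ℤ} {m a b c : ℕ} (h : P.Rep u m a b c ι)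
    (hu : 1 ≤ u) (hus : u ≤ P.us) : P.kappa ι ≤ u := by
  obtain ⟨α, d, e, hpres, -⟩ := h.exists_isPres hP
  exact Nat.sInf_le ⟨hu, hus, m, α, d, e, hpres⟩

theorem exists_rep_kappa (hP : P.Admissible N₀) {ι : ℤ} (hι : ι ∈ P.A0) :
    1 ≤ P.kappa ι ∧ P.kappa ι ≤ P.us ∧
      ∃ m b, P.Rep (P.kappa ι) m (P.aNum ι) b (P.ch ι) ι := by
  obtain ⟨hle, m, a, b, c, h⟩ := (mem_A0_iff hP).1 hι
  have hne : {u : ℕ | 1 ≤ u ∧ u ≤ P.us ∧ ∃ m α b e, P.IsPres u ι m α b e}.Nonempty := by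
    obtain ⟨α, d, e, hpres, -⟩ := h.exists_isPres hP
    exact ⟨P.us, one_le_us, le_rfl, m, α, d, e, hpres⟩
  obtain ⟨h1, h2, m', α', d', e', h3⟩ := Nat.sInf_mem hne
  obtain ⟨a', b', h4, -⟩ := Rep.of_isPres hP h1 h3
  have h5 := (h4.mono hP h2).nums_eq hP hle
  refine ⟨h1, h2, m', b', ?_⟩
  rw [h5.1, h5.2.2]
  exact h4

/-- If `c = 0` then `ι = q a` with `a < w^*`, so that `a` has a presentation with one digit. -/
theorem Rep.a_lt_ws (hP : P.Admissible N₀) {u : ℕ} {ι : ℤ} {m a b : ℕ} (h : P.Rep u m a b 0 ι)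
    (hι : ι ≤ P.bs * ((p : ℤ) - 1)) : (a : ℝ) < P.ws := by
  have hp : (2 : ℝ) ≤ p := by exact_mod_cast (Fact.out : p.Prime).two_le
  have hb : b = 0 := h.2.1.eq_zero_iff.2 rfl
  have heq := h.2.2
  rw [hb] at heq
  have h1 : (P.q : ℝ) * a ≤ P.bs * ((p : ℝ) - 1) := by
    rw [heq] at hι
    have h2 : (P.q : ℤ) * a ≤ P.bs * ((p : ℤ) - 1) := by simpa using hι
    exact_mod_cast h2
  have hq : (1 : ℝ) < P.q := by exact_mod_cast hP.one_lt_q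
  have hrs : (P.rs : ℝ) < P.v₀ := hP.rs_mem.2
  have hrs0 : (0 : ℝ) < P.rs := by exact_mod_cast hP.rs_pos
  have hbs : (P.bs : ℝ) = ((P.q : ℝ) - 1) * P.rs := by
    have := hP.bs_eq_rat
    have h2 : ((P.bs : ℚ) : ℝ) = (((P.q : ℚ) - 1) * P.rs : ℚ) := by rw [this]
    push_cast at h2
    exact h2
  rw [hbs] at h1
  have h3 : (P.q : ℝ) * a < P.q * P.ws := by
    refine lt_of_le_of_lt h1 ?_
    rw [ws, show (P.q : ℝ) * (((p : ℝ) - 1) * P.v₀) = (P.q : ℝ) * P.v₀ * ((p : ℝ) - 1) by ring]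
    refine mul_lt_mul_of_pos_right ?_ (by linarith)
    nlinarith
  exact lt_of_mul_lt_mul_left h3 (by linarith)

/-- `c` powers `p^0` can be used as a presentation of `b = c` for every `c < p`. -/
theorem rep_of_small (hP : P.Admissible N₀) {a c : ℕ} (ha : (a : ℝ) < P.ws) (hc : c < p) :
    P.Rep 1 0 a c c (P.q * a - P.bs * c) := by
  refine ⟨?_, ?_, rfl⟩
  · have := ADig.of_fintype (P := P) (ι := Fin 1) (u := 1) (m := 0) hP.ws_pos (fun _ => a)
      (fun _ => 0) (fun _ => ha) (fun _ => le_rfl) ⟨0, rfl⟩ (by simp)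
    simpa using this
  · have := BDig.of_fintype (p := p) (ι := Fin c) (m := 0) (c := c) (fun _ => 0) (by simp) hc
      (fun _ => le_rfl) (fun h => ⟨⟨0, h⟩, rfl⟩)
    simpa using this

/-- A presentation with the minimal number of digits `a_i`; if `ch(ι) = 0` it is chosen with
`m = 0`. -/
theorem exists_rep_normalized (hP : P.Admissible N₀) {ι : ℤ} (hι : ι ∈ P.A0) :
    ∃ m b, P.Rep (P.kappa ι) m (P.aNum ι) b (P.ch ι) ι ∧ (P.ch ι = 0 → m = 0) := by
  obtain ⟨h1, -, m, b, h⟩ := exists_rep_kappa hP hι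
  by_cases hc : P.ch ι = 0
  · have h2 := (le_abs_self ι).trans (abs_le_of_mem_A0 hP hι)
    rw [hc] at h ⊢
    have h3 := rep_of_small (c := 0) hP (h.a_lt_ws hP h2) (Fact.out : p.Prime).pos
    have hb : b = 0 := h.2.1.eq_zero_iff.2 rfl
    have h4 : ι = P.q * (P.aNum ι : ℤ) - P.bs * ((0 : ℕ) : ℤ) := by rw [← hb]; exact h.2.2
    refine ⟨0, 0, ?_, fun _ => rfl⟩
    rw [← h4] at h3
    exact h3.mono hP h1
  · exact ⟨m, b, h, fun h => absurd h hc⟩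

theorem ADig.add (hP : P.Admissible N₀) {u u' m m' a a' : ℕ} (h : P.ADig u m a)
    (h' : P.ADig u' m' a') : P.ADig (u + u') (max m m') (a + a') := by
  obtain ⟨d, f, hd, hf, ⟨i, hi⟩, rfl⟩ := h
  obtain ⟨d', f', hd', hf', ⟨i', hi'⟩, rfl⟩ := h'
  have := ADig.of_fintype (P := P) (ι := Fin u ⊕ Fin u') (u := u + u') (m := max m m') hP.ws_pos
    (Sum.elim d d') (Sum.elim f f') (by rintro (j | j); exacts [hd j, hd' j])
    (by
      rintro (j | j)
      exacts [(hf j).trans (le_max_left _ _), (hf' j).trans (le_max_right _ _)])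
    (by
      rcases le_total m m' with hle | hle
      · exact ⟨Sum.inr i', by simp [hi', hle]⟩
      · exact ⟨Sum.inl i, by simp [hi, hle]⟩) (by simp)
  simpa [Fintype.sum_sum_type] using this

omit [Fact p.Prime] in
theorem BDig.add {m m' b b' c c' : ℕ} (h : BDig p m b c) (h' : BDig p m' b' c')
    (h0 : c = 0 → m = 0) (h0' : c' = 0 → m' = 0) (hc : c + c' < p) :
    BDig p (max m m') (b + b') (c + c') := by
  obtain ⟨-, f, hf, hm, rfl⟩ := h
  obtain ⟨-, f', hf', hm', rfl⟩ := h'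
  have := BDig.of_fintype (p := p) (ι := Fin c ⊕ Fin c') (m := max m m') (c := c + c')
    (Sum.elim f f') (by simp) hc
    (by
      rintro (j | j)
      exacts [(hf j).trans (le_max_left _ _), (hf' j).trans (le_max_right _ _)])
    (fun hpos => by
      have hl : 0 < c → m' ≤ m → ∃ i, Sum.elim f f' i = max m m' := fun h1 h2 => by
        obtain ⟨i, hi⟩ := hm h1
        exact ⟨Sum.inl i, by simp [hi, h2]⟩
      have hr : 0 < c' → m ≤ m' → ∃ i, Sum.elim f f' i = max m m' := fun h1 h2 => by
        obtain ⟨i, hi⟩ := hm' h1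
        exact ⟨Sum.inr i, by simp [hi, h2]⟩
      rcases Nat.eq_zero_or_pos c with h1 | h1
      · exact hr (by omega) (by have := h0 h1; omega)
      · rcases Nat.eq_zero_or_pos c' with h2 | h2
        · exact hl h1 (by have := h0' h2; omega)
        · rcases le_total m m' with h3 | h3
          exacts [hr h2 h3, hl h1 h3])
  simpa [Fintype.sum_sum_type] using this

/-- The numbers attached to the elements of `𝔄⁰` are additive, as long as the sum of the `b_i`
remains below `p` and the number of the `a_i` does not exceed `u^*`. -/
theorem add_mem_A0 (hP : P.Admissible N₀) {ι ι' : ℤ} (hι : ι ∈ P.A0) (hι' : ι' ∈ P.A0)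
    (hc : P.ch ι + P.ch ι' < p) (hκ : P.kappa ι + P.kappa ι' ≤ P.us)
    (hle : |ι + ι'| ≤ P.bs * ((p : ℤ) - 1)) :
    ι + ι' ∈ P.A0 ∧ P.aNum (ι + ι') = P.aNum ι + P.aNum ι' ∧
      P.ch (ι + ι') = P.ch ι + P.ch ι' ∧ P.kappa (ι + ι') ≤ P.kappa ι + P.kappa ι' := by
  obtain ⟨m, b, h, h0⟩ := exists_rep_normalized hP hι
  obtain ⟨m', b', h', h0'⟩ := exists_rep_normalized hP hι'
  have hR : P.Rep (P.kappa ι + P.kappa ι') (max m m') (P.aNum ι + P.aNum ι') (b + b')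
      (P.ch ι + P.ch ι') (ι + ι') := by
    refine ⟨h.1.add hP h'.1, h.2.1.add h'.2.1 h0 h0' hc, ?_⟩
    have e1 := h.2.2
    have e2 := h'.2.2
    push_cast
    linarith
  have hR' := hR.mono hP hκ
  have hn := hR'.nums_eq hP hle
  have hk := (exists_rep_kappa hP hι).1
  exact ⟨(mem_A0_iff hP).2 ⟨hle, _, _, _, _, hR'⟩, hn.1, hn.2.2, hR.kappa_le hP (by omega) hκ⟩

/-- Elements of `𝔄⁰` may be diminished by multiples of `b^*`. -/
theorem sub_mul_bs_mem_A0 (hP : P.Admissible N₀) {ι : ℤ} (hι : ι ∈ P.A0) {j : ℕ}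
    (hc : P.ch ι + j < p) (hle : |ι - j * P.bs| ≤ P.bs * ((p : ℤ) - 1)) :
    ι - j * P.bs ∈ P.A0 ∧ P.aNum (ι - j * P.bs) = P.aNum ι ∧
      P.ch (ι - j * P.bs) = P.ch ι + j ∧ P.kappa (ι - j * P.bs) ≤ P.kappa ι := by
  obtain ⟨m, b, h, h0⟩ := exists_rep_normalized hP hι
  have hj : BDig p 0 j j := by
    have := BDig.of_fintype (p := p) (ι := Fin j) (m := 0) (c := j) (fun _ => 0) (by simp)
      (by omega) (fun _ => le_rfl) (fun h => ⟨⟨0, h⟩, rfl⟩)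
    simpa using this
  have hR : P.Rep (P.kappa ι) m (P.aNum ι) (b + j) (P.ch ι + j) (ι - j * P.bs) := by
    refine ⟨h.1, ?_, ?_⟩
    · have := h.2.1.add hj h0 (fun _ => rfl) hc
      rwa [Nat.max_zero] at this
    · have e1 := h.2.2
      push_cast
      linarith
  have hk := exists_rep_kappa hP hι
  have hR' := hR.mono hP hk.2.1
  have hn := hR'.nums_eq hP hle
  exact ⟨(mem_A0_iff hP).2 ⟨hle, _, _, _, _, hR'⟩, hn.1, hn.2.2, hR.kappa_le hP hk.1 hk.2.1⟩

omit [Fact p.Prime] in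
theorem Rep.pow_mul {u m a b c : ℕ} {ι : ℤ} (h : P.Rep u m a b c ι) (j : ℕ) :
    P.Rep u (m + j) (p ^ j * a) (p ^ j * b) c ((p : ℤ) ^ j * ι) := by
  obtain ⟨⟨d, f, hd, hf, ⟨i, hi⟩, rfl⟩, ⟨hc, g, hg, hm, rfl⟩, rfl⟩ := h
  refine ⟨⟨d, fun i => f i + j, hd, fun i => Nat.add_le_add_right (hf i) j, ⟨i, by simp [hi]⟩, ?_⟩,
    ⟨hc, fun i => g i + j, fun i => Nat.add_le_add_right (hg i) j, fun h => ?_, ?_⟩, ?_⟩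
  · rw [Finset.mul_sum]
    exact Finset.sum_congr rfl fun i _ => by ring
  · obtain ⟨i, hi⟩ := hm h
    exact ⟨i, by simp [hi]⟩
  · rw [Finset.mul_sum]
    exact Finset.sum_congr rfl fun i _ => by ring
  · push_cast
    ring

/-- A presentation of `ι` becomes one of `p^j ι` when `m` is replaced by `m + j`. -/
theorem nums_pow_mul (hP : P.Admissible N₀) {ι : ℤ} (hι : ι ∈ P.A0) {j : ℕ}
    (h : (p : ℤ) ^ j * ι ∈ P.A0) : P.aNum ((p : ℤ) ^ j * ι) = p ^ j * P.aNum ι ∧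
      P.bNum ((p : ℤ) ^ j * ι) = p ^ j * P.bNum ι ∧ P.ch ((p : ℤ) ^ j * ι) = P.ch ι := by
  obtain ⟨hle, m, a, b, c, hR⟩ := (mem_A0_iff hP).1 hι
  have h1 := hR.nums_eq hP hle
  have h2 := (hR.pow_mul j).nums_eq hP (abs_le_of_mem_A0 hP h)
  rw [h1.1, h1.2.1, h1.2.2]
  exact h2

omit [Fact p.Prime] in
theorem mem_A0_of_mem_Aplus {ι : ℤ} (h : ι ∈ P.Aplus) : ι ∈ P.A0 := by
  simp only [Aplus, Finset.mem_filter] at h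
  exact h.1

omit [Fact p.Prime] in
theorem pos_of_mem_Aplus {ι : ℤ} (h : ι ∈ P.Aplus) : 0 < ι := by
  simp only [Aplus, Finset.mem_filter] at h
  exact h.2.1

/-- The numbers attached to `p^{j+1} ι` are divisible by `p`, contrary to the condition
`gcd(p^m α, p^m β / r^*, p) = 1` in the definition of `𝔄⁺(p)`. -/
theorem pow_mul_notMem_Aplus (hP : P.Admissible N₀) {ι : ℤ} (hι : ι ∈ P.A0) (j : ℕ) :
    (p : ℤ) ^ (j + 1) * ι ∉ P.Aplus := by
  intro h
  have h1 := nums_pow_mul hP hι (mem_A0_of_mem_Aplus h)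
  simp only [Aplus, Finset.mem_filter] at h
  have h2 := h.2.2.1
  rw [h1.1, h1.2.1] at h2
  have h3 : p ∣ Nat.gcd (Nat.gcd (p ^ (j + 1) * P.aNum ι) (p ^ (j + 1) * P.bNum ι)) p :=
    Nat.dvd_gcd (Nat.dvd_gcd (Dvd.dvd.mul_right (dvd_pow_self p (by omega)) _)
      (Dvd.dvd.mul_right (dvd_pow_self p (by omega)) _)) dvd_rfl
  rw [h2] at h3
  exact (Fact.out : p.Prime).one_lt.ne' (Nat.dvd_one.1 h3)

/-- If `q` divides `ι = q a - b^* b`, then it divides `b < q`; so `b = 0`. -/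
theorem ch_eq_zero_of_dvd (hP : P.Admissible N₀) {ι : ℤ} (hι : ι ∈ P.A0) (hq : (P.q : ℤ) ∣ ι) :
    P.ch ι = 0 := by
  obtain ⟨hle, m, a, b, c, hR⟩ := (mem_A0_iff hP).1 hι
  rw [(hR.nums_eq hP hle).2.2]
  have h1 := hR.2.2
  have h2 : (P.q : ℤ) ∣ P.bs * b := by
    have : (P.bs : ℤ) * b = P.q * a - ι := by linarith
    rw [this]
    exact dvd_sub (dvd_mul_right _ _) hq
  have h3 : P.q ∣ b := by
    refine Nat.Coprime.dvd_of_dvd_mul_left hP.coprime_q_bs ?_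
    exact_mod_cast h2
  exact hR.2.1.eq_zero_iff.1 (Nat.eq_zero_of_dvd_of_lt h3 (hR.b_lt_q hP hle))

theorem ch_lt (hP : P.Admissible N₀) {ι : ℤ} (hι : ι ∈ P.A0) : P.ch ι < p := by
  obtain ⟨-, -, m, b, h⟩ := exists_rep_kappa hP hι
  exact h.2.1.1

omit [Fact p.Prime] in
theorem w0_le {ι : ℤ} {w : ℕ} (hw : 1 ≤ w) (h : ι < w * P.bs) : P.w0 ι ≤ w :=
  Nat.sInf_le ⟨hw, h⟩

theorem one_le_w0 (hP : P.Admissible N₀) (ι : ℤ) : 1 ≤ P.w0 ι := by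
  have hne : {w : ℕ | 1 ≤ w ∧ ι < w * P.bs}.Nonempty := by
    refine ⟨ι.natAbs + 1, by omega, ?_⟩
    have hb : (1 : ℤ) ≤ P.bs := by exact_mod_cast hP.bs_pos
    have h1 : ι ≤ |ι| := le_abs_self ι
    push_cast
    nlinarith [abs_nonneg ι]
  exact (Nat.sInf_mem hne).1

end Param

end IndexSet

/-! ### The lattice `𝒩^{sp}` of a graded filtered Lie algebra -/

section SpLattice

variable {p : ℕ} [Fact p.Prime] {P : Param p} {N₀ : ℕ} {k : Type*} [Field k] [Algebra (ZMod p) k]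
  {L L' : Type*} [LieRing L] [LieAlgebra (ZMod p) L] [LieRing L'] [LieAlgebra (ZMod p) L']

variable (P k) in
/-- `t^{(p-1)b^*} 𝒩`, where `𝒩` is the lattice of the filtration `F` for `c = b^*`. -/
def topLattice (F : ℕ → LieIdeal (ZMod p) L) : Submodule (ZMod p) (LK p k L) :=
  lattice p k F P.bs (((p : ℝ) - 1) * P.bs)

/-- The conditions on the generators `t^{-ι} l` of `𝒩^{sp}⟨j⟩`. -/
structure SpTerm (P : Param p) (F : ℕ → LieIdeal (ZMod p) L) (Gr : ℕ → Submodule (ZMod p) L)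
    (j : ℕ) (ι : ℤ) (s m : ℕ) (l : Lk p k L) : Prop where
  mem : ι ∈ P.A0
  one_le : 1 ≤ s
  l_mem : l ∈ subK k ((F s).toSubmodule ⊓ Gr m)
  weight : ι + P.ch ι * P.bs < s * P.bs
  ch : m + j ≤ P.ch ι
  kappa : (P.kappa ι : ℤ) ≤ ((p : ℤ) - 3) * m + s

variable (P k) in
/-- The preimage in `L_𝒦` of the analogue of `𝒩^{sp}⟨j⟩` for a Lie algebra with filtration `F` and
grading `Gr`. -/
def spLattice (F : ℕ → LieIdeal (ZMod p) L) (Gr : ℕ → Submodule (ZMod p) L) (j : ℕ) :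
    Submodule (ZMod p) (LK p k L) :=
  Submodule.span (ZMod p)
    {x | ∃ ι s m, ∃ l : Lk p k L, SpTerm P F Gr j ι s m l ∧ x = tmon p k (-ι) l} ⊔ topLattice P k F

variable {F : ℕ → LieIdeal (ZMod p) L} {Gr : ℕ → Submodule (ZMod p) L} {j : ℕ}

@[elab_as_elim]
theorem spLattice_induction {motive : LK p k L → Prop} {x : LK p k L}
    (hx : x ∈ spLattice P k F Gr j)
    (term : ∀ ι s m l, SpTerm P F Gr j ι s m l → motive (tmon p k (-ι) l))
    (top : ∀ x ∈ topLattice P k F, motive x) (add : ∀ x y, motive x → motive y → motive (x + y))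
    (smul : ∀ (c : ZMod p) x, motive x → motive (c • x)) : motive x := by
  obtain ⟨y, hy, z, hz, rfl⟩ := Submodule.mem_sup.1 hx
  refine add _ _ ?_ (top z hz)
  clear hx hz
  induction hy using Submodule.span_induction with
  | mem x hx =>
    obtain ⟨ι, s, m, l, h, rfl⟩ := hx
    exact term ι s m l h
  | zero => exact top 0 (zero_mem _)
  | add x y _ _ hx hy =>
    exact add _ _ hx hy
  | smul c x _ hx => exact smul c x hx

theorem SpTerm.tmon_mem {ι : ℤ} {s m : ℕ} {l : Lk p k L} (h : SpTerm P F Gr j ι s m l) :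
    tmon p k (-ι) l ∈ spLattice P k F Gr j :=
  Submodule.mem_sup_left (Submodule.subset_span ⟨ι, s, m, l, h, rfl⟩)

theorem topLattice_le_spLattice : topLattice P k F ≤ spLattice P k F Gr j := le_sup_right

theorem SpTerm.mem_filtration {ι : ℤ} {s m : ℕ} {l : Lk p k L} (h : SpTerm P F Gr j ι s m l) :
    l ∈ subK k (F s).toSubmodule := subK_mono inf_le_left h.l_mem

theorem SpTerm.mono {i ι} {s m : ℕ} {l : Lk p k L} (h : SpTerm P F Gr j ι s m l) (hij : i ≤ j) :
    SpTerm P F Gr i ι s m l :=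
  ⟨h.mem, h.one_le, h.l_mem, h.weight, by have := h.ch; omega, h.kappa⟩

theorem spLattice_anti {i : ℕ} (hij : i ≤ j) : spLattice P k F Gr j ≤ spLattice P k F Gr i := by
  intro x hx
  refine spLattice_induction hx (fun ι s m l h => (h.mono hij).tmon_mem)
    (fun x hx => topLattice_le_spLattice hx) (fun x y hx hy => add_mem hx hy)
    (fun c x hx => Submodule.smul_mem _ c hx)

section Top

variable (hP : P.Admissible N₀) (hF : IsLieFiltration F)

theorem Param.Admissible.bs_pos_real (hP : P.Admissible N₀) : (0 : ℝ) < P.bs := by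
  exact_mod_cast hP.bs_pos

include hP hF in
theorem tmon_mem_topLattice {n : ℤ} {s : ℕ} {l : Lk p k L} (hl : l ∈ subK k (F s).toSubmodule)
    (h : ((p : ℤ) - 1 - s) * P.bs < n) : tmon p k n l ∈ topLattice P k F := by
  refine tmon_mem_lattice hP.bs_pos_real hF.antitone hl ?_
  have : (((p : ℝ) - 1 - s) * P.bs) < n := by exact_mod_cast h
  linarith

theorem tmon_add_mem_topLattice {n : ℤ} {l : Lk p k L} (hl : tmon p k n l ∈ topLattice P k F)
    {i : ℤ} (hi : 0 ≤ i) : tmon p k (n + i) l ∈ topLattice P k F := by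
  have := tmon_tcoeff_mem_lattice hl n hi
  rwa [tcoeff_tmon_self] at this

theorem tmon_tcoeff_mem_topLattice {x : LK p k L} (hx : x ∈ topLattice P k F) (n : ℤ) {i : ℤ}
    (hi : 0 ≤ i) : tmon p k (n + i) (tcoeff p k n x) ∈ topLattice P k F :=
  tmon_tcoeff_mem_lattice hx n hi

include hF in
theorem tcoeff_eq_zero_of_mem_topLattice {x : LK p k L} (hx : x ∈ topLattice P k F) {n : ℤ}
    (hn : n ≤ 0) : tcoeff p k n x = 0 := by
  have h := tcoeff_mem_of_nonpos (fun s => by rw [hF.eq_bot]; exact bot_le) hx hn p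
  rw [hF.eq_bot, LieSubmodule.bot_toSubmodule, subK_bot] at h
  exact h

include hF in
theorem sigma_mem_topLattice {x : LK p k L} (hx : x ∈ topLattice P k F) :
    sigma p k x ∈ topLattice P k F :=
  sigma_mem_lattice (fun s => by rw [hF.eq_bot]; exact bot_le) hx

theorem topLattice_le_lattice : topLattice P k F ≤ lattice p k F P.bs 0 := by
  refine lattice_anti (mul_nonneg ?_ (Nat.cast_nonneg _))
  have : (1 : ℝ) ≤ p := by exact_mod_cast (Fact.out : p.Prime).one_le
  linarith

include hP hF in
theorem lie_mem_topLattice {x y : LK p k L} (hx : x ∈ lattice p k F P.bs 0)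
    (hy : y ∈ topLattice P k F) : ⁅x, y⁆ ∈ topLattice P k F := by
  have := lie_mem_lattice (J := 0) hP.bs_pos_real hF.one hF.one hF.antitone
    (fun _ _ _ _ _ hx _ hy => hF.lie_mem hx hy) hx hy
  rwa [zero_add] at this

include hP hF in
theorem lie_mem_topLattice' {x y : LK p k L} (hx : x ∈ topLattice P k F)
    (hy : y ∈ lattice p k F P.bs 0) : ⁅x, y⁆ ∈ topLattice P k F := by
  rw [← lie_skew, neg_mem_iff]
  exact lie_mem_topLattice hP hF hy hx

include hP hF in
theorem spLattice_le_lattice : spLattice P k F Gr j ≤ lattice p k F P.bs 0 := by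
  intro x hx
  refine spLattice_induction hx (fun ι s m l h => ?_) (fun x hx => topLattice_le_lattice hx)
    (fun x y hx hy => add_mem hx hy) (fun c x hx => Submodule.smul_mem _ c hx)
  refine tmon_mem_lattice hP.bs_pos_real hF.antitone h.mem_filtration ?_
  have h1 : ι < s * P.bs := by
    have h2 := h.weight
    have h3 : (0 : ℤ) ≤ P.ch ι * P.bs := by positivity
    linarith
  have : (ι : ℝ) < s * P.bs := by exact_mod_cast h1
  push_cast
  linarith

theorem tmon_tcoeff_mem_topLattice_of_notMem {x : LK p k L} (hx : x ∈ spLattice P k F Gr j) {n : ℤ}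
    (hn : -n ∉ P.A0) : tmon p k n (tcoeff p k n x) ∈ topLattice P k F := by
  refine spLattice_induction hx (fun ι s m l h => ?_) (fun x hx => ?_) (fun x y hx hy => ?_)
    (fun c x hx => ?_)
  · rw [tcoeff_tmon, if_neg, map_zero]
    · exact zero_mem _
    · rintro rfl
      rw [neg_neg] at hn
      exact hn h.mem
  · have := tmon_tcoeff_mem_topLattice hx n le_rfl
    rwa [add_zero] at this
  · rw [map_add, map_add]; exact add_mem hx hy
  · rw [map_smul, map_smul]; exact Submodule.smul_mem _ _ hx

include hF in
theorem tcoeff_eq_zero_of_notMem {x : LK p k L} (hx : x ∈ spLattice P k F Gr j) {n : ℤ}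
    (hn0 : n ≤ 0) (hn : -n ∉ P.A0) : tcoeff p k n x = 0 := by
  have h := tcoeff_eq_zero_of_mem_topLattice hF (tmon_tcoeff_mem_topLattice_of_notMem hx hn) hn0
  rwa [tcoeff_tmon_self] at h

include hP hF in
/-- No `ι ∈ 𝔄⁰` with `ch(ι) ≥ 1` is equal to `0`, as `q` does not divide it. -/
theorem tcoeff_zero_eq_zero {x : LK p k L} (hx : x ∈ spLattice P k F Gr (j + 1)) :
    tcoeff p k 0 x = 0 := by
  refine spLattice_induction hx (fun ι s m l h => ?_)
    (fun x hx => tcoeff_eq_zero_of_mem_topLattice hF hx le_rfl) (fun x y hx hy => ?_)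
    (fun c x hx => ?_)
  · refine tcoeff_tmon_of_ne (fun h0 => ?_) l
    have hι : ι = 0 := by omega
    have h1 := Param.ch_eq_zero_of_dvd hP h.mem (by rw [hι]; exact dvd_zero _)
    have := h.ch
    omega
  · rw [map_add, hx, hy, add_zero]
  · rw [map_smul, hx, smul_zero]

include hP hF in
/-- The coefficient at `t^{-ι}` has weight `≥ w⁰(ι) + ch(ι)`, because `ι + ch(ι) b^* < s b^*` says
that `w⁰(ι) ≤ s - ch(ι)`. -/
theorem tcoeff_mem_wdag {x : LK p k L} (hx : x ∈ spLattice P k F Gr j) {ι : ℤ} (hι : 0 < ι) :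
    tcoeff p k (-ι) x ∈ subK k (F (P.wdag ι)).toSubmodule := by
  refine spLattice_induction hx (fun ι' s m l h => ?_)
    (fun x hx => ?_) (fun x y hx hy => ?_) (fun c x hx => ?_)
  · rw [tcoeff_tmon]
    split_ifs with heq
    · have : ι' = ι := by omega
      subst this
      refine subK_mono (hF.antitone ?_) h.mem_filtration
      have hw := h.weight
      have hb : (0 : ℤ) < P.bs := by exact_mod_cast hP.bs_pos
      have hlt : P.ch ι' < s := by
        by_contra hcon
        have h1 : (s : ℤ) ≤ P.ch ι' := by exact_mod_cast not_lt.1 hcon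
        nlinarith
      have h2 : P.w0 ι' ≤ s - P.ch ι' := by
        refine Param.w0_le (by omega) ?_
        rw [Nat.cast_sub hlt.le]
        linarith
      rw [Param.wdag]
      omega
    · exact zero_mem _
  · rw [tcoeff_eq_zero_of_mem_topLattice hF hx (by omega)]
    exact zero_mem _
  · rw [map_add]; exact add_mem hx hy
  · rw [map_smul]; exact zmod_smul_mem_subK c hx

include hP hF in
/-- Shifting the exponents of an element of `𝒩^{sp}` by at least `p b^*`. -/
theorem tmon_add_mem_topLattice_of_mem {x : LK p k L} (hx : x ∈ spLattice P k F Gr j) (n : ℤ)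
    {J : ℕ} (hJ : p ≤ J) : tmon p k (n + J * P.bs) (tcoeff p k n x) ∈ topLattice P k F := by
  have hJ0 : (0 : ℤ) ≤ J * P.bs := by positivity
  refine spLattice_induction hx (fun ι s m l h => ?_)
    (fun x hx => tmon_tcoeff_mem_topLattice hx n hJ0) (fun x y hx hy => ?_) (fun c x hx => ?_)
  · rw [tcoeff_tmon]
    split_ifs with heq
    · refine tmon_mem_topLattice hP hF h.mem_filtration ?_
      have hw := h.weight
      have hb : (0 : ℤ) < P.bs := by exact_mod_cast hP.bs_pos
      have h1 : (p : ℤ) ≤ J := by exact_mod_cast hJ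
      have h2 : (0 : ℤ) ≤ P.ch ι * P.bs := by positivity
      rw [heq]
      nlinarith
    · rw [map_zero]; exact zero_mem _
  · rw [map_add, map_add]; exact add_mem hx hy
  · rw [map_smul, map_smul]; exact Submodule.smul_mem _ _ hx

variable (P k L) in
/-- The part of an element with exponents `-ι`, `ι ∈ 𝔄⁰`. -/
def projA0 : LK p k L →ₗ[ZMod p] LK p k L := ∑ ι ∈ P.A0, tmon p k (-ι) ∘ₗ tcoeff p k (-ι)

theorem projA0_apply (x : LK p k L) :
    projA0 P k L x = ∑ ι ∈ P.A0, tmon p k (-ι) (tcoeff p k (-ι) x) := by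
  simp [projA0]

theorem sub_projA0_mem {x : LK p k L} (hx : x ∈ spLattice P k F Gr j) :
    x - projA0 P k L x ∈ topLattice P k F := by
  refine spLattice_induction hx (fun ι s m l h => ?_)
    (fun x hx => ?_) (fun x y hx hy => ?_) (fun c x hx => ?_)
  · rw [projA0_apply, Finset.sum_eq_single_of_mem ι h.mem, tcoeff_tmon_self, sub_self]
    · exact zero_mem _
    · intro ι' _ hne
      rw [tcoeff_tmon_of_ne (by omega), map_zero]
  · rw [projA0_apply]
    refine sub_mem hx (sum_mem fun ι _ => ?_)
    have := tmon_tcoeff_mem_topLattice hx (-ι) le_rfl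
    rwa [add_zero] at this
  · rw [map_add, add_sub_add_comm]; exact add_mem hx hy
  · rw [map_smul, ← smul_sub]; exact Submodule.smul_mem _ _ hx

include hP hF in
/-- Multiplication by `t^{J b^*}` takes a generator of `𝒩^{sp}⟨j⟩` to one of `𝒩^{sp}⟨j+J⟩`, or it
and all further multiplications lead to `t^{(p-1)b^*} 𝒩`. -/
theorem SpTerm.shift {ι : ℤ} {s m : ℕ} {l : Lk p k L} (h : SpTerm P F Gr j ι s m l) (J : ℕ) :
    (tmon p k (-ι + J * P.bs) l ∈ topLattice P k F) ∨
      (P.aNum (ι - J * P.bs) = P.aNum ι ∧ P.ch (ι - J * P.bs) = P.ch ι + J ∧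
        SpTerm P F Gr (j + J) (ι - J * P.bs) s m l) := by
  have hw := h.weight
  have hb : (0 : ℤ) < P.bs := by exact_mod_cast hP.bs_pos
  have hs : (1 : ℤ) ≤ s := by exact_mod_cast h.one_le
  have hpp : (2 : ℤ) ≤ p := by exact_mod_cast (Fact.out : p.Prime).two_le
  have hι := abs_le.1 (Param.abs_le_of_mem_A0 hP h.mem)
  have hJ0 : (0 : ℤ) ≤ J * P.bs := by positivity
  -- If `ch(ι) + J ≥ p` or `ι - J b^* < -(p - 1) b^*`, the exponent exceeds `(p - 1 - s) b^*`.
  by_cases hc : P.ch ι + J < p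
  · by_cases hle : |ι - J * P.bs| ≤ P.bs * ((p : ℤ) - 1)
    · right
      obtain ⟨h1, h2, h3, h4⟩ := Param.sub_mul_bs_mem_A0 hP h.mem hc hle
      refine ⟨h2, h3, h1, h.one_le, h.l_mem, ?_, ?_, ?_⟩
      · rw [h3]; push_cast; linarith
      · have := h.ch; omega
      · have h5 := h.kappa
        have : (P.kappa (ι - J * P.bs) : ℤ) ≤ P.kappa ι := by exact_mod_cast h4
        linarith
    · left
      refine tmon_mem_topLattice hP hF h.mem_filtration ?_
      have h1 : ι - J * P.bs < -(P.bs * ((p : ℤ) - 1)) := by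
        by_contra hcon
        exact hle (abs_le.2 ⟨not_lt.1 hcon, by linarith [hι.2]⟩)
      nlinarith
  · left
    refine tmon_mem_topLattice hP hF h.mem_filtration ?_
    have h1 : (p : ℤ) ≤ P.ch ι + J := by exact_mod_cast not_lt.1 hc
    nlinarith

variable (hGr : ∀ m m' : ℕ, ∀ x ∈ Gr m, ∀ y ∈ Gr m', ⁅x, y⁆ ∈ Gr (m + m'))

include hP hF hGr in
/-- The commutator of two generators of `𝒩^{sp}` is a generator, or it lies in
`t^{(p-1)b^*} 𝒩`. -/
theorem SpTerm.lie {i : ℕ} {ι ι' : ℤ} {s s' m m' : ℕ} {l l' : Lk p k L}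
    (h : SpTerm P F Gr i ι s m l) (h' : SpTerm P F Gr j ι' s' m' l') :
    (tmon p k (-(ι + ι')) ⁅l, l'⁆ ∈ topLattice P k F) ∨
      (P.aNum (ι + ι') = P.aNum ι + P.aNum ι' ∧ P.ch (ι + ι') = P.ch ι + P.ch ι' ∧
        SpTerm P F Gr (i + j) (ι + ι') (s + s') (m + m') ⁅l, l'⁆) := by
  have hll : ⁅l, l'⁆ ∈ subK k ((F (s + s')).toSubmodule ⊓ Gr (m + m')) :=
    lie_mem_subK (M := (F s).toSubmodule ⊓ Gr m) (M' := (F s').toSubmodule ⊓ Gr m')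
      (fun x hx y hy => Submodule.mem_inf.2
      ⟨hF.lie_mem hx.1 hy.1, hGr m m' x hx.2 y hy.2⟩) h.l_mem h'.l_mem
  have hllF : ⁅l, l'⁆ ∈ subK k (F (s + s')).toSubmodule := subK_mono inf_le_left hll
  have hw := h.weight
  have hw' := h'.weight
  have hb : (0 : ℤ) < P.bs := by exact_mod_cast hP.bs_pos
  have hs : (1 : ℤ) ≤ s := by exact_mod_cast h.one_le
  have hs' : (1 : ℤ) ≤ s' := by exact_mod_cast h'.one_le
  have hpp : (2 : ℤ) ≤ p := by exact_mod_cast (Fact.out : p.Prime).two_le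
  have hch := h.ch
  have hch' := h'.ch
  -- Apart from the case that the commutator has weight `≥ p` and vanishes, the monomial lies in
  -- `t^{(p-1)b^*} 𝒩` if `ch(ι) + ch(ι') ≥ p - 1` or `ι + ι' < -(p - 1) b^*`.
  by_cases hss : p ≤ s + s'
  · left
    have h0 : F (s + s') = ⊥ := eq_bot_iff.2 (hF.eq_bot ▸ hF.antitone hss)
    rw [h0, LieSubmodule.bot_toSubmodule, subK_bot, Submodule.mem_bot] at hllF
    rw [hllF, map_zero]
    exact zero_mem _
  by_cases hc : p - 1 ≤ P.ch ι + P.ch ι'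
  · left
    refine tmon_mem_topLattice hP hF hllF ?_
    have h1 : (p : ℤ) - 1 ≤ P.ch ι + P.ch ι' := by omega
    push_cast
    nlinarith
  by_cases hle : |ι + ι'| ≤ P.bs * ((p : ℤ) - 1)
  · right
    have hk := h.kappa
    have hk' := h'.kappa
    -- `κ(ι) + κ(ι') ≤ (p - 3)(m + m') + s + s'` with `m + m' ≤ p - 2` and `s + s' ≤ p - 1`,
    -- which is at most `u^* = (p - 1)(p - 2) + 1`
    have hκ : P.kappa ι + P.kappa ι' ≤ P.us := by
      obtain ⟨n, hn⟩ : ∃ n, p = n + 2 := ⟨p - 2, by omega⟩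
      have hus : (P.us : ℤ) = (n + 1) * n + 1 := by
        have : P.us = (n + 1) * n + 1 := by
          rw [Param.us, show p - 1 = n + 1 by omega, show p - 2 = n by omega]
        rw [this]; push_cast; ring
      have hpn : (p : ℤ) = n + 2 := by exact_mod_cast hn
      have hmm : (m : ℤ) + m' ≤ n := by omega
      have hss2 : (s : ℤ) + s' ≤ n + 1 := by omega
      have h3 : (P.kappa ι : ℤ) + P.kappa ι' ≤ P.us := by
        rw [hus]
        rw [hpn] at hk hk'
        have h4 : ((n : ℤ) - 1) * (m + m') ≤ n * n := by
          have hn0 : (0 : ℤ) ≤ n := by positivity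
          have hm0 : (0 : ℤ) ≤ m + m' := by positivity
          nlinarith
        nlinarith
      exact_mod_cast h3
    obtain ⟨h1, h2, h3, h4⟩ := Param.add_mem_A0 hP h.mem h'.mem (by omega) hκ hle
    refine ⟨h2, h3, h1, by have := h.one_le; omega, hll, ?_, ?_, ?_⟩
    · rw [h3]; push_cast; linarith
    · rw [h3]; omega
    · have : (P.kappa (ι + ι') : ℤ) ≤ P.kappa ι + P.kappa ι' := by exact_mod_cast h4
      push_cast
      linarith
  · left
    refine tmon_mem_topLattice hP hF hllF ?_
    have h1 : ι + ι' < -(P.bs * ((p : ℤ) - 1)) := by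
      by_contra hcon
      refine hle (abs_le.2 ⟨not_lt.1 hcon, ?_⟩)
      have h2 : (s : ℤ) + s' ≤ p - 1 := by omega
      have h3 : (0 : ℤ) ≤ P.ch ι * P.bs := by positivity
      have h4 : (0 : ℤ) ≤ P.ch ι' * P.bs := by positivity
      nlinarith
    push_cast
    nlinarith

include hP hF hGr in
theorem lie_mem_spLattice {i : ℕ} {x y : LK p k L} (hx : x ∈ spLattice P k F Gr i)
    (hy : y ∈ spLattice P k F Gr j) : ⁅x, y⁆ ∈ spLattice P k F Gr (i + j) := by
  have hyN := spLattice_le_lattice hP hF hy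
  refine spLattice_induction hx (fun ι s m l h => ?_)
    (fun x hx => topLattice_le_spLattice (lie_mem_topLattice' hP hF hx hyN)) (fun x z hx hz => ?_)
    (fun c x hx => ?_)
  · refine spLattice_induction hy (fun ι' s' m' l' h' => ?_)
      (fun y hy => topLattice_le_spLattice
        (lie_mem_topLattice hP hF (spLattice_le_lattice hP hF h.tmon_mem) hy))
      (fun y z hy hz => ?_) (fun c y hy => ?_)
    · rw [lie_tmon_tmon, ← neg_add]
      rcases h.lie hP hF hGr h' with h1 | ⟨-, -, h1⟩
      · exact topLattice_le_spLattice h1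
      · exact h1.tmon_mem
    · rw [lie_add]; exact add_mem hy hz
    · rw [lie_smul]; exact Submodule.smul_mem _ _ hy
  · rw [add_lie]; exact add_mem hx hz
  · rw [smul_lie]; exact Submodule.smul_mem _ _ hx

variable (k) in
/-- `𝒩^{sp}⟨j⟩` is a Lie algebra. -/
def spSubalgebra (j : ℕ) : LieSubalgebra (ZMod p) (LK p k L) :=
  { spLattice P k F Gr j with
    lie_mem' := fun hx hy => spLattice_anti (by omega) (lie_mem_spLattice hP hF hGr hx hy) }

end Top

end SpLattice

/-! ### The operators `Ω_γ` and their twists -/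

section Phi

variable {p : ℕ} [Fact p.Prime] {P : Param p} {N₀ : ℕ} {k : Type*} [Field k] [Algebra (ZMod p) k]
  {L L' : Type*} [LieRing L] [LieAlgebra (ZMod p) L] [LieRing L'] [LieAlgebra (ZMod p) L']
  {F : ℕ → LieIdeal (ZMod p) L} {Gr : ℕ → Submodule (ZMod p) L} {j : ℕ}

theorem sum_antidiagonal_exp (x y : ZMod p) {n : ℕ} (hn : n < p) :
    ∑ i ∈ Finset.HasAntidiagonal.antidiagonal n,
      ((i.1.factorial : ZMod p)⁻¹ * x ^ i.1) * ((i.2.factorial : ZMod p)⁻¹ * y ^ i.2) =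
      (n.factorial : ZMod p)⁻¹ * (x + y) ^ n := by
  rw [(Commute.all x y).add_pow', Finset.mul_sum]
  refine Finset.sum_congr rfl fun i hi => ?_
  rw [nsmul_eq_mul, ← mul_assoc (n.factorial : ZMod p)⁻¹, choose_mul_inv_factorial hn hi]
  ring

/-- The coefficient of `t^{-ι + i b^*} l` in `Φ_{γ,μ}(t^{-ι} l)`. -/
def phiCoeff (P : Param p) (γ μ : ZMod p) (ι : ℤ) (i : ℕ) : ZMod p :=
  μ ^ P.ch ι * ((i.factorial : ZMod p)⁻¹ * (γ * P.aNum ι) ^ i)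

variable (P k L) in
/-- The operator `Φ_{γ,μ}`: it takes `t^{-ι} l`, for `ι ∈ 𝔄⁰`, to
`μ^{ch(ι)} t^{-ι} exp(γ (p^m α)_ι t^{b^*}) l`, and the other monomials to `0`. Thus `Φ_{γ,1} = Ω_γ`,
and `Φ_{0,μ}` multiplies the part of degree `ch = c` by `μ^c`. -/
def Phi (γ μ : ZMod p) : LK p k L →ₗ[ZMod p] LK p k L :=
  ∑ ι ∈ P.A0, ∑ i ∈ Finset.range p,
    phiCoeff P γ μ ι i • (tmon p k (-ι + i * P.bs) ∘ₗ tcoeff p k (-ι))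

theorem Phi_apply (γ μ : ZMod p) (x : LK p k L) : Phi P k L γ μ x =
    ∑ ι ∈ P.A0, ∑ i ∈ Finset.range p,
      phiCoeff P γ μ ι i • tmon p k (-ι + i * P.bs) (tcoeff p k (-ι) x) := by
  simp [Phi]

theorem Phi_tmon (γ μ : ZMod p) {ι : ℤ} (hι : ι ∈ P.A0) (l : Lk p k L) :
    Phi P k L γ μ (tmon p k (-ι) l) =
      ∑ i ∈ Finset.range p, phiCoeff P γ μ ι i • tmon p k (-ι + i * P.bs) l := by
  rw [Phi_apply, Finset.sum_eq_single_of_mem ι hι]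
  · rw [tcoeff_tmon_self]
  · intro ι' _ hne
    refine Finset.sum_eq_zero fun i _ => ?_
    rw [tcoeff_tmon_of_ne (by omega), map_zero, smul_zero]

theorem Phi_tmon_of_notMem (γ μ : ZMod p) {n : ℤ} (hn : -n ∉ P.A0) (l : Lk p k L) :
    Phi P k L γ μ (tmon p k n l) = 0 := by
  rw [Phi_apply]
  refine Finset.sum_eq_zero fun ι hι => Finset.sum_eq_zero fun i _ => ?_
  rw [tcoeff_tmon_of_ne, map_zero, smul_zero]
  rintro rfl
  rw [neg_neg] at hn
  exact hn hι

theorem Phi_mapK (f : L →ₗ[ZMod p] L') (γ μ : ZMod p) (x : LK p k L) :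
    mapK k f (Phi P k L γ μ x) = Phi P k L' γ μ (mapK k f x) := by
  simp only [Phi_apply, map_sum, mapK_zmod_smul, mapK_tmon, tcoeff_mapK]

theorem phiCoeff_zero_succ (μ : ZMod p) (ι : ℤ) (i : ℕ) : phiCoeff P 0 μ ι (i + 1) = 0 := by
  simp [phiCoeff]

theorem phiCoeff_at_zero (γ μ : ZMod p) (ι : ℤ) : phiCoeff P γ μ ι 0 = μ ^ P.ch ι := by
  simp [phiCoeff]

theorem Phi_zero_tmon (μ : ZMod p) {ι : ℤ} (hι : ι ∈ P.A0) (l : Lk p k L) :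
    Phi P k L 0 μ (tmon p k (-ι) l) = μ ^ P.ch ι • tmon p k (-ι) l := by
  rw [Phi_tmon _ _ hι, Finset.sum_eq_single_of_mem 0
    (Finset.mem_range.2 (Fact.out : p.Prime).pos)]
  · rw [phiCoeff_at_zero, Nat.cast_zero, zero_mul, add_zero]
  · intro i _ hi
    obtain ⟨i, rfl⟩ := Nat.exists_eq_succ_of_ne_zero hi
    rw [phiCoeff_zero_succ, zero_smul]

theorem Phi_zero_apply (μ : ZMod p) (x : LK p k L) : Phi P k L 0 μ x =
    ∑ ι ∈ P.A0, μ ^ P.ch ι • tmon p k (-ι) (tcoeff p k (-ι) x) := by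
  rw [Phi_apply]
  refine Finset.sum_congr rfl fun ι hι => ?_
  rw [← Phi_tmon 0 μ hι, Phi_zero_tmon μ hι]

theorem tcoeff_Phi_zero (μ : ZMod p) (x : LK p k L) (n : ℤ) : tcoeff p k n (Phi P k L 0 μ x) =
    if -n ∈ P.A0 then μ ^ P.ch (-n) • tcoeff p k n x else 0 := by
  rw [Phi_zero_apply, map_sum]
  simp only [map_smul, tcoeff_tmon]
  split_ifs with hn
  · rw [Finset.sum_eq_single_of_mem _ hn]
    · rw [neg_neg, if_pos rfl]
    · intro ι _ hne
      rw [if_neg (by omega), smul_zero]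
  · refine Finset.sum_eq_zero fun ι hι => ?_
    rw [if_neg, smul_zero]
    rintro rfl
    rw [neg_neg] at hn
    exact hn hι

variable (hP : P.Admissible N₀) (hF : IsLieFiltration F)

theorem Phi_mem_topLattice (γ μ : ZMod p) {x : LK p k L} (hx : x ∈ topLattice P k F) :
    Phi P k L γ μ x ∈ topLattice P k F := by
  rw [Phi_apply]
  exact sum_mem fun ι _ => sum_mem fun i _ => Submodule.smul_mem _ _
    (tmon_tcoeff_mem_topLattice hx _ (by positivity))

include hP hF in
theorem Phi_mem_spLattice (γ μ : ZMod p) {x : LK p k L} (hx : x ∈ spLattice P k F Gr j) :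
    Phi P k L γ μ x ∈ spLattice P k F Gr j := by
  refine spLattice_induction hx (fun ι s m l h => ?_)
    (fun x hx => topLattice_le_spLattice (Phi_mem_topLattice γ μ hx)) (fun x y hx hy => ?_)
    (fun c x hx => ?_)
  · rw [Phi_tmon _ _ h.mem]
    refine sum_mem fun i _ => Submodule.smul_mem _ _ ?_
    rcases h.shift hP hF i with h1 | ⟨-, -, h1⟩
    · exact topLattice_le_spLattice h1
    · have := h1.tmon_mem
      rw [show -(ι - i * P.bs) = -ι + (i * P.bs : ℤ) by ring] at this
      exact spLattice_anti (by omega) this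
  · rw [map_add]; exact add_mem hx hy
  · rw [map_smul]; exact Submodule.smul_mem _ _ hx

variable (hGr : ∀ m m' : ℕ, ∀ x ∈ Gr m, ∀ y ∈ Gr m', ⁅x, y⁆ ∈ Gr (m + m'))

theorem Phi_lie_sub_mem_of_terms (hP : P.Admissible N₀) (hF : IsLieFiltration F)
    (hGr : ∀ m m' : ℕ, ∀ x ∈ Gr m, ∀ y ∈ Gr m', ⁅x, y⁆ ∈ Gr (m + m')) (γ μ : ZMod p)
    {i j : ℕ} {ι ι' : ℤ} {s s' m m' : ℕ} {l l' : Lk p k L}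
    (h : SpTerm P F Gr i ι s m l) (h' : SpTerm P F Gr j ι' s' m' l') :
    Phi P k L γ μ ⁅tmon p k (-ι) l, tmon p k (-ι') l'⁆ -
      ⁅Phi P k L γ μ (tmon p k (-ι) l), Phi P k L γ μ (tmon p k (-ι') l')⁆ ∈
        topLattice P k F := by
  have hR : ⁅Phi P k L γ μ (tmon p k (-ι) l), Phi P k L γ μ (tmon p k (-ι') l')⁆ =
      ∑ a ∈ Finset.range p, ∑ b ∈ Finset.range p, (phiCoeff P γ μ ι a * phiCoeff P γ μ ι' b) •
        tmon p k (-(ι + ι') + ((a + b : ℕ) : ℤ) * P.bs) ⁅l, l'⁆ := by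
    rw [Phi_tmon _ _ h.mem, Phi_tmon _ _ h'.mem, sum_lie]
    refine Finset.sum_congr rfl fun a _ => ?_
    rw [lie_sum]
    refine Finset.sum_congr rfl fun b _ => ?_
    rw [smul_lie, lie_smul, smul_smul, lie_tmon_tmon]
    have e : -ι + (a : ℤ) * P.bs + (-ι' + b * P.bs) =
        -(ι + ι') + ((a + b : ℕ) : ℤ) * P.bs := by push_cast; ring
    rw [e]
  rw [hR, lie_tmon_tmon, ← neg_add]
  rcases h.lie hP hF hGr h' with h1 | ⟨ha, hc, h1⟩
  · refine sub_mem (Phi_mem_topLattice γ μ h1) (sum_mem fun a _ => sum_mem fun b _ =>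
      Submodule.smul_mem _ _ (tmon_add_mem_topLattice h1 (by positivity)))
  · have h2 := sum_range_sub_sum_antidiagonal_mem (topLattice P k F) (fun a b =>
      (phiCoeff P γ μ ι a * phiCoeff P γ μ ι' b) •
        tmon p k (-(ι + ι') + ((a + b : ℕ) : ℤ) * P.bs) ⁅l, l'⁆) p (fun a b hab => by
      refine Submodule.smul_mem _ _ ?_
      have := tmon_add_mem_topLattice_of_mem hP hF h1.tmon_mem (-(ι + ι')) hab
      rwa [tcoeff_tmon_self] at this)
    have h3 : ∑ n ∈ Finset.range p, ∑ a ∈ Finset.HasAntidiagonal.antidiagonal n,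
        (phiCoeff P γ μ ι a.1 * phiCoeff P γ μ ι' a.2) •
          tmon p k (-(ι + ι') + ((a.1 + a.2 : ℕ) : ℤ) * P.bs) ⁅l, l'⁆ =
        Phi P k L γ μ (tmon p k (-(ι + ι')) ⁅l, l'⁆) := by
      rw [Phi_tmon _ _ h1.mem]
      refine Finset.sum_congr rfl fun n hn => ?_
      have h4 : phiCoeff P γ μ (ι + ι') n = ∑ a ∈ Finset.HasAntidiagonal.antidiagonal n,
          phiCoeff P γ μ ι a.1 * phiCoeff P γ μ ι' a.2 := by
        rw [phiCoeff, ha, hc, Nat.cast_add, mul_add,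
          ← sum_antidiagonal_exp _ _ (Finset.mem_range.1 hn), Finset.mul_sum]
        refine Finset.sum_congr rfl fun a _ => ?_
        rw [phiCoeff, phiCoeff]
        ring
      rw [h4, Finset.sum_smul]
      refine Finset.sum_congr rfl fun a ha => ?_
      rw [Finset.HasAntidiagonal.mem_antidiagonal] at ha
      rw [ha]
    rw [h3] at h2
    rw [← neg_mem_iff, neg_sub]
    exact h2

include hP hF hGr in
/-- `Φ_{γ,μ}` is a Lie homomorphism on `𝒩^{sp}` modulo `t^{(p-1)b^*} 𝒩`, since the integers
`(p^m α)_ι` and `ch(ι)` are additive. -/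
theorem Phi_lie_sub_mem (γ μ : ZMod p) {x y : LK p k L} (hx : x ∈ spLattice P k F Gr j)
    (hy : y ∈ spLattice P k F Gr j) :
    Phi P k L γ μ ⁅x, y⁆ - ⁅Phi P k L γ μ x, Phi P k L γ μ y⁆ ∈ topLattice P k F := by
  have hyN := spLattice_le_lattice hP hF hy
  have hyN' := spLattice_le_lattice hP hF (Phi_mem_spLattice hP hF γ μ hy)
  refine spLattice_induction hx (fun ι s m l h => ?_)
    (fun x hx => sub_mem (Phi_mem_topLattice γ μ (lie_mem_topLattice' hP hF hx hyN))
      (lie_mem_topLattice' hP hF (Phi_mem_topLattice γ μ hx) hyN')) (fun x z hx hz => ?_)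
    (fun c x hx => ?_)
  · have hxN := spLattice_le_lattice hP hF h.tmon_mem
    have hxN' := spLattice_le_lattice hP hF (Phi_mem_spLattice hP hF γ μ h.tmon_mem)
    refine spLattice_induction hy (fun ι' s' m' l' h' => ?_)
      (fun y hy => sub_mem (Phi_mem_topLattice γ μ (lie_mem_topLattice hP hF hxN hy))
        (lie_mem_topLattice hP hF hxN' (Phi_mem_topLattice γ μ hy)))
      (fun y z hy hz => ?_) (fun c y hy => ?_)
    · exact Phi_lie_sub_mem_of_terms hP hF hGr γ μ h h'
    · simp only [lie_add, map_add]
      rw [add_sub_add_comm]; exact add_mem hy hz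
    · simp only [lie_smul, map_smul]
      rw [← smul_sub]; exact Submodule.smul_mem _ _ hy
  · simp only [add_lie, map_add]
    rw [add_sub_add_comm]; exact add_mem hx hz
  · simp only [smul_lie, map_smul]
    rw [← smul_sub]; exact Submodule.smul_mem _ _ hx

include hP hF in
/-- The `a`-th term of `Φ_{γ',μ'}` raises `ch` by `a`, so that `Φ_{γ,μ}` multiplies it by
`μ^{ch(ι) + a}`; the factor `μ^a` replaces `γ'` by `μ γ'` in the first exponential, and the two
exponentials combine to that of `(γ + μ γ') (p^m α)_ι t^{b^*}`. -/
theorem Phi_Phi_sub_mem_of_term (γ μ γ' μ' : ZMod p) {ι : ℤ} {s m : ℕ} {l : Lk p k L}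
    (h : SpTerm P F Gr j ι s m l) :
    Phi P k L γ μ (Phi P k L γ' μ' (tmon p k (-ι) l)) -
      Phi P k L (γ + μ * γ') (μ * μ') (tmon p k (-ι) l) ∈ topLattice P k F := by
  set f : ℕ → ℕ → LK p k L := fun a b =>
    (phiCoeff P γ' μ' ι a * (μ ^ (P.ch ι + a) * ((b.factorial : ZMod p)⁻¹ *
      (γ * P.aNum ι) ^ b))) • tmon p k (-ι + ((a + b : ℕ) : ℤ) * P.bs) l with hf
  have h1 : Phi P k L γ μ (Phi P k L γ' μ' (tmon p k (-ι) l)) -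
      ∑ a ∈ Finset.range p, ∑ b ∈ Finset.range p, f a b ∈ topLattice P k F := by
    rw [Phi_tmon γ' μ' h.mem, map_sum, ← Finset.sum_sub_distrib]
    refine sum_mem fun a _ => ?_
    have h2 : ∑ b ∈ Finset.range p, f a b = phiCoeff P γ' μ' ι a • ∑ b ∈ Finset.range p,
        (μ ^ (P.ch ι + a) * ((b.factorial : ZMod p)⁻¹ * (γ * P.aNum ι) ^ b)) •
          tmon p k (-ι + ((a : ℕ) : ℤ) * P.bs + b * P.bs) l := by
      rw [Finset.smul_sum]
      refine Finset.sum_congr rfl fun b _ => ?_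
      have e : -ι + ((a + b : ℕ) : ℤ) * P.bs = -ι + (a : ℤ) * P.bs + b * P.bs := by
        push_cast; ring
      rw [smul_smul, ← e]
    rw [h2, map_smul, ← smul_sub]
    refine Submodule.smul_mem _ _ ?_
    rcases h.shift hP hF a with h3 | ⟨ha, hc, h3⟩
    · exact sub_mem (Phi_mem_topLattice γ μ h3) (sum_mem fun b _ => Submodule.smul_mem _ _
        (tmon_add_mem_topLattice h3 (by positivity)))
    · have h4 : -ι + ((a : ℕ) : ℤ) * P.bs = -(ι - a * P.bs) := by ring
      rw [h4, Phi_tmon γ μ h3.mem]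
      have h5 : ∀ b : ℕ, phiCoeff P γ μ (ι - a * P.bs) b =
          μ ^ (P.ch ι + a) * ((b.factorial : ZMod p)⁻¹ * (γ * P.aNum ι) ^ b) := by
        intro b; rw [phiCoeff, ha, hc]
      simp only [h5, sub_self, zero_mem]
  have h2 := sum_range_sub_sum_antidiagonal_mem (topLattice P k F) f p (fun a b hab => by
    refine Submodule.smul_mem _ _ ?_
    have := tmon_add_mem_topLattice_of_mem hP hF h.tmon_mem (-ι) hab
    rwa [tcoeff_tmon_self] at this)
  have h3 : ∑ n ∈ Finset.range p, ∑ a ∈ Finset.HasAntidiagonal.antidiagonal n, f a.1 a.2 =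
      Phi P k L (γ + μ * γ') (μ * μ') (tmon p k (-ι) l) := by
    rw [Phi_tmon _ _ h.mem]
    refine Finset.sum_congr rfl fun n hn => ?_
    have h4 : phiCoeff P (γ + μ * γ') (μ * μ') ι n =
        ∑ a ∈ Finset.HasAntidiagonal.antidiagonal n, phiCoeff P γ' μ' ι a.1 *
          (μ ^ (P.ch ι + a.1) * ((a.2.factorial : ZMod p)⁻¹ * (γ * P.aNum ι) ^ a.2)) := by
      rw [phiCoeff, show (γ + μ * γ') * (P.aNum ι : ZMod p) =
        μ * (γ' * P.aNum ι) + γ * P.aNum ι by ring,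
        ← sum_antidiagonal_exp _ _ (Finset.mem_range.1 hn), Finset.mul_sum]
      refine Finset.sum_congr rfl fun a _ => ?_
      rw [phiCoeff, mul_pow μ (γ' * _), mul_pow μ μ', pow_add]
      ring
    rw [h4, Finset.sum_smul]
    refine Finset.sum_congr rfl fun a ha => ?_
    rw [Finset.HasAntidiagonal.mem_antidiagonal] at ha
    rw [← ha]
  rw [h3] at h2
  have h4 := add_mem h1 h2
  rwa [sub_add_sub_cancel] at h4

include hP hF in
/-- Composition of the operators `Φ_{γ,μ}` follows the group law of affine transformations. -/
theorem Phi_Phi_sub_mem (γ μ γ' μ' : ZMod p) {x : LK p k L} (hx : x ∈ spLattice P k F Gr j) :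
    Phi P k L γ μ (Phi P k L γ' μ' x) - Phi P k L (γ + μ * γ') (μ * μ') x ∈ topLattice P k F := by
  refine spLattice_induction hx (fun ι s m l h => Phi_Phi_sub_mem_of_term hP hF γ μ γ' μ' h)
    (fun x hx => sub_mem (Phi_mem_topLattice _ _ (Phi_mem_topLattice _ _ hx))
      (Phi_mem_topLattice _ _ hx)) (fun x y hx hy => ?_) (fun c x hx => ?_)
  · simp only [map_add]
    rw [add_sub_add_comm]; exact add_mem hx hy
  · simp only [map_smul]
    rw [← smul_sub]; exact Submodule.smul_mem _ _ hx

include hP hF in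
/-- `Φ_{γ,μ}` commutes with `σ` modulo `t^{(p-1)b^*} 𝒩`: on the side of `σ` the exponential is
trivial, because `(p^m α)_{pι} = p (p^m α)_ι` vanishes in `𝔽_p`, and on the other side all terms of
the exponential except the first are multiplied by `t^{p b^*}` at least. -/
theorem Phi_sigma_sub_mem (γ μ : ZMod p) {x : LK p k L} (hx : x ∈ spLattice P k F Gr j)
    (hσ : sigma p k x ∈ spLattice P k F Gr j) :
    Phi P k L γ μ (sigma p k x) - sigma p k (Phi P k L γ μ x) ∈ topLattice P k F := by
  have hp := (Fact.out : p.Prime).pos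
  have hmon : ∀ ι ∈ P.A0, Phi P k L γ μ (sigma p k (tmon p k (-ι) (tcoeff p k (-ι) x))) -
      sigma p k (Phi P k L γ μ (tmon p k (-ι) (tcoeff p k (-ι) x))) ∈ topLattice P k F := by
    intro ι hι
    have hl := tcoeff_sigma_mul (-ι) x
    rw [Phi_tmon _ _ hι, map_sum, sigma_tmon]
    simp only [map_smul, sigma_tmon]
    set l := frobk p k L (tcoeff p k (-ι) x) with hldef
    obtain ⟨p', hp'⟩ : ∃ p', p = p' + 1 := ⟨p - 1, by omega⟩
    have hcast : ∀ i : ℕ, (p : ℤ) * (-ι + i * P.bs) = p * (-ι) + ((p * i : ℕ) : ℤ) * P.bs := by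
      intro i; push_cast; ring
    by_cases hpι : p * ι ∈ P.A0
    · have hnum := Param.nums_pow_mul hP hι (j := 1) (by rwa [pow_one])
      rw [pow_one, pow_one] at hnum
      have h0 : (P.aNum (p * ι) : ZMod p) = 0 := by
        rw [hnum.1]; push_cast; rw [CharP.cast_eq_zero, zero_mul]
      have h1 : Phi P k L γ μ (tmon p k (p * -ι) l) = μ ^ P.ch ι • tmon p k (p * -ι) l := by
        have h2 : (p : ℤ) * -ι = -(p * ι) := by ring
        rw [h2, Phi_tmon _ _ hpι, Finset.sum_eq_single_of_mem 0 (Finset.mem_range.2 hp)]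
        · rw [phiCoeff_at_zero, Nat.cast_zero, zero_mul, add_zero, hnum.2.2]
        · intro i _ hi
          rw [phiCoeff, h0, mul_zero, zero_pow hi, mul_zero, mul_zero, zero_smul]
      rw [h1, ← Finset.add_sum_erase _ _ (Finset.mem_range.2 hp), phiCoeff_at_zero, Nat.cast_zero,
        zero_mul, add_zero, sub_add_cancel_left, neg_mem_iff]
      refine sum_mem fun i hi => Submodule.smul_mem _ _ ?_
      have hi0 : 1 ≤ i := Nat.pos_of_ne_zero (Finset.ne_of_mem_erase hi)
      have h3 := tmon_add_mem_topLattice_of_mem hP hF hσ (p * -ι) (J := p * i)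
        (Nat.le_mul_of_pos_right p hi0)
      rw [hl] at h3
      rwa [hcast]
    · have h1 : -((p : ℤ) * -ι) ∉ P.A0 := by rwa [mul_neg, neg_neg]
      rw [Phi_tmon_of_notMem _ _ h1, zero_sub, neg_mem_iff]
      have h2 := tmon_tcoeff_mem_topLattice_of_notMem hσ h1
      rw [hl] at h2
      refine sum_mem fun i _ => Submodule.smul_mem _ _ ?_
      rw [hcast]
      exact tmon_add_mem_topLattice h2 (by positivity)
  have h1 := sub_projA0_mem hx
  have h2 : x = (x - projA0 P k L x) + projA0 P k L x := by abel
  rw [h2, map_add, map_add, map_add, map_add, add_sub_add_comm]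
  refine add_mem (sub_mem (Phi_mem_topLattice _ _ (sigma_mem_topLattice hF h1))
    (sigma_mem_topLattice hF (Phi_mem_topLattice _ _ h1))) ?_
  rw [projA0_apply]
  simp only [map_sum]
  rw [← Finset.sum_sub_distrib]
  exact sum_mem hmon

end Phi

/-! ### Twisted conjugation -/

section TwistedConjugation

variable {p : ℕ} [Fact p.Prime] {P : Param p} {N₀ : ℕ} {k : Type*} [Field k] [Algebra (ZMod p) k]

/-- The twisted conjugate `σ(d) ∘ y ∘ (-d)`. -/
def conjSigma {L : Type*} [LieRing L] [LieAlgebra (ZMod p) L] (d y : LK p k L) : LK p k L :=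
  bch p (bch p (sigma p k d) y) (-d)

theorem mapK_conjSigma {L L' : Type*} [LieRing L] [LieAlgebra (ZMod p) L] [LieRing L']
    [LieAlgebra (ZMod p) L'] (f : L →ₗ⁅ZMod p⁆ L') (d y : LK p k L) :
    mapK k (f : L →ₗ[ZMod p] L') (conjSigma d y) =
      conjSigma (mapK k (f : L →ₗ[ZMod p] L') d) (mapK k (f : L →ₗ[ZMod p] L') y) := by
  rw [conjSigma, mapK_bch, mapK_bch, mapK_sigma, map_neg, conjSigma]

section Group

variable {G : Type*} {w : G → ℕ} (hw : ∀ g, 1 ≤ w g)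

include hw in
theorem neg_bch (x y : LK p k (TruncLie p w)) : -bch p x y = bch p (-y) (-x) := by
  have h1 : bch p (bch p x y) (bch p (-y) (-x)) = 0 := by
    rw [bch_assoc hw, ← bch_assoc hw y, bch_neg_self, zero_bch, bch_neg_self]
  have h2 : bch p (-bch p x y) (bch p (bch p x y) (bch p (-y) (-x))) = bch p (-y) (-x) := by
    rw [← bch_assoc hw, neg_bch_self, zero_bch]
  rw [← h2, h1, bch_zero]

include hw in
theorem conjSigma_conjSigma (d d' y : LK p k (TruncLie p w)) :
    conjSigma d (conjSigma d' y) = conjSigma (bch p d d') y := by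
  simp only [conjSigma]
  rw [sigma_bch, neg_bch hw]
  simp only [bch_assoc hw]

theorem conjSigma_zero (y : LK p k (TruncLie p w)) : conjSigma 0 y = y := by
  rw [conjSigma, map_zero, zero_bch, neg_zero, bch_zero]

include hw in
theorem conjSigma_neg_conjSigma (d y : LK p k (TruncLie p w)) :
    conjSigma (-d) (conjSigma d y) = y := by
  rw [conjSigma_conjSigma hw, neg_bch_self, conjSigma_zero]

end Group

variable {L : Type*} [LieRing L] [LieAlgebra (ZMod p) L]
  {F : ℕ → LieIdeal (ZMod p) L} {Gr : ℕ → Submodule (ZMod p) L} {j : ℕ}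
  (hP : P.Admissible N₀) (hF : IsLieFiltration F)

theorem conjSigma_mem {N : LieSubalgebra (ZMod p) (LK p k L)} {d y : LK p k L} (hd : d ∈ N)
    (hσ : sigma p k d ∈ N) (hy : y ∈ N) : conjSigma d y ∈ N :=
  bch_mem N (bch_mem N hσ hy) (neg_mem hd)

include hP hF in
theorem conjSigma_sub_mem {d y y' : LK p k L} (hd : d ∈ lattice p k F P.bs 0)
    (hσ : sigma p k d ∈ lattice p k F P.bs 0) (hy : y ∈ lattice p k F P.bs 0)
    (h : y' - y ∈ topLattice P k F) : conjSigma d y' - conjSigma d y ∈ topLattice P k F := by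
  have hT : ∀ x ∈ latticeSubalgebra k hF hP.bs_pos_real, ∀ t ∈ topLattice P k F,
      ⁅x, t⁆ ∈ topLattice P k F := fun x hx t ht => lie_mem_topLattice hP hF hx ht
  have hTN : topLattice P k F ≤ (latticeSubalgebra k hF hP.bs_pos_real).toSubmodule :=
    topLattice_le_lattice
  have h1 := bch_sub_bch_mem hT hTN (x := sigma p k d) (x' := sigma p k d) hσ hy
    (by rw [sub_self]; exact zero_mem _) h
  exact bch_sub_bch_mem hT hTN (y := -d) (y' := -d) (bch_mem _ hσ hy) (neg_mem hd) h1
    (by rw [sub_self]; exact zero_mem _)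

include hP hF in
theorem Phi_conjSigma_sub_mem
    (hGr : ∀ m m' : ℕ, ∀ x ∈ Gr m, ∀ y ∈ Gr m', ⁅x, y⁆ ∈ Gr (m + m')) (γ μ : ZMod p)
    {d y : LK p k L} (hd : d ∈ spLattice P k F Gr 0) (hσ : sigma p k d ∈ spLattice P k F Gr 0)
    (hy : y ∈ spLattice P k F Gr 0) :
    Phi P k L γ μ (conjSigma d y) - conjSigma (Phi P k L γ μ d) (Phi P k L γ μ y) ∈
      topLattice P k F := by
  set S := spSubalgebra k hP hF hGr 0 with hS
  have hle : ∀ {x}, x ∈ S → x ∈ lattice p k F P.bs 0 := fun hx => spLattice_le_lattice hP hF hx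
  have hT : ∀ x ∈ latticeSubalgebra k hF hP.bs_pos_real, ∀ t ∈ topLattice P k F,
      ⁅x, t⁆ ∈ topLattice P k F := fun x hx t ht => lie_mem_topLattice hP hF hx ht
  have hTS : ∀ x ∈ S, ∀ t ∈ topLattice P k F, ⁅x, t⁆ ∈ topLattice P k F :=
    fun x hx t ht => hT x (hle hx) t ht
  have hTN : topLattice P k F ≤ (latticeSubalgebra k hF hP.bs_pos_real).toSubmodule :=
    topLattice_le_lattice
  have hmap : ∀ x ∈ S, Phi P k L γ μ x ∈ S := fun x hx => Phi_mem_spLattice hP hF γ μ hx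
  have hlie : ∀ x ∈ S, ∀ y ∈ S,
      Phi P k L γ μ ⁅x, y⁆ - ⁅Phi P k L γ μ x, Phi P k L γ μ y⁆ ∈ topLattice P k F :=
    fun x hx y hy => Phi_lie_sub_mem hP hF hGr γ μ hx hy
  have hσy : bch p (sigma p k d) y ∈ S := bch_mem S hσ hy
  have h1 := map_bch_sub_mem hTS _ hmap hlie (x := sigma p k d) (y := y) hσ hy
  have h2 := map_bch_sub_mem hTS _ hmap hlie hσy (neg_mem (S := LieSubalgebra (ZMod p) _) hd : -d ∈ S)
  have hσΦ := Phi_sigma_sub_mem hP hF γ μ hd hσ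
  have hσN : sigma p k (Phi P k L γ μ d) ∈ lattice p k F P.bs 0 := by
    have := sub_mem (hle (hmap _ hσ)) (topLattice_le_lattice hσΦ)
    rwa [sub_sub_cancel] at this
  have hyN := hle (hmap _ hy)
  have h3 := bch_sub_bch_mem hT hTN (x := sigma p k (Phi P k L γ μ d)) (y := Phi P k L γ μ y)
    (y' := Phi P k L γ μ y) hσN hyN hσΦ (by rw [sub_self]; exact zero_mem _)
  have h4 := add_mem h1 h3
  rw [sub_add_sub_cancel] at h4
  have h5 := bch_sub_bch_mem hT hTN (y := -Phi P k L γ μ d) (y' := Phi P k L γ μ (-d))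
    (bch_mem _ hσN hyN) (neg_mem (hle (hmap _ hd))) h4
    (by rw [map_neg, sub_self]; exact zero_mem _)
  have h6 := add_mem h2 h5
  rw [sub_add_sub_cancel] at h6
  exact h6

end TwistedConjugation

section Comparison

variable {p : ℕ} {G G' : Type*} {w : G → ℕ} {w' : G' → ℕ}

/-- Homomorphisms that agree modulo `C_{r+1}` agree modulo `C_{r+2}` on commutators. -/
theorem sub_mem_lcs_of_mem_lcs_one {L L' : Type*} [LieRing L] [LieAlgebra (ZMod p) L] [LieRing L']
    [LieAlgebra (ZMod p) L'] {f g : L →ₗ⁅ZMod p⁆ L'} {r : ℕ}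
    (hr : ∀ x, f x - g x ∈ lcs p L' r) {x : L} (hx : x ∈ lcs p L 1) :
    f x - g x ∈ lcs p L' (r + 1) := by
  rw [lcs, LieModule.lowerCentralSeries_succ, LieModule.lowerCentralSeries_zero,
    ← LieSubmodule.mem_toSubmodule, LieSubmodule.lieIdeal_oper_eq_linear_span'] at hx
  induction hx using Submodule.span_induction with
  | mem x hx =>
    obtain ⟨y, -, z, -, rfl⟩ := hx
    have : f ⁅y, z⁆ - g ⁅y, z⁆ = ⁅f y - g y, f z⁆ + ⁅g y, f z - g z⁆ := by
      rw [LieHom.map_lie, LieHom.map_lie, sub_lie, lie_sub]; abel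
    rw [this]
    exact add_mem (lie_mem_lcs' (hr y)) (lie_mem_lcs (hr z))
  | zero => simp
  | add x y _ _ hx hy => rw [map_add, map_add, add_sub_add_comm]; exact add_mem hx hy
  | smul c x _ hx => rw [map_smul, map_smul, ← smul_sub]; exact SMulMemClass.smul_mem c hx

theorem lnBracket_mem_lcs {L : Type*} [LieRing L] [LieAlgebra (ZMod p) L] {l : List L}
    (hl : 2 ≤ l.length) : lnBracket l ∈ lcs p L 1 := by
  obtain ⟨l', x, rfl⟩ : ∃ l' x, l = l' ++ [x] := by
    refine ⟨l.dropLast, l.getLast (by rintro rfl; simp at hl), ?_⟩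
    rw [List.dropLast_append_getLast]
  rw [lnBracket_append_singleton (by rintro rfl; simp at hl)]
  exact lie_mem_lcs (LieSubmodule.mem_top _)

theorem sub_mem_lcs_succ {L' : Type*} [LieRing L'] [LieAlgebra (ZMod p) L']
    {f g : TruncLie p w →ₗ⁅ZMod p⁆ L'} {r : ℕ} (hr : ∀ x, f x - g x ∈ lcs p L' r)
    (hgen : ∀ i, f (gen p w i) - g (gen p w i) ∈ lcs p L' (r + 1)) (x : TruncLie p w) :
    f x - g x ∈ lcs p L' (r + 1) := by
  have hx := mem_lnSpan_true w x
  induction hx using Submodule.span_induction with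
  | mem x hx =>
    obtain ⟨l, -, rfl⟩ := hx
    match l with
    | [] => simp [lnBracket]
    | [i] => exact hgen i
    | i :: i' :: l => exact sub_mem_lcs_of_mem_lcs_one hr (lnBracket_mem_lcs (by simp))
  | zero => simp
  | add x y _ _ hx hy => rw [map_add, map_add, add_sub_add_comm]; exact add_mem hx hy
  | smul c x _ hx => rw [map_smul, map_smul, ← smul_sub]; exact SMulMemClass.smul_mem c hx

variable [Fact p.Prime]

theorem isLieFiltration_filt (hw : ∀ g, 1 ≤ w g) : IsLieFiltration (filt p w) where
  one := filt_one_eq_top hw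
  antitone := fun _ _ h => filt_antitone w h
  lie_mem := fun hx hy => lie_mem_filt w hx hy
  eq_bot := filt_eq_bot w le_rfl

/-- For `2 ≤ n < p` the length derivation acts on `C_n / C_{n+1}` as multiplication by `n ≠ 1`, so
it fixes no element of `C₂` other than `0`. -/
theorem eq_zero_of_lengthDer_eq (hw : ∀ g, 1 ≤ w g) {x : TruncLie p w}
    (hx : x ∈ lcs p (TruncLie p w) 1) (h : lengthDer p w x = x) : x = 0 := by
  have hp := (Fact.out : p.Prime).two_le
  have key : ∀ n, n ≤ p - 2 → x ∈ lcs p (TruncLie p w) (n + 1) := by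
    intro n
    induction n with
    | zero => intro _; exact hx
    | succ n ih =>
      intro hn
      have h1 := lengthLike_sub_smul_mem (K := ZMod p) (lengthDer p w) lengthDer_lie
        lengthDer_sub_mem (n + 1) (ih (by omega))
      have h2 : x - ((n + 1 + 1 : ℕ) : ZMod p) • x = -(((n + 1 : ℕ) : ZMod p) • x) := by
        rw [Nat.cast_succ (n + 1), add_smul, one_smul]; abel
      rw [h, h2, neg_mem_iff] at h1
      have h3 := natCast_ne_zero_of_lt (p := p) (n := n + 1) (by omega) (by omega)
      have h4 := SMulMemClass.smul_mem (((n + 1 : ℕ) : ZMod p)⁻¹) h1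
      rwa [smul_smul, inv_mul_cancel₀ h3, one_smul] at h4
  have h1 := key (p - 2) le_rfl
  rw [lcs_eq_bot hw (by omega)] at h1
  simpa using h1

/-- The weight filtration and the lower central series are compatible. -/
theorem mem_lnSpan_of_mem_lcs_one_of_mem_filt (hw : ∀ g, 1 ≤ w g) {s : ℕ} {x : TruncLie p w}
    (hx : x ∈ lcs p (TruncLie p w) 1) (hs : x ∈ filt p w s) :
    x ∈ lnSpan p (gen p w) fun l => 2 ≤ l.length ∧ s ≤ (l.map w).sum := by
  have h1 : lnSpan p (gen p w) (fun l => s ≤ (l.map w).sum) ≤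
      lnSpan p (gen p w) (fun l => l.length ≤ 1) ⊔
        lnSpan p (gen p w) (fun l => 2 ≤ l.length ∧ s ≤ (l.map w).sum) := by
    refine Submodule.span_le.2 ?_
    rintro x ⟨l, hl, rfl⟩
    rcases le_or_gt l.length 1 with h | h
    · exact Submodule.mem_sup_left (lnBracket_mem_lnSpan _ h)
    · exact Submodule.mem_sup_right
        (lnBracket_mem_lnSpan (Q := fun l => 2 ≤ l.length ∧ s ≤ (l.map w).sum) _ ⟨h, hl⟩)
  rw [mem_filt_iff] at hs
  obtain ⟨y, hy, z, hz, rfl⟩ := Submodule.mem_sup.1 (h1 hs)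
  have hzl : z ∈ lcs p (TruncLie p w) 1 := by
    have : lnSpan p (gen p w) (fun l => 2 ≤ l.length ∧ s ≤ (l.map w).sum) ≤
        (lcs p (TruncLie p w) 1).toSubmodule := by
      refine Submodule.span_le.2 ?_
      rintro x ⟨l, hl, rfl⟩
      exact lnBracket_mem_lcs (by simpa using hl.1)
    exact this hz
  have hyd : lengthDer p w y = y := by
    clear hs hx
    induction hy using Submodule.span_induction with
    | mem y hy =>
      obtain ⟨l, hl, rfl⟩ := hy
      rw [lengthDer_lnBracket]
      match l, hl with
      | [], _ => simp [lnBracket]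
      | [i], _ => simp
    | zero => simp
    | add x y _ _ hx hy => rw [map_add, hx, hy]
    | smul c x _ hx => rw [map_smul, hx]
  have hyl : y ∈ lcs p (TruncLie p w) 1 := by
    have := sub_mem hx hzl
    rwa [add_sub_cancel_right] at this
  rw [eq_zero_of_lengthDer_eq hw hyl hyd, zero_add]
  exact hz

omit [Fact p.Prime] in
/-- If the images of generators have the right weight modulo `C_{r+1}`, then so have the images of
commutators, and those of length `≥ 2` even modulo `C_{r+2}`. -/
theorem map_lnBracket_mem (f : TruncLie p w →ₗ⁅ZMod p⁆ TruncLie p w') {r : ℕ}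
    (h : ∀ g, f (gen p w g) ∈ filt p w' (w g) ⊔ lcs p (TruncLie p w') r) {l : List G} (hl : l ≠ []) :
    f (lnBracket (l.map (gen p w))) ∈ filt p w' (l.map w).sum ⊔ lcs p (TruncLie p w') r ∧
      (2 ≤ l.length → f (lnBracket (l.map (gen p w))) ∈
        filt p w' (l.map w).sum ⊔ lcs p (TruncLie p w') (r + 1)) := by
  induction l using List.reverseRecOn with
  | nil => exact absurd rfl hl
  | append_singleton l i ih =>
    by_cases hl0 : l = []
    · subst hl0
      simpa [lnBracket] using h i
    · have h1 : f (lnBracket ((l ++ [i]).map (gen p w))) =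
          ⁅f (lnBracket (l.map (gen p w))), f (gen p w i)⁆ := by
        rw [List.map_append, List.map_singleton, lnBracket_append_singleton (by simpa using hl0),
          LieHom.map_lie]
      have h2 : f (lnBracket ((l ++ [i]).map (gen p w))) ∈
          filt p w' ((l ++ [i]).map w).sum ⊔ lcs p (TruncLie p w') (r + 1) := by
        rw [h1, List.map_append, List.sum_append, List.map_singleton, List.sum_singleton]
        obtain ⟨a, ha, b, hb, hab⟩ := (LieSubmodule.mem_sup _ _ _).1 (ih hl0).1
        obtain ⟨a', ha', b', hb', hab'⟩ := (LieSubmodule.mem_sup _ _ _).1 (h i)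
        rw [← hab, ← hab', add_lie, lie_add, add_assoc]
        exact (LieSubmodule.mem_sup _ _ _).2 ⟨_, lie_mem_filt w' ha ha', _,
          add_mem (lie_mem_lcs hb') (lie_mem_lcs' hb), rfl⟩
      exact ⟨sup_le_sup_left (LieModule.antitone_lowerCentralSeries _ _ _ (Nat.le_succ r)) _ h2,
        fun _ => h2⟩

/-- A homomorphism respects the weight filtrations if the images of the generators have the right
weight. -/
theorem map_mem_filt (hw : ∀ g, 1 ≤ w' g) (f : TruncLie p w →ₗ⁅ZMod p⁆ TruncLie p w')
    (h : ∀ g, f (gen p w g) ∈ filt p w' (w g)) {s : ℕ} {x : TruncLie p w} (hx : x ∈ filt p w s) :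
    f x ∈ filt p w' s := by
  rw [mem_filt_iff] at hx
  induction hx using Submodule.span_induction with
  | mem x hx =>
    obtain ⟨l, hl, rfl⟩ := hx
    by_cases hl0 : l = []
    · subst hl0; simp [lnBracket]
    · have h1 := (map_lnBracket_mem f (r := p - 1)
        (fun g => le_sup_left (a := filt p w' (w g)) (h g)) hl0).1
      rw [lcs_eq_bot hw (by omega), sup_bot_eq] at h1
      exact filt_antitone w' hl h1
  | zero => simp
  | add x y _ _ hx hy => rw [map_add]; exact add_mem hx hy
  | smul c x _ hx => rw [map_smul]; exact SMulMemClass.smul_mem c hx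

end Comparison

/-! ### Iteration of the uniqueness step -/

section Iteration

variable {p : ℕ} [Fact p.Prime] {k : Type*} [Field k] [Finite k] [Algebra (ZMod p) k]
  {L : Type*} [LieRing L] [LieAlgebra (ZMod p) L] {P : Param p} {N₀ : ℕ}
  {F : ℕ → LieIdeal (ZMod p) L} {E : LieIdeal (ZMod p) L}

/-- If `σ d₁ ∘ ε₁ ∘ (-d₁)` and `σ d₂ ∘ ε₂ ∘ (-d₂)` agree, `d₁ - d₂` has no coefficients
at `t^n` with `n ≤ 0` except at the exponents `-ι`, `0 ≠ ι ∈ 𝔄⁰`, and the agreement of `ε₁`, `ε₂`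
modulo `C_{r+1}` implies that they agree modulo `C_{r+2}` at the exponents outside `-𝔄⁺(p) ∪ {0}`,
then `ε₁` and `ε₂` agree modulo every `C_{r+1}`. Throughout, congruences are also modulo `E` and
`t^{(p-1)b^*} 𝒩`. -/
theorem conjSigma_unique (hP : P.Admissible N₀) (hF : IsLieFiltration F)
    {d₁ d₂ ε₁ ε₂ : LK p k L} (hd₁ : d₁ ∈ lattice p k F P.bs 0) (hd₂ : d₂ ∈ lattice p k F P.bs 0)
    (hσ₁ : sigma p k d₁ ∈ lattice p k F P.bs 0) (hσ₂ : sigma p k d₂ ∈ lattice p k F P.bs 0)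
    (hε₁ : ε₁ ∈ lattice p k F P.bs 0) (hε₂ : ε₂ ∈ lattice p k F P.bs 0)
    (heq : conjSigma d₁ ε₁ - conjSigma d₂ ε₂ ∈ topLattice P k F)
    (hz : ∀ n ≤ 0, (n = 0 ∨ -n ∉ P.A0) → tcoeff p k n (d₁ - d₂) = 0)
    (hη : ∀ r, ε₁ - ε₂ ∈ lattice p k (stepFil F E r) P.bs (((p : ℝ) - 1) * P.bs) →
      ∀ n, n ≠ 0 → -n ∉ P.Aplus → ∀ s : ℕ, 1 ≤ s →
        ((s : ℝ) - 1) * P.bs ≤ ((p : ℝ) - 1) * P.bs - n →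
        tcoeff p k n (ε₁ - ε₂) ∈ subK k (stepFil F E (r + 1) s).toSubmodule) (r : ℕ) :
    ε₁ - ε₂ ∈ lattice p k (stepFil F E r) P.bs (((p : ℝ) - 1) * P.bs) := by
  have htop : ∀ x : LK p k L, x ∈ lattice p k (stepFil F E 0) P.bs (((p : ℝ) - 1) * P.bs) := by
    intro x n s _ _
    have : stepFil F E 0 s = ⊤ := by
      rw [stepFil, lcs, LieModule.lowerCentralSeries_zero, top_sup_eq, sup_top_eq]
    rw [this, LieSubmodule.top_toSubmodule, subK_top]
    exact Submodule.mem_top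
  suffices h : d₁ - d₂ ∈ lattice p k (stepFil F E r) P.bs (((p : ℝ) - 1) * P.bs) ∧
      ε₁ - ε₂ ∈ lattice p k (stepFil F E r) P.bs (((p : ℝ) - 1) * P.bs) from h.2
  induction r with
  | zero => exact ⟨htop _, htop _⟩
  | succ r ih =>
    exact conj_unique_step hF hP.bs_pos_real (fun ι hι => Param.pos_of_mem_Aplus hι)
      (fun ι hι j => Param.pow_mul_notMem_Aplus hP hι j) hd₁ hd₂ hσ₁ hσ₂ hε₁ hε₂
      (lattice_mono (fun s => le_sup_left) heq) ih.1 ih.2 hz (hη r ih.2)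

end Iteration

/-! ### The automorphisms `A_γ` -/

section Action

variable {p : ℕ} [Fact p.Prime] {P : Param p} {k : Type*} [Field k] [Algebra (ZMod p) k]

theorem one_le_wtDag (hP : P.Admissible (Module.finrank (ZMod p) k)) (g) : 1 ≤ wtDag P k g := by
  match g with
  | none => exact le_rfl
  | some (ι, i) => exact (Param.one_le_w0 hP ι.1).trans (Nat.le_add_right _ _)

theorem one_le_wtBar (g) : 1 ≤ wtBar P k g := by
  match g with
  | none => exact le_rfl
  | some (a, i) => exact Nat.le_add_left _ _

theorem lie_mem_LdagGr (m m' : ℕ) : ∀ x ∈ LdagGr P k m, ∀ y ∈ LdagGr P k m',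
    ⁅x, y⁆ ∈ LdagGr P k (m + m') := fun _ hx _ hy => lie_mem_grade _ _ hx hy

theorem Nsp_eq_spLattice (j : ℕ) :
    Nsp P k j = spLattice P k (filt p (wtDag P k)) (LdagGr P k) j := by
  have : ∀ S S' : Set (LK p k (Ldag P k)), S = S' →
      Submodule.span (ZMod p) S ⊔ NdagTop P k = Submodule.span (ZMod p) S' ⊔ NdagTop P k := by
    rintro S _ rfl; rfl
  refine this _ _ (Set.ext fun x => ⟨?_, ?_⟩)
  · rintro ⟨ι, hι, s, m, hs, l, hl, h1, h2, h3, rfl⟩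
    exact ⟨ι, s, m, l, ⟨hι, hs, hl, h1, h2, h3⟩, rfl⟩
  · rintro ⟨ι, s, m, l, ⟨hι, hs, hl, h1, h2, h3⟩, rfl⟩
    exact ⟨ι, hι, s, m, hs, l, hl, h1, h2, h3, rfl⟩

theorem Omega_eq_Phi (γ : ZMod p) (e : LK p k (Ldag P k)) :
    Omega P γ e = Phi P k (Ldag P k) γ 1 e := by
  rw [Omega, Phi_apply]
  simp only [phiCoeff, one_pow, one_mul]

variable [Finite k]

theorem coordk_Delt {X : Type*} (w : Gen X (Module.finrank (ZMod p) k) → ℕ) (α₀ : k) (x : X) (i) :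
    coordk k (TruncLie p w) i (Delt p α₀ w 0 (some x)) = gen p w (some (x, i)) := by
  simp only [Delt, pow_zero, pow_one]
  exact coordk_sum_tmul (fun i => gen p w (some (x, i))) i

theorem Delt_mem_subK_iff {X : Type*} {w : Gen X (Module.finrank (ZMod p) k) → ℕ} {α₀ : k} {x : X}
    {L' : Type*} [LieRing L'] [LieAlgebra (ZMod p) L'] {M : Submodule (ZMod p) L'}
    {f : TruncLie p w →ₗ[ZMod p] L'} :
    mapk k f (Delt p α₀ w 0 (some x)) ∈ subK k M ↔ ∀ i, f (gen p w (some (x, i))) ∈ M := by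
  rw [mem_subK_iff]
  refine forall_congr' fun i => ?_
  rw [coordk_mapk, coordk_Delt]

variable {α₀ : k} {e : LK p k (Ldag P k)}

/-- The coefficients of `ē^{sp}` at `t^{-ι}` modulo `C₂`. -/
theorem IsSpElement.tcoeff_sub_mem (he : IsSpElement P α₀ e) (ι : LabelDag P) :
    tcoeff p k (-ι.1) e - Ddag P α₀ 0 (some ι) ∈ subK k (lcs p (Ldag P k) 1).toSubmodule := by
  have h := tcoeff_mem_of_mem_commK he.2.1 (-ι.1)
  have hι := Param.pos_of_mem_Aplus ι.2
  rw [map_sub, map_add, tcoeff_tmon_of_ne (by omega), zero_add, map_sum,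
    Finset.sum_eq_single ι, tcoeff_tmon_self] at h
  · exact h
  · intro ι' _ hne
    refine tcoeff_tmon_of_ne (fun h => hne (Subtype.ext ?_)) _
    omega
  · simp

theorem IsSpElement.tcoeff_mem (he : IsSpElement P α₀ e) {n : ℤ} (h0 : n ≠ 0)
    (hn : -n ∉ P.Aplus) : tcoeff p k n e ∈ subK k (lcs p (Ldag P k) 1).toSubmodule := by
  have h := tcoeff_mem_of_mem_commK he.2.1 n
  rw [map_sub, map_add, tcoeff_tmon_of_ne h0, zero_add, map_sum, Finset.sum_eq_zero, sub_zero] at h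
  · exact h
  · intro ι _
    refine tcoeff_tmon_of_ne (fun h => hn ?_) _
    rw [h, neg_neg]
    exact ι.2

theorem IsSpElement.mem_spLattice (he : IsSpElement P α₀ e) :
    e ∈ spLattice P k (filt p (wtDag P k)) (LdagGr P k) 0 := by
  rw [← Nsp_eq_spLattice]; exact he.2.2

variable (P k) in
/-- `f` is an endomorphism with `f(D₀) = D₀` and `Ω_γ(e) ≡ σ(c) ∘ f(e) ∘ (-c)` modulo `t^{(p-1)b^*}
𝒩`, where `c` and `σ(c)` lie in `𝒩^{sp}⟨1⟩`. Invertibility of `f` and its effect on the degrees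
play no role in the comparison of conjugations. -/
structure IsConjugation (e : LK p k (Ldag P k)) (γ : ZMod p) (f : Ldag P k →ₗ⁅ZMod p⁆ Ldag P k)
    (c : LK p k (Ldag P k)) : Prop where
  mem : c ∈ spLattice P k (filt p (wtDag P k)) (LdagGr P k) 1
  sigma_mem : sigma p k c ∈ spLattice P k (filt p (wtDag P k)) (LdagGr P k) 1
  conj : conjSigma c (mapK k (f : Ldag P k →ₗ[ZMod p] Ldag P k) e) -
    Phi P k (Ldag P k) γ 1 e ∈ topLattice P k (filt p (wtDag P k))
  gen_none : f (gen p (wtDag P k) none) = gen p (wtDag P k) none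

theorem IsConjugatedAction.exists_isConjugation
    (hP : P.Admissible (Module.finrank (ZMod p) k)) (hα₀ : α₀ ≠ 0)
    {A : ZMod p → (Ldag P k ≃ₗ⁅ZMod p⁆ Ldag P k)} (hA : IsConjugatedAction P α₀ e A) (γ : ZMod p) :
    ∃ c, IsConjugation P k e γ (A γ : Ldag P k →ₗ⁅ZMod p⁆ Ldag P k) c := by
  obtain ⟨⟨c, hc, hσ, v, hv, hvΩ⟩, hnone, -⟩ := hA γ
  rw [Nsp_eq_spLattice] at hc hσ
  refine ⟨c, hc, hσ, ?_, ?_⟩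
  · have := isCHProd_eq_bch (one_le_wtDag hP) hv
    rw [this, Omega_eq_Phi] at hvΩ
    exact hvΩ
  · obtain ⟨i, hi⟩ : ∃ i, (Module.finBasis (ZMod p) k).coord i α₀ ≠ 0 := by
      by_contra! h
      exact hα₀ ((Module.finBasis (ZMod p) k).forall_coord_eq_zero_iff.1 h)
    have h1 := congrArg (coordk k (Ldag P k) i) hnone
    simp only [Ddag, Delt, pow_zero, pow_one] at h1
    rw [coordk_mapk, coordk_tmul, map_smul] at h1
    exact smul_right_injective _ hi h1

variable {γ γ' : ZMod p} {f f' g : Ldag P k →ₗ⁅ZMod p⁆ Ldag P k} {c c' d : LK p k (Ldag P k)}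
  (hP : P.Admissible (Module.finrank (ZMod p) k)) (he : IsSpElement P α₀ e)

include hP he in
theorem IsConjugation.mapK_mem (h : IsConjugation P k e γ f c) :
    mapK k (f : Ldag P k →ₗ[ZMod p] Ldag P k) e ∈
      spLattice P k (filt p (wtDag P k)) (LdagGr P k) 0 := by
  have hF := isLieFiltration_filt (p := p) (one_le_wtDag (k := k) hP)
  set S := spSubalgebra k hP hF lie_mem_LdagGr 0
  have h1 : conjSigma c (mapK k (f : Ldag P k →ₗ[ZMod p] Ldag P k) e) ∈ S := by
    have := add_mem (topLattice_le_spLattice (j := 0) (Gr := LdagGr P k) h.conj)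
      (Phi_mem_spLattice hP hF γ 1 he.mem_spLattice)
    rwa [sub_add_cancel] at this
  rw [← conjSigma_neg_conjSigma (one_le_wtDag hP) c
    (mapK k (f : Ldag P k →ₗ[ZMod p] Ldag P k) e)]
  refine conjSigma_mem (N := S) (neg_mem ?_) ?_ h1
  · exact spLattice_anti (zero_le_one) h.mem
  · rw [map_neg]
    exact neg_mem (spLattice_anti (j := 1) (zero_le_one) h.sigma_mem)

include hP he in
/-- Conjugations respect the weight filtration. The element `f(ē^{sp})` lies in `𝒩^{sp}`, so that
its coefficient at `t^{-ι}` has weight `≥ w⁰(ι) + ch(ι)`. This coefficient is the image of `D_ι`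
plus an element of `C₂` of the same weight, whose image has the right weight modulo `C_{r+2}` if
the images of the generators have it modulo `C_{r+1}`. -/
theorem IsConjugation.map_mem_filt (h : IsConjugation P k e γ f c) {s : ℕ} {x : Ldag P k}
    (hx : x ∈ filt p (wtDag P k) s) : f x ∈ filt p (wtDag P k) s := by
  have hw := one_le_wtDag (k := k) hP
  have hF := isLieFiltration_filt (p := p) hw
  have key : ∀ r, ∀ g, f (gen p (wtDag P k) g) ∈
      filt p (wtDag P k) (wtDag P k g) ⊔ lcs p (Ldag P k) r := by
    intro r
    induction r with
    | zero => intro g; rw [lcs, LieModule.lowerCentralSeries_zero, sup_top_eq]; trivial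
    | succ r ih =>
      rintro (_ | ⟨ι, i⟩)
      · rw [h.gen_none]
        exact le_sup_left (a := filt p (wtDag P k) (wtDag P k none)) (gen_mem_filt _ _)
      · have h1 := tcoeff_mem_wdag hP hF (h.mapK_mem hP he) (Param.pos_of_mem_Aplus ι.2)
        have h2 := tcoeff_mem_wdag hP hF he.mem_spLattice (Param.pos_of_mem_Aplus ι.2)
        have h3 := he.tcoeff_sub_mem ι
        rw [tcoeff_mapK] at h1
        rw [mem_subK_iff] at h1 h2 h3
        have h1 := h1 i
        have h2 := h2 i
        have h3 := h3 i
        rw [coordk_mapk] at h1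
        rw [map_sub, Ddag, coordk_Delt] at h3
        set y := coordk k (Ldag P k) i (tcoeff p k (-ι.1) e) with hy
        replace h1 : f y ∈ filt p (wtDag P k) (P.wdag ι.1) := h1
        have h4 : y - gen p (wtDag P k) (some (ι, i)) ∈ filt p (wtDag P k) (P.wdag ι.1) :=
          sub_mem h2 (gen_mem_filt (wtDag P k) (some (ι, i)))
        have h5 : f (y - gen p (wtDag P k) (some (ι, i))) ∈
            filt p (wtDag P k) (P.wdag ι.1) ⊔ lcs p (Ldag P k) (r + 1) := by
          have h6 := mem_lnSpan_of_mem_lcs_one_of_mem_filt hw h3 h4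
          generalize y - gen p (wtDag P k) (some (ι, i)) = z at h6 ⊢
          clear h3 h4
          induction h6 using Submodule.span_induction with
          | mem x hx =>
            obtain ⟨l, hl, rfl⟩ := hx
            exact sup_le_sup_right (filt_antitone _ hl.2) _
              ((map_lnBracket_mem f ih (by rintro rfl; simp at hl)).2 hl.1)
          | zero => rw [map_zero]; exact zero_mem _
          | add x y _ _ hx hy => rw [map_add]; exact add_mem hx hy
          | smul c x _ hx => rw [map_smul]; exact SMulMemClass.smul_mem c hx
        have h7 := sub_mem (le_sup_left (a := filt p (wtDag P k) (P.wdag ι.1))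
          (b := lcs p (Ldag P k) (r + 1)) h1) h5
        rw [map_sub, sub_sub_cancel] at h7
        exact h7
  refine Ramification.map_mem_filt hw f (fun g => ?_) hx
  have := key (p - 1) g
  rwa [lcs_eq_bot hw (by omega), sup_bot_eq] at this

include hP he in
/-- Conjugations are multiplicative in `γ`, because `Ω_{γ+γ'} ≡ Ω_{γ'} Ω_γ` and the conjugating
endomorphism is determined by its effect on `ē^{sp}`. -/
theorem IsConjugation.comp_eq (h : IsConjugation P k e γ f c) (h' : IsConjugation P k e γ' f' c')
    (h'' : IsConjugation P k e (γ + γ') g d) (x : Ldag P k) : g x = f (f' x) := by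
  have hw := one_le_wtDag (k := k) hP
  have hF := isLieFiltration_filt (p := p) hw
  have hGr := lie_mem_LdagGr (P := P) (k := k)
  have hle : ∀ {j x}, x ∈ spLattice P k (filt p (wtDag P k)) (LdagGr P k) j →
      x ∈ lattice p k (filt p (wtDag P k)) P.bs 0 := fun hx => spLattice_le_lattice hP hF hx
  have h0 : ∀ {x}, x ∈ spLattice P k (filt p (wtDag P k)) (LdagGr P k) 1 →
      x ∈ spLattice P k (filt p (wtDag P k)) (LdagGr P k) 0 := fun hx => spLattice_anti zero_le_one hx
  have hes := he.mem_spLattice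
  set φ := Phi P k (Ldag P k) γ' 1 with hφ
  set fK := mapK k (f : Ldag P k →ₗ[ZMod p] Ldag P k) with hfK
  set gK := mapK k (g : Ldag P k →ₗ[ZMod p] Ldag P k) with hgK
  set fK' := mapK k (f' : Ldag P k →ₗ[ZMod p] Ldag P k) with hfK'
  have hφσ : sigma p k (φ c) ∈ lattice p k (filt p (wtDag P k)) P.bs 0 := by
    have := sub_mem (hle (Phi_mem_spLattice hP hF γ' 1 h.sigma_mem))
      (topLattice_le_lattice (Phi_sigma_sub_mem hP hF γ' 1 h.mem h.sigma_mem))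
    rwa [sub_sub_cancel] at this
  have hφc : φ c ∈ spLattice P k (filt p (wtDag P k)) (LdagGr P k) 1 :=
    Phi_mem_spLattice hP hF γ' 1 h.mem
  have hfe := h.mapK_mem hP he
  have hfe' := h'.mapK_mem hP he
  have hge := h''.mapK_mem hP he
  have hd₁ : bch p (-φ c) d ∈ spLattice P k (filt p (wtDag P k)) (LdagGr P k) 1 :=
    bch_mem (spSubalgebra k hP hF hGr 1) (neg_mem hφc) h''.mem
  have hfN : ∀ x, x ∈ lattice p k (filt p (wtDag P k)) P.bs 0 →
      fK x ∈ lattice p k (filt p (wtDag P k)) P.bs 0 :=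
    fun x hx => mapK_mem_lattice _ (fun s x hx => h.map_mem_filt hP he hx) hx
  -- both sides of the comparison are congruent to `Ω_{γ'}(f e)`
  have heq₁ : conjSigma (bch p (-φ c) d) (gK e) - φ (fK e) ∈
      topLattice P k (filt p (wtDag P k)) := by
    have e1 : φ (conjSigma c (fK e)) - conjSigma (φ c) (φ (fK e)) ∈
        topLattice P k (filt p (wtDag P k)) :=
      Phi_conjSigma_sub_mem hP hF hGr γ' 1 (h0 h.mem) (h0 h.sigma_mem) hfe
    have e2 := Phi_mem_topLattice γ' 1 h.conj
    rw [map_sub] at e2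
    have e3 := Phi_Phi_sub_mem hP hF γ' 1 γ 1 hes
    rw [one_mul, one_mul, add_comm γ' γ] at e3
    have e4 := h''.conj
    have e5 : conjSigma d (gK e) - conjSigma (φ c) (φ (fK e)) ∈
        topLattice P k (filt p (wtDag P k)) := by
      have := add_mem (sub_mem (sub_mem e4 e3) e2) e1
      convert this using 1
      abel
    rw [← conjSigma_conjSigma hw, ← conjSigma_neg_conjSigma hw (φ c) (φ (fK e))]
    refine conjSigma_sub_mem hP hF (neg_mem (hle hφc)) ?_ ?_ e5
    · rw [map_neg]; exact neg_mem hφσ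
    · exact conjSigma_mem (N := latticeSubalgebra k hF hP.bs_pos_real) (hle hφc) hφσ
        (hle (Phi_mem_spLattice hP hF γ' 1 hfe))
  have heq₂ : conjSigma (fK c') (fK (fK' e)) - φ (fK e) ∈
      topLattice P k (filt p (wtDag P k)) := by
    rw [hφ, hfK, ← Phi_mapK, ← mapK_conjSigma, ← map_sub]
    exact mapK_mem_lattice _ (fun s x hx => h.map_mem_filt hP he hx) h'.conj
  have heq := sub_mem heq₁ heq₂
  rw [sub_sub_sub_cancel_right] at heq
  have hco : ∀ n, tcoeff p k n (gK e - fK (fK' e)) =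
      mapk k ((g : Ldag P k →ₗ[ZMod p] Ldag P k) -
        (f : Ldag P k →ₗ[ZMod p] Ldag P k) ∘ₗ (f' : Ldag P k →ₗ[ZMod p] Ldag P k))
        (tcoeff p k n e) := by
    intro n
    rw [map_sub, hgK, hfK, hfK', tcoeff_mapK, tcoeff_mapK, tcoeff_mapK, mapk, mapk, mapk, mapk,
      LinearMap.baseChange_sub, LinearMap.baseChange_comp]
    rfl
  -- agreement on `ē^{sp}` modulo `C_{r+1}` gives agreement on the generators, hence everywhere
  have hall : ∀ r, gK e - fK (fK' e) ∈ lattice p k (stepFil (filt p (wtDag P k)) ⊥ r) P.bs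
      (((p : ℝ) - 1) * P.bs) → ∀ x, g x - (f.comp f') x ∈ lcs p (Ldag P k) r := by
    intro r
    induction r with
    | zero => intro _ x; rw [lcs, LieModule.lowerCentralSeries_zero]; trivial
    | succ r ih =>
      intro hr
      have ih := ih (lattice_mono (stepFil_succ_le r) hr)
      refine sub_mem_lcs_succ ih ?_
      rintro (_ | ⟨ι, i⟩)
      · rw [h''.gen_none, LieHom.comp_apply, h'.gen_none, h.gen_none, sub_self]
        exact zero_mem _
      · have hι := Param.pos_of_mem_Aplus ι.2
        have h1 := tcoeff_mem_of_nonpos (stepFil_le hF (r + 1)) hr (n := -ι.1) (by omega) p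
        rw [hco, stepFil, filt_eq_bot _ le_rfl, bot_sup_eq, sup_bot_eq] at h1
        have h2 := mapk_mem_subK (M' := (lcs p (Ldag P k) (r + 1)).toSubmodule)
          (f := (g : Ldag P k →ₗ[ZMod p] Ldag P k) -
            (f : Ldag P k →ₗ[ZMod p] Ldag P k) ∘ₗ (f' : Ldag P k →ₗ[ZMod p] Ldag P k))
          (fun x hx => sub_mem_lcs_of_mem_lcs_one (f := g) (g := f.comp f') ih hx)
          (he.tcoeff_sub_mem ι)
        rw [map_sub] at h2
        have h3 := sub_mem h1 h2
        rw [sub_sub_cancel] at h3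
        exact Delt_mem_subK_iff.1 h3 i
  have hfin := conjSigma_unique (E := ⊥) hP hF (hle hd₁) (hfN _ (hle h'.mem)) (by
      rw [sigma_bch, map_neg]
      exact bch_mem (latticeSubalgebra k hF hP.bs_pos_real) (neg_mem hφσ) (hle h''.sigma_mem))
    (by rw [hfK, ← mapK_sigma]; exact hfN _ (hle h'.sigma_mem)) (hle hge) (hfN _ (hle hfe')) heq
    (by
      intro n hn hn'
      have h1 : ∀ y ∈ spLattice P k (filt p (wtDag P k)) (LdagGr P k) 1, tcoeff p k n y = 0 := by
        intro y hy
        rcases hn' with rfl | hn'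
        · exact tcoeff_zero_eq_zero hP hF hy
        · exact tcoeff_eq_zero_of_notMem hF hy hn hn'
      rw [map_sub, h1 _ hd₁, hfK, tcoeff_mapK, h1 _ h'.mem, map_zero, sub_zero])
    (by
      intro r hr n hn hn' s _ _
      rw [hco]
      refine subK_mono (M := (lcs p (Ldag P k) (r + 1)).toSubmodule)
        (le_trans (le_sup_left : _ ≤ lcs p (Ldag P k) (r + 1) ⊔ ⊥) le_sup_right) ?_
      exact mapk_mem_subK (fun x hx => sub_mem_lcs_of_mem_lcs_one (f := g) (g := f.comp f')
        (hall r hr) hx) (he.tcoeff_mem hn hn')) (p - 1)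
  have := hall _ hfin x
  rw [lcs_eq_bot hw (by omega), LieSubmodule.mem_bot, sub_eq_zero] at this
  exact this

end Action

/-! ### Polynomial functions on `𝔽_p` -/

section Interpolation

variable {p : ℕ} [Fact p.Prime] {M : Type*} [AddCommGroup M] [Module (ZMod p) M]

/-- The coefficient of `γ^i`, `i < p`, of a function of `γ ∈ 𝔽_p`, written as a polynomial of degree
`< p`. -/
def polyCoeff (i : ℕ) : (ZMod p → M) →ₗ[ZMod p] M :=
  ∑ γ, (Lagrange.basis Finset.univ id γ).coeff i • LinearMap.proj (R := ZMod p) (φ := fun _ => M) γ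

theorem polyCoeff_apply (i : ℕ) (f : ZMod p → M) :
    polyCoeff i f = ∑ γ, (Lagrange.basis Finset.univ id γ).coeff i • f γ := by
  simp [polyCoeff]

theorem polyCoeff_pow_smul {i j : ℕ} (hj : j < p) (x : M) :
    polyCoeff i (fun γ : ZMod p => γ ^ j • x) = if i = j then x else 0 := by
  have h : (Polynomial.X ^ j : Polynomial (ZMod p)) =
      Lagrange.interpolate Finset.univ id fun γ : ZMod p => γ ^ j := by
    refine Lagrange.eq_interpolate_of_eval_eq _ (Set.injOn_id _) ?_ fun γ _ => by simp
    rw [Polynomial.degree_X_pow, Finset.card_univ, ZMod.card]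
    exact_mod_cast hj
  have h1 := congrArg (fun q => q.coeff i) h
  simp only [Lagrange.interpolate_apply, Polynomial.finsetSum_coeff, Polynomial.coeff_C_mul,
    Polynomial.coeff_X_pow] at h1
  rw [polyCoeff_apply]
  simp only [smul_smul]
  rw [← Finset.sum_smul, Finset.sum_congr rfl fun γ _ => mul_comm _ _, ← h1, ite_smul, one_smul,
    zero_smul]

theorem polyCoeff_sum_pow_smul {i : ℕ} (hi : i < p) (x : ℕ → M) :
    polyCoeff i (fun γ : ZMod p => ∑ j ∈ Finset.range p, γ ^ j • x j) = x i := by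
  have : (fun γ : ZMod p => ∑ j ∈ Finset.range p, γ ^ j • x j) =
      ∑ j ∈ Finset.range p, fun γ : ZMod p => γ ^ j • x j := by
    ext γ; simp
  rw [this, map_sum, Finset.sum_eq_single_of_mem i (Finset.mem_range.2 hi)]
  · rw [polyCoeff_pow_smul hi, if_pos rfl]
  · intro j hj hne
    rw [polyCoeff_pow_smul (Finset.mem_range.1 hj), if_neg hne.symm]

theorem sum_pow_smul_polyCoeff (f : ZMod p → M) (γ : ZMod p) :
    ∑ i ∈ Finset.range p, γ ^ i • polyCoeff i f = f γ := by
  have hp := (Fact.out : p.Prime).pos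
  simp only [polyCoeff_apply, Finset.smul_sum, smul_smul]
  rw [Finset.sum_comm]
  have h : ∀ γ' : ZMod p, ∑ i ∈ Finset.range p,
      (γ ^ i * (Lagrange.basis Finset.univ id γ').coeff i) • f γ' =
        if γ' = γ then f γ' else 0 := by
    intro γ'
    have hdeg : (Lagrange.basis Finset.univ id γ' : Polynomial (ZMod p)).natDegree < p := by
      have h1 := Lagrange.degree_basis (s := (Finset.univ : Finset (ZMod p))) (v := id)
        (Set.injOn_id _) (Finset.mem_univ γ')
      rw [Finset.card_univ, ZMod.card] at h1
      rw [Polynomial.natDegree_eq_of_degree_eq_some h1]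
      omega
    have h2 := Polynomial.eval_eq_sum_range' hdeg γ
    rw [← Finset.sum_smul, Finset.sum_congr rfl fun i _ => mul_comm _ _, ← h2]
    split_ifs with heq
    · subst heq
      have := Lagrange.eval_basis_self (s := (Finset.univ : Finset (ZMod p))) (v := id)
        (Set.injOn_id _) (Finset.mem_univ γ')
      rw [id] at this
      rw [this, one_smul]
    · have := Lagrange.eval_basis_of_ne (s := (Finset.univ : Finset (ZMod p))) (v := id)
        heq (Finset.mem_univ γ)
      rw [id] at this
      rw [this, zero_smul]
  rw [Finset.sum_congr rfl fun γ' _ => h γ', Finset.sum_ite_eq' Finset.univ γ f,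
    if_pos (Finset.mem_univ _)]

theorem polyCoeff_map {M' : Type*} [AddCommGroup M'] [Module (ZMod p) M'] (φ : M →ₗ[ZMod p] M')
    (i : ℕ) (f : ZMod p → M) : polyCoeff i (fun γ => φ (f γ)) = φ (polyCoeff i f) := by
  simp only [polyCoeff_apply, map_sum, map_smul]

theorem polyCoeff_mem {N : Submodule (ZMod p) M} {i : ℕ} {f : ZMod p → M} (h : ∀ γ, f γ ∈ N) :
    polyCoeff i f ∈ N := by
  rw [polyCoeff_apply]
  exact sum_mem fun γ _ => Submodule.smul_mem _ _ (h γ)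

end Interpolation

/-! ### One-parameter groups over `𝔽_p` -/

section OneParameter

variable {p : ℕ} [Fact p.Prime] {M : Type*} [AddCommGroup M] [Module (ZMod p) M]
  {a : ZMod p → Module.End (ZMod p) M}

/-- The coefficients `B_i` of a homomorphism `γ ↦ A_γ` satisfy `B_i B_j = (i+j choose i) B_{i+j}`
for `i + j < p`: they behave like divided powers of `B_1`. -/
theorem polyCoeff_mul_polyCoeff (ha : ∀ γ γ', a (γ + γ') = a γ * a γ') {i j : ℕ} (hij : i + j < p) :
    polyCoeff i a * polyCoeff j a = ((i + j).choose i : ZMod p) • polyCoeff (i + j) a := by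
  set b := fun i => polyCoeff i a with hb
  -- Compare the coefficients of `γ^i γ'^j` in `A_{γ+γ'} = A_γ A_{γ'}`
  have h1 : ∀ γ, polyCoeff j (fun γ' => a (γ + γ')) = a γ * b j := fun γ => by
    rw [funext (ha γ)]
    exact polyCoeff_map (LinearMap.mulLeft (ZMod p) (a γ)) j a
  have h2 : ∀ γ, polyCoeff j (fun γ' => a (γ + γ')) =
      ∑ n ∈ Finset.range p, γ ^ n • ((if n + j < p then ((n + j).choose n : ZMod p) else 0) •
        b (n + j)) := by
    intro γ
    have h3 : (fun γ' => a (γ + γ')) = fun γ' => ∑ l ∈ Finset.range p, γ' ^ l •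
        ∑ n ∈ Finset.range p, γ ^ n • ((if n + l < p then ((n + l).choose n : ZMod p) else 0) •
          b (n + l)) := by
      ext1 γ'
      rw [← sum_pow_smul_polyCoeff a (γ + γ')]
      have h4 : ∀ m ∈ Finset.range p, (γ + γ') ^ m • polyCoeff m a =
          ∑ x ∈ Finset.HasAntidiagonal.antidiagonal m,
            (γ' ^ x.2 * (γ ^ x.1 * (if x.1 + x.2 < p then ((x.1 + x.2).choose x.1 : ZMod p) else 0)))
              • b (x.1 + x.2) := by
        intro m hm
        rw [(Commute.all γ γ').add_pow', Finset.sum_smul]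
        refine Finset.sum_congr rfl fun x hx => ?_
        rw [Finset.HasAntidiagonal.mem_antidiagonal] at hx
        rw [hx, if_pos (Finset.mem_range.1 hm), nsmul_eq_mul]
        congr 1
        ring
      rw [Finset.sum_congr rfl h4]
      simp only [Finset.smul_sum, smul_smul]
      rw [Finset.sum_comm (s := Finset.range p) (t := Finset.range p), ← Finset.sum_product',
        Finset.sum_sigma']
      refine Finset.sum_bij_ne_zero (fun x _ _ => x.2) ?_ ?_ ?_ ?_
      · rintro ⟨m, x⟩ hx -
        simp only [Finset.mem_sigma, Finset.mem_range, Finset.HasAntidiagonal.mem_antidiagonal] at hx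
        simp only [Finset.mem_product, Finset.mem_range]
        omega
      · rintro ⟨m, x⟩ hx - ⟨m', x'⟩ hx' - h
        simp only [Finset.mem_sigma, Finset.mem_range, Finset.HasAntidiagonal.mem_antidiagonal]
          at hx hx'
        simp only at h
        subst h
        obtain rfl : m = m' := by omega
        rfl
      · rintro x hx hne
        have hlt : x.1 + x.2 < p := by
          by_contra h
          rw [if_neg h, mul_zero, mul_zero, zero_smul] at hne
          exact hne rfl
        exact ⟨⟨x.1 + x.2, x⟩, by simp [hlt], hne, rfl⟩
      · rintro x _ _; rfl
    rw [h3]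
    exact polyCoeff_sum_pow_smul (by omega) fun l => ∑ n ∈ Finset.range p, γ ^ n •
      ((if n + l < p then ((n + l).choose n : ZMod p) else 0) • b (n + l))
  have h5 : polyCoeff i (fun γ => a γ * b j) = b i * b j :=
    polyCoeff_map (LinearMap.mulRight (ZMod p) (b j)) i a
  change b i * b j = _
  rw [← h5, ← funext h1, funext h2]
  rw [polyCoeff_sum_pow_smul (by omega) fun n => (if n + j < p then ((n + j).choose n : ZMod p)
    else 0) • b (n + j), if_pos hij]

theorem polyCoeff_eq_pow (ha : ∀ γ γ', a (γ + γ') = a γ * a γ') (h0 : a 0 = 1) {i : ℕ}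
    (hi : i < p) : polyCoeff i a = (i.factorial : ZMod p)⁻¹ • polyCoeff 1 a ^ i := by
  induction i with
  | zero =>
    have := sum_pow_smul_polyCoeff a 0
    rw [Finset.sum_eq_single_of_mem 0 (Finset.mem_range.2 hi)
      (fun i _ hi => by rw [zero_pow hi, zero_smul]), pow_zero, one_smul, h0] at this
    rw [this, Nat.factorial_zero, Nat.cast_one, inv_one, one_smul, pow_zero]
  | succ i ih =>
    have h1 := polyCoeff_mul_polyCoeff ha (i := i) (j := 1) hi
    have h2 := natCast_ne_zero_of_lt (p := p) (n := i + 1) (by omega) hi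
    rw [ih (by omega), smul_mul_assoc, ← pow_succ, Nat.choose_succ_self_right] at h1
    rw [← inv_smul_smul₀ h2 (polyCoeff (i + 1) a), ← h1, smul_smul, Nat.factorial_succ,
      Nat.cast_mul, mul_inv]

theorem eq_sum_pow_polyCoeff_one (ha : ∀ γ γ', a (γ + γ') = a γ * a γ') (h0 : a 0 = 1)
    (γ : ZMod p) (x : M) : a γ x = ∑ i ∈ Finset.range p, ((i.factorial : ZMod p)⁻¹ * γ ^ i) •
      (polyCoeff 1 a ^ i) x := by
  conv_lhs => rw [← sum_pow_smul_polyCoeff a γ]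
  rw [LinearMap.sum_apply]
  refine Finset.sum_congr rfl fun i hi => ?_
  rw [polyCoeff_eq_pow ha h0 (Finset.mem_range.1 hi), smul_smul, mul_comm]
  rfl

theorem polyCoeff_one_of_eq_sum_pow {b : Module.End (ZMod p) M}
    (h : ∀ γ x, a γ x = ∑ i ∈ Finset.range p, ((i.factorial : ZMod p)⁻¹ * γ ^ i) • (b ^ i) x) :
    polyCoeff 1 a = b := by
  have hp := (Fact.out : p.Prime).one_lt
  have h1 : a = fun γ => ∑ i ∈ Finset.range p, γ ^ i • ((i.factorial : ZMod p)⁻¹ • b ^ i) := by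
    ext γ x
    rw [h, LinearMap.sum_apply]
    refine Finset.sum_congr rfl fun i _ => ?_
    rw [smul_smul, mul_comm]
    rfl
  rw [h1, polyCoeff_sum_pow_smul hp fun i => (i.factorial : ZMod p)⁻¹ • b ^ i, pow_one,
    Nat.factorial_one, Nat.cast_one, inv_one, one_smul]

/-- If every `A_γ - 1` maps `N` to `N'`, then so does the coefficient of `γ`. -/
theorem polyCoeff_one_mem {N N' : Submodule (ZMod p) M} (h : ∀ γ, ∀ x ∈ N, a γ x - x ∈ N') {x : M}
    (hx : x ∈ N) : polyCoeff 1 a x ∈ N' := by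
  have hp := (Fact.out : p.Prime).one_lt
  have h1 : polyCoeff 1 (fun _ : ZMod p => (1 : Module.End (ZMod p) M)) = 0 := by
    have := polyCoeff_pow_smul (p := p) (i := 1) (j := 0) (by omega) (1 : Module.End (ZMod p) M)
    simpa using this
  have h2 : polyCoeff 1 a x = polyCoeff 1 (fun γ => a γ x - x) := by
    have h3 := polyCoeff_map (LinearMap.applyₗ x) 1 (fun γ => a γ - (1 : Module.End (ZMod p) M))
    have h4 : polyCoeff 1 (fun γ => a γ - (1 : Module.End (ZMod p) M)) = polyCoeff 1 a := by
      have := map_sub (polyCoeff (p := p) 1) a fun _ => (1 : Module.End (ZMod p) M)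
      rw [h1, sub_zero] at this
      exact this
    rw [h4] at h3
    exact h3.symm
  rw [h2]
  exact polyCoeff_mem fun γ => h γ x hx

end OneParameter

/-! ### The differential of an action that lowers degrees -/

section Differential

variable {p : ℕ} {G : Type*} {w c : G → ℕ}

variable (p w c) in
/-- The sum of the graded pieces of degree `< m`. -/
def gradeLT (m : ℕ) : Submodule (ZMod p) (TruncLie p w) := ⨆ m' : Fin m, grade p w c m'

theorem grade_le_gradeLT {m m' : ℕ} (h : m' < m) : grade p w c m' ≤ gradeLT p w c m :=
  le_iSup (fun m' : Fin m => grade p w c m') ⟨m', h⟩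

theorem gradeLT_mono {m m' : ℕ} (h : m' ≤ m) : gradeLT p w c m' ≤ gradeLT p w c m :=
  iSup_le fun i => grade_le_gradeLT (i.2.trans_le h)

theorem lie_mem_gradeLT {m m' : ℕ} {x y : TruncLie p w} (hx : x ∈ gradeLT p w c m)
    (hy : y ∈ gradeLT p w c (m' + 1)) : ⁅x, y⁆ ∈ gradeLT p w c (m + m') := by
  rw [gradeLT] at hx hy
  induction hx using Submodule.iSup_induction' with
  | mem i x hx =>
    induction hy using Submodule.iSup_induction' with
    | mem j y hy => exact grade_le_gradeLT (by omega) (lie_mem_grade w c hx hy)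
    | zero => rw [lie_zero]; exact zero_mem _
    | add y z _ _ hy hz => rw [lie_add]; exact add_mem hy hz
  | zero => rw [zero_lie]; exact zero_mem _
  | add x z _ _ hx hz => rw [add_lie]; exact add_mem hx hz

theorem lie_mem_gradeLT' {m m' : ℕ} {x y : TruncLie p w} (hx : x ∈ grade p w c m)
    (hy : y ∈ gradeLT p w c m') : ⁅x, y⁆ ∈ gradeLT p w c (m + m') := by
  rw [gradeLT] at hy
  induction hy using Submodule.iSup_induction' with
  | mem j y hy => exact grade_le_gradeLT (by omega) (lie_mem_grade w c hx hy)
  | zero => rw [lie_zero]; exact zero_mem _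
  | add y z _ _ hy hz => rw [lie_add]; exact add_mem hy hz

theorem gen_mem_grade (g : G) : gen p w g ∈ grade p w c (c g) :=
  Submodule.subset_span ⟨[g], by simp, by simp [lnBracket]⟩

/-- A homomorphism that is the identity on generators up to terms of smaller degree has this
property everywhere. -/
theorem sub_mem_gradeLT {f : TruncLie p w →ₗ⁅ZMod p⁆ TruncLie p w}
    (hf : ∀ g, f (gen p w g) - gen p w g ∈ gradeLT p w c (c g)) {m : ℕ} {x : TruncLie p w}
    (hx : x ∈ grade p w c m) : f x - x ∈ gradeLT p w c m := by
  have key : ∀ l : List G, f (lnBracket (l.map (gen p w))) - lnBracket (l.map (gen p w)) ∈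
      gradeLT p w c (l.map c).sum := by
    intro l
    induction l using List.reverseRecOn with
    | nil => simp [lnBracket]
    | append_singleton l g ih =>
      by_cases hl : l = []
      · subst hl
        simpa [lnBracket] using hf g
      · rw [List.map_append (f := gen p w), List.map_singleton,
          lnBracket_append_singleton (by simpa using hl), LieHom.map_lie, List.map_append,
          List.sum_append, List.map_singleton, List.sum_singleton]
        have h1 : f (gen p w g) ∈ gradeLT p w c (c g + 1) := by
          have := add_mem (gradeLT_mono (Nat.le_succ _) (hf g))
            (grade_le_gradeLT (Nat.lt_succ_self _) (gen_mem_grade (c := c) g))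
          rwa [sub_add_cancel] at this
        have h2 := lie_mem_gradeLT ih h1
        have h3 := lie_mem_gradeLT' (c := c) (w := w) (p := p) (m := (l.map c).sum)
          (Submodule.subset_span ⟨l, rfl, rfl⟩) (hf g)
        have h4 := add_mem h2 h3
        rw [sub_lie, lie_sub, sub_add_sub_cancel] at h4
        exact h4
  rw [grade] at hx
  induction hx using Submodule.span_induction with
  | mem x hx => obtain ⟨l, rfl, rfl⟩ := hx; exact key l
  | zero => rw [map_zero, sub_zero]; exact zero_mem _
  | add x y _ _ hx hy => rw [map_add, add_sub_add_comm]; exact add_mem hx hy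
  | smul r x _ hx => rw [map_smul, ← smul_sub]; exact Submodule.smul_mem _ _ hx

theorem pow_apply_eq_zero_of_mem_gradeLT {b : Module.End (ZMod p) (TruncLie p w)}
    (hb : ∀ m, ∀ x ∈ grade p w c m, b x ∈ gradeLT p w c m) (m : ℕ) {x : TruncLie p w}
    (hx : x ∈ gradeLT p w c m) : (b ^ m) x = 0 := by
  induction m generalizing x with
  | zero =>
    rw [gradeLT, iSup_of_empty, Submodule.mem_bot] at hx
    rw [hx, map_zero]
  | succ m ih =>
    rw [gradeLT] at hx
    induction hx using Submodule.iSup_induction' with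
    | mem i x hx =>
      rw [pow_succ, Module.End.mul_apply]
      exact ih (gradeLT_mono (by omega) (hb _ x hx))
    | zero => rw [map_zero]
    | add x y _ _ hx hy => rw [map_add, hx, hy, add_zero]

variable [Fact p.Prime]

/-- The coefficient of `γ` in an action of `𝔽_p` by automorphisms which preserve the weight
filtration and lower the degree is a derivation. In the coefficient of `γ` of `[A_γ x, A_γ y]`
there are, besides the terms of a derivation, the terms `[B_i x, B_j y]` with `i + j = p`. If these
are not zero, the degrees of `x` and `y` are at least `i` and `j`; as the weight exceeds the
degree, their weight is at least `p`. -/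
theorem polyCoeff_one_lie (hcw : ∀ g, c g + 1 ≤ w g)
    (f : ZMod p → (TruncLie p w →ₗ⁅ZMod p⁆ TruncLie p w)) {a : ZMod p → Module.End (ZMod p) _}
    (haf : ∀ γ x, a γ x = f γ x)
    (hadd : ∀ γ γ', a (γ + γ') = a γ * a γ') (h0 : a 0 = 1)
    (hfilt : ∀ γ s, ∀ x ∈ filt p w s, a γ x ∈ filt p w s)
    (hlow : ∀ γ m, ∀ x ∈ grade p w c m, a γ x - x ∈ gradeLT p w c m) (x y : TruncLie p w) :
    polyCoeff 1 a ⁅x, y⁆ = ⁅x, polyCoeff 1 a y⁆ - ⁅y, polyCoeff 1 a x⁆ := by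
  have hp := (Fact.out : p.Prime).two_le
  set b := fun i => polyCoeff i a with hb
  have hab : ∀ γ x, a γ x = ∑ i ∈ Finset.range p, γ ^ i • b i x := by
    intro γ x
    conv_lhs => rw [← sum_pow_smul_polyCoeff a γ]
    rw [LinearMap.sum_apply]
    rfl
  have hb0 : ∀ x, b 0 x = x := by
    intro x
    rw [hb]
    simp only
    rw [polyCoeff_eq_pow hadd h0 (by omega), Nat.factorial_zero, Nat.cast_one, inv_one, one_smul,
      pow_zero]
    rfl
  have hbapp : ∀ i x, b i x = polyCoeff i (fun γ => a γ x) := fun i x =>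
    (polyCoeff_map (LinearMap.applyₗ x) i a).symm
  have hbfilt : ∀ i s, ∀ x ∈ filt p w s, b i x ∈ filt p w s := by
    intro i s x hx
    rw [hbapp]
    exact polyCoeff_mem (N := (filt p w s).toSubmodule) fun γ => hfilt γ s x hx
  have hb1 : ∀ m, ∀ x ∈ grade p w c m, b 1 x ∈ gradeLT p w c m := fun m x hx =>
    polyCoeff_one_mem (fun γ x hx => hlow γ m x hx) hx
  have hbzero : ∀ i m, i < p → m < i → ∀ x ∈ grade p w c m, b i x = 0 := by
    intro i m hi hm x hx
    have h1 : b i = (i.factorial : ZMod p)⁻¹ • b 1 ^ i := polyCoeff_eq_pow hadd h0 hi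
    rw [h1, LinearMap.smul_apply, pow_apply_eq_zero_of_mem_gradeLT hb1 i
      (grade_le_gradeLT hm hx), smul_zero]
  have hsum : ∀ l : List G, l ≠ [] → (l.map c).sum + 1 ≤ (l.map w).sum := by
    intro l
    induction l with
    | nil => intro h; exact absurd rfl h
    | cons g l ih =>
      intro _
      rcases eq_or_ne l [] with rfl | h
      · simpa using hcw g
      · have := ih h
        have := hcw g
        simp only [List.map_cons, List.sum_cons]
        omega
  -- The terms with `i + j = p` would contribute to the coefficient of `γ`, as `γ^p = γ`.
  have hexc : ∀ i j, i < p → j < p → i + j = p → ∀ x y, ⁅b i x, b j y⁆ = 0 := by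
    intro i j hi hj hij x y
    have hx := mem_lnSpan_true w x
    have hy := mem_lnSpan_true w y
    induction hx using Submodule.span_induction with
    | mem x hx =>
      obtain ⟨l, -, rfl⟩ := hx
      induction hy using Submodule.span_induction with
      | mem y hy =>
        obtain ⟨l', -, rfl⟩ := hy
        rcases eq_or_ne l [] with rfl | hl
        · simp [lnBracket]
        rcases eq_or_ne l' [] with rfl | hl'
        · simp [lnBracket]
        have hlg : lnBracket (l.map (gen p w)) ∈ grade p w c (l.map c).sum :=
          Submodule.subset_span ⟨l, rfl, rfl⟩
        have hlg' : lnBracket (l'.map (gen p w)) ∈ grade p w c (l'.map c).sum :=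
          Submodule.subset_span ⟨l', rfl, rfl⟩
        rcases lt_or_ge (l.map c).sum i with h | h
        · rw [hbzero i _ hi h _ hlg, zero_lie]
        rcases lt_or_ge (l'.map c).sum j with h' | h'
        · rw [hbzero j _ hj h' _ hlg', lie_zero]
        have h1 := lie_mem_filt w
          (hbfilt i _ _ (LieSubmodule.subset_lieSpan ⟨l, le_rfl, rfl⟩))
          (hbfilt j _ _ (LieSubmodule.subset_lieSpan ⟨l', le_rfl, rfl⟩))
        rw [filt_eq_bot w (by have := hsum l hl; have := hsum l' hl'; omega)] at h1
        simpa using h1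
      | zero => simp
      | add x y _ _ hx hy => rw [map_add, lie_add, hx, hy, add_zero]
      | smul r x _ hx => rw [map_smul, lie_smul, hx, smul_zero]
    | zero => simp
    | add x y _ _ hx hy => rw [map_add, add_lie, hx, hy, add_zero]
    | smul r x _ hx => rw [map_smul, smul_lie, hx, smul_zero]
  have hprod : (fun γ => a γ ⁅x, y⁆) = ∑ i ∈ Finset.range p, ∑ j ∈ Finset.range p,
      fun γ : ZMod p => γ ^ (i + j) • ⁅b i x, b j y⁆ := by
    ext γ
    rw [haf, LieHom.map_lie, ← haf, ← haf, hab γ x, hab γ y, sum_lie, Finset.sum_apply]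
    refine Finset.sum_congr rfl fun i _ => ?_
    rw [lie_sum, Finset.sum_apply]
    refine Finset.sum_congr rfl fun j _ => ?_
    rw [smul_lie, lie_smul, smul_smul, pow_add]
  have hterm : ∀ i ∈ Finset.range p, ∀ j ∈ Finset.range p,
      polyCoeff 1 (fun γ : ZMod p => γ ^ (i + j) • ⁅b i x, b j y⁆) =
        if i + j = 1 then ⁅b i x, b j y⁆ else 0 := by
    intro i hi j hj
    rw [Finset.mem_range] at hi hj
    rcases lt_trichotomy (i + j) p with h | h | h
    · rw [polyCoeff_pow_smul h]
      simp only [eq_comm]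
    · rw [hexc i j hi hj h, if_neg (by omega)]
      simp only [smul_zero]
      exact map_zero (polyCoeff 1)
    · -- `γ^(i+j) = γ^(i+j-p+1)`, and the exponent `i + j - p + 1` lies between `2` and `p - 1`
      have h1 : (fun γ : ZMod p => γ ^ (i + j) • ⁅b i x, b j y⁆) =
          fun γ : ZMod p => γ ^ (i + j - (p - 1)) • ⁅b i x, b j y⁆ := by
        ext γ
        congr 1
        rcases eq_or_ne γ 0 with rfl | hγ
        · rw [zero_pow (by omega), zero_pow (by omega)]
        · conv_lhs => rw [show i + j = (i + j - (p - 1)) + (p - 1) by omega, pow_add,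
            ZMod.pow_card_sub_one_eq_one hγ, mul_one]
      rw [h1, polyCoeff_pow_smul (by omega), if_neg (by omega), if_neg (by omega)]
  have hmain : b 1 ⁅x, y⁆ = ∑ i ∈ Finset.range p, ∑ j ∈ Finset.range p,
      if i + j = 1 then ⁅b i x, b j y⁆ else 0 := by
    rw [hbapp, hprod, map_sum]
    refine Finset.sum_congr rfl fun i hi => ?_
    rw [map_sum]
    exact Finset.sum_congr rfl fun j hj => hterm i hi j hj
  change b 1 ⁅x, y⁆ = ⁅x, b 1 y⁆ - ⁅y, b 1 x⁆
  have h10 : ∑ j ∈ Finset.range p, (if 1 + j = 1 then ⁅b 1 x, b j y⁆ else 0) = ⁅b 1 x, b 0 y⁆ := by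
    rw [Finset.sum_eq_single_of_mem 0 (Finset.mem_range.2 (by omega)), if_pos rfl]
    exact fun j _ hj => if_neg (by omega)
  have h01 : ∑ j ∈ Finset.range p, (if 0 + j = 1 then ⁅b 0 x, b j y⁆ else 0) = ⁅b 0 x, b 1 y⁆ := by
    rw [Finset.sum_eq_single_of_mem 1 (Finset.mem_range.2 (by omega)), if_pos rfl]
    exact fun j _ hj => if_neg (by omega)
  rw [hmain, ← Finset.sum_subset (s₁ := {0, 1}), Finset.sum_pair zero_ne_one, h10, h01, hb0, hb0,
    ← lie_skew y, sub_neg_eq_add]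
  · intro i hi
    simp only [Finset.mem_insert, Finset.mem_singleton] at hi
    exact Finset.mem_range.2 (by omega)
  · intro i _ hi
    simp only [Finset.mem_insert, Finset.mem_singleton] at hi
    exact Finset.sum_eq_zero fun j _ => if_neg (by omega)

end Differential

/-! ### The derivation `B†` -/

section Derivation

variable {p : ℕ} [Fact p.Prime] {P : Param p} {k : Type*} [Field k] [Finite k]
  [Algebra (ZMod p) k] {α₀ : k} {e : LK p k (Ldag P k)}
  {A : ZMod p → (Ldag P k ≃ₗ⁅ZMod p⁆ Ldag P k)}

omit [Finite k] in
theorem chDag_add_one_le (hP : P.Admissible (Module.finrank (ZMod p) k)) (g) :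
    chDag P k g + 1 ≤ wtDag P k g := by
  match g with
  | none => exact le_rfl
  | some (ι, i) =>
    have := Param.one_le_w0 hP ι.1
    change P.ch ι.1 + 1 ≤ P.w0 ι.1 + P.ch ι.1
    omega

/-- `A_γ` as a linear endomorphism. -/
def actionEnd (A : ZMod p → (Ldag P k ≃ₗ⁅ZMod p⁆ Ldag P k)) (γ : ZMod p) :
    Module.End (ZMod p) (Ldag P k) := (A γ : Ldag P k →ₗ[ZMod p] Ldag P k)

variable (hP : P.Admissible (Module.finrank (ZMod p) k)) (hα₀ : α₀ ≠ 0)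
  (he : IsSpElement P α₀ e) (hA : IsConjugatedAction P α₀ e A)

include hP hα₀ he hA in
theorem actionEnd_add (γ γ' : ZMod p) :
    actionEnd A (γ + γ') = actionEnd A γ * actionEnd A γ' := by
  obtain ⟨c, hc⟩ := hA.exists_isConjugation hP hα₀ γ
  obtain ⟨c', hc'⟩ := hA.exists_isConjugation hP hα₀ γ'
  obtain ⟨d, hd⟩ := hA.exists_isConjugation hP hα₀ (γ + γ')
  exact LinearMap.ext fun x => hc.comp_eq hP he hc' hd x

include hP hα₀ he hA in
theorem actionEnd_zero : actionEnd A 0 = 1 := by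
  have h := actionEnd_add hP hα₀ he hA 0 0
  rw [add_zero] at h
  exact LinearMap.ext fun x => (A 0).injective (LinearMap.congr_fun h x).symm

include hP hα₀ he hA in
theorem actionEnd_mem_filt (γ : ZMod p) (s : ℕ) (x : Ldag P k)
    (hx : x ∈ filt p (wtDag P k) s) : actionEnd A γ x ∈ filt p (wtDag P k) s := by
  obtain ⟨c, hc⟩ := hA.exists_isConjugation hP hα₀ γ
  exact hc.map_mem_filt hP he hx

include hP hα₀ hA in
theorem actionEnd_sub_mem (γ : ZMod p) (m : ℕ) (x : Ldag P k)
    (hx : x ∈ LdagGr P k m) : actionEnd A γ x - x ∈ LdagGrLT P k m := by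
  obtain ⟨c, hc⟩ := hA.exists_isConjugation hP hα₀ γ
  refine sub_mem_gradeLT (f := (A γ : Ldag P k →ₗ⁅ZMod p⁆ Ldag P k)) ?_ hx
  rintro (_ | ⟨ι, i⟩)
  · rw [hc.gen_none, sub_self]
    exact zero_mem _
  · have h := mem_subK_iff.1 ((hA γ).2.2 ι) i
    rw [map_sub, coordk_mapk, Ddag, coordk_Delt] at h
    exact h

include hP hα₀ he hA in
/-- The derivation is the coefficient of `γ` in the polynomial function `A_γ`. -/
theorem existsUnique_isDifferential : ∃! B, IsDifferential P A B := by
  have hadd := actionEnd_add hP hα₀ he hA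
  have h0 := actionEnd_zero hP hα₀ he hA
  have hlow := actionEnd_sub_mem hP hα₀ hA
  refine ⟨⟨polyCoeff 1 (actionEnd A), ?_⟩, ⟨?_, ?_⟩, ?_⟩
  · exact polyCoeff_one_lie (chDag_add_one_le hP)
      (fun γ => (A γ : Ldag P k →ₗ⁅ZMod p⁆ Ldag P k)) (fun _ _ => rfl) hadd h0
      (actionEnd_mem_filt hP hα₀ he hA) hlow
  · exact fun m x hx => polyCoeff_one_mem (fun γ x hx => hlow γ m x hx) hx
  · exact fun γ x => eq_sum_pow_polyCoeff_one hadd h0 γ x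
  · intro B hB
    have h := polyCoeff_one_of_eq_sum_pow (a := actionEnd A)
      (b := (B : Ldag P k →ₗ[ZMod p] Ldag P k)) hB.2
    exact LieDerivation.ext fun x => (LinearMap.congr_fun h x).symm

end Derivation

/-! ### Projection to `ℒ̄` -/

section Projection

variable {p : ℕ} [Fact p.Prime] {P : Param p} {k : Type*} [Field k] [Algebra (ZMod p) k]

theorem lnBracket_eq_zero_of_mem {L : Type*} [LieRing L] {l : List L} (h : (0 : L) ∈ l) :
    lnBracket l = 0 := by
  have key : ∀ (l : List L) (y : L), (0 : L) ∈ l → l.foldl (fun y z => ⁅y, z⁆) y = 0 := by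
    intro l
    induction l with
    | nil => intro y h; simp at h
    | cons a l ih =>
      intro y h
      rw [List.foldl_cons]
      rcases List.mem_cons.1 h with rfl | h
      · rw [lie_zero, foldl_lie_zero]
      · exact ih _ h
  match l with
  | [] => rfl
  | a :: l =>
    rcases List.mem_cons.1 h with rfl | h
    · exact foldl_lie_zero l
    · exact key l a h

variable (P k) in
/-- The grading of `ℒ̄` which is concentrated in degree `0`. -/
def trivialGr (m : ℕ) : Submodule (ZMod p) (Lbar P k) := if m = 0 then ⊤ else ⊥

theorem lie_mem_trivialGr (m m' : ℕ) : ∀ x ∈ trivialGr P k m, ∀ y ∈ trivialGr P k m',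
    ⁅x, y⁆ ∈ trivialGr P k (m + m') := by
  intro x hx y hy
  by_cases h : m + m' = 0
  · rw [trivialGr, if_pos h]; trivial
  · rw [trivialGr, if_neg h, Submodule.mem_bot]
    rcases Nat.eq_zero_or_pos m with rfl | hm
    · rw [trivialGr, if_neg (by omega), Submodule.mem_bot] at hy
      rw [hy, lie_zero]
    · rw [trivialGr, if_neg (by omega), Submodule.mem_bot] at hx
      rw [hx, zero_lie]

variable (hP : P.Admissible (Module.finrank (ZMod p) k))

theorem V_gen (g) : V P k hP (gen p (wtDag P k) g) = VGen P k g := truncLift_gen _ _ g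

theorem V_gen_eq_zero {g} (hg : chDag P k g ≠ 0) : V P k hP (gen p (wtDag P k) g) = 0 := by
  match g, hg with
  | none, hg => exact absurd rfl hg
  | some (ι, i), hg =>
    rw [V_gen, VGen, dif_neg]
    rintro ⟨a, ha⟩
    exact hg (Param.ch_eq_zero_of_dvd hP (Param.mem_A0_of_mem_Aplus ι.2) ⟨_, ha⟩)

theorem V_mem_filt {s : ℕ} {x : Ldag P k} (hx : x ∈ filt p (wtDag P k) s) :
    V P k hP x ∈ filt p (wtBar P k) s := by
  refine map_mem_filt one_le_wtBar (V P k hP) (fun g => ?_) hx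
  rw [V_gen]
  match g with
  | none => exact gen_mem_filt (wtBar P k) none
  | some (ι, i) =>
    by_cases h : ∃ a : LabelBar p, ι.1 = (P.q : ℤ) * a.1
    · rw [VGen, dif_pos h]
      exact filt_antitone _ (hP.wdag_le ι.2 h.choose_spec)
        (gen_mem_filt (wtBar P k) (some (h.choose, i)))
    · rw [VGen, dif_neg h]
      exact zero_mem _

theorem V_mem_trivialGr {m : ℕ} {x : Ldag P k} (hx : x ∈ LdagGr P k m) :
    V P k hP x ∈ trivialGr P k m := by
  rw [trivialGr]
  split_ifs with hm
  · trivial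
  · rw [Submodule.mem_bot]
    rw [LdagGr, grade] at hx
    induction hx using Submodule.span_induction with
    | mem x hx =>
      obtain ⟨l, hl, rfl⟩ := hx
      obtain ⟨g, hg, hg0⟩ : ∃ g ∈ l, chDag P k g ≠ 0 := by
        by_contra! h
        refine hm (hl.symm.trans (List.sum_eq_zero fun n hn => ?_))
        obtain ⟨g, hg, rfl⟩ := List.mem_map.1 hn
        exact h g hg
      rw [map_lnBracket]
      refine lnBracket_eq_zero_of_mem (List.mem_map.2 ⟨_, List.mem_map_of_mem hg, ?_⟩)
      exact V_gen_eq_zero hP hg0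
    | zero => rw [map_zero]
    | add x y _ _ hx hy => rw [map_add, hx, hy, add_zero]
    | smul r x _ hx => rw [map_smul, hx, smul_zero]

theorem mapK_V_mem_topLattice {x : LK p k (Ldag P k)}
    (hx : x ∈ topLattice P k (filt p (wtDag P k))) :
    mapK k (V P k hP : Ldag P k →ₗ[ZMod p] Lbar P k) x ∈ topLattice P k (filt p (wtBar P k)) :=
  mapK_mem_lattice _ (fun _ _ hx => V_mem_filt hP hx) hx

theorem mapK_V_mem_spLattice {j : ℕ} {x : LK p k (Ldag P k)}
    (hx : x ∈ spLattice P k (filt p (wtDag P k)) (LdagGr P k) j) :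
    mapK k (V P k hP : Ldag P k →ₗ[ZMod p] Lbar P k) x ∈
      spLattice P k (filt p (wtBar P k)) (trivialGr P k) j := by
  refine spLattice_induction hx (fun ι s m l h => ?_)
    (fun x hx => topLattice_le_spLattice (mapK_V_mem_topLattice hP hx)) (fun x y hx hy => ?_)
    (fun c x hx => ?_)
  · rw [mapK_tmon]
    refine SpTerm.tmon_mem ⟨h.mem, h.one_le, ?_, h.weight, h.ch, h.kappa⟩
    exact mapk_mem_subK (fun x hx => Submodule.mem_inf.2 ⟨V_mem_filt hP (Submodule.mem_inf.1 hx).1,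
      V_mem_trivialGr hP (Submodule.mem_inf.1 hx).2⟩) h.l_mem
  · rw [map_add]; exact add_mem hx hy
  · rw [mapK_zmod_smul]; exact Submodule.smul_mem _ _ hx

theorem tcoeff_sigma_iterate_of_not_dvd {L : Type*} [LieRing L] [LieAlgebra (ZMod p) L]
    (x : LK p k L) {N : ℕ} {n : ℤ} (hn : ¬ (p : ℤ) ^ N ∣ n) :
    tcoeff p k n ((sigma p k)^[N] x) = 0 := by
  induction N generalizing n with
  | zero => exact absurd (by rw [pow_zero]; exact one_dvd n) hn
  | succ N ih =>
    rw [Function.iterate_succ_apply']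
    by_cases h : (p : ℤ) ∣ n
    · obtain ⟨m, rfl⟩ := h
      rw [tcoeff_sigma_mul, ih, map_zero]
      intro h
      rw [pow_succ'] at hn
      exact hn (mul_dvd_mul_left _ h)
    · exact tcoeff_sigma_of_not_dvd h _

end Projection

/-! ### The ideal generated by the values of `𝒱 B†` -/

section Ideal

variable {p : ℕ} [Fact p.Prime] {P : Param p} {k : Type*} [Field k] [Finite k]
  [Algebra (ZMod p) k] {α₀ : k} {e : LK p k (Ldag P k)}
  {A : ZMod p → (Ldag P k ≃ₗ⁅ZMod p⁆ Ldag P k)}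
  {B : LieDerivation (ZMod p) (Ldag P k) (Ldag P k)}
  (hP : P.Admissible (Module.finrank (ZMod p) k)) (hα₀ : α₀ ≠ 0)
  (he : IsSpElement P α₀ e) (hA : IsConjugatedAction P α₀ e A) (hB : IsDifferential P A B)

/-- Membership of `𝒱 B†(D†_{ι0})` in `M ⊗ k` is a condition on the coordinates: as `D†_{ι0}` is a
combination of the generators over a basis of `k`, the latter must go to `M`. -/
theorem VB_mem_iff {M : Submodule (ZMod p) (Lbar P k)} (ι : LabelDag P) :
    VB P hP α₀ B ι ∈ subK k M ↔ ∀ i, V P k hP (B (gen p (wtDag P k) (some (ι, i)))) ∈ M := by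
  rw [VB, mem_subK_iff]
  refine forall_congr' fun i => ?_
  rw [coordk_mapk, coordk_mapk, Ddag, coordk_Delt]
  rfl

/-- The ideal of `ℒ̄` generated by `𝒱 B†(ℒ̄†)`. -/
def derIdeal (B : LieDerivation (ZMod p) (Ldag P k) (Ldag P k)) : LieIdeal (ZMod p) (Lbar P k) :=
  LieSubmodule.lieSpan (ZMod p) (Lbar P k) {y | ∃ x, y = V P k hP (B x)}

variable (B) in
omit [Finite k] in
theorem V_der_mem (x : Ldag P k) : V P k hP (B x) ∈ derIdeal hP B :=
  LieSubmodule.subset_lieSpan ⟨x, rfl⟩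

variable (B) in
omit [Finite k] in
/-- On `C₂` the values of `𝒱 B†` lie in `[ℐ, ℒ̄]`, where `ℐ` is the ideal they generate. -/
theorem V_der_mem_of_mem_lcs_one {x : Ldag P k} (hx : x ∈ lcs p (Ldag P k) 1) :
    V P k hP (B x) ∈ ⁅derIdeal hP B, (⊤ : LieIdeal (ZMod p) (Lbar P k))⁆ := by
  have h : ∀ x y, ⁅V P k hP (B x), y⁆ ∈ ⁅derIdeal hP B, (⊤ : LieIdeal (ZMod p) (Lbar P k))⁆ :=
    fun x y => LieSubmodule.lie_mem_lie (V_der_mem B hP x) (LieSubmodule.mem_top y)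
  rw [lcs, LieModule.lowerCentralSeries_succ, LieModule.lowerCentralSeries_zero,
    ← LieSubmodule.mem_toSubmodule, LieSubmodule.lieIdeal_oper_eq_linear_span'] at hx
  induction hx using Submodule.span_induction with
  | mem x hx =>
    obtain ⟨y, -, z, -, rfl⟩ := hx
    rw [LieDerivation.apply_lie_eq_sub, map_sub, LieHom.map_lie, LieHom.map_lie]
    refine sub_mem ?_ ?_
    · rw [← lie_skew]; exact neg_mem (h _ _)
    · rw [← lie_skew]; exact neg_mem (h _ _)
  | zero => rw [map_zero, map_zero]; exact zero_mem _
  | add x y _ _ hx hy => rw [map_add, map_add]; exact add_mem hx hy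
  | smul r x _ hx => rw [map_smul, map_smul]; exact SMulMemClass.smul_mem r hx

omit [Finite k] in
theorem der_mem_lcs_one {x : Ldag P k} (hx : x ∈ lcs p (Ldag P k) 1) :
    B x ∈ lcs p (Ldag P k) 1 := by
  rw [lcs, LieModule.lowerCentralSeries_succ, LieModule.lowerCentralSeries_zero,
    ← LieSubmodule.mem_toSubmodule, LieSubmodule.lieIdeal_oper_eq_linear_span'] at hx
  induction hx using Submodule.span_induction with
  | mem x hx =>
    obtain ⟨y, -, z, -, rfl⟩ := hx
    rw [LieDerivation.apply_lie_eq_sub]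
    exact sub_mem (lie_mem_lcs (LieSubmodule.mem_top _)) (lie_mem_lcs (LieSubmodule.mem_top _))
  | zero => rw [map_zero]; exact zero_mem _
  | add x y _ _ hx hy => rw [map_add]; exact add_mem hx hy
  | smul r x _ hx => rw [map_smul]; exact SMulMemClass.smul_mem r hx

include hB in
omit [Finite k] in
/-- If `f ∘ B†` maps a `B†`-stable subspace `N` to `N'`, then so do all `f ∘ (A_γ - 1)`. -/
theorem IsDifferential.map_sub_mem {M : Type*} [AddCommGroup M] [Module (ZMod p) M]
    (f : Ldag P k →ₗ[ZMod p] M) {N : Submodule (ZMod p) (Ldag P k)} {N' : Submodule (ZMod p) M}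
    (hN : ∀ x ∈ N, B x ∈ N) (hf : ∀ x ∈ N, f (B x) ∈ N') (γ : ZMod p) {x : Ldag P k}
    (hx : x ∈ N) : f (A γ x) - f x ∈ N' := by
  have hpow : ∀ i, ((B : Ldag P k →ₗ[ZMod p] Ldag P k) ^ i) x ∈ N := by
    intro i
    induction i with
    | zero => exact hx
    | succ i ih => rw [pow_succ', Module.End.mul_apply]; exact hN _ ih
  rw [hB.2 γ x, Finset.range_eq_Ico, Finset.sum_eq_sum_Ico_succ_bot (Fact.out : p.Prime).pos,
    map_add, Nat.factorial_zero, Nat.cast_one, inv_one, pow_zero, one_mul, one_smul, pow_zero,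
    Module.End.one_apply, add_sub_cancel_left, map_sum]
  refine sum_mem fun i hi => ?_
  obtain ⟨i, rfl⟩ := Nat.exists_eq_add_of_le' (Finset.mem_Ico.1 hi).1
  rw [map_smul, zero_add, pow_succ' (B : Ldag P k →ₗ[ZMod p] Ldag P k), Module.End.mul_apply]
  exact Submodule.smul_mem _ _ (hf _ (hpow i))

include hB in
omit [Finite k] in
/-- `B†` is the coefficient of `γ` in `A_γ`, also after a linear map. -/
theorem IsDifferential.polyCoeff_map {M : Type*} [AddCommGroup M] [Module (ZMod p) M]
    (f : Ldag P k →ₗ[ZMod p] M) (x : Ldag P k) : polyCoeff 1 (fun γ => f (A γ x)) = f (B x) := by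
  have h := polyCoeff_one_of_eq_sum_pow (a := actionEnd A)
    (b := (B : Ldag P k →ₗ[ZMod p] Ldag P k)) hB.2
  have h1 := Ramification.polyCoeff_map (f ∘ₗ LinearMap.applyₗ x) 1 (actionEnd A)
  rw [h] at h1
  exact h1

variable {ebar : LK p k (Lbar P k)}
  (hcompat : mapK k (V P k hP : Ldag P k →ₗ[ZMod p] Lbar P k) e = (sigma p k)^[P.Ns] ebar)

include hcompat in
omit [Finite k] in
/-- The coefficients of `𝒱 ē^{sp} = σ^{N^*} ē` at `t^{-ι}` with `ch(ι) ≠ 0` vanish. -/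
theorem smul_mapk_V_tcoeff (μ : ZMod p) {ι : ℤ} (hι : ι ∈ P.A0) :
    μ ^ P.ch ι • mapk k (V P k hP : Ldag P k →ₗ[ZMod p] Lbar P k) (tcoeff p k (-ι) e) =
      mapk k (V P k hP : Ldag P k →ₗ[ZMod p] Lbar P k) (tcoeff p k (-ι) e) := by
  rw [← tcoeff_mapK, hcompat]
  by_cases h : (p : ℤ) ^ P.Ns ∣ -ι
  · rw [Param.ch_eq_zero_of_dvd hP hι (by
      rw [dvd_neg] at h; rw [Param.q]; push_cast; exact h), pow_zero, one_smul]
  · rw [tcoeff_sigma_iterate_of_not_dvd _ h, smul_zero]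

include hα₀ he hA hB hcompat in
/-- The key comparison: `𝒱(A_μ - 1) D†_ι` and `μ^{ch(ι)} 𝒱(A_1 - 1) D†_ι` agree modulo `[ℐ, ℒ̄]`.
Indeed, `𝒱 A_μ ē^{sp}` and the image of `𝒱 A_1 ē^{sp}` under the multiplication of the part of
degree `ch = c` by `μ^c` are obtained by conjugation from the same element, since that
multiplication fixes `𝒱 ē^{sp}` and takes `Ω_1` to `Ω_μ`. -/
theorem V_action_sub_mem (μ : ZMod p) (ι : LabelDag P) (i) :
    (V P k hP (A μ (gen p (wtDag P k) (some (ι, i)))) -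
        V P k hP (gen p (wtDag P k) (some (ι, i)))) -
      μ ^ P.ch ι.1 • (V P k hP (A 1 (gen p (wtDag P k) (some (ι, i)))) -
        V P k hP (gen p (wtDag P k) (some (ι, i)))) ∈
      ⁅derIdeal hP B, (⊤ : LieIdeal (ZMod p) (Lbar P k))⁆ := by
  set E := ⁅derIdeal hP B, (⊤ : LieIdeal (ZMod p) (Lbar P k))⁆ with hE
  have hw := one_le_wtDag (k := k) hP
  have hwb := one_le_wtBar (P := P) (k := k)
  have hF := isLieFiltration_filt (p := p) hwb
  have hGr := lie_mem_trivialGr (P := P) (k := k)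
  have hle : ∀ {j x}, x ∈ spLattice P k (filt p (wtBar P k)) (trivialGr P k) j →
      x ∈ lattice p k (filt p (wtBar P k)) P.bs 0 := fun hx => spLattice_le_lattice hP hF hx
  have h0 : ∀ {x}, x ∈ spLattice P k (filt p (wtBar P k)) (trivialGr P k) 1 →
      x ∈ spLattice P k (filt p (wtBar P k)) (trivialGr P k) 0 := fun hx => spLattice_anti zero_le_one hx
  obtain ⟨c, hc⟩ := hA.exists_isConjugation hP hα₀ μ
  obtain ⟨c', hc'⟩ := hA.exists_isConjugation hP hα₀ 1
  set VK := mapK k (V P k hP : Ldag P k →ₗ[ZMod p] Lbar P k) with hVK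
  set Vk := mapk k (V P k hP : Ldag P k →ₗ[ZMod p] Lbar P k) with hVk
  set a := mapK k ((A μ : Ldag P k →ₗ⁅ZMod p⁆ Ldag P k) : Ldag P k →ₗ[ZMod p] Ldag P k) with ha
  set a' := mapK k ((A 1 : Ldag P k →ₗ⁅ZMod p⁆ Ldag P k) : Ldag P k →ₗ[ZMod p] Ldag P k) with ha'
  set ak := mapk k ((A μ : Ldag P k →ₗ⁅ZMod p⁆ Ldag P k) : Ldag P k →ₗ[ZMod p] Ldag P k) with hak
  set ak' := mapk k ((A 1 : Ldag P k →ₗ⁅ZMod p⁆ Ldag P k) : Ldag P k →ₗ[ZMod p] Ldag P k) with hak'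
  set θ := Phi P k (Lbar P k) 0 μ with hθ
  have hVe := mapK_V_mem_spLattice hP he.mem_spLattice
  have hd₁ := mapK_V_mem_spLattice hP hc.mem
  have hσ₁ := mapK_V_mem_spLattice hP hc.sigma_mem
  have hε₁ := mapK_V_mem_spLattice hP (hc.mapK_mem hP he)
  have hd₂ := mapK_V_mem_spLattice hP hc'.mem
  have hσ₂ := mapK_V_mem_spLattice hP hc'.sigma_mem
  have hε₂ := mapK_V_mem_spLattice hP (hc'.mapK_mem hP he)
  rw [mapK_sigma] at hσ₁ hσ₂
  have hθσ : sigma p k (θ (VK c')) ∈ lattice p k (filt p (wtBar P k)) P.bs 0 := by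
    have := sub_mem (hle (Phi_mem_spLattice hP hF 0 μ hσ₂))
      (topLattice_le_lattice (Phi_sigma_sub_mem hP hF 0 μ hd₂ hσ₂))
    rwa [sub_sub_cancel] at this
  -- `𝒱 ē^{sp}` is fixed by `θ`
  have hθe : θ (VK e) - VK e ∈ topLattice P k (filt p (wtBar P k)) := by
    have h1 := sub_projA0_mem hVe
    have h2 : θ (VK e) = projA0 P k (Lbar P k) (VK e) := by
      rw [hθ, Phi_zero_apply, projA0_apply]
      refine Finset.sum_congr rfl fun ι hι => ?_
      rw [← map_smul, hVK, tcoeff_mapK, smul_mapk_V_tcoeff hP hcompat μ hι]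
    rw [h2, ← neg_mem_iff, neg_sub]
    exact h1
  have heq₁ : conjSigma (VK c) (VK (a e)) - Phi P k (Lbar P k) μ 1 (VK e) ∈
      topLattice P k (filt p (wtBar P k)) := by
    rw [hVK, ← Phi_mapK, ← mapK_conjSigma, ← map_sub]
    exact mapK_V_mem_topLattice hP hc.conj
  have heq₂ : conjSigma (θ (VK c')) (θ (VK (a' e))) - Phi P k (Lbar P k) μ 1 (VK e) ∈
      topLattice P k (filt p (wtBar P k)) := by
    have e1 := Phi_conjSigma_sub_mem hP hF hGr 0 μ (h0 hd₂) (h0 hσ₂) hε₂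
    have e2 : conjSigma (VK c') (VK (a' e)) - Phi P k (Lbar P k) 1 1 (VK e) ∈
        topLattice P k (filt p (wtBar P k)) := by
      rw [hVK, ← Phi_mapK, ← mapK_conjSigma, ← map_sub]
      exact mapK_V_mem_topLattice hP hc'.conj
    have e3 := Phi_mem_topLattice 0 μ e2
    rw [map_sub] at e3
    have e4 := Phi_Phi_sub_mem hP hF 0 μ 1 1 hVe
    have e5 := Phi_Phi_sub_mem hP hF μ 1 0 μ hVe
    rw [mul_one, zero_add] at e4
    rw [mul_zero, add_zero, one_mul] at e5
    have e6 := Phi_mem_topLattice μ 1 hθe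
    rw [map_sub] at e6
    have := add_mem (add_mem (sub_mem e3 e1) (sub_mem e4 e5)) e6
    convert this using 1
    abel
  have heq := sub_mem heq₁ heq₂
  rw [sub_sub_sub_cancel_right] at heq
  -- `𝒱 (A_γ x - x)` lies in `[ℐ, ℒ̄]` for `x` in `C₂`
  have hVA : ∀ (γ : ZMod p) {x : Lk p k (Ldag P k)}, x ∈ subK k (lcs p (Ldag P k) 1).toSubmodule →
      Vk (mapk k ((A γ : Ldag P k →ₗ⁅ZMod p⁆ Ldag P k) : Ldag P k →ₗ[ZMod p] Ldag P k) x) - Vk x ∈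
        subK k E.toSubmodule := by
    intro γ x hx
    rw [mem_subK_iff] at hx ⊢
    intro i
    rw [map_sub, coordk_mapk, coordk_mapk, coordk_mapk]
    exact hB.map_sub_mem (V P k hP : Ldag P k →ₗ[ZMod p] Lbar P k)
      (N := (lcs p (Ldag P k) 1).toSubmodule) (N' := E.toSubmodule)
      (fun x hx => der_mem_lcs_one hx) (fun x hx => V_der_mem_of_mem_lcs_one B hP hx) γ (hx i)
  have hco : ∀ n, -n ∈ P.A0 → tcoeff p k n (VK (a e) - θ (VK (a' e))) =
      Vk (ak (tcoeff p k n e)) - μ ^ P.ch (-n) • Vk (ak' (tcoeff p k n e)) := by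
    intro n hn
    have h1 : ∀ x, tcoeff p k n (VK x) = Vk (tcoeff p k n x) := tcoeff_mapK _ n
    have h2 : tcoeff p k n (a e) = ak (tcoeff p k n e) := tcoeff_mapK _ n e
    have h3 : tcoeff p k n (a' e) = ak' (tcoeff p k n e) := tcoeff_mapK _ n e
    rw [map_sub, hθ, tcoeff_Phi_zero, if_pos hn, h1, h1, h2, h3]
  have hfin := conjSigma_unique (E := E) hP hF (hle hd₁)
    (hle (Phi_mem_spLattice hP hF 0 μ hd₂)) (hle hσ₁) hθσ (hle hε₁)
    (hle (Phi_mem_spLattice hP hF 0 μ hε₂)) heq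
    (by
      intro n hn hn'
      have h1 : ∀ y ∈ spLattice P k (filt p (wtBar P k)) (trivialGr P k) 1,
          tcoeff p k n y = 0 := by
        intro y hy
        rcases hn' with rfl | hn'
        · exact tcoeff_zero_eq_zero hP hF hy
        · exact tcoeff_eq_zero_of_notMem hF hy hn hn'
      rw [map_sub, h1 _ hd₁, h1 _ (Phi_mem_spLattice hP hF 0 μ hd₂), sub_zero])
    (by
      intro r _ n hn hn' s hs hsn
      by_cases hnA : -n ∈ P.A0
      · rw [hco n hnA]
        have hC := he.tcoeff_mem hn hn'
        refine subK_mono (M := E.toSubmodule)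
          (le_trans (le_sup_right : E ≤ lcs p (Lbar P k) (r + 1) ⊔ E) le_sup_right) ?_
        have h1 := sub_mem (hVA μ hC) (zmod_smul_mem_subK (μ ^ P.ch (-n)) (hVA 1 hC))
        have h2 := smul_mapk_V_tcoeff hP hcompat μ hnA
        rw [neg_neg] at h2
        rw [smul_sub, h2, sub_sub_sub_cancel_right] at h1
        exact h1
      · have h1 := tmon_tcoeff_mem_topLattice_of_notMem (sub_mem hε₁
          (Phi_mem_spLattice hP hF 0 μ hε₂)) hnA n s hs hsn
        rw [tcoeff_tmon_self] at h1
        exact subK_mono (le_sup_left : filt p (wtBar P k) s ≤ _) h1) (p - 1)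
  have hι := Param.pos_of_mem_Aplus ι.2
  have hιA := Param.mem_A0_of_mem_Aplus ι.2
  have h1 := tcoeff_mem_of_nonpos (stepFil_le hF (p - 1)) hfin (n := -ι.1) (by omega) p
  rw [hco _ (by rw [neg_neg]; exact hιA), stepFil, filt_eq_bot _ le_rfl, bot_sup_eq,
    lcs_eq_bot hwb (by omega), bot_sup_eq, neg_neg] at h1
  have hC := he.tcoeff_sub_mem ι
  have h2 := smul_mapk_V_tcoeff hP hcompat μ hιA
  set y := tcoeff p k (-ι.1) e with hy
  set D := Ddag P α₀ 0 (some ι) with hD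
  have h3 := sub_mem h1 (sub_mem (hVA μ hC) (zmod_smul_mem_subK (μ ^ P.ch ι.1) (hVA 1 hC)))
  have h4 : Vk (ak y) - μ ^ P.ch ι.1 • Vk (ak' y) -
      (Vk (ak (y - D)) - Vk (y - D) - μ ^ P.ch ι.1 • (Vk (ak' (y - D)) - Vk (y - D))) =
        (Vk (ak D) - Vk D) - μ ^ P.ch ι.1 • (Vk (ak' D) - Vk D) := by
    simp only [map_sub, smul_sub]
    rw [← hVk] at h2
    rw [h2]
    abel
  rw [h4, mem_subK_iff] at h3
  have h5 := h3 i
  rw [map_sub, map_smul, map_sub, map_sub, coordk_mapk, coordk_mapk, coordk_mapk, coordk_mapk,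
    coordk_mapk, hD, Ddag, coordk_Delt] at h5
  exact h5

include hα₀ he hA hB hcompat in
/-- If `ch(ι) ≥ 2`, the coefficient of `μ` in `μ^{ch(ι)} 𝒱(A_1 - 1) D†_ι` vanishes, whereas the
coefficient of `μ` in `𝒱(A_μ - 1) D†_ι` is `𝒱 B†(D†_ι)`. -/
theorem V_der_gen_mem (ι : LabelDag P) (hch : 2 ≤ P.ch ι.1) (i) :
    V P k hP (B (gen p (wtDag P k) (some (ι, i)))) ∈
      ⁅derIdeal hP B, (⊤ : LieIdeal (ZMod p) (Lbar P k))⁆ := by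
  have hp := (Fact.out : p.Prime).one_lt
  set x := gen p (wtDag P k) (some (ι, i)) with hx
  set v := V P k hP (A 1 x) - V P k hP x with hv
  have h1 := polyCoeff_mem (i := 1)
    (N := (⁅derIdeal hP B, (⊤ : LieIdeal (ZMod p) (Lbar P k))⁆).toSubmodule)
    fun μ => V_action_sub_mem hP hα₀ he hA hB hcompat μ ι i
  have h2 : (fun μ : ZMod p => V P k hP (A μ x) - V P k hP x - μ ^ P.ch ι.1 • v) =
      (fun μ => V P k hP (A μ x)) - (fun μ : ZMod p => μ ^ 0 • V P k hP x) -
        fun μ : ZMod p => μ ^ P.ch ι.1 • v := by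
    ext μ; simp
  rw [h2, map_sub, map_sub, polyCoeff_pow_smul (by omega),
    polyCoeff_pow_smul (Param.ch_lt hP (Param.mem_A0_of_mem_Aplus ι.2)), if_neg (by omega),
    if_neg (by omega), sub_zero, sub_zero] at h1
  have h3 := hB.polyCoeff_map (V P k hP : Ldag P k →ₗ[ZMod p] Lbar P k) x
  have h4 : polyCoeff 1 (fun μ => V P k hP (A μ x)) = V P k hP (B x) := h3
  rw [h4] at h1
  exact h1

include hα₀ he hA hB hcompat in
/-- An ideal that contains the values of `𝒱 B†` at the generators with `ch = 1` contains all the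
values of `𝒱 B†`: modulo `[ℐ, ℒ̄]` this is so because the other generators and `C₂` go to `[ℐ, ℒ̄]`,
and `ℒ̄` is nilpotent. -/
theorem derIdeal_le {J : LieIdeal (ZMod p) (Lbar P k)}
    (hJ : ∀ ι : LabelDag P, P.ch ι.1 = 1 → VB P hP α₀ B ι ∈ subK k J.toSubmodule) :
    derIdeal hP B ≤ J := by
  set E := ⁅derIdeal hP B, (⊤ : LieIdeal (ZMod p) (Lbar P k))⁆ with hE
  have hgen0 : ∀ g, chDag P k g = 0 → B (gen p (wtDag P k) g) = 0 := by
    intro g hg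
    have h := hB.1 0 _ (hg ▸ gen_mem_grade (w := wtDag P k) (c := chDag P k) g)
    rwa [LdagGrLT, iSup_of_empty, Submodule.mem_bot] at h
  have h1 : derIdeal hP B ≤ J ⊔ E := by
    refine LieSubmodule.lieSpan_le.2 ?_
    rintro _ ⟨x, rfl⟩
    have hx := mem_lnSpan_true _ x
    rw [SetLike.mem_coe]
    induction hx using Submodule.span_induction with
    | mem x hx =>
      obtain ⟨l, -, rfl⟩ := hx
      match l with
      | [] => simp [lnBracket]
      | [none] =>
        have h0 := hgen0 none rfl
        change V P k hP (B (gen p (wtDag P k) none)) ∈ _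
        rw [h0, map_zero]
        exact zero_mem _
      | [some (ι, i)] =>
        change V P k hP (B (gen p (wtDag P k) (some (ι, i)))) ∈ _
        rcases Nat.lt_trichotomy (P.ch ι.1) 1 with h | h | h
        · rw [hgen0 (some (ι, i)) (by change P.ch ι.1 = 0; omega), map_zero]
          exact zero_mem _
        · exact le_sup_left (a := J) ((VB_mem_iff hP ι).1 (hJ ι h) i)
        · exact le_sup_right (a := J) (V_der_gen_mem hP hα₀ he hA hB hcompat ι h i)
      | g :: g' :: l =>
        exact le_sup_right (a := J) (V_der_mem_of_mem_lcs_one B hP (lnBracket_mem_lcs (by simp)))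
    | zero => rw [map_zero, map_zero]; exact zero_mem _
    | add x y _ _ hx hy => rw [map_add, map_add]; exact add_mem hx hy
    | smul r x _ hx => rw [map_smul, map_smul]; exact SMulMemClass.smul_mem r hx
  -- iterate `ℐ ≤ J + [ℐ, ℒ̄]`
  have h2 : ∀ r, derIdeal hP B ≤ J ⊔ lcs p (Lbar P k) r := by
    intro r
    induction r with
    | zero => rw [lcs, LieModule.lowerCentralSeries_zero, sup_top_eq]; exact le_top
    | succ r ih =>
      refine h1.trans (sup_le le_sup_left ?_)
      refine (LieSubmodule.mono_lie_left _ ih).trans ?_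
      rw [LieSubmodule.sup_lie]
      refine sup_le_sup (LieSubmodule.lie_le_left _ _) ?_
      rw [LieSubmodule.lie_comm, lcs, lcs, LieModule.lowerCentralSeries_succ]
  have h3 := h2 (p - 1)
  rwa [lcs_eq_bot one_le_wtBar (by omega), sup_bot_eq] at h3

include hα₀ he hA hB hcompat in
/-- If `𝒱 x = 0`, then `𝒱 A_γ x` is a polynomial in `γ` without constant term whose coefficients
lie in `ℐ`; conversely, `𝒱 B† D†_ι` is a coefficient of `𝒱 A_γ D†_ι`, where `𝒱 D†_ι = 0` if `ch(ι)
≠ 0`. -/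
theorem LbarIdeal_eq_derIdeal : LbarIdeal P hP A = derIdeal hP B := by
  refine le_antisymm ?_ (derIdeal_le hP hα₀ he hA hB hcompat fun ι hι => ?_)
  · refine LieIdeal.map_le_iff_le_comap.2 (LieSubmodule.lieSpan_le.2 ?_)
    rintro _ ⟨γ, x, hx, rfl⟩
    have h := hB.map_sub_mem (V P k hP : Ldag P k →ₗ[ZMod p] Lbar P k) (N := ⊤)
      (N' := (derIdeal hP B).toSubmodule) (fun _ _ => trivial) (fun x _ => V_der_mem B hP x) γ
      (x := x) trivial
    have h0 : V P k hP x = 0 := hx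
    have h1 : V P k hP (A γ x) - V P k hP x ∈ derIdeal hP B := h
    rw [h0, sub_zero] at h1
    exact h1
  · refine (VB_mem_iff hP ι).2 fun i => ?_
    have h := hB.polyCoeff_map (V P k hP : Ldag P k →ₗ[ZMod p] Lbar P k)
      (gen p (wtDag P k) (some (ι, i)))
    change V P k hP (B (gen p (wtDag P k) (some (ι, i)))) ∈ _
    have h1 : polyCoeff 1 (fun γ => V P k hP (A γ (gen p (wtDag P k) (some (ι, i))))) =
      V P k hP (B (gen p (wtDag P k) (some (ι, i)))) := h
    rw [← h1]
    refine polyCoeff_mem fun γ => LieIdeal.mem_map (LieSubmodule.subset_lieSpan ⟨γ, _, ?_, rfl⟩)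
    refine V_gen_eq_zero hP (g := some (ι, i)) ?_
    change P.ch ι.1 ≠ 0
    omega

end Ideal

end Ramification

end

open Ramification in
theorem corollary2p16 {p : ℕ} [Fact p.Prime] {k : Type*} [Field k] [Finite k] [Algebra (ZMod p) k]
    (α₀ : k) (hα₀ : Algebra.trace (ZMod p) k α₀ = 1)
    (P : Param p) (hP : P.Admissible (Module.finrank (ZMod p) k))
    (ebar : LK p k (Lbar P k)) (hebar : IsBarElement P α₀ ebar)
    (esp : LK p k (Ldag P k)) (hesp : IsSpElement P α₀ esp)
    (hcompat : mapK k (V P k hP : Ldag P k →ₗ[ZMod p] Lbar P k) esp = (sigma p k)^[P.Ns] ebar)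
    (A : ZMod p → (Ldag P k ≃ₗ⁅ZMod p⁆ Ldag P k)) (hA : IsConjugatedAction P α₀ esp A) :
    (∃! B, IsDifferential P A B) ∧
    ∀ B, IsDifferential P A B →
      IsLeast {I : LieIdeal (ZMod p) (Lbar P k) |
          ∀ ι : LabelDag P, P.ch ι.1 = 1 → VB P hP α₀ B ι ∈ subK k I.toSubmodule}
        (LbarIdeal P hP A) ∧
      ∀ ι : LabelDag P, 2 ≤ P.ch ι.1 →
        VB P hP α₀ B ι ∈ subK k
          (⁅LbarIdeal P hP A, (⊤ : LieIdeal (ZMod p) (Lbar P k))⁆ :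
            LieIdeal (ZMod p) (Lbar P k)).toSubmodule := by
  have hα : α₀ ≠ 0 := by
    rintro rfl
    rw [map_zero] at hα₀
    exact zero_ne_one hα₀
  refine ⟨existsUnique_isDifferential hP hα hesp hA, fun B hB => ?_⟩
  rw [LbarIdeal_eq_derIdeal hP hα hesp hA hB hcompat]
  refine ⟨⟨fun ι _ => (VB_mem_iff hP ι).2 fun i => V_der_mem B hP _,
    fun J hJ => derIdeal_le hP hα hesp hA hB hcompat hJ⟩, fun ι hι => ?_⟩
  exact (VB_mem_iff hP ι).2 fun i => V_der_gen_mem hP hα hesp hA hB hcompat ι hι i
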